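/- Let $\Omega\subset\mathbb R^2$ be a convex polygonal domain, $u_0\in H^1_0(\Omega)$, $u_1\in L^2(\Omega)$, $f(s)=s^3-s$, and let $k\ge 0$ be an integer. Let $\sigma$, $C_0$, $\rho$ and $0<\tau_0\le\tau_1$ be real constants. There is a constant $C>0$, depending only on $\Omega,u_0,u_1,k,\sigma,\tau_0,\tau_1,C_0,\rho$, such that the following holds. Let $\mathscr T_h$ be any conforming triangulation of $\bar\Omega$ that is shape regular with constant $\sigma$ (each triangle $K$, of diameter $h_K$, contains a disc of diameter at least $h_K/\sigma$), $h=\max_K h_K$, let $\mathcal E_h$ be the set of its edges, $\Gamma_\partial$ the set of the edges on $\partial\Omega$, and let $\tau:\mathcal E_h\to[\tau_0,\tau_1]$ be constant on each edge. Let $W_h$, $\boldsymbol V_h$, $M_h$ be the spaces of functions that are polynomials of degree $\le k$ on each triangle (scalar and $\mathbb R^2$-valued, respectively) and on each edge. Write $(\cdot,\cdot)=\sum_K\int_K$, $\langle\cdot,\cdot\rangle=\sum_K\int_{\partial K}$, and $\|\psi-\widehat\psi\|_+^2=\sum_K\int_{\partial K}\tau(\psi-\widehat\psi)^2$; let $\boldsymbol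 n$ be the outward unit normal on $\partial K$ and put $\widehat{\boldsymbol q}_h\cdot\boldsymbol n=\boldsymbol q_h\cdot\boldsymbol n-\tau(u_h-\widehat u_h)$. Let $(u_h(t),\boldsymbol q_h(t),\widehat u_h(t))\in W_h\times\boldsymbol V_h\times M_h$, $t\in(0,T]$, be a solution of the semidiscrete HDG method for $u_{tt}-\Delta u+f(u)=0$, $u|_{\partial\Omega}=0$: for all $t\in(0,T]$, $\boldsymbol v\in\boldsymbol V_h$, $w\in W_h$, $\mu\in M_h$, $$(\boldsymbol q_h,\boldsymbol v)+(u_h,\nabla\cdot\boldsymbol v)-\langle\widehat u_h,\boldsymbol v\cdot\boldsymbol n\rangle=0,$$ $$(u_{htt},w)+(\boldsymbol q_h,\nabla w)-\langle\widehat{\boldsymbol q}_h\cdot\boldsymbol n,w\rangle+(f(u_h),w)=0,$$ $$\langle\widehat{\boldsymbol q}_h\cdot\boldsymbol n,\mu\rangle_{\mathcal E_h\setminus\Gamma_\partial}=0,\qquad\langle\widehat u_h,\mu\rangle_{\Gamma_\partial}=0,$$ where $u_h:[0,T]\to W_h$ is $C^1$ on $[0,T]$ and twice differentiable on $(0,T]$,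 with $u_h(0)=u_{h0}\in W_h$ and $u_{ht}(0)=u_{h1}\in W_h$. (In the third equation both traces of $\widehat{\boldsymbol q}_h\cdot\boldsymbol n$ on an interior edge are summed.) Assume $\|u_1-u_{h1}\|\le C_0h^{k+1}$ and one of the following: 1. $\Delta u_0\in L^2(\Omega)$ and $u_{h0}$ is the first component of the HDG solution of the elliptic problem with datum $\Delta u_0$, that is, for some $(\boldsymbol q,\widehat u)\in\boldsymbol V_h\times M_h$ the triple $(u_{h0},\boldsymbol q,\widehat u)$ satisfies the first, third and fourth of the above equations, and $(\boldsymbol q,\nabla w)-\langle\widehat{\boldsymbol q}\cdot\boldsymbol n,w\rangle=-(\Delta u_0,w)$ for all $w\in W_h$; 2. $\|u_0-u_{h0}\|\le C_0h^{k+1}$, and $h^{k+1}\le\rho\,h_K$ for all triangles $K$ (for instance, the triangulations are quasi-uniform). Then for all $t\in(0,T]$ $$\|u_{ht}(t)\|^2+\|\boldsymbol q_h(t)\|^2+\|u_h(t)-\widehat u_h(t)\|_+^2+\|u_h(t)\|_{L^4(\Omega)}^4\le C .$$ In particular, $C$ is independent of $t$, of $T$ and of the mesh. -/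

import Mathlib

open MeasureTheory Filter Topology
open scoped ContDiff

noncomputable section

namespace KGHDG

/-- The Euclidean plane. -/
abbrev Plane : Type := EuclideanSpace ℝ (Fin 2)

/-- Real polynomials in two variables. -/
abbrev Poly : Type := MvPolynomial (Fin 2) ℝ

/-- The value of a polynomial at a point of the plane. -/
def val (p : Poly) (x : Plane) : ℝ := MvPolynomial.eval (fun i => x i) p

/-- The gradient of a polynomial. -/
def grad (p : Poly) : Fin 2 → Poly := fun i => MvPolynomial.pderiv i p

/-- The divergence of a polynomial vector field. -/
def dvg (v : Fin 2 → Poly) : Poly := ∑ i, MvPolynomial.pderiv i (v i)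

/-! ### Domains, test functions, Sobolev spaces -/

/-- A convex polygonal domain: the nonempty interior of the convex hull of finitely many points. -/
def IsConvexPolygon (Ω : Set Plane) : Prop :=
  Ω.Nonempty ∧ ∃ S : Finset Plane, Ω = interior (convexHull ℝ (S : Set Plane))

/-- `φ ∈ C_c^∞(Ω)`. -/
def IsTestFun (Ω : Set Plane) (φ : Plane → ℝ) : Prop :=
  ContDiff ℝ ∞ φ ∧ HasCompactSupport φ ∧ tsupport φ ⊆ Ω

/-- `u ∈ L²(Ω)`. -/
def MemL2 (Ω : Set Plane) (u : Plane → ℝ) : Prop := MemLp u 2 (volume.restrict Ω)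

/-- `u ∈ H¹₀(Ω)`, the closure of `C_c^∞(Ω)` in `H¹(Ω)`: there are test functions that converge to
`u` in `L²(Ω)` and whose gradients converge in `L²(Ω)²` (to the weak gradient `g` of `u`). -/
def MemH10 (Ω : Set Plane) (u : Plane → ℝ) : Prop :=
  MemL2 Ω u ∧ ∃ g : Plane → Plane, MemLp g 2 (volume.restrict Ω) ∧
    ∃ φ : ℕ → Plane → ℝ, (∀ n, IsTestFun Ω (φ n)) ∧
      Tendsto (fun n => eLpNorm (fun x => φ n x - u x) 2 (volume.restrict Ω)) atTop (𝓝 0) ∧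
      Tendsto (fun n => eLpNorm (fun x => gradient (φ n) x - g x) 2 (volume.restrict Ω))
        atTop (𝓝 0)

/-- `g = Δ u` in `Ω` in the sense of distributions. -/
def IsWeakLaplacian (Ω : Set Plane) (u g : Plane → ℝ) : Prop :=
  ∀ φ : Plane → ℝ, IsTestFun Ω φ →
    ∫ x in Ω, u x * Laplacian.laplacian φ x = ∫ x in Ω, g x * φ x

/-! ### Triangles, edges, triangulations -/

/-- The closed triangle (or segment) with the given vertices. -/
def hull (K : Finset Plane) : Set Plane := convexHull ℝ (K : Set Plane)

/-- `h_K`, the diameter of a triangle. -/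
def hK (K : Finset Plane) : ℝ := Metric.diam (hull K)

/-- The three edges of a triangle, each given by its two end points. -/
def edges (K : Finset Plane) : Finset (Finset Plane) := K.powersetCard 2

/-- The unit normal to the edge `E` of the triangle `K` that points out of `K`: the component
orthogonal to `E` of the vector from the barycentre of `K` to the midpoint of `E`, normalized. -/
def normal (K E : Finset Plane) : Plane :=
  let w : Plane := (2 : ℝ)⁻¹ • (∑ x ∈ E, x) - (3 : ℝ)⁻¹ • (∑ x ∈ K, x)
  let v : Plane := w - (vectorSpan ℝ (E : Set Plane)).starProjection w
  ‖v‖⁻¹ • v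

/-- A (conforming) triangulation of the closure of `Ω`; a triangle is given by its vertices. -/
structure Triangulation (Ω : Set Plane) where
  /-- the triangles -/
  cells : Finset (Finset Plane)
  card_eq : ∀ K ∈ cells, K.card = 3
  nondegenerate : ∀ K ∈ cells, AffineIndependent ℝ ((↑) : K → Plane)
  /-- two triangles meet in the hull of their common vertices: not at all, in a common vertex,
  in a common edge, or they coincide -/
  conforming : ∀ K ∈ cells, ∀ L ∈ cells,
    hull K ∩ hull L = convexHull ℝ ((K : Set Plane) ∩ (L : Set Plane))
  cover : (⋃ K ∈ cells, hull K) = closure Ω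

/-- The edge `E` lies on the boundary of `Ω`. -/
def IsBdryEdge (Ω : Set Plane) (E : Finset Plane) : Prop := hull E ⊆ frontier Ω

namespace Triangulation

variable {Ω : Set Plane} (T : Triangulation Ω)

open Classical in
/-- The set `ℰ_h` of all edges. -/
def allEdges : Finset (Finset Plane) := T.cells.biUnion edges

/-- The mesh size `h = max_K h_K`. -/
def meshSize : ℝ := ⨆ K : T.cells, hK (K : Finset Plane)

/-- Shape regularity with constant `σ`: each triangle `K` contains a disc of radius `r` with
`h_K ≤ σ (2 r)`. -/
def ShapeRegular (σ : ℝ) : Prop :=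
  ∀ K ∈ T.cells, ∃ (x : Plane) (r : ℝ), 0 < r ∧ Metric.closedBall x r ⊆ hull K ∧
    hK K ≤ σ * (2 * r)

/-! An element of `W_h` is a family `K ↦ w K` of polynomials, the restrictions of the function to
the triangles; likewise for `V_h`. An element of `M_h` is a family `E ↦ μ E` of polynomials, of
which only the restriction of `μ E` to the edge `E` is ever used. -/

/-- `w ∈ W_h`, polynomial degree `k`. -/
def MemW (k : ℕ) (w : Finset Plane → Poly) : Prop := ∀ K ∈ T.cells, (w K).totalDegree ≤ k

/-- `v ∈ V_h`, polynomial degree `k`. -/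
def MemV (k : ℕ) (v : Finset Plane → Fin 2 → Poly) : Prop :=
  ∀ K ∈ T.cells, ∀ i, (v K i).totalDegree ≤ k

/-- `μ ∈ M_h`, polynomial degree `k`. -/
def MemM (k : ℕ) (μ : Finset Plane → Poly) : Prop := ∀ E ∈ T.allEdges, (μ E).totalDegree ≤ k

/-- `∑_K ∫_K φ_K`. -/
def cellSum (φ : Finset Plane → Plane → ℝ) : ℝ := ∑ K ∈ T.cells, ∫ x in hull K, φ K x

/-- `∑_K ∫_{∂K} φ_K`: the sum, over the triangles `K` and the edges `E` of `K`, of the integral of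
`φ K E` over `E` with respect to arc length. -/
def bdrySum (φ : Finset Plane → Finset Plane → Plane → ℝ) : ℝ :=
  ∑ K ∈ T.cells, ∑ E ∈ edges K, ∫ x in hull E, φ K E x ∂(Measure.hausdorffMeasure 1)

open Classical in
/-- As `bdrySum`, restricted to the edges that are not on the boundary of `Ω`. -/
def interiorBdrySum (φ : Finset Plane → Finset Plane → Plane → ℝ) : ℝ :=
  ∑ K ∈ T.cells, ∑ E ∈ edges K with ¬ IsBdryEdge Ω E,
    ∫ x in hull E, φ K E x ∂(Measure.hausdorffMeasure 1)

open Classical in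
/-- `∑_E ∫_E φ_E`, the sum over the edges on the boundary of `Ω`. -/
def exteriorEdgeSum (φ : Finset Plane → Plane → ℝ) : ℝ :=
  ∑ E ∈ T.allEdges with IsBdryEdge Ω E, ∫ x in hull E, φ E x ∂(Measure.hausdorffMeasure 1)

/-- `‖w‖²` for `w ∈ W_h`. -/
def normSqW (w : Finset Plane → Poly) : ℝ := T.cellSum fun K x => val (w K) x ^ 2

/-- `‖v‖²` for `v ∈ V_h`. -/
def normSqV (v : Finset Plane → Fin 2 → Poly) : ℝ :=
  T.cellSum fun K x => ∑ i, val (v K i) x ^ 2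

/-- `‖w‖_{L⁴}⁴` for `w ∈ W_h`. -/
def normL4Pow4 (w : Finset Plane → Poly) : ℝ := T.cellSum fun K x => val (w K) x ^ 4

/-- `‖w - ŵ‖₊² = ∑_K ‖τ^{1/2} (w - ŵ)‖²_{L²(∂K)}`, so an interior edge contributes one term for each
of the two traces of `w`. -/
def normPlusSq (τ : Finset Plane → ℝ) (w what : Finset Plane → Poly) : ℝ :=
  T.bdrySum fun K E x => τ E * (val (w K) x - val (what E) x) ^ 2

/-- `‖g - w‖` in `L²(Ω)`, for a function `g` on `Ω` and `w ∈ W_h`. -/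
def distL2 (g : Plane → ℝ) (w : Finset Plane → Poly) : ℝ :=
  Real.sqrt (T.cellSum fun K x => (g x - val (w K) x) ^ 2)

end Triangulation

/-! ### The HDG method -/

/-- `v · n` on the edge `E` of `K`. -/
def dotNormal (v : Finset Plane → Fin 2 → Poly) (K E : Finset Plane) (x : Plane) : ℝ :=
  ∑ i, val (v K i) x * normal K E i

/-- The numerical flux `q̂ · n = q · n - τ (u - û)` on the edge `E` of `K`. -/
def fluxHat (τ : Finset Plane → ℝ) (u : Finset Plane → Poly) (q : Finset Plane → Fin 2 → Poly)
    (uhat : Finset Plane → Poly) (K E : Finset Plane) (x : Plane) : ℝ :=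
  dotNormal q K E x - τ E * (val (u K) x - val (uhat E) x)

section
variable {Ω : Set Plane}

/-- The part of the HDG equations that does not involve the right-hand side: `u ∈ W_h`, `q ∈ V_h`,
`û ∈ M_h`, the equation of the flux, the conservativity of the numerical flux across interior
edges, and the boundary condition. -/
structure IsHDGTriple (T : Triangulation Ω) (k : ℕ) (τ : Finset Plane → ℝ)
    (u : Finset Plane → Poly) (q : Finset Plane → Fin 2 → Poly) (uhat : Finset Plane → Poly) :
    Prop where
  memW : T.MemW k u
  memV : T.MemV k q
  memM : T.MemM k uhat
  /-- `(q, v) + (u, ∇·v) - ⟨û, v·n⟩ = 0` -/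
  flux : ∀ v, T.MemV k v →
    T.cellSum (fun K x => ∑ i, val (q K i) x * val (v K i) x)
      + T.cellSum (fun K x => val (u K) x * val (dvg (v K)) x)
      - T.bdrySum (fun K E x => val (uhat E) x * dotNormal v K E x) = 0
  /-- `⟨q̂·n, μ⟩ = 0` on the interior edges -/
  conservative : ∀ μ, T.MemM k μ →
    T.interiorBdrySum (fun K E x => fluxHat τ u q uhat K E x * val (μ E) x) = 0
  /-- `⟨û, μ⟩ = 0` on the boundary edges -/
  boundary : ∀ μ, T.MemM k μ →
    T.exteriorEdgeSum (fun E x => val (uhat E) x * val (μ E) x) = 0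

/-- `(q, ∇w) - ⟨q̂·n, w⟩`. -/
def diffusionForm (T : Triangulation Ω) (τ : Finset Plane → ℝ)
    (u : Finset Plane → Poly) (q : Finset Plane → Fin 2 → Poly) (uhat : Finset Plane → Poly)
    (w : Finset Plane → Poly) : ℝ :=
  T.cellSum (fun K x => ∑ i, val (q K i) x * val (grad (w K) i) x)
    - T.bdrySum (fun K E x => fluxHat τ u q uhat K E x * val (w K) x)

/-- `uh0` is the HDG approximation of the solution of the Dirichlet problem for the Laplace operator
with datum `g`, where `g = Δ u₀`. -/
def IsEllipticApprox (T : Triangulation Ω) (k : ℕ) (τ : Finset Plane → ℝ) (g : Plane → ℝ)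
    (uh0 : Finset Plane → Poly) : Prop :=
  ∃ (q : Finset Plane → Fin 2 → Poly) (uhat : Finset Plane → Poly),
    IsHDGTriple T k τ uh0 q uhat ∧
    ∀ w, T.MemW k w →
      diffusionForm T τ uh0 q uhat w = - T.cellSum (fun K x => g x * val (w K) x)

/-- The nonlinearity `f(s) = s³ - s`. -/
def nonlin (s : ℝ) : ℝ := s ^ 3 - s

/-- `(u, q, û)` is a solution of the semidiscrete HDG method on `[0, tf]` with initial data
`u(0) = uh0` and `u_t(0) = uh1`. The functions `ut`, `utt` are the first and the second time
derivative of `u`. -/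
structure IsSemidiscreteSolution (T : Triangulation Ω) (k : ℕ) (τ : Finset Plane → ℝ) (tf : ℝ)
    (uh0 uh1 : Finset Plane → Poly) (u ut utt : ℝ → Finset Plane → Poly)
    (q : ℝ → Finset Plane → Fin 2 → Poly) (uhat : ℝ → Finset Plane → Poly) : Prop where
  init : ∀ K ∈ T.cells, u 0 K = uh0 K
  init_t : ∀ K ∈ T.cells, ut 0 K = uh1 K
  hasDeriv : ∀ t ∈ Set.Icc 0 tf, ∀ K ∈ T.cells, ∀ x : Plane,
    HasDerivWithinAt (fun s => val (u s K) x) (val (ut t K) x) (Set.Icc 0 tf) t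
  continuous_t : ∀ K ∈ T.cells, ∀ x : Plane,
    ContinuousOn (fun s => val (ut s K) x) (Set.Icc 0 tf)
  hasDeriv_t : ∀ t ∈ Set.Ioc 0 tf, ∀ K ∈ T.cells, ∀ x : Plane,
    HasDerivWithinAt (fun s => val (ut s K) x) (val (utt t K) x) (Set.Icc 0 tf) t
  triple : ∀ t ∈ Set.Ioc 0 tf, IsHDGTriple T k τ (u t) (q t) (uhat t)
  /-- `(u_tt, w) + (q, ∇w) - ⟨q̂·n, w⟩ + (f(u), w) = 0` -/
  wave : ∀ t ∈ Set.Ioc 0 tf, ∀ w, T.MemW k w →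
    T.cellSum (fun K x => val (utt t K) x * val (w K) x)
      + diffusionForm T τ (u t) (q t) (uhat t) w
      + T.cellSum (fun K x => nonlin (val (u t K) x) * val (w K) x) = 0

/-- The admissible initial approximations. The velocity `uh1` approximates `u₁` in `L²` to the order
`h^(k+1)`. The displacement `uh0` is either the HDG approximation of the elliptic problem with datum
`Δ u₀ ∈ L²(Ω)`, or any element of `W_h` that approximates `u₀` in `L²` to the order `h^(k+1)`; in
the latter case the triangles may not be too small compared with the largest one. -/
def AdmissibleInitialData (T : Triangulation Ω) (k : ℕ) (τ : Finset Plane → ℝ) (C₀ ρ : ℝ)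
    (u₀ u₁ : Plane → ℝ) (uh0 uh1 : Finset Plane → Poly) : Prop :=
  T.MemW k uh0 ∧ T.MemW k uh1 ∧
  T.distL2 u₁ uh1 ≤ C₀ * T.meshSize ^ (k + 1) ∧
  ((∃ g : Plane → ℝ, MemL2 Ω g ∧ IsWeakLaplacian Ω u₀ g ∧ IsEllipticApprox T k τ g uh0) ∨
    (T.distL2 u₀ uh0 ≤ C₀ * T.meshSize ^ (k + 1) ∧
      ∀ K ∈ T.cells, T.meshSize ^ (k + 1) ≤ ρ * hK K))

end

end KGHDG

end

/-!
The bound rests on the conservation of energy. On functions that come with their flux and their trace,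
that is, on triples which satisfy the equation of the flux, the conservativity of the numerical flux
and the boundary condition, the diffusion form is symmetric, and its value at `u` is
`‖q‖² + ‖u - û‖₊²`, the energy of the diffusion (`IsHDGTriple.diffusionForm_eq`). Hence the sum of the
kinetic energy, the energy of the diffusion and the integral of the potential `u⁴ / 4 - u² / 2` is
constant in time. Only `u` is known to be differentiable, not `q` or `û`; therefore the energy of the
diffusion is differentiated through its increments, whose quadratic part is controlled by that of `u`
(`IsSemidiscreteSolution.hasDerivWithinAt_discEnergy`, `IsSemidiscreteSolution.waveEnergy_eq`). As the
potential is at least `u⁴ / 8 - 1 / 2`, the conserved energy controls the four quantities of the theorem,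
and it suffices to bound it, uniformly in the mesh, at some time close to the initial one.

Its `L⁴` part is bounded by the energy of the diffusion through a discrete Sobolev inequality,
`IsHDGTriple.normL4Pow4_le`, for which the triangulation need not be quasi-uniform. Testing with the
field `(y - x) / |y - x|²` of a point source in a triangle represents `u` there by the fluxes and the jumps
in all triangles, with weights that are a discrete version of the kernel of the Riesz potential
(`IsHDGTriple.abs_val_le`). The weights make sense because a triangle is at most as large as a multiple
of its distance to the centre of another one (`Triangulation.HasDiscs.hK_le_dist`; the convexity of the
domain is used here, to pass from one triangle at a vertex to the next one across their common edge). The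
potential maps `ℓ²` into `ℓ⁴` by a duality argument and a packing property of the triangles
(`riesz_potential_le`).

The energy of the diffusion near the initial time is bounded by two stability estimates. If `u` is
the HDG solution of an elliptic problem, then its energy is the integral of the datum against `u`, and
the discrete Sobolev inequality applies (`IsHDGTriple.discEnergy_le_integral_sq`). In general, the
energy is at most the distance of `u` to constants on the edges that vanish on the boundary, with
the weight `h_K⁻²` (`IsHDGTriple.discEnergy_le`). For these constants one takes the means of a test
function close to `u₀` in `L²` and bounded in `H¹`; by Poincaré's inequality with the mean over an edge
and by the condition `h ^ (k + 1) ≤ ρ h_K`, that distance is bounded (`exists_edge_constants`).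
-/

open MeasureTheory Filter Topology
open scoped ContDiff

noncomputable section

namespace KGHDG

/-! ### Integrals over segments and triangles -/

theorem integral_segment_eq (a b : Plane) (f : Plane → ℝ) :
    ∫ x in segment ℝ a b, f x ∂(Measure.hausdorffMeasure 1)
      = ‖b - a‖ * ∫ t in (0 : ℝ)..1, f (a + t • (b - a)) := by
  by_cases hab : b = a
  · subst hab
    have := Measure.nullSingletonClass_hausdorff Plane (d := 1) one_pos
    simp
  have hd : 0 < ‖b - a‖ := norm_pos_iff.2 (sub_ne_zero.2 hab)
  set d := ‖b - a‖ with hd_def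
  set γ : ℝ → Plane := fun t => a + t • (d⁻¹ • (b - a)) with hγ
  have hu : ‖d⁻¹ • (b - a)‖ = 1 := by
    rw [norm_smul, norm_inv, Real.norm_of_nonneg hd.le, ← hd_def, inv_mul_cancel₀ hd.ne']
  have hiso : Isometry γ := by
    refine Isometry.of_dist_eq fun s t => ?_
    simp only [hγ, dist_add_left]
    rw [dist_eq_norm, ← sub_smul, norm_smul, hu, mul_one, Real.dist_eq, Real.norm_eq_abs]
  have hseg : segment ℝ a b = γ '' Set.Icc 0 d := by
    rw [segment_eq_image']
    ext x
    simp only [Set.mem_image, Set.mem_Icc, hγ]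
    constructor
    · rintro ⟨t, ht, rfl⟩
      refine ⟨t * d, ⟨by nlinarith [ht.1], by nlinarith [ht.2]⟩, ?_⟩
      rw [smul_smul, mul_assoc, mul_inv_cancel₀ hd.ne', mul_one]
    · rintro ⟨t, ht, rfl⟩
      refine ⟨t / d, ⟨div_nonneg ht.1 hd.le, (div_le_one hd).2 ht.2⟩, ?_⟩
      rw [smul_smul, div_eq_mul_inv]
  have hpre : γ ⁻¹' (segment ℝ a b) = Set.Icc 0 d := by
    rw [hseg, Set.preimage_image_eq _ hiso.injective]
  have hsub : segment ℝ a b ⊆ Set.range γ := by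
    rw [hseg]; exact Set.image_subset_range _ _
  have hme : MeasurableEmbedding γ := hiso.isClosedEmbedding.measurableEmbedding
  have h1 : ∫ x in segment ℝ a b, f x ∂(Measure.hausdorffMeasure 1)
      = ∫ t in Set.Icc 0 d, f (γ t) := by
    have := hme.setIntegral_map (μ := (Measure.hausdorffMeasure 1 : Measure ℝ)) f
      (segment ℝ a b)
    rw [hiso.map_hausdorffMeasure (Or.inl zero_le_one), hpre,
      Measure.restrict_restrict_of_subset hsub, hausdorffMeasure_real] at this
    exact this
  rw [h1, integral_Icc_eq_integral_Ioc, ← intervalIntegral.integral_of_le hd.le]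
  have h2 := intervalIntegral.mul_integral_comp_mul_left (a := 0) (b := 1)
    (f := fun t => f (γ t)) (c := d)
  rw [mul_zero, mul_one] at h2
  rw [← h2]
  congr 1
  refine intervalIntegral.integral_congr fun t _ => ?_
  simp only [hγ, smul_smul]
  congr 3
  field_simp

/-- Twice the signed area of the triangle with vertices `a`, `b`, `c`. -/
def det3 (a b c : Plane) : ℝ := (b 0 - a 0) * (c 1 - a 1) - (b 1 - a 1) * (c 0 - a 0)

theorem integral_refTriangle (g : ℝ → ℝ → ℝ)
    (hg : Continuous (Function.uncurry g)) :
    ∫ x in {x : Plane | 0 ≤ x 0 ∧ 0 ≤ x 1 ∧ x 0 + x 1 ≤ 1}, g (x 0) (x 1)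
      = ∫ t in (0 : ℝ)..1, ∫ s in (0 : ℝ)..(1 - t), g s t := by
  set R : Set (ℝ × ℝ) := {p | 0 ≤ p.1 ∧ 0 ≤ p.2 ∧ p.1 + p.2 ≤ 1} with hR
  have hRm : MeasurableSet R := by
    refine (isClosed_le continuous_const continuous_fst).measurableSet.inter
      ((isClosed_le continuous_const continuous_snd).measurableSet.inter
        (isClosed_le (continuous_fst.add continuous_snd) continuous_const).measurableSet)
  have hRc : R ⊆ Set.Icc 0 1 ×ˢ Set.Icc 0 1 := by
    rintro ⟨s, t⟩ ⟨h1, h2, h3⟩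
    simp only at h1 h2 h3
    exact ⟨⟨h1, by simp only; linarith⟩, ⟨h2, by simp only; linarith⟩⟩
  have hmp : MeasurePreserving
      ((MeasurableEquiv.toLp 2 (Fin 2 → ℝ)).symm.trans MeasurableEquiv.finTwoArrow)
      (volume : Measure Plane) (volume : Measure (ℝ × ℝ)) :=
    (volume_preserving_finTwoArrow ℝ).comp
      (EuclideanSpace.volume_preserving_symm_measurableEquiv_toLp (Fin 2))
  have h1 : ∫ x in {x : Plane | 0 ≤ x 0 ∧ 0 ≤ x 1 ∧ x 0 + x 1 ≤ 1}, g (x 0) (x 1)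
      = ∫ p in R, g p.1 p.2 := by
    have := hmp.setIntegral_preimage_emb (MeasurableEquiv.measurableEmbedding _)
      (fun p : ℝ × ℝ => g p.1 p.2) R
    exact this
  have hint : IntegrableOn (fun p : ℝ × ℝ => g p.1 p.2) R :=
    (ContinuousOn.integrableOn_compact (isCompact_Icc.prod isCompact_Icc)
      hg.continuousOn).mono_set hRc
  rw [h1, ← integral_indicator hRm, Measure.volume_eq_prod, integral_prod_symm _ (by
    rw [← Measure.volume_eq_prod]; exact hint.integrable_indicator hRm)]
  rw [intervalIntegral.integral_of_le zero_le_one, ← integral_Icc_eq_integral_Ioc,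
    ← integral_indicator measurableSet_Icc]
  congr 1
  ext t
  by_cases ht : t ∈ Set.Icc (0 : ℝ) 1
  · rw [Set.indicator_of_mem ht, intervalIntegral.integral_of_le (by linarith [ht.2]),
      ← integral_Icc_eq_integral_Ioc, ← integral_indicator measurableSet_Icc]
    congr 1
    ext s
    by_cases hs : s ∈ Set.Icc 0 (1 - t)
    · rw [Set.indicator_of_mem hs, Set.indicator_of_mem]
      exact ⟨hs.1, ht.1, by simp only; linarith [hs.2]⟩
    · rw [Set.indicator_of_notMem hs, Set.indicator_of_notMem]
      rintro ⟨h1, h2, h3⟩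
      simp only at h1 h2 h3
      exact hs ⟨h1, by linarith⟩
  · rw [Set.indicator_of_notMem ht]
    have : ∀ s, R.indicator (fun p : ℝ × ℝ => g p.1 p.2) (s, t) = 0 := by
      intro s
      refine Set.indicator_of_notMem ?_ _
      rintro ⟨h1, h2, h3⟩
      simp only at h1 h2 h3
      exact ht ⟨h2, by linarith⟩
    simp [this]

theorem mem_hull_triple_iff (a b c x : Plane) :
    x ∈ convexHull ℝ ({a, b, c} : Set Plane) ↔
      ∃ s t : ℝ, 0 ≤ s ∧ 0 ≤ t ∧ s + t ≤ 1 ∧ x = a + s • (b - a) + t • (c - a) := by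
  rw [convexHull_insert (by simp), convexHull_pair]
  simp only [convexJoin, segment_eq_image', Set.mem_iUnion, Set.mem_image, Set.mem_Icc,
    exists_prop, Set.mem_singleton_iff, exists_eq_left]
  constructor
  · rintro ⟨y, ⟨t, ht, rfl⟩, r, hr, rfl⟩
    refine ⟨r * (1 - t), r * t, mul_nonneg hr.1 (by linarith [ht.2]), mul_nonneg hr.1 ht.1, by
      nlinarith [hr.2], ?_⟩
    module
  · rintro ⟨s, t, hs, ht, hst, rfl⟩
    by_cases h : s + t = 0
    · have hs0 : s = 0 := by linarith
      have ht0 : t = 0 := by linarith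
      exact ⟨b, ⟨0, by simp, by simp⟩, 0, by simp, by simp [hs0, ht0]⟩
    · have hpos : 0 < s + t := lt_of_le_of_ne (by linarith) (Ne.symm h)
      refine ⟨b + (t / (s + t)) • (c - b), ⟨t / (s + t), ⟨by positivity, ?_⟩, rfl⟩, s + t,
        ⟨hpos.le, hst⟩, ?_⟩
      · rw [div_le_one hpos]; linarith
      · have : (s + t) * (t / (s + t)) = t := by field_simp
        have e : (s + t) • (b + (t / (s + t)) • (c - b) - a)
          = (s + t) • (b - a) + ((s + t) * (t / (s + t))) • (c - b) := by module
        rw [e, this]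
        module

/-- The linear map that sends the standard basis to `b - a`, `c - a`. -/
def edgeMap (a b c : Plane) : Plane →L[ℝ] Plane :=
  (EuclideanSpace.proj (0 : Fin 2) : Plane →L[ℝ] ℝ).smulRight (b - a)
    + (EuclideanSpace.proj (1 : Fin 2) : Plane →L[ℝ] ℝ).smulRight (c - a)

theorem edgeMap_apply (a b c x : Plane) : edgeMap a b c x = x 0 • (b - a) + x 1 • (c - a) := by
  simp [edgeMap]

theorem det_edgeMap (a b c : Plane) : (edgeMap a b c).det = det3 a b c := by
  rw [ContinuousLinearMap.det, ← LinearMap.det_toMatrix (EuclideanSpace.basisFun (Fin 2) ℝ).toBasis,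
    Matrix.det_fin_two]
  simp only [LinearMap.toMatrix_apply, OrthonormalBasis.coe_toBasis, EuclideanSpace.basisFun_apply,
    ContinuousLinearMap.coe_coe, edgeMap_apply, OrthonormalBasis.coe_toBasis_repr_apply,
    EuclideanSpace.basisFun_repr]
  simp [det3]
  ring

/-- A function continuous on a closed set agrees there with a continuous function. -/
theorem exists_continuous_eqOn {S : Set Plane} (hS : IsClosed S) {f : Plane → ℝ}
    (hf : ContinuousOn f S) : ∃ F : Plane → ℝ, Continuous F ∧ Set.EqOn f F S := by
  obtain ⟨g, hg⟩ := ContinuousMap.exists_restrict_eq hS ⟨S.domRestrict f, hf.domRestrict⟩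
  refine ⟨g, g.continuous, fun x hx => ?_⟩
  have := congrArg (fun h : C(S, ℝ) => h ⟨x, hx⟩) hg
  exact this.symm

theorem isCompact_hull_triple (a b c : Plane) :
    IsCompact (convexHull ℝ ({a, b, c} : Set Plane)) :=
  Set.Finite.isCompact_convexHull ℝ (Set.toFinite _)

theorem triple_param_mem (a b c : Plane) {s t : ℝ} (hs : 0 ≤ s) (ht : 0 ≤ t) (hst : s + t ≤ 1) :
    a + s • (b - a) + t • (c - a) ∈ convexHull ℝ ({a, b, c} : Set Plane) :=
  (mem_hull_triple_iff a b c _).2 ⟨s, t, hs, ht, hst, rfl⟩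

theorem integral_triangle_eq (a b c : Plane) (hdet : det3 a b c ≠ 0) (f : Plane → ℝ)
    (hf : ContinuousOn f (convexHull ℝ ({a, b, c} : Set Plane))) :
    ∫ x in convexHull ℝ ({a, b, c} : Set Plane), f x
      = |det3 a b c| * ∫ t in (0 : ℝ)..1, ∫ s in (0 : ℝ)..(1 - t),
          f (a + s • (b - a) + t • (c - a)) := by
  obtain ⟨F, hF, hfF⟩ := exists_continuous_eqOn (isCompact_hull_triple a b c).isClosed hf
  have hmeas := (isCompact_hull_triple a b c).isClosed.measurableSet
  rw [setIntegral_congr_fun hmeas hfF]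
  have hR : ∫ t in (0 : ℝ)..1, ∫ s in (0 : ℝ)..(1 - t), f (a + s • (b - a) + t • (c - a))
      = ∫ t in (0 : ℝ)..1, ∫ s in (0 : ℝ)..(1 - t), F (a + s • (b - a) + t • (c - a)) := by
    refine intervalIntegral.integral_congr fun t ht => ?_
    rw [Set.uIcc_of_le zero_le_one] at ht
    refine intervalIntegral.integral_congr fun s hs => ?_
    rw [Set.uIcc_of_le (by linarith [ht.2])] at hs
    exact hfF (triple_param_mem a b c hs.1 ht.1 (by linarith [hs.2]))
  rw [hR, ← integral_refTriangle (fun s t => F (a + s • (b - a) + t • (c - a)))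
    (by simp only [Function.uncurry_def]; fun_prop)]
  set R : Set Plane := {x : Plane | 0 ≤ x 0 ∧ 0 ≤ x 1 ∧ x 0 + x 1 ≤ 1} with hRdef
  have hRm : MeasurableSet R := by
    have h0 : Continuous fun x : Plane => x 0 := by fun_prop
    have h1 : Continuous fun x : Plane => x 1 := by fun_prop
    exact (isClosed_le continuous_const h0).measurableSet.inter
      ((isClosed_le continuous_const h1).measurableSet.inter
        (isClosed_le (h0.add h1) continuous_const).measurableSet)
  have himg : convexHull ℝ ({a, b, c} : Set Plane) = (fun x => a + edgeMap a b c x) '' R := by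
    ext y
    rw [mem_hull_triple_iff]
    simp only [Set.mem_image, edgeMap_apply, hRdef, Set.mem_ofPred_eq]
    constructor
    · rintro ⟨s, t, hs, ht, hst, rfl⟩
      exact ⟨!₂[s, t], by simpa using ⟨hs, ht, hst⟩, by simp [add_assoc]⟩
    · rintro ⟨x, ⟨h0, h1, h2⟩, rfl⟩
      exact ⟨x 0, x 1, h0, h1, h2, by rw [add_assoc]⟩
  have hinj : Set.InjOn (fun x => a + edgeMap a b c x) R := by
    intro x _ y _ hxy
    have h : edgeMap a b c x = edgeMap a b c y := add_left_cancel hxy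
    have hunit : IsUnit (edgeMap a b c : Plane →ₗ[ℝ] Plane).det := by
      have h2 : (edgeMap a b c : Plane →ₗ[ℝ] Plane).det = det3 a b c := det_edgeMap a b c
      rw [h2]; exact hdet.isUnit
    have h3 : ∀ z, LinearMap.equivOfIsUnitDet hunit z = edgeMap a b c z := fun z => by simp
    exact (LinearMap.equivOfIsUnitDet hunit).injective (by rw [h3, h3, h])
  have hder : ∀ x ∈ R, HasFDerivWithinAt (fun x => a + edgeMap a b c x) (edgeMap a b c) R x :=
    fun x _ => ((edgeMap a b c).hasFDerivAt.const_add a).hasFDerivWithinAt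
  rw [himg, integral_image_eq_integral_abs_det_fderiv_smul volume hRm hder hinj, det_edgeMap,
    ← integral_const_mul]
  simp only [edgeMap_apply, smul_eq_mul, add_assoc]

/-- The fundamental theorem of calculus along the lines parallel to `b - a` in a triangle. -/
theorem integral_triangle_fderiv (a b c : Plane) (hdet : det3 a b c ≠ 0) {F : Plane → ℝ}
    {F' : Plane → Plane →L[ℝ] ℝ}
    (hF : ∀ x ∈ convexHull ℝ ({a, b, c} : Set Plane), HasFDerivAt F (F' x) x)
    (hF' : ContinuousOn F' (convexHull ℝ ({a, b, c} : Set Plane))) :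
    ∫ x in convexHull ℝ ({a, b, c} : Set Plane), F' x (b - a)
      = |det3 a b c| * ((∫ t in (0 : ℝ)..1, F (b + t • (c - b)))
          - ∫ t in (0 : ℝ)..1, F (a + t • (c - a))) := by
  have hFc : ContinuousOn F (convexHull ℝ ({a, b, c} : Set Plane)) :=
    fun x hx => (hF x hx).continuousAt.continuousWithinAt
  rw [integral_triangle_eq a b c hdet _ (hF'.clm_apply continuousOn_const)]
  congr 1
  rw [← intervalIntegral.integral_sub]
  · refine intervalIntegral.integral_congr fun t ht => ?_
    rw [Set.uIcc_of_le zero_le_one] at ht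
    have hderiv : ∀ s ∈ Set.uIcc 0 (1 - t),
        HasDerivAt (fun s : ℝ => F (a + s • (b - a) + t • (c - a)))
          (F' (a + s • (b - a) + t • (c - a)) (b - a)) s := by
      intro s hs
      rw [Set.uIcc_of_le (by linarith [ht.2])] at hs
      have h1 : HasDerivAt (fun s : ℝ => a + s • (b - a) + t • (c - a)) (b - a) s := by
        simpa using (((hasDerivAt_id s).smul_const (b - a)).const_add a).add_const
          (t • (c - a))
      exact (hF _ (triple_param_mem a b c hs.1 ht.1 (by linarith [hs.2]))).comp_hasDerivAt s h1
    have hint : IntervalIntegrable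
        (fun s : ℝ => F' (a + s • (b - a) + t • (c - a)) (b - a)) volume 0 (1 - t) := by
      refine ContinuousOn.intervalIntegrable ?_
      refine (hF'.clm_apply continuousOn_const).comp (by fun_prop) fun s hs => ?_
      rw [Set.uIcc_of_le (by linarith [ht.2])] at hs
      exact triple_param_mem a b c hs.1 ht.1 (by linarith [hs.2])
    rw [intervalIntegral.integral_eq_sub_of_hasDerivAt hderiv hint]
    congr 2
    · module
    · module
  · refine ContinuousOn.intervalIntegrable (hFc.comp (by fun_prop) fun t ht => ?_)
    rw [Set.uIcc_of_le zero_le_one] at ht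
    have := triple_param_mem a b c (s := 1 - t) (t := t) (by linarith [ht.2]) ht.1 (by linarith)
    convert this using 1
    module
  · refine ContinuousOn.intervalIntegrable (hFc.comp (by fun_prop) fun t ht => ?_)
    rw [Set.uIcc_of_le zero_le_one] at ht
    simpa using triple_param_mem a b c (s := 0) (t := t) le_rfl ht.1 (by linarith [ht.2])

/-! ### Normals and the divergence theorem on a triangle -/

theorem inner_plane (x y : Plane) : inner ℝ x y = x 0 * y 0 + x 1 * y 1 := by
  simp [PiLp.inner_apply, Fin.sum_univ_two, mul_comm]

theorem norm_sq_plane (x : Plane) : ‖x‖ ^ 2 = x 0 ^ 2 + x 1 ^ 2 := by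
  rw [EuclideanSpace.real_norm_sq_eq, Fin.sum_univ_two]

theorem det3_ne_zero {a b c : Plane} (h : AffineIndependent ℝ ![a, b, c]) : det3 a b c ≠ 0 := by
  intro h0
  have h1 := (affineIndependent_iff_linearIndependent_vsub ℝ _ (0 : Fin 3)).1 h
  have h2 : LinearIndependent ℝ ![b - a, c - a] := by
    have := h1.comp (fun i : Fin 2 => (⟨i.succ, Fin.succ_ne_zero i⟩ : {x : Fin 3 // x ≠ 0}))
      (fun i j hij => by simpa using hij)
    have e : ![b - a, c - a] = (fun i : {x : Fin 3 // x ≠ 0} => ![a, b, c] i -ᵥ ![a, b, c] 0) ∘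
        (fun i : Fin 2 => (⟨i.succ, Fin.succ_ne_zero i⟩ : {x : Fin 3 // x ≠ 0})) := by
      ext i j
      fin_cases i <;> simp
    rw [e]
    exact this
  rw [LinearIndependent.pair_iff] at h2
  by_cases hz : b - a = 0
  · have := (h2 1 0 (by simp [hz])).1
    norm_num at this
  · have key : ∀ i j : Fin 2, (c i - a i) * (b j - a j) = (b i - a i) * (c j - a j) := by
      unfold det3 at h0
      intro i j
      fin_cases i <;> fin_cases j <;> simp <;> linarith
    have : ∃ j, (b - a) j ≠ 0 := by
      by_contra hcon
      push Not at hcon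
      exact hz (by ext j; exact hcon j)
    obtain ⟨j, hj⟩ := this
    refine hj ?_
    have := (h2 ((c - a) j) (-(b - a) j) (by
      ext i
      simp only [PiLp.add_apply, PiLp.smul_apply, PiLp.sub_apply, smul_eq_mul, PiLp.zero_apply]
      linarith [key i j])).2
    simp only [PiLp.sub_apply, neg_sub] at this ⊢
    linarith

/-- The defining properties of the outward unit normal to the edge `{b, c}` of the triangle with
vertices `a`, `b`, `c`: it is orthogonal to the edge, of length one, and the product of the length of
the edge and of the altitude is twice the area. -/
theorem normal_spec {a b c : Plane} {K E : Finset Plane} 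
    (hKs : ∑ x ∈ K, x = a + b + c) (hE : (E : Set Plane) = {b, c}) (hEs : ∑ x ∈ E, x = b + c)
    (hdet : det3 a b c ≠ 0) :
    inner ℝ (normal K E) (c - b) = 0 ∧ ‖normal K E‖ = 1 ∧
      ‖c - b‖ * inner ℝ (normal K E) (b - a) = |det3 a b c| := by
  set w : Plane := (2 : ℝ)⁻¹ • (∑ x ∈ E, x) - (3 : ℝ)⁻¹ • (∑ x ∈ K, x) with hw
  set v : Plane := w - (vectorSpan ℝ (E : Set Plane)).starProjection w with hv
  have hn : normal K E = ‖v‖⁻¹ • v := rfl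
  have hw' : w = (3 : ℝ)⁻¹ • (b - a) + (6 : ℝ)⁻¹ • (c - b) := by
    rw [hw, hKs, hEs]; module
  have hspan : vectorSpan ℝ (E : Set Plane) = ℝ ∙ (c - b) := by
    rw [hE, vectorSpan_pair_rev]; simp
  have hvorth : ∀ y ∈ vectorSpan ℝ (E : Set Plane), inner ℝ v y = 0 := fun y hy => by
    have := Submodule.sub_starProjection_mem_orthogonal (K := vectorSpan ℝ (E : Set Plane)) w
    rw [real_inner_comm]
    exact this y hy
  have hvc : inner ℝ v (c - b) = 0 := hvorth _ (by
    rw [hspan]; exact Submodule.mem_span_singleton_self _)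
  have hvw : inner ℝ v w = ‖v‖ ^ 2 := by
    have : w = v + (vectorSpan ℝ (E : Set Plane)).starProjection w := by rw [hv]; abel
    conv_lhs => rw [this]
    rw [inner_add_right, hvorth _ (Submodule.starProjection_apply_mem _ _), add_zero,
      real_inner_self_eq_norm_sq]
  have hvb : inner ℝ v (b - a) = 3 * ‖v‖ ^ 2 := by
    have h := hvw
    rw [hw', inner_add_right, inner_smul_right, inner_smul_right, hvc] at h
    linarith
  obtain ⟨μ, hμ⟩ : ∃ μ : ℝ, v = (3 : ℝ)⁻¹ • (b - a) + μ • (c - b) := by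
    have hm := Submodule.starProjection_apply_mem (vectorSpan ℝ (E : Set Plane)) w
    nth_rewrite 1 [hspan] at hm
    obtain ⟨l, hl⟩ := Submodule.mem_span_singleton.1 hm
    refine ⟨(6 : ℝ)⁻¹ - l, ?_⟩
    rw [hv, ← hl, hw']
    module
  have hdetv : det3 a b c = 3 * (v 0 * (c 1 - b 1) - v 1 * (c 0 - b 0)) := by
    rw [hμ]
    simp only [PiLp.add_apply, PiLp.smul_apply, PiLp.sub_apply, smul_eq_mul, det3]
    ring
  have hv0 : v ≠ 0 := by
    intro h
    apply hdet
    rw [hdetv, h]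
    simp
  have hvpos : 0 < ‖v‖ := norm_pos_iff.2 hv0
  refine ⟨?_, ?_, ?_⟩
  · rw [hn, real_inner_smul_left, hvc, mul_zero]
  · rw [hn, norm_smul, norm_inv, norm_norm, inv_mul_cancel₀ hvpos.ne']
  · rw [hn, real_inner_smul_left, hvb]
    have h1 : ‖c - b‖ * (‖v‖⁻¹ * (3 * ‖v‖ ^ 2)) = 3 * (‖c - b‖ * ‖v‖) := by
      field_simp
    rw [h1]
    have h2 : (3 * (‖c - b‖ * ‖v‖)) ^ 2 = |det3 a b c| ^ 2 := by
      rw [sq_abs, hdetv, mul_pow, mul_pow, norm_sq_plane, norm_sq_plane]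
      have h3 := hvc
      rw [inner_plane] at h3
      simp only [PiLp.sub_apply] at h3 ⊢
      linear_combination 9 * (v 0 * (c 0 - b 0) + v 1 * (c 1 - b 1)) * h3
    exact (pow_left_inj₀ (by positivity) (abs_nonneg _) two_ne_zero).1 h2

open scoped Classical in
theorem exists_vertices {K : Finset Plane} (h3 : K.card = 3)
    (hind : AffineIndependent ℝ ((↑) : K → Plane)) :
    ∃ a b c : Plane, a ≠ b ∧ a ≠ c ∧ b ≠ c ∧ K = {a, b, c} ∧ det3 a b c ≠ 0 := by
  obtain ⟨a, b, c, hab, hac, hbc, rfl⟩ := Finset.card_eq_three.1 h3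
  refine ⟨a, b, c, hab, hac, hbc, rfl, det3_ne_zero ?_⟩
  have := hind.comp_embedding ⟨![(⟨a, by simp⟩ : ({a, b, c} : Finset Plane)), ⟨b, by simp⟩,
    ⟨c, by simp⟩], by
      intro i j hij
      fin_cases i <;> fin_cases j <;> simp_all⟩
  convert this using 1
  ext i : 1
  fin_cases i <;> rfl

open scoped Classical in
theorem sum_edges {a b c : Plane} (hab : a ≠ b) (hac : a ≠ c) (hbc : b ≠ c)
    {M : Type*} [AddCommMonoid M] (f : Finset Plane → M) :
    ∑ E ∈ edges {a, b, c}, f E = f {b, c} + f {a, c} + f {a, b} := by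
  have h1 : ({b, c} : Finset Plane) ≠ {a, c} := fun h => by
    have : b ∈ ({a, c} : Finset Plane) := h ▸ by simp
    simp [hab.symm, hbc] at this
  have h2 : ({b, c} : Finset Plane) ≠ {a, b} := fun h => by
    have : c ∈ ({a, b} : Finset Plane) := h ▸ by simp
    simp [hac.symm, hbc.symm] at this
  have h3 : ({a, c} : Finset Plane) ≠ {a, b} := fun h => by
    have : c ∈ ({a, b} : Finset Plane) := h ▸ by simp
    simp [hac.symm, hbc.symm] at this
  have key : edges {a, b, c} = {{b, c}, {a, c}, {a, b}} := by
    refine (Finset.eq_of_subset_of_card_le ?_ ?_).symm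
    · intro E hE
      simp only [Finset.mem_insert, Finset.mem_singleton] at hE
      rw [edges, Finset.mem_powersetCard]
      rcases hE with rfl | rfl | rfl
      · exact ⟨by intro x; simp; tauto, Finset.card_pair hbc⟩
      · exact ⟨by intro x; simp; tauto, Finset.card_pair hac⟩
      · exact ⟨by intro x; simp; tauto, Finset.card_pair hab⟩
    · rw [edges, Finset.card_powersetCard, Finset.card_eq_three.2 ⟨a, b, c, hab, hac, hbc, rfl⟩,
        Finset.card_eq_three.2 ⟨_, _, _, h1, h2, h3, rfl⟩]
      decide
  rw [key, Finset.sum_insert (by simp [h1, h2]), Finset.sum_insert (by simp [h3]),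
    Finset.sum_singleton, add_assoc]

theorem det3_rotate (a b c : Plane) : det3 b c a = det3 a b c := by
  unfold det3; ring

theorem det3_swap (a b c : Plane) : det3 a c b = -det3 a b c := by
  unfold det3; ring

open scoped Classical in
theorem normal_triple {a b c : Plane} (hab : a ≠ b) (hac : a ≠ c) (hbc : b ≠ c)
    (hdet : det3 a b c ≠ 0) :
    inner ℝ (normal {a, b, c} {b, c}) (c - b) = 0 ∧ ‖normal {a, b, c} {b, c}‖ = 1 ∧
      ‖c - b‖ * inner ℝ (normal {a, b, c} {b, c}) (b - a) = |det3 a b c| := by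
  refine normal_spec ?_ (by simp) (Finset.sum_pair hbc) hdet
  rw [Finset.sum_insert (by simp [hab, hac]), Finset.sum_pair hbc, add_assoc]

open scoped Classical in
theorem integral_hull_pair (a b : Plane) (f : Plane → ℝ) :
    ∫ x in hull {a, b}, f x ∂(Measure.hausdorffMeasure 1)
      = ‖b - a‖ * ∫ t in (0 : ℝ)..1, f (a + t • (b - a)) := by
  rw [hull, Finset.coe_pair, convexHull_pair, integral_segment_eq]

open scoped Classical in
theorem divergence_theorem_edge {a b c : Plane} (hab : a ≠ b) (hac : a ≠ c) (hbc : b ≠ c)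
    (hdet : det3 a b c ≠ 0) {F : Plane → ℝ} {F' : Plane → Plane →L[ℝ] ℝ}
    (hF : ∀ x ∈ hull {a, b, c}, HasFDerivAt F (F' x) x)
    (hF' : ContinuousOn F' (hull {a, b, c})) :
    ∫ x in hull {a, b, c}, F' x (b - a)
      = ∑ E ∈ edges {a, b, c}, (∫ x in hull E, F x ∂(Measure.hausdorffMeasure 1))
          * inner ℝ (normal {a, b, c} E) (b - a) := by
  have hh : hull {a, b, c} = convexHull ℝ ({a, b, c} : Set Plane) := by
    rw [hull]; simp
  rw [hh] at hF hF'
  rw [sum_edges hab hac hbc, hh, integral_triangle_fderiv a b c hdet hF hF', integral_hull_pair,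
    integral_hull_pair]
  obtain ⟨-, -, h1⟩ := normal_triple hab hac hbc hdet
  obtain ⟨h2, -, h2'⟩ := normal_triple (a := b) (b := a) (c := c) hab.symm hbc hac (by
    rw [← det3_rotate, det3_swap]; simpa using hdet)
  obtain ⟨h3, -, -⟩ := normal_triple (a := c) (b := a) (c := b) hac.symm hbc.symm hab (by
    rw [← det3_rotate]; exact hdet)
  have e1 : ({b, a, c} : Finset Plane) = {a, b, c} := Finset.insert_comm _ _ _
  have e2 : ({c, a, b} : Finset Plane) = {a, b, c} := by
    rw [Finset.insert_comm, Finset.pair_comm]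
  rw [e1] at h2 h2'
  rw [e2] at h3
  have h4 : |det3 b a c| = |det3 a b c| := by
    rw [← det3_rotate, det3_swap, abs_neg]
  have h5 : inner ℝ (normal {a, b, c} {a, c}) (b - a)
      = - inner ℝ (normal {a, b, c} {a, c}) (a - b) := by
    rw [← inner_neg_right, neg_sub]
  rw [h3, mul_zero, add_zero, h5, mul_sub]
  rw [h4] at h2'
  linear_combination (-(∫ t in (0 : ℝ)..1, F (b + t • (c - b)))) * h1
    + (∫ t in (0 : ℝ)..1, F (a + t • (c - a))) * h2'

/-- The divergence theorem on a triangle, for a scalar function and a constant direction. -/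
theorem divergence_theorem {K : Finset Plane} (h3 : K.card = 3)
    (hind : AffineIndependent ℝ ((↑) : K → Plane)) {F : Plane → ℝ}
    {F' : Plane → Plane →L[ℝ] ℝ} (hF : ∀ x ∈ hull K, HasFDerivAt F (F' x) x)
    (hF' : ContinuousOn F' (hull K)) (e : Plane) :
    ∫ x in hull K, F' x e
      = ∑ E ∈ edges K, (∫ x in hull E, F x ∂(Measure.hausdorffMeasure 1))
          * inner ℝ (normal K E) e := by
  classical
  obtain ⟨a, b, c, hab, hac, hbc, rfl, hdet⟩ := exists_vertices h3 hind
  have hB := divergence_theorem_edge hab hac hbc hdet hF hF'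
  have e1 : ({a, c, b} : Finset Plane) = {a, b, c} := by rw [Finset.pair_comm]
  have hC := divergence_theorem_edge (a := a) (b := c) (c := b) hac hab hbc.symm (by
    rw [det3_swap]; simpa using hdet) (F := F) (F' := F') (by rwa [e1]) (by rwa [e1])
  rw [e1] at hC
  have hcomp : IsCompact (hull {a, b, c}) := Set.Finite.isCompact_convexHull ℝ (Finset.finite_toSet _)
  have hint : ∀ v : Plane, IntegrableOn (fun x => F' x v) (hull {a, b, c}) := fun v =>
    (hF'.clm_apply continuousOn_const).integrableOn_compact hcomp
  obtain ⟨s, t, he⟩ : ∃ s t : ℝ, e = s • (b - a) + t • (c - a) := by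
    refine ⟨(e 0 * (c 1 - a 1) - e 1 * (c 0 - a 0)) / det3 a b c,
      (e 1 * (b 0 - a 0) - e 0 * (b 1 - a 1)) / det3 a b c, ?_⟩
    ext i
    simp only [PiLp.add_apply, PiLp.smul_apply, PiLp.sub_apply, smul_eq_mul]
    rw [div_mul_eq_mul_div, div_mul_eq_mul_div, ← add_div, eq_div_iff hdet]
    unfold det3
    fin_cases i <;> simp <;> ring
  have hL : ∫ x in hull {a, b, c}, F' x e
      = s * (∫ x in hull {a, b, c}, F' x (b - a)) + t * ∫ x in hull {a, b, c}, F' x (c - a) := by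
    rw [← integral_const_mul, ← integral_const_mul,
      ← integral_add ((hint _).const_mul s) ((hint _).const_mul t)]
    refine integral_congr_ae (Filter.Eventually.of_forall fun x => ?_)
    simp [he]
  rw [hL, hB, hC, Finset.mul_sum, Finset.mul_sum, ← Finset.sum_add_distrib]
  refine Finset.sum_congr rfl fun E _ => ?_
  rw [he, inner_add_right, inner_smul_right, inner_smul_right]
  ring

/-! ### Geometry of a triangle -/

/-- `K` is the set of vertices of a nondegenerate triangle. -/
def IsTriangle (K : Finset Plane) : Prop :=
  K.card = 3 ∧ AffineIndependent ℝ ((↑) : K → Plane)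

theorem isCompact_hull (K : Finset Plane) : IsCompact (hull K) :=
  Set.Finite.isCompact_convexHull ℝ K.finite_toSet

theorem convex_hull (K : Finset Plane) : Convex ℝ (hull K) := convex_convexHull ℝ _

theorem measurableSet_hull (K : Finset Plane) : MeasurableSet (hull K) :=
  (isCompact_hull K).isClosed.measurableSet

theorem subset_hull (K : Finset Plane) : (K : Set Plane) ⊆ hull K := subset_convexHull ℝ _

theorem hull_mono {E K : Finset Plane} (h : E ⊆ K) : hull E ⊆ hull K :=
  convexHull_mono (Finset.coe_subset.2 h)

theorem dist_le_hK {K : Finset Plane} {x y : Plane} (hx : x ∈ hull K) (hy : y ∈ hull K) :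
    dist x y ≤ hK K :=
  Metric.dist_le_diam_of_mem (isCompact_hull K).isBounded hx hy

theorem edge_subset {K E : Finset Plane} (hE : E ∈ edges K) : E ⊆ K :=
  (Finset.mem_powersetCard.1 hE).1

theorem hull_edge_subset {K E : Finset Plane} (hE : E ∈ edges K) : hull E ⊆ hull K :=
  hull_mono (edge_subset hE)

open scoped Classical in
theorem hull_triple (a b c : Plane) : hull {a, b, c} = convexHull ℝ ({a, b, c} : Set Plane) := by
  rw [hull]; simp

open scoped Classical in
theorem exists_vertices_of_edge {K E : Finset Plane} (hK : IsTriangle K) (hE : E ∈ edges K) :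
    ∃ a b c : Plane, a ≠ b ∧ a ≠ c ∧ b ≠ c ∧ K = {a, b, c} ∧ E = {b, c} ∧ det3 a b c ≠ 0 := by
  obtain ⟨a, b, c, hab, hac, hbc, rfl, hdet⟩ := exists_vertices hK.1 hK.2
  obtain ⟨hsub, hcard⟩ := Finset.mem_powersetCard.1 hE
  obtain ⟨x, y, hxy, rfl⟩ := Finset.card_eq_two.1 hcard
  have hx : x = a ∨ x = b ∨ x = c := by simpa using hsub (show x ∈ ({x, y} : Finset Plane) by simp)
  have hy : y = a ∨ y = b ∨ y = c := by simpa using hsub (show y ∈ ({x, y} : Finset Plane) by simp)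
  have e1 : ({b, a, c} : Finset Plane) = {a, b, c} := Finset.insert_comm _ _ _
  have e2 : ({c, a, b} : Finset Plane) = {a, b, c} := by
    rw [Finset.insert_comm, Finset.pair_comm]
  have d1 : det3 b a c ≠ 0 := by rw [← det3_rotate, det3_swap]; simpa using hdet
  have d2 : det3 c a b ≠ 0 := by rw [← det3_rotate]; exact hdet
  rcases hx with rfl | rfl | rfl <;> rcases hy with rfl | rfl | rfl <;> try exact absurd rfl hxy
  · exact ⟨c, x, y, hac.symm, hbc.symm, hab, e2.symm, rfl, d2⟩
  · exact ⟨b, x, y, hab.symm, hbc, hac, e1.symm, rfl, d1⟩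
  · exact ⟨c, y, x, hac.symm, hbc.symm, hab, e2.symm, Finset.pair_comm _ _, d2⟩
  · exact ⟨a, x, y, hab, hac, hbc, rfl, rfl, hdet⟩
  · exact ⟨b, y, x, hab.symm, hbc, hac, e1.symm, Finset.pair_comm _ _, d1⟩
  · exact ⟨a, y, x, hab, hac, hbc, rfl, Finset.pair_comm _ _, hdet⟩

theorem norm_normal {K E : Finset Plane} (hK : IsTriangle K) (hE : E ∈ edges K) :
    ‖normal K E‖ = 1 := by
  classical
  obtain ⟨a, b, c, hab, hac, hbc, rfl, rfl, hdet⟩ := exists_vertices_of_edge hK hE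
  exact (normal_triple hab hac hbc hdet).2.1

open scoped Classical in
theorem normal_inner_pos {a b c : Plane} (hab : a ≠ b) (hac : a ≠ c) (hbc : b ≠ c)
    (hdet : det3 a b c ≠ 0) : 0 < inner ℝ (normal {a, b, c} {b, c}) (b - a) := by
  have h := (normal_triple hab hac hbc hdet).2.2
  have h1 : 0 < ‖c - b‖ := norm_pos_iff.2 (sub_ne_zero.2 hbc.symm)
  have h2 : 0 < |det3 a b c| := abs_pos.2 hdet
  rw [← h] at h2
  exact (mul_pos_iff_of_pos_left h1).1 h2

/-- The triangle lies on the inner side of the line through any of its edges. -/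
theorem normal_inner_le {K E : Finset Plane} (hK : IsTriangle K) (hE : E ∈ edges K) {y z : Plane}
    (hy : y ∈ hull E) (hz : z ∈ hull K) : inner ℝ (normal K E) (z - y) ≤ 0 := by
  classical
  obtain ⟨a, b, c, hab, hac, hbc, rfl, rfl, hdet⟩ := exists_vertices_of_edge hK hE
  have h1 := (normal_triple hab hac hbc hdet).1
  have h2 := normal_inner_pos hab hac hbc hdet
  set n := normal {a, b, c} {b, c}
  rw [hull_triple, mem_hull_triple_iff] at hz
  obtain ⟨s, t, hs, ht, hst, rfl⟩ := hz
  rw [hull, Finset.coe_pair, convexHull_pair, segment_eq_image'] at hy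
  obtain ⟨r, hr, rfl⟩ := hy
  have e : a + s • (b - a) + t • (c - a) - (b + r • (c - b))
      = (s + t - 1) • (b - a) + (t - r) • (c - b) := by module
  rw [e, inner_add_right, inner_smul_right, inner_smul_right, h1]
  nlinarith

theorem normal_inner_edge {K E : Finset Plane} (hK : IsTriangle K) (hE : E ∈ edges K) {y z : Plane}
    (hy : y ∈ hull E) (hz : z ∈ hull E) : inner ℝ (normal K E) (z - y) = 0 := by
  refine le_antisymm (normal_inner_le hK hE hy (hull_edge_subset hE hz)) ?_
  have := normal_inner_le hK hE hz (hull_edge_subset hE hy)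
  rw [← neg_sub, inner_neg_right] at this
  linarith

/-- Near an interior point of an edge, a triangle coincides with a half-plane. -/
theorem eventually_mem_hull {K E : Finset Plane} (hK : IsTriangle K) {b c : Plane}
    (hE : E ∈ edges K) (hEbc : (E : Set Plane) = {b, c}) {m : Plane} (hm : m ∈ openSegment ℝ b c) :
    ∀ᶠ z in 𝓝 m, inner ℝ (normal K E) (z - m) ≤ 0 → z ∈ hull K := by
  classical
  obtain ⟨a, b', c', hab, hac, hbc, rfl, rfl, hdet⟩ := exists_vertices_of_edge hK hE
  have hm' : m ∈ openSegment ℝ b' c' := by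
    rw [Finset.coe_pair] at hEbc
    rcases Set.pair_eq_pair_iff.1 hEbc with ⟨rfl, rfl⟩ | ⟨rfl, rfl⟩
    · exact hm
    · rwa [openSegment_symm]
  clear hm hEbc
  have h1 := (normal_triple hab hac hbc hdet).1
  have h2 := normal_inner_pos hab hac hbc hdet
  set n := normal {a, b', c'} {b', c'}
  obtain ⟨s, t, hs, ht, hst, rfl⟩ := hm'
  set S : Plane → ℝ := fun z =>
    ((z 0 - a 0) * (c' 1 - a 1) - (z 1 - a 1) * (c' 0 - a 0)) / det3 a b' c' with hS
  set U : Plane → ℝ := fun z =>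
    ((z 1 - a 1) * (b' 0 - a 0) - (z 0 - a 0) * (b' 1 - a 1)) / det3 a b' c' with hU
  have hrep : ∀ z, z = a + S z • (b' - a) + U z • (c' - a) := by
    intro z
    ext i
    simp only [PiLp.add_apply, PiLp.smul_apply, PiLp.sub_apply, smul_eq_mul, hS, hU]
    rw [← sub_eq_zero]
    field_simp
    unfold det3
    fin_cases i <;> simp <;> ring
  have hSc : Continuous S := by
    simp only [hS]; fun_prop
  have hUc : Continuous U := by
    simp only [hU]; fun_prop
  have hSm : S (s • b' + t • c') = s := by
    have ht' : t = 1 - s := by linarith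
    simp only [hS, PiLp.add_apply, PiLp.smul_apply, smul_eq_mul]
    rw [div_eq_iff hdet, ht']
    unfold det3
    ring
  have hUm : U (s • b' + t • c') = t := by
    have hs' : s = 1 - t := by linarith
    simp only [hU, PiLp.add_apply, PiLp.smul_apply, smul_eq_mul]
    rw [div_eq_iff hdet, hs']
    unfold det3
    ring
  have e1 : ∀ᶠ z in 𝓝 (s • b' + t • c'), 0 < S z :=
    hSc.continuousAt.eventually_const_lt (by rw [hSm]; exact hs)
  have e2 : ∀ᶠ z in 𝓝 (s • b' + t • c'), 0 < U z :=
    hUc.continuousAt.eventually_const_lt (by rw [hUm]; exact ht)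
  filter_upwards [e1, e2] with z hz1 hz2 hz3
  rw [hull_triple, mem_hull_triple_iff]
  refine ⟨S z, U z, hz1.le, hz2.le, ?_, hrep z⟩
  have e : z - (s • b' + t • c') = (S z + U z - 1) • (b' - a) + (U z - t) • (c' - b') := by
    have hs' : s = 1 - t := by linarith
    have hz := hrep z
    set p := S z
    set q := U z
    rw [hz, hs']
    module
  rw [e, inner_add_right, inner_smul_right, inner_smul_right, h1] at hz3
  by_contra hcon
  push Not at hcon
  nlinarith

theorem normal_inner_ge_radius {K E : Finset Plane} (hK : IsTriangle K) (hE : E ∈ edges K)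
    {x y : Plane} {r : ℝ} (hr : 0 ≤ r) (hball : Metric.closedBall x r ⊆ hull K)
    (hy : y ∈ hull E) : r ≤ inner ℝ (normal K E) (y - x) := by
  have hmem : x + r • normal K E ∈ hull K := hball (by
    simp [norm_smul, norm_normal hK hE, abs_of_nonneg hr])
  have := normal_inner_le hK hE hy hmem
  have e : x + r • normal K E - y = r • normal K E - (y - x) := by abel
  rw [e, inner_sub_right, inner_smul_right, real_inner_self_eq_norm_sq, norm_normal hK hE] at this
  linarith

/-- Every edge is at least as long as the diameter of an inscribed disc. -/
theorem two_mul_radius_le_dist {K : Finset Plane} (hK : IsTriangle K) {b c : Plane} (hb : b ∈ K)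
    (hc : c ∈ K) (hbc : b ≠ c) {x : Plane} {r : ℝ} (hr : 0 ≤ r)
    (hball : Metric.closedBall x r ⊆ hull K) : 2 * r ≤ dist b c := by
  classical
  have hE : ({b, c} : Finset Plane) ∈ edges K :=
    Finset.mem_powersetCard.2 ⟨by intro z; simp; rintro (rfl | rfl) <;> assumption,
      Finset.card_pair hbc⟩
  -- the width of the triangle in the direction normal to a second edge through `b`
  obtain ⟨a, b', c', hab, hac, hbc', hKe, hEe, hdet⟩ := exists_vertices_of_edge hK hE
  obtain ⟨hKa, hba, hca⟩ : K = {a, b, c} ∧ a ≠ b ∧ a ≠ c := by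
    have hb' : b = b' ∨ b = c' := by
      have : b ∈ ({b', c'} : Finset Plane) := hEe ▸ by simp
      simpa using this
    have ha : a ∉ ({b, c} : Finset Plane) := by rw [hEe]; simp [hab, hac]
    refine ⟨?_, fun h => ha (by simp [h]), fun h => ha (by simp [h])⟩
    rw [hKe, ← hEe]
  have hF : ({a, b} : Finset Plane) ∈ edges K :=
    Finset.mem_powersetCard.2 ⟨by rw [hKa]; intro z; simp; tauto, Finset.card_pair hba⟩
  set n := normal K {a, b} with hn
  have hn1 : ‖n‖ = 1 := norm_normal hK hF
  have hbF : b ∈ hull {a, b} := subset_hull _ (by simp)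
  have haF : a ∈ hull {a, b} := subset_hull _ (by simp)
  have h1 : r ≤ inner ℝ n (b - x) := normal_inner_ge_radius hK hF hr hball hbF
  have h2 : x - r • n ∈ hull K := hball (by simp [norm_smul, hn1, abs_of_nonneg hr])
  have h3 : ∀ z ∈ hull K, inner ℝ n (b - z) ≤ inner ℝ n (b - c) := by
    have hconv : Convex ℝ {z : Plane | inner ℝ n (b - z) ≤ inner ℝ n (b - c)} := by
      intro z hz w hw s t hs ht hst
      simp only [Set.mem_ofPred_eq, inner_sub_right, inner_add_right, inner_smul_right] at *
      have hs' : s = 1 - t := by linarith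
      subst hs'
      nlinarith
    refine convexHull_min (fun z hz => ?_) hconv
    have hle : 0 ≤ inner ℝ n (b - c) := by
      have := normal_inner_le hK hF hbF (subset_hull K hc)
      rw [← neg_sub, inner_neg_right] at this
      linarith
    rw [hKa] at hz
    simp only [Finset.coe_insert, Finset.coe_singleton, Set.mem_insert_iff,
      Set.mem_singleton_iff] at hz
    rcases hz with rfl | rfl | rfl
    · have := normal_inner_edge hK hF haF hbF
      change inner ℝ n (b - z) ≤ inner ℝ n (b - c)
      rw [this]
      exact hle
    · change inner ℝ n (z - z) ≤ inner ℝ n (z - c)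
      simpa using hle
    · exact le_refl (inner ℝ n (b - z))
  have h4 := h3 _ h2
  have e : b - (x - r • n) = (b - x) + r • n := by abel
  rw [e, inner_add_right, inner_smul_right, real_inner_self_eq_norm_sq, hn1] at h4
  have h5 : inner ℝ n (b - c) ≤ ‖n‖ * ‖b - c‖ := real_inner_le_norm _ _
  rw [hn1, one_mul, ← dist_eq_norm] at h5
  linarith

/-- The hulls of two triangles that meet in the hull of their common vertices do not overlap. -/
theorem volume_hull_inter {K L : Finset Plane} (hK : K.card = 3) (hL : L.card = 3) (hKL : K ≠ L)
    (hconf : hull K ∩ hull L = convexHull ℝ ((K : Set Plane) ∩ (L : Set Plane))) :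
    volume (hull K ∩ hull L) = 0 := by
  classical
  rw [hconf, ← Finset.coe_inter]
  have hcard : (K ∩ L).card ≤ 2 := by
    by_contra hcon
    push Not at hcon
    have h1 : K ∩ L = K := Finset.eq_of_subset_of_card_le Finset.inter_subset_left (by omega)
    have h2 : K ∩ L = L := Finset.eq_of_subset_of_card_le Finset.inter_subset_right (by omega)
    exact hKL (h1.symm.trans h2)
  have hrank : Module.finrank ℝ (vectorSpan ℝ ((K ∩ L : Finset Plane) : Set Plane)) ≤ 1 := by
    rcases Nat.eq_zero_or_pos (K ∩ L).card with h0 | h0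
    · rw [Finset.card_eq_zero.1 h0, Finset.coe_empty, vectorSpan_empty, finrank_bot]
      exact zero_le_one
    · obtain ⟨n, hn⟩ : ∃ n, (K ∩ L).card = n + 1 := ⟨(K ∩ L).card - 1, by omega⟩
      have := finrank_vectorSpan_image_finset_le ℝ (id : Plane → Plane) (K ∩ L) hn
      rw [Finset.coe_image, Set.image_id] at this
      omega
  refine measure_mono_null (convexHull_subset_affineSpan _) (Measure.addHaar_affineSubspace _ _ ?_)
  intro htop
  rw [← direction_affineSpan, htop, AffineSubspace.direction_top, finrank_top] at hrank
  simp at hrank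

theorem volume_real_closedBall (x : Plane) {r : ℝ} (hr : 0 ≤ r) :
    volume.real (Metric.closedBall x r) = Real.pi * r ^ 2 := by
  rw [Measure.real, EuclideanSpace.volume_closedBall_fin_two]
  simp [hr, ENNReal.toReal_mul, Real.pi_pos.le]
  ring

theorem volume_hull_lt_top (K : Finset Plane) : volume (hull K) < ⊤ := (isCompact_hull K).measure_lt_top

theorem volume_hull_ge {K : Finset Plane} {x : Plane} {r : ℝ} (hr : 0 ≤ r)
    (hball : Metric.closedBall x r ⊆ hull K) : Real.pi * r ^ 2 ≤ volume.real (hull K) := by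
  rw [← volume_real_closedBall x hr]
  exact measureReal_mono hball (volume_hull_lt_top K).ne

theorem volume_hull_le {K : Finset Plane} {x : Plane} (hx : x ∈ hull K) :
    volume.real (hull K) ≤ Real.pi * hK K ^ 2 := by
  rw [← volume_real_closedBall x (r := hK K) Metric.diam_nonneg]
  refine measureReal_mono (fun y hy => ?_) measure_closedBall_lt_top.ne
  exact dist_le_hK hy hx

theorem radius_le_hK {K : Finset Plane} {x : Plane} {r : ℝ} (hr : 0 ≤ r)
    (hball : Metric.closedBall x r ⊆ hull K) : r ≤ hK K := by
  have h1 : x + r • (EuclideanSpace.single 0 1 : Plane) ∈ hull K := hball (by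
    simp [norm_smul, abs_of_nonneg hr])
  have h2 := dist_le_hK h1 (hball (Metric.mem_closedBall_self hr))
  simpa [norm_smul, abs_of_nonneg hr] using h2

theorem hausdorff_edge {K E : Finset Plane} (hE : E ∈ edges K) :
    (Measure.hausdorffMeasure 1 : Measure Plane).real (hull E) ≤ hK K ∧
      (Measure.hausdorffMeasure 1 : Measure Plane) (hull E) < ⊤ := by
  classical
  obtain ⟨hsub, hcard⟩ := Finset.mem_powersetCard.1 hE
  obtain ⟨x, y, hxy, rfl⟩ := Finset.card_eq_two.1 hcard
  rw [Measure.real, hull, Finset.coe_pair, convexHull_pair, hausdorffMeasure_segment, edist_dist]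
  refine ⟨?_, ENNReal.ofReal_lt_top⟩
  rw [ENNReal.toReal_ofReal dist_nonneg]
  exact dist_le_hK (subset_hull K (hsub (by simp))) (subset_hull K (hsub (by simp)))

/-! ### Triangulations: overlap, integrals over the domain, packing -/

section
variable {Ω : Set Plane}

theorem IsConvexPolygon.isOpen (h : IsConvexPolygon Ω) : IsOpen Ω := by
  obtain ⟨-, S, rfl⟩ := h
  exact isOpen_interior

theorem IsConvexPolygon.convex (h : IsConvexPolygon Ω) : Convex ℝ Ω := by
  obtain ⟨-, S, rfl⟩ := h
  exact (convex_convexHull ℝ _).interior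

theorem IsConvexPolygon.isBounded (h : IsConvexPolygon Ω) : Bornology.IsBounded Ω := by
  obtain ⟨-, S, rfl⟩ := h
  exact (isCompact_hull S).isBounded.subset interior_subset

theorem IsConvexPolygon.closure_ae_eq (h : IsConvexPolygon Ω) :
    closure Ω =ᵐ[volume] Ω := by
  refine (ae_eq_set.2 ⟨?_, ?_⟩)
  · have : closure Ω \ Ω = frontier Ω := by rw [h.isOpen.frontier_eq]
    rw [this]
    exact h.convex.addHaar_frontier volume
  · rw [Set.sdiff_eq_empty.2 subset_closure, measure_empty]

namespace Triangulation

variable (T : Triangulation Ω)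

theorem isTriangle {K : Finset Plane} (hK : K ∈ T.cells) : IsTriangle K :=
  ⟨T.card_eq K hK, T.nondegenerate K hK⟩

theorem hull_subset {K : Finset Plane} (hK : K ∈ T.cells) : hull K ⊆ closure Ω := by
  rw [← T.cover]
  exact Set.subset_biUnion_of_mem (u := fun K => hull K) hK

theorem exists_mem_hull {x : Plane} (hx : x ∈ closure Ω) : ∃ K ∈ T.cells, x ∈ hull K := by
  rw [← T.cover] at hx
  simpa using hx

theorem volume_inter {K L : Finset Plane} (hK : K ∈ T.cells) (hL : L ∈ T.cells) (hKL : K ≠ L) :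
    volume (hull K ∩ hull L) = 0 :=
  volume_hull_inter (T.card_eq K hK) (T.card_eq L hL) hKL (T.conforming K hK L hL)

theorem cellSum_eq_integral (hΩ : IsConvexPolygon Ω) {f : Plane → ℝ} (hf : IntegrableOn f Ω) :
    T.cellSum (fun _ => f) = ∫ x in Ω, f x := by
  have h1 : ∫ x in Ω, f x = ∫ x in closure Ω, f x :=
    (setIntegral_congr_set hΩ.closure_ae_eq).symm
  have hf' : IntegrableOn f (closure Ω) := hf.congr_set_ae hΩ.closure_ae_eq
  have h2 : (⋃ K : T.cells, hull (K : Finset Plane)) = closure Ω := by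
    rw [← T.cover]; simp [Set.iUnion_subtype]
  rw [h1, ← h2, integral_iUnion_ae (fun K => (measurableSet_hull _).nullMeasurableSet)
    (fun K L hKL => T.volume_inter K.2 L.2 (fun h => hKL (Subtype.ext h)))
    (by rw [h2]; exact hf'), tsum_fintype]
  rw [cellSum, Finset.sum_coe_sort T.cells (fun K => ∫ x in hull K, f x)]

/-- Pairwise nonoverlapping parts of triangles have total area at most that of a set that contains
them. -/
theorem sum_volume_le {C : Finset (Finset Plane)} (hC : C ⊆ T.cells) {A : Finset Plane → Set Plane}
    (hAm : ∀ K ∈ C, MeasurableSet (A K)) (hA : ∀ K ∈ C, A K ⊆ hull K) {B : Set Plane}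
    (hB : volume B ≠ ⊤) (hAB : ∀ K ∈ C, A K ⊆ B) :
    ∑ K ∈ C, volume.real (A K) ≤ volume.real B := by
  have h1 : volume (⋃ K ∈ C, A K) = ∑ K ∈ C, volume (A K) := by
    refine measure_biUnion_finset₀ (fun K hK L hL hKL => ?_) (fun K hK => (hAm K hK).nullMeasurableSet)
    exact measure_mono_null (Set.inter_subset_inter (hA K hK) (hA L hL))
      (T.volume_inter (hC hK) (hC hL) hKL)
  have h2 : ∑ K ∈ C, volume.real (A K) = volume.real (⋃ K ∈ C, A K) := by
    rw [Measure.real, h1, ENNReal.toReal_sum]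
    · rfl
    · intro K hK
      exact (lt_of_le_of_lt (measure_mono (hAB K hK)) hB.lt_top).ne
  rw [h2]
  exact measureReal_mono (Set.iUnion₂_subset hAB) hB

/-- `x K`, `r K` are the centre and the radius of a disc contained in the triangle `K`, whose
diameter is at most `s * r K`. -/
structure HasDiscs (s : ℝ) (x : Finset Plane → Plane) (r : Finset Plane → ℝ) : Prop where
  one_le : 1 ≤ s
  pos : ∀ K ∈ T.cells, 0 < r K
  ball : ∀ K ∈ T.cells, Metric.closedBall (x K) (r K) ⊆ hull K
  le : ∀ K ∈ T.cells, hK K ≤ s * r K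

theorem ShapeRegular.exists_hasDiscs {T : Triangulation Ω} {σ : ℝ} (h : T.ShapeRegular σ) :
    ∃ x r, T.HasDiscs (max (2 * σ) 1) x r := by
  choose! x r h1 h2 h3 using h
  refine ⟨x, r, le_max_right _ _, h1, h2, fun K hK => (h3 K hK).trans ?_⟩
  have := mul_le_mul_of_nonneg_right (le_max_left (2 * σ) 1) (h1 K hK).le
  linarith

variable {T} {s : ℝ} {x : Finset Plane → Plane} {r : Finset Plane → ℝ}

namespace HasDiscs

theorem hK_pos (D : T.HasDiscs s x r) {K : Finset Plane} (hK : K ∈ T.cells) : 0 < KGHDG.hK K :=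
  (D.pos K hK).trans_le (radius_le_hK (D.pos K hK).le (D.ball K hK))

theorem center_mem (D : T.HasDiscs s x r) {K : Finset Plane} (hK : K ∈ T.cells) : x K ∈ hull K :=
  D.ball K hK (Metric.mem_closedBall_self (D.pos K hK).le)

/-- Any other triangle keeps away from the disc inscribed in `K`. -/
theorem radius_le_dist (D : T.HasDiscs s x r) {K L : Finset Plane} (hK : K ∈ T.cells)
    (hL : L ∈ T.cells) (hKL : L ≠ K) {y : Plane} (hy : y ∈ hull L) : r K ≤ dist y (x K) := by
  by_contra hcon
  push Not at hcon
  -- near `y` the triangle `L` has interior points, and they belong to the disc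
  have hLint : (interior (hull L)).Nonempty :=
    ⟨x L, interior_mono (D.ball L hL) (by
      rw [interior_closedBall _ (D.pos L hL).ne']; exact Metric.mem_ball_self (D.pos L hL))⟩
  have hycl : y ∈ closure (interior (hull L)) := by
    rw [(convex_hull L).closure_interior_eq_closure_of_nonempty_interior hLint]
    exact subset_closure hy
  obtain ⟨z, hz1, hz2⟩ := mem_closure_iff.1 hycl (Metric.ball (x K) (r K)) Metric.isOpen_ball hcon
  have hpos : 0 < volume (Metric.ball (x K) (r K) ∩ interior (hull L)) :=
    (Metric.isOpen_ball.inter isOpen_interior).measure_pos _ ⟨z, hz1, hz2⟩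
  refine hpos.ne' (measure_mono_null ?_ (T.volume_inter hK hL hKL.symm))
  exact Set.inter_subset_inter (Metric.ball_subset_closedBall.trans (D.ball K hK)) interior_subset

theorem hK_le_of_common_edge (D : T.HasDiscs s x r) {K L : Finset Plane} (hK : K ∈ T.cells)
    {v w : Plane} (hvw : v ≠ w) (hvK : v ∈ K) (hwK : w ∈ K) (hvL : v ∈ L)
    (hwL : w ∈ L) : KGHDG.hK K ≤ s * KGHDG.hK L := by
  have h1 := two_mul_radius_le_dist (T.isTriangle hK) hvK hwK hvw (D.pos K hK).le (D.ball K hK)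
  have h2 := dist_le_hK (subset_hull L hvL) (subset_hull L hwL)
  have h3 := D.le K hK
  have h4 := D.pos K hK
  have h5 := D.one_le
  nlinarith

end HasDiscs

/-! ### Edges shared by two triangles -/

theorem mem_vertices_of_mem_convexHull {K : Finset Plane} (hK : IsTriangle K) {S : Set Plane}
    (hS : S ⊆ K) {v : Plane} (hv : v ∈ K) (hvS : v ∈ convexHull ℝ S) : v ∈ S := by
  classical
  by_contra hcon
  have hE : K.erase v ∈ edges K :=
    Finset.mem_powersetCard.2 ⟨Finset.erase_subset _ _, by rw [Finset.card_erase_of_mem hv, hK.1]⟩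
  have hvE : v ∈ hull (K.erase v) := convexHull_mono (fun z hz => by
    simp only [Finset.coe_erase, Set.mem_sdiff, Set.mem_singleton_iff]
    exact ⟨hS hz, fun h => hcon (h ▸ hz)⟩) hvS
  obtain ⟨a, b, c, hab, hac, hbc, hKe, hEe, hdet⟩ := exists_vertices_of_edge hK hE
  have hva : v = a := by
    have h1 : v ∈ ({a, b, c} : Finset Plane) := hKe ▸ hv
    have h2 : v ∉ ({b, c} : Finset Plane) := hEe ▸ Finset.notMem_erase v K
    simp only [Finset.mem_insert, Finset.mem_singleton] at h1 h2
    tauto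
  have h1 := normal_inner_edge hK hE hvE (subset_hull _ (show b ∈ _ by rw [hEe]; simp))
  have h2 := normal_inner_pos hab hac hbc hdet
  rw [hEe, hva] at h1
  rw [← hKe] at h2
  exact h2.ne' h1

/-- A subset of the vertices whose hull meets the interior of the edge `{b, c}` contains `b`. -/
theorem left_mem_of_openSegment {K : Finset Plane} (hK : IsTriangle K) {S : Set Plane}
    (hS : S ⊆ K) {b c m : Plane} (hb : b ∈ K) (hc : c ∈ K) (hbc : b ≠ c)
    (hm : m ∈ openSegment ℝ b c) (hmS : m ∈ convexHull ℝ S) : b ∈ S := by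
  classical
  by_contra hcon
  have hE : ({b, c} : Finset Plane) ∈ edges K :=
    Finset.mem_powersetCard.2 ⟨by intro z; simp; rintro (rfl | rfl) <;> assumption,
      Finset.card_pair hbc⟩
  obtain ⟨a, b', c', hab, hac, hbc', hKe, hEe, hdet⟩ := exists_vertices_of_edge hK hE
  have hac' : a ∉ ({b, c} : Finset Plane) := by rw [hEe]; simp [hab, hac]
  have hKa : K = {a, b, c} := by rw [hKe, ← hEe]
  have hac : a ≠ c := fun h => hac' (by simp [h])
  have hab : a ≠ b := fun h => hac' (by simp [h])
  have hF : ({a, c} : Finset Plane) ∈ edges K :=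
    Finset.mem_powersetCard.2 ⟨by rw [hKa]; intro z; simp; tauto, Finset.card_pair hac⟩
  have hSF : S ⊆ (({a, c} : Finset Plane) : Set Plane) := by
    intro z hz
    have h1 : z ∈ K := hS hz
    have h2 : z ≠ b := fun h => hcon (h ▸ hz)
    rw [hKa] at h1
    simp at h1 ⊢
    tauto
  have hmF : m ∈ hull {a, c} := convexHull_mono hSF hmS
  have hcF : c ∈ hull {a, c} := subset_hull _ (by simp)
  have h0 := normal_inner_edge hK hF hcF hmF
  obtain ⟨s, t, hs, ht, hst, rfl⟩ := hm
  have e : s • b + t • c - c = s • (b - c) := by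
    have : t = 1 - s := by linarith
    rw [this]; module
  rw [e, inner_smul_right] at h0
  have hKb : K = {b, a, c} := by rw [hKa, Finset.insert_comm]
  have hd : det3 b a c ≠ 0 := by
    obtain ⟨a1, b1, c1, h1, h2, h3, h4, h5, h6⟩ := exists_vertices_of_edge hK hF
    have hb1 : b = a1 := by
      have : b ∈ ({a1, b1, c1} : Finset Plane) := h4 ▸ hb
      rw [← h5] at this
      simpa [hab.symm, hbc] using this
    subst hb1
    rw [← Finset.coe_inj, Finset.coe_pair, Finset.coe_pair] at h5
    rcases Set.pair_eq_pair_iff.1 h5 with ⟨rfl, rfl⟩ | ⟨rfl, rfl⟩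
    · exact h6
    · rw [det3_swap]; simpa using h6
  have h7 := normal_inner_pos hab.symm hbc hac hd
  rw [← hKb] at h7
  have h8 : inner ℝ (normal K {a, c}) (b - c) = - inner ℝ (normal K {a, c}) (a - b) := by
    have h9 := normal_inner_edge hK hF hcF (subset_hull {a, c} (show a ∈ _ by simp))
    have : b - c = (a - c) - (a - b) := by abel
    rw [this, inner_sub_right, h9, zero_sub]
  rw [h8] at h0
  nlinarith

variable (T) in
/-- An edge that is not on the boundary belongs to a second triangle. -/
theorem exists_neighbor (hΩ : IsConvexPolygon Ω) {K E : Finset Plane} (hK : K ∈ T.cells)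
    (hE : E ∈ edges K) (hb : ¬ IsBdryEdge Ω E) : ∃ L ∈ T.cells, L ≠ K ∧ E ∈ edges L := by
  classical
  by_contra hcon
  push Not at hcon
  refine hb ?_
  obtain ⟨hsub, hcard⟩ := Finset.mem_powersetCard.1 hE
  obtain ⟨b, c, hbc, rfl⟩ := Finset.card_eq_two.1 hcard
  have hbK : b ∈ K := hsub (by simp)
  have hcK : c ∈ K := hsub (by simp)
  have hKT := T.isTriangle hK
  have hopen : openSegment ℝ b c ⊆ frontier Ω := by
    intro m hm
    have hmE : m ∈ hull {b, c} := by
      rw [hull, Finset.coe_pair, convexHull_pair]; exact openSegment_subset_segment _ _ _ hm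
    have hmK : m ∈ hull K := hull_edge_subset hE hmE
    rw [hΩ.isOpen.frontier_eq]
    refine ⟨T.hull_subset hK hmK, fun hmΩ => ?_⟩
    -- no other triangle contains `m`
    have hother : ∀ L ∈ T.cells, L ≠ K → m ∉ hull L := by
      intro L hL hLK hmL
      have hmem : m ∈ convexHull ℝ ((K : Set Plane) ∩ (L : Set Plane)) := by
        rw [← T.conforming K hK L hL]; exact ⟨hmK, hmL⟩
      have hb' := left_mem_of_openSegment hKT Set.inter_subset_left hbK hcK hbc hm hmem
      have hc' := left_mem_of_openSegment hKT Set.inter_subset_left hcK hbK hbc.symm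
        (by rwa [openSegment_symm]) hmem
      refine hcon L hL hLK (Finset.mem_powersetCard.2 ⟨?_, hcard⟩)
      intro z hz
      simp only [Finset.mem_insert, Finset.mem_singleton] at hz
      rcases hz with rfl | rfl
      · exact hb'.2
      · exact hc'.2
    have h1 : ∀ᶠ z in 𝓝 m, ∀ L ∈ T.cells, L ≠ K → z ∉ hull L := by
      rw [Filter.eventually_all_finset]
      intro L hL
      by_cases hLK : L = K
      · simp [hLK]
      · filter_upwards [(isCompact_hull L).isClosed.isOpen_compl.mem_nhds (hother L hL hLK)]
          with z hz _
        exact hz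
    have h2 : ∀ᶠ z in 𝓝 m, z ∈ Ω := hΩ.isOpen.mem_nhds hmΩ
    have h3 : Tendsto (fun ε : ℝ => m + ε • normal K {b, c}) (𝓝[>] 0) (𝓝 m) := by
      have : Continuous fun ε : ℝ => m + ε • normal K {b, c} := by fun_prop
      simpa using (this.tendsto 0).mono_left nhdsWithin_le_nhds
    obtain ⟨ε, ⟨hε1, hε2⟩, hε⟩ := ((h3.eventually (h1.and h2)).and self_mem_nhdsWithin).exists
    obtain ⟨L, hL, hLm⟩ := T.exists_mem_hull (subset_closure hε2)
    by_cases hLK : L = K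
    · subst hLK
      have := normal_inner_le hKT hE hmE hLm
      rw [add_sub_cancel_left, inner_smul_right, real_inner_self_eq_norm_sq, norm_normal hKT hE]
        at this
      have hε' : (0 : ℝ) < ε := hε
      linarith
    · exact hε1 L hL hLK hLm
  rw [IsBdryEdge, hull, Finset.coe_pair, convexHull_pair, ← closure_openSegment]
  exact isClosed_frontier.closure_subset_iff.2 hopen

/-- Two triangles that share an edge lie on different sides of it. -/
theorem normal_eq_neg {K L E : Finset Plane} (hK : K ∈ T.cells) (hL : L ∈ T.cells) (hKL : L ≠ K)
    (hEK : E ∈ edges K) (hEL : E ∈ edges L) : normal L E = -normal K E := by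
  classical
  obtain ⟨-, hcard⟩ := Finset.mem_powersetCard.1 hEK
  obtain ⟨b, c, hbc, rfl⟩ := Finset.card_eq_two.1 hcard
  have hKT := T.isTriangle hK
  have hLT := T.isTriangle hL
  have hbE : b ∈ hull {b, c} := subset_hull _ (by simp)
  have hcE : c ∈ hull {b, c} := subset_hull _ (by simp)
  have o1 := normal_inner_edge hKT hEK hbE hcE
  have o2 := normal_inner_edge hLT hEL hbE hcE
  have u1 := norm_normal hKT hEK
  have u2 := norm_normal hLT hEL
  have hne : normal L {b, c} ≠ normal K {b, c} := by
    intro heq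
    set m : Plane := midpoint ℝ b c with hm
    have hmo : m ∈ openSegment ℝ b c := midpoint_mem_openSegment (𝕜 := ℝ) b c
    have h1 := eventually_mem_hull hKT hEK (Finset.coe_pair) hmo
    have h2 := eventually_mem_hull hLT hEL (Finset.coe_pair) hmo
    have h3 : Tendsto (fun ε : ℝ => m - ε • normal K {b, c}) (𝓝[>] 0) (𝓝 m) := by
      have : Continuous fun ε : ℝ => m - ε • normal K {b, c} := by fun_prop
      simpa using (this.tendsto 0).mono_left nhdsWithin_le_nhds
    obtain ⟨ε, ⟨hε1, hε2⟩, hε⟩ := ((h3.eventually (h1.and h2)).and self_mem_nhdsWithin).exists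
    have hε' : (0 : ℝ) < ε := hε
    have e : inner ℝ (normal K {b, c}) (m - ε • normal K {b, c} - m) = -ε := by
      rw [sub_sub_cancel_left, inner_neg_right, inner_smul_right, real_inner_self_eq_norm_sq, u1]
      ring
    rw [heq] at hε2
    rw [e] at hε1 hε2
    have hmem : m - ε • normal K {b, c} ∈ convexHull ℝ ((K : Set Plane) ∩ (L : Set Plane)) := by
      rw [← T.conforming K hK L hL]
      exact ⟨hε1 (by linarith), hε2 (by linarith)⟩
    have hKLE : K ∩ L = {b, c} := by
      refine (Finset.eq_of_subset_of_card_le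
        (Finset.subset_inter (edge_subset hEK) (edge_subset hEL)) ?_).symm
      rw [hcard]
      by_contra hcon
      push Not at hcon
      have c1 : K ∩ L = K := Finset.eq_of_subset_of_card_le Finset.inter_subset_left (by
        rw [hKT.1]; omega)
      have c2 : K ∩ L = L := Finset.eq_of_subset_of_card_le Finset.inter_subset_right (by
        rw [hLT.1]; omega)
      exact hKL (c2.symm.trans c1)
    rw [← Finset.coe_inter, hKLE] at hmem
    have hmE : m ∈ hull {b, c} := by
      rw [hull, Finset.coe_pair, convexHull_pair]; exact openSegment_subset_segment _ _ _ hmo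
    have := normal_inner_edge hKT hEK hmE hmem
    rw [e] at this
    linarith
  -- in the plane, two distinct unit vectors orthogonal to `c - b ≠ 0` are opposite
  have hd : 0 < ‖c - b‖ ^ 2 := by
    have := norm_pos_iff.2 (sub_ne_zero.2 hbc.symm)
    positivity
  have q1 : ‖normal K {b, c}‖ ^ 2 = 1 := by rw [u1]; norm_num
  have q2 : ‖normal L {b, c}‖ ^ 2 = 1 := by rw [u2]; norm_num
  rw [inner_plane] at o1 o2
  rw [norm_sq_plane] at hd q1 q2
  set p := normal K {b, c}
  set q := normal L {b, c}
  set d := c - b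
  have hcross : p 0 * q 1 - p 1 * q 0 = 0 := by
    have : (d 0 ^ 2 + d 1 ^ 2) * (p 0 * q 1 - p 1 * q 0) = 0 := by
      linear_combination (q 1 * d 0 - q 0 * d 1) * o1 + (p 0 * d 1 - p 1 * d 0) * o2
    exact (mul_eq_zero.1 this).resolve_left hd.ne'
  have hdot : (p 0 * q 0 + p 1 * q 1) ^ 2 = 1 := by
    linear_combination (q 0 ^ 2 + q 1 ^ 2) * q1 + q2 - (p 0 * q 1 - p 1 * q 0) * hcross
  have hzero : ∀ u v : ℝ, u ^ 2 + v ^ 2 = 0 → u = 0 ∧ v = 0 := fun u v h =>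
    ⟨by nlinarith [sq_nonneg u, sq_nonneg v], by nlinarith [sq_nonneg u, sq_nonneg v]⟩
  rcases sq_eq_sq_iff_eq_or_eq_neg.1 (hdot.trans (one_pow 2).symm) with h | h
  · refine absurd ?_ hne
    obtain ⟨h0, h1⟩ := hzero (q 0 - p 0) (q 1 - p 1) (by linear_combination q1 + q2 - 2 * h)
    ext i
    fin_cases i
    · exact sub_eq_zero.1 h0
    · exact sub_eq_zero.1 h1
  · obtain ⟨h0, h1⟩ := hzero (q 0 + p 0) (q 1 + p 1) (by linear_combination q1 + q2 + 2 * h)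
    ext i
    fin_cases i
    · exact eq_neg_of_add_eq_zero_left h0
    · exact eq_neg_of_add_eq_zero_left h1

open scoped Classical in
/-- The outward normals of the triangles that share an interior edge cancel. -/
theorem sum_normal_eq_zero (hΩ : IsConvexPolygon Ω) {E : Finset Plane} (hE : E ∈ T.allEdges)
    (hb : ¬ IsBdryEdge Ω E) : ∑ K ∈ T.cells with E ∈ edges K, normal K E = 0 := by
  obtain ⟨K, hK, hEK⟩ := Finset.mem_biUnion.1 hE
  obtain ⟨L, hL, hLK, hEL⟩ := T.exists_neighbor hΩ hK hEK hb
  have hKL := normal_eq_neg hK hL hLK hEK hEL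
  have hfil : T.cells.filter (fun M => E ∈ edges M) = {K, L} := by
    ext M
    simp only [Finset.mem_filter, Finset.mem_insert, Finset.mem_singleton]
    refine ⟨fun ⟨hM, hEM⟩ => ?_, ?_⟩
    · by_contra hcon
      push Not at hcon
      have h1 := normal_eq_neg hK hM hcon.1 hEK hEM
      have h2 := normal_eq_neg hL hM hcon.2 hEL hEM
      rw [hKL, neg_neg] at h2
      have h3 : normal K E = 0 := by
        have h5 : normal K E + normal K E = 0 := by
          nth_rewrite 1 [h2.symm.trans h1]
          exact neg_add_cancel _
        rw [← two_smul ℝ] at h5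
        exact (smul_eq_zero.1 h5).resolve_left two_ne_zero
      have h4 := norm_normal (T.isTriangle hK) hEK
      rw [h3, norm_zero] at h4
      exact zero_ne_one h4
    · rintro (rfl | rfl)
      · exact ⟨hK, hEK⟩
      · exact ⟨hL, hEL⟩
  rw [hfil, Finset.sum_pair hLK.symm, hKL, add_neg_cancel]

end Triangulation
end

/-! ### Local quasi-uniformity -/

/-- A function on `[0, 1]` that agrees on each of finitely many closed sets with a `G`-Lipschitz
function increases by at most `G`. -/
theorem le_add_of_finite_closed_cover {ι : Type*} (I : Finset ι) {A : ι → Set ℝ}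
    (hA : ∀ i ∈ I, IsClosed (A i)) (hcov : ∀ t ∈ Set.Icc (0 : ℝ) 1, ∃ i ∈ I, t ∈ A i) {G : ℝ}
    {f : ι → ℝ → ℝ} (hf : ∀ i ∈ I, ∀ a b, |f i a - f i b| ≤ G * |a - b|) {g : ℝ → ℝ}
    (hg : ∀ i ∈ I, ∀ t ∈ A i, g t = f i t) : g 1 ≤ g 0 + G := by
  have hloc : ∀ t ∈ Set.Icc (0 : ℝ) 1, ∀ᶠ a in 𝓝[Set.Icc 0 1] t, |g a - g t| ≤ G * |a - t| := by
    intro t ht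
    have h1 : ∀ᶠ a in 𝓝 t, ∀ i ∈ I, t ∉ A i → a ∉ A i := by
      rw [Filter.eventually_all_finset]
      intro i hi
      by_cases hti : t ∈ A i
      · simp [hti]
      · filter_upwards [(hA i hi).isOpen_compl.mem_nhds hti] with a ha _
        exact ha
    filter_upwards [nhdsWithin_le_nhds h1, self_mem_nhdsWithin] with a ha haI
    obtain ⟨i, hi, hai⟩ := hcov a haI
    have hti : t ∈ A i := by
      by_contra hcon
      exact ha i hi hcon hai
    rw [hg i hi a hai, hg i hi t hti]
    exact hf i hi a t
  have hcont : ContinuousOn g (Set.Icc 0 1) := by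
    intro t ht
    rw [ContinuousWithinAt, tendsto_iff_dist_tendsto_zero]
    refine squeeze_zero' (Eventually.of_forall fun _ => dist_nonneg) (hloc t ht)
      (g := fun a => G * |a - t|) ?_
    have : Continuous fun a : ℝ => G * |a - t| := by fun_prop
    simpa using (this.tendsto t).mono_left (nhdsWithin_le_nhds (s := Set.Icc 0 1))
  have key := image_le_of_liminf_slope_right_le_deriv_boundary (a := 0) (b := 1) hcont
    (B := fun t => g 0 + G * t) (B' := fun _ => G) (by simp) (by fun_prop)
    (fun t _ => by simpa using (((hasDerivAt_id t).const_mul G).const_add (g 0)).hasDerivWithinAt)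
    (by
      intro t ht q hq
      have h1 := hloc t ⟨ht.1, ht.2.le⟩
      have h2 : ∀ᶠ a in 𝓝[>] t, |g a - g t| ≤ G * |a - t| := by
        have hle : 𝓝[>] t ≤ 𝓝[Set.Icc 0 1] t := by
          rw [← nhdsWithin_Ioo_eq_nhdsGT ht.2]
          exact nhdsWithin_mono _ fun z hz => ⟨ht.1.trans hz.1.le, hz.2.le⟩
        exact hle h1
      refine Eventually.frequently ?_
      filter_upwards [h2, self_mem_nhdsWithin] with a ha hta
      have hpos : 0 < a - t := sub_pos.2 hta
      rw [slope_def_field, div_lt_iff₀ hpos]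
      rw [abs_of_pos hpos] at ha
      have := (le_abs_self _).trans ha
      nlinarith)
  have := key (Set.right_mem_Icc.2 zero_le_one)
  simpa using this

/-- Every function on the vertices of a triangle has an affine interpolant. -/
theorem exists_affine_interpolant {K : Finset Plane} (hK : IsTriangle K) (H : Plane → ℝ) :
    ∃ (α : ℝ) (g : Plane), ∀ v ∈ K, α + inner ℝ g v = H v := by
  classical
  obtain ⟨a, b, c, hab, hac, hbc, rfl, hdet⟩ := exists_vertices hK.1 hK.2
  set g : Plane := !₂[((H b - H a) * (c 1 - a 1) - (H c - H a) * (b 1 - a 1)) / det3 a b c,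
    ((H c - H a) * (b 0 - a 0) - (H b - H a) * (c 0 - a 0)) / det3 a b c] with hg
  refine ⟨H a - inner ℝ g a, g, fun v hv => ?_⟩
  have g0 : g 0 = ((H b - H a) * (c 1 - a 1) - (H c - H a) * (b 1 - a 1)) / det3 a b c := rfl
  have g1 : g 1 = ((H c - H a) * (b 0 - a 0) - (H b - H a) * (c 0 - a 0)) / det3 a b c := rfl
  simp only [Finset.mem_insert, Finset.mem_singleton] at hv
  rcases hv with rfl | rfl | rfl
  · ring
  · rw [inner_plane, inner_plane, g0, g1]
    field_simp
    unfold det3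
    ring
  · rw [inner_plane, inner_plane, g0, g1]
    field_simp
    unfold det3
    ring

theorem convex_setOf_affine_le (α β : ℝ) (g : Plane) :
    Convex ℝ {z : Plane | α + inner ℝ g z ≤ β} := by
  intro z hz w hw p q hp hq hpq
  have hz' : α + inner ℝ g z ≤ β := hz
  have hw' : α + inner ℝ g w ≤ β := hw
  change α + inner ℝ g (p • z + q • w) ≤ β
  rw [inner_add_right, inner_smul_right, inner_smul_right]
  have hp' : p = 1 - q := by linarith
  subst hp'
  nlinarith

theorem convex_setOf_le_affine (α β : ℝ) (g : Plane) :
    Convex ℝ {z : Plane | β ≤ α + inner ℝ g z} := by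
  have := convex_setOf_affine_le (-α) (-β) (-g)
  convert this using 2
  ext z
  rw [inner_neg_left]
  constructor <;> intro h <;> linarith

/-- The gradient of an affine function that takes values in `[0, M]` on a disc. -/
theorem norm_le_of_affine_mem_Icc {α : ℝ} {g x : Plane} {r M : ℝ} (hr : 0 < r)
    (h : ∀ z ∈ Metric.closedBall x r, 0 ≤ α + inner ℝ g z ∧ α + inner ℝ g z ≤ M) :
    2 * r * ‖g‖ ≤ M := by
  by_cases hg : g = 0
  · have := h x (Metric.mem_closedBall_self hr.le)
    rw [hg, norm_zero]
    linarith
  have hgn : 0 < ‖g‖ := norm_pos_iff.2 hg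
  have hu : ‖(r / ‖g‖) • g‖ ≤ r := by
    rw [norm_smul, Real.norm_of_nonneg (by positivity)]
    exact le_of_eq (by field_simp)
  have h1 := (h (x + (r / ‖g‖) • g) (by simpa using hu)).2
  have h2 := (h (x - (r / ‖g‖) • g) (by simpa using hu)).1
  rw [inner_add_right, inner_smul_right, real_inner_self_eq_norm_sq] at h1
  rw [inner_sub_right, inner_smul_right, real_inner_self_eq_norm_sq] at h2
  have e : r / ‖g‖ * ‖g‖ ^ 2 = r * ‖g‖ := by field_simp
  rw [e] at h1 h2
  linarith

namespace Triangulation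

variable {Ω : Set Plane} {T : Triangulation Ω} {s : ℝ} {x : Finset Plane → Plane}
  {r : Finset Plane → ℝ}

/-- There are no hanging nodes. -/
theorem mem_cell_of_vertex_mem_hull {K L : Finset Plane} (hK : K ∈ T.cells) (hL : L ∈ T.cells)
    {v : Plane} (hv : v ∈ K) (hvL : v ∈ hull L) : v ∈ L := by
  have h : v ∈ convexHull ℝ ((K : Set Plane) ∩ (L : Set Plane)) := by
    rw [← T.conforming K hK L hL]; exact ⟨subset_hull K hv, hvL⟩
  exact (mem_vertices_of_mem_convexHull (T.isTriangle hK) Set.inter_subset_left hv h).2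

/-- A proper part of the triangles around a vertex has a common edge with the rest: otherwise the
two parts would disconnect the punctured neighbourhood of the vertex in the convex domain. -/
theorem exists_common_edge (hΩ : IsConvexPolygon Ω) {v : Plane} {A B : Finset (Finset Plane)}
    (hA : A.Nonempty) (hB : B.Nonempty)
    (hABv : ∀ K, K ∈ A ∨ K ∈ B ↔ K ∈ T.cells ∧ v ∈ K) :
    ∃ K ∈ A, ∃ L ∈ B, ∃ w, v ≠ w ∧ w ∈ K ∧ w ∈ L := by
  classical
  by_contra hcon
  push Not at hcon
  have hAc : ∀ K ∈ A, K ∈ T.cells ∧ v ∈ K := fun K hK => (hABv K).1 (Or.inl hK)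
  have hBc : ∀ K ∈ B, K ∈ T.cells ∧ v ∈ K := fun K hK => (hABv K).1 (Or.inr hK)
  have hmeet : ∀ K ∈ A, ∀ L ∈ B, ∀ z, z ∈ hull K → z ∈ hull L → z = v := by
    intro K hK L hL z hzK hzL
    have h1 : z ∈ convexHull ℝ ((K : Set Plane) ∩ (L : Set Plane)) := by
      rw [← T.conforming K (hAc K hK).1 L (hBc L hL).1]; exact ⟨hzK, hzL⟩
    have h2 : (K : Set Plane) ∩ (L : Set Plane) ⊆ {v} := by
      rintro w ⟨hwK, hwL⟩
      by_contra hwv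
      exact hcon K hK L hL w (fun h => hwv h.symm) hwK hwL
    have h3 := convexHull_mono (𝕜 := ℝ) h2 h1
    simpa using h3
  obtain ⟨K, hKA⟩ := hA
  obtain ⟨L, hLB⟩ := hB
  obtain ⟨hK, hvK⟩ := hAc K hKA
  obtain ⟨hL, hvL⟩ := hBc L hLB
  obtain ⟨b, hbL, hbv⟩ : ∃ b ∈ L, b ≠ v :=
    Finset.exists_mem_ne (by rw [T.card_eq L hL]; norm_num) v
  -- a vertex of `K` whose segment to `b` avoids `v`
  obtain ⟨a, haK, hav, hseg⟩ : ∃ a ∈ K, a ≠ v ∧ v ∉ segment ℝ a b := by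
    have hKv : (K.erase v).card = 2 := by rw [Finset.card_erase_of_mem hvK, T.card_eq K hK]
    obtain ⟨a, c, hac, hKe⟩ := Finset.card_eq_two.1 hKv
    have haK : a ∈ K.erase v := by rw [hKe]; simp
    have hcK : c ∈ K.erase v := by rw [hKe]; simp
    rw [Finset.mem_erase] at haK hcK
    by_contra hno
    push Not at hno
    have ha := hno a haK.2 haK.1
    have hc := hno c hcK.2 hcK.1
    rw [segment_eq_image'] at ha hc
    obtain ⟨p, hp, hpe⟩ := ha
    obtain ⟨q, hq, hqe⟩ := hc
    have hE : K.erase v ∈ edges K :=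
      Finset.mem_powersetCard.2 ⟨Finset.erase_subset _ _, hKv⟩
    obtain ⟨v', a', c', h1, h2, h3, hKe', hEe', hdet⟩ := exists_vertices_of_edge (T.isTriangle hK) hE
    have hv' : v = v' := by
      have h4 : v ∈ ({v', a', c'} : Finset Plane) := hKe' ▸ hvK
      have h5 : v ∉ ({a', c'} : Finset Plane) := hEe' ▸ Finset.notMem_erase v K
      simp only [Finset.mem_insert, Finset.mem_singleton] at h4 h5
      tauto
    subst hv'
    have hdet' : det3 v a c ≠ 0 := by
      have h6 : ({a, c} : Set Plane) = {a', c'} := by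
        rw [← Finset.coe_pair, ← Finset.coe_pair, ← hKe, ← hEe']
      rcases Set.pair_eq_pair_iff.1 h6 with ⟨rfl, rfl⟩ | ⟨rfl, rfl⟩
      · exact hdet
      · rw [det3_swap]; simpa using hdet
    have hp0 : p ≠ 1 := by
      rintro rfl
      apply hbv
      rw [← hpe]; module
    have hq0 : q ≠ 1 := by
      rintro rfl
      apply hbv
      rw [← hqe]; module
    apply hdet'
    have e1 : ∀ i, (1 - p) * (a i - v i) = - p * (b i - v i) := fun i => by
      have := congrArg (fun z : Plane => z i) hpe
      simp only [PiLp.add_apply, PiLp.smul_apply, PiLp.sub_apply, smul_eq_mul] at this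
      linarith
    have e2 : ∀ i, (1 - q) * (c i - v i) = - q * (b i - v i) := fun i => by
      have := congrArg (fun z : Plane => z i) hqe
      simp only [PiLp.add_apply, PiLp.smul_apply, PiLp.sub_apply, smul_eq_mul] at this
      linarith
    have e3 : (1 - p) * (1 - q) * det3 v a c = 0 := by
      unfold det3
      linear_combination (1 - q) * (c 1 - v 1) * e1 0 - p * (b 0 - v 0) * e2 1
        - (1 - q) * (c 0 - v 0) * e1 1 + p * (b 1 - v 1) * e2 0
    rcases mul_eq_zero.1 e3 with h | h
    · rcases mul_eq_zero.1 h with h | h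
      · exact absurd (by linarith) hp0
      · exact absurd (by linarith) hq0
    · exact h
  -- near `v` only triangles with vertex `v` are met
  have hnear : ∀ᶠ z in 𝓝 v, ∀ M ∈ T.cells, v ∉ M → z ∉ hull M := by
    rw [Filter.eventually_all_finset]
    intro M hM
    by_cases hvM : v ∈ M
    · simp [hvM]
    · filter_upwards [(isCompact_hull M).isClosed.isOpen_compl.mem_nhds
        (fun h => hvM (mem_cell_of_vertex_mem_hull hK hM hvK h))] with z hz _
      exact hz
  obtain ⟨ε, hε, hball⟩ := Metric.eventually_nhds_iff_ball.1 hnear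
  obtain ⟨η, hη0, hη1, hηa, hηb⟩ : ∃ η : ℝ, 0 < η ∧ η ≤ 1 ∧ v + η • (a - v) ∈ Metric.ball v ε ∧
      v + η • (b - v) ∈ Metric.ball v ε := by
    have ht : ∀ y : Plane, Tendsto (fun η : ℝ => v + η • (y - v)) (𝓝[>] 0) (𝓝 v) := fun y => by
      have : Continuous fun η : ℝ => v + η • (y - v) := by fun_prop
      simpa using (this.tendsto 0).mono_left nhdsWithin_le_nhds
    have h1 := (ht a).eventually (Metric.ball_mem_nhds v hε)
    have h2 := (ht b).eventually (Metric.ball_mem_nhds v hε)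
    have h3 : ∀ᶠ η : ℝ in 𝓝[>] 0, η ≤ 1 :=
      nhdsWithin_le_nhds (eventually_le_nhds zero_lt_one)
    obtain ⟨η, ⟨⟨h1, h2⟩, h3⟩, h4⟩ := (((h1.and h2).and h3).and self_mem_nhdsWithin).exists
    exact ⟨η, h4, h3, h1, h2⟩
  set a' := v + η • (a - v) with ha'
  set b' := v + η • (b - v) with hb'
  have haK' : a' ∈ hull K := (convex_hull K).add_smul_sub_mem (subset_hull K hvK)
    (subset_hull K haK) ⟨hη0.le, hη1⟩
  have hbL' : b' ∈ hull L := (convex_hull L).add_smul_sub_mem (subset_hull L hvL)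
    (subset_hull L hbL) ⟨hη0.le, hη1⟩
  have hseg' : v ∉ segment ℝ a' b' := by
    intro h
    apply hseg
    rw [segment_eq_image'] at h ⊢
    obtain ⟨p, hp, hpe⟩ := h
    refine ⟨p, hp, ?_⟩
    have h1 : η • (a + p • (b - a) - v) = 0 := by
      have h2 : a' + p • (b' - a') - v = η • (a + p • (b - a) - v) := by
        rw [ha', hb']; module
      simp only at hpe
      rw [← h2, hpe, sub_self]
    exact sub_eq_zero.1 ((smul_eq_zero.1 h1).resolve_left hη0.ne')
  have hsegball : segment ℝ a' b' ⊆ Metric.ball v ε := (convex_ball v ε).segment_subset hηa hηb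
  have hsegΩ : segment ℝ a' b' ⊆ closure Ω :=
    hΩ.convex.closure.segment_subset (T.hull_subset hK haK') (T.hull_subset hL hbL')
  have hpre := (convex_segment (𝕜 := ℝ) a' b').isPreconnected
  rw [isPreconnected_closed_iff] at hpre
  obtain ⟨z, hz, hz1, hz2⟩ := hpre (⋃ M ∈ A, hull M) (⋃ M ∈ B, hull M)
    (A.finite_toSet.isClosed_biUnion fun M _ => (isCompact_hull M).isClosed)
    (B.finite_toSet.isClosed_biUnion fun M _ => (isCompact_hull M).isClosed)
    (by
      intro z hz
      obtain ⟨M, hM, hzM⟩ := T.exists_mem_hull (hsegΩ hz)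
      have hvM : v ∈ M := by
        by_contra h
        exact hball z (hsegball hz) M hM h hzM
      rcases (hABv M).2 ⟨hM, hvM⟩ with h | h
      · exact Or.inl (Set.mem_biUnion h hzM)
      · exact Or.inr (Set.mem_biUnion h hzM))
    ⟨a', left_mem_segment ℝ a' b', Set.mem_biUnion hKA haK'⟩
    ⟨b', right_mem_segment ℝ a' b', Set.mem_biUnion hLB hbL'⟩
  simp only [Set.mem_iUnion] at hz1 hz2
  obtain ⟨M, hM, hzM⟩ := hz1
  obtain ⟨N, hN, hzN⟩ := hz2
  exact hseg' (hmeet M hM N hN z hzM hzN ▸ hz)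

/-- At most `s ^ 2` triangles meet at a vertex. -/
theorem HasDiscs.card_vertex_le (D : T.HasDiscs s x r) {v : Plane} {C : Finset (Finset Plane)}
    (hC : ∀ K ∈ C, K ∈ T.cells ∧ v ∈ K) : (C.card : ℝ) ≤ s ^ 2 := by
  rcases C.eq_empty_or_nonempty with rfl | hne
  · simpa using sq_nonneg s
  obtain ⟨ε, hε0, hε⟩ : ∃ ε > 0, ∀ K ∈ C, ε ≤ KGHDG.hK K := by
    obtain ⟨K₀, hK₀, hmin⟩ := Finset.exists_min_image C KGHDG.hK hne
    exact ⟨KGHDG.hK K₀, D.hK_pos (hC K₀ hK₀).1, hmin⟩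
  have hs : 0 < s := zero_lt_one.trans_le D.one_le
  -- scaling `K` towards `v` by the factor `ε / h_K` yields a disc of radius at least `ε / s`
  have key := T.sum_volume_le (C := C) (fun K hK => (hC K hK).1)
    (A := fun K => Metric.closedBall (v + (ε / KGHDG.hK K) • (x K - v)) (ε / s))
    (B := Metric.closedBall v ε) (fun K _ => measurableSet_closedBall) ?_
    measure_closedBall_lt_top.ne ?_
  · have h1 : ∀ K ∈ C, volume.real (Metric.closedBall (v + (ε / KGHDG.hK K) • (x K - v)) (ε / s))
        = Real.pi * (ε / s) ^ 2 := fun K _ => volume_real_closedBall _ (by positivity)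
    rw [Finset.sum_congr rfl h1, Finset.sum_const, nsmul_eq_mul, volume_real_closedBall _ hε0.le]
      at key
    rw [div_pow] at key
    have hpi := Real.pi_pos
    have h2 : (C.card : ℝ) * (Real.pi * (ε ^ 2 / s ^ 2)) = Real.pi * ε ^ 2 * (C.card / s ^ 2) := by
      field_simp
    rw [h2] at key
    have h3 : (C.card : ℝ) / s ^ 2 ≤ 1 := by
      by_contra hcon
      push Not at hcon
      have : 0 < Real.pi * ε ^ 2 := by positivity
      nlinarith
    rwa [div_le_one (by positivity)] at h3
  all_goals
    intro K hK y hy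
    obtain ⟨hKc, hvK⟩ := hC K hK
    have hh := D.hK_pos hKc
    have hr := D.pos K hKc
    -- `y` is the image of a point `z` of the disc in `K`
    have hz : x K + (KGHDG.hK K / ε) • (y - (v + (ε / KGHDG.hK K) • (x K - v))) ∈ hull K := by
      apply D.ball K hKc
      rw [mem_closedBall_iff_norm, add_sub_cancel_left, norm_smul,
        Real.norm_of_nonneg (by positivity)]
      rw [mem_closedBall_iff_norm] at hy
      calc KGHDG.hK K / ε * ‖y - (v + (ε / KGHDG.hK K) • (x K - v))‖
          ≤ KGHDG.hK K / ε * (ε / s) := by gcongr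
        _ = KGHDG.hK K / s := by field_simp
        _ ≤ r K := by
          rw [div_le_iff₀ hs, mul_comm]
          exact D.le K hKc
    set z := x K + (KGHDG.hK K / ε) • (y - (v + (ε / KGHDG.hK K) • (x K - v))) with hzdef
    have hyz : y = v + (ε / KGHDG.hK K) • (z - v) := by
      have e : ε / KGHDG.hK K * (KGHDG.hK K / ε) = 1 := by field_simp
      have : (ε / KGHDG.hK K) • (z - v) = (ε / KGHDG.hK K) • (x K - v)
          + (ε / KGHDG.hK K * (KGHDG.hK K / ε)) •
            (y - (v + (ε / KGHDG.hK K) • (x K - v))) := by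
        rw [hzdef]; module
      rw [this, e]
      module
  · rw [hyz]
    exact (convex_hull K).add_smul_sub_mem (subset_hull K hvK) hz
      ⟨by positivity, (div_le_one hh).2 (hε K hK)⟩
  · rw [hyz, mem_closedBall_iff_norm, add_sub_cancel_left, norm_smul,
      Real.norm_of_nonneg (by positivity), ← dist_eq_norm]
    have := dist_le_hK hz (subset_hull K hvK)
    calc ε / KGHDG.hK K * dist z v ≤ ε / KGHDG.hK K * KGHDG.hK K := by gcongr
      _ = ε := by field_simp

/-- Triangles with a common vertex have comparable diameters. -/
theorem HasDiscs.hK_le_of_common_vertex (D : T.HasDiscs s x r) (hΩ : IsConvexPolygon Ω)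
    {K L : Finset Plane} (hK : K ∈ T.cells) (hL : L ∈ T.cells) {v : Plane} (hvK : v ∈ K)
    (hvL : v ∈ L) : KGHDG.hK K ≤ s ^ ⌈s ^ 2⌉₊ * KGHDG.hK L := by
  classical
  have hs := D.one_le
  set C := T.cells.filter (fun M => v ∈ M) with hC
  -- the triangles that are reached from `K` across at most `n` edges at `v`
  set A : ℕ → Finset (Finset Plane) := fun n => C.filter (fun M => KGHDG.hK K ≤ s ^ n * KGHDG.hK M)
    with hA
  have hcard : ∀ n, A n = C ∨ n + 1 ≤ (A n).card := by
    intro n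
    induction n with
    | zero =>
      right
      refine Finset.card_pos.2 ⟨K, ?_⟩
      simp [hA, hC, hK, hvK]
    | succ n ih =>
      have hmono : A n ⊆ A (n + 1) := by
        intro M hM
        simp only [hA, Finset.mem_filter] at hM ⊢
        refine ⟨hM.1, hM.2.trans ?_⟩
        have hMc : M ∈ T.cells := (Finset.mem_filter.1 hM.1).1
        exact mul_le_mul_of_nonneg_right (pow_le_pow_right₀ hs (Nat.le_succ n)) (D.hK_pos hMc).le
      have hCsub : A (n + 1) ⊆ C := Finset.filter_subset _ _
      rcases ih with h | h
      · left
        exact Finset.Subset.antisymm hCsub fun M hM => hmono (by rw [h]; exact hM)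
      · by_cases hAC : A n = C
        · left
          exact Finset.Subset.antisymm hCsub fun M hM => hmono (by rw [hAC]; exact hM)
        right
        have hAsub : A n ⊆ C := Finset.filter_subset _ _
        have hB : (C \ A n).Nonempty := by
          rw [Finset.sdiff_nonempty]
          exact fun h' => hAC (hAsub.antisymm h')
        obtain ⟨M, hM, N, hN, w, hvw, hwM, hwN⟩ := exists_common_edge (T := T) hΩ
          (v := v) (A := A n) (B := C \ A n) (Finset.card_pos.1 (by omega)) hB
          (by
            intro M
            rw [← Finset.mem_union, Finset.union_sdiff_of_subset hAsub, hC, Finset.mem_filter])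
        rw [Finset.mem_sdiff] at hN
        have hMc := Finset.mem_filter.1 (hAsub hM)
        have hNc := Finset.mem_filter.1 hN.1
        have hadj := D.hK_le_of_common_edge hMc.1 hvw hMc.2 hwM hNc.2 hwN
        have hN' : N ∈ A (n + 1) := by
          simp only [hA, Finset.mem_filter] at hM ⊢
          refine ⟨hN.1, hM.2.trans ?_⟩
          rw [pow_succ, mul_assoc]
          gcongr
        have h2 : insert N (A n) ⊆ A (n + 1) := Finset.insert_subset hN' hmono
        have h3 := Finset.card_le_card h2
        rw [Finset.card_insert_of_notMem hN.2] at h3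
        omega
  have hCle : C.card ≤ ⌈s ^ 2⌉₊ := by
    have := D.card_vertex_le (v := v) (C := C) (fun M hM => Finset.mem_filter.1 hM)
    exact_mod_cast this.trans (Nat.le_ceil _)
  have hAll : A ⌈s ^ 2⌉₊ = C := by
    rcases hcard ⌈s ^ 2⌉₊ with h | h
    · exact h
    · have := Finset.card_le_card (Finset.filter_subset (fun M => KGHDG.hK K ≤ s ^ ⌈s ^ 2⌉₊ * KGHDG.hK M) C)
      simp only [hA] at h
      omega
  have hLC : L ∈ A ⌈s ^ 2⌉₊ := by rw [hAll]; exact Finset.mem_filter.2 ⟨hL, hvL⟩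
  exact (Finset.mem_filter.1 hLC).2

/-- The constant of local quasi-uniformity. -/
def lquConst (s : ℝ) : ℝ := 2 * (s ^ 2 * s ^ ⌈s ^ 2⌉₊ * s)

theorem one_le_lquConst (hs : 1 ≤ s) : 1 ≤ lquConst s := by
  have h1 : 1 ≤ s ^ 2 := one_le_pow₀ hs
  have h2 : 1 ≤ s ^ ⌈s ^ 2⌉₊ := one_le_pow₀ hs
  unfold lquConst
  have h3 : 1 ≤ s ^ 2 * s ^ ⌈s ^ 2⌉₊ := one_le_mul_of_one_le_of_one_le h1 h2
  have h4 := one_le_mul_of_one_le_of_one_le h3 hs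
  linarith

/-- Local quasi-uniformity: a triangle that comes near the centre of another one cannot be much
larger than the distance. The reason is that the piecewise affine function whose value at a vertex is
the sum of the diameters of the adjacent triangles is Lipschitz continuous. -/
theorem HasDiscs.hK_le_dist (D : T.HasDiscs s x r) (hΩ : IsConvexPolygon Ω)
    {K L : Finset Plane} (hK : K ∈ T.cells) (hL : L ∈ T.cells) (hLK : L ≠ K) {y : Plane}
    (hy : y ∈ hull L) : KGHDG.hK L ≤ lquConst s * dist y (x K) := by
  classical
  have hs := D.one_le
  set Γ := s ^ ⌈s ^ 2⌉₊ with hΓ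
  have hΓ1 : 1 ≤ Γ := one_le_pow₀ hs
  set H : Plane → ℝ := fun v => ∑ M ∈ T.cells with v ∈ M, KGHDG.hK M with hH
  have hHlo : ∀ M ∈ T.cells, ∀ v ∈ M, KGHDG.hK M ≤ H v := fun M hM v hv =>
    Finset.single_le_sum (f := KGHDG.hK) (fun N hN => (D.hK_pos (Finset.mem_filter.1 hN).1).le)
      (Finset.mem_filter.2 ⟨hM, hv⟩)
  have hHhi : ∀ M ∈ T.cells, ∀ v ∈ M, H v ≤ s ^ 2 * Γ * KGHDG.hK M := by
    intro M hM v hv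
    have h1 : H v ≤ ((T.cells.filter (fun N => v ∈ N)).card : ℝ) * (Γ * KGHDG.hK M) := by
      rw [← nsmul_eq_mul]
      refine Finset.sum_le_card_nsmul _ _ _ fun N hN => ?_
      obtain ⟨hN1, hN2⟩ := Finset.mem_filter.1 hN
      exact D.hK_le_of_common_vertex hΩ hN1 hM hN2 hv
    refine h1.trans ?_
    rw [mul_assoc]
    have := D.hK_pos hM
    exact mul_le_mul_of_nonneg_right
      (D.card_vertex_le (v := v) (fun N hN => Finset.mem_filter.1 hN)) (by positivity)
  choose! α g hαg using fun M (hM : M ∈ T.cells) =>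
    exists_affine_interpolant (T.isTriangle hM) H
  have hlo : ∀ M ∈ T.cells, ∀ z ∈ hull M, KGHDG.hK M ≤ α M + inner ℝ (g M) z := fun M hM =>
    convexHull_min (fun v hv => by
      change KGHDG.hK M ≤ α M + inner ℝ (g M) v
      rw [hαg M hM v hv]; exact hHlo M hM v hv) (convex_setOf_le_affine _ _ _)
  have hhi : ∀ M ∈ T.cells, ∀ z ∈ hull M, α M + inner ℝ (g M) z ≤ s ^ 2 * Γ * KGHDG.hK M :=
    fun M hM => convexHull_min (fun v hv => by
      change α M + inner ℝ (g M) v ≤ s ^ 2 * Γ * KGHDG.hK M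
      rw [hαg M hM v hv]; exact hHhi M hM v hv) (convex_setOf_affine_le _ _ _)
  have hagree : ∀ M ∈ T.cells, ∀ N ∈ T.cells, ∀ z ∈ hull M, z ∈ hull N →
      α M + inner ℝ (g M) z = α N + inner ℝ (g N) z := by
    intro M hM N hN z hzM hzN
    have hz : z ∈ convexHull ℝ ((M : Set Plane) ∩ (N : Set Plane)) := by
      rw [← T.conforming M hM N hN]; exact ⟨hzM, hzN⟩
    have h1 : convexHull ℝ ((M : Set Plane) ∩ (N : Set Plane)) ⊆
        {z | (α M - α N) + inner ℝ (g M - g N) z ≤ 0} ∩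
        {z | 0 ≤ (α M - α N) + inner ℝ (g M - g N) z} := by
      refine convexHull_min ?_ ((convex_setOf_affine_le _ _ _).inter (convex_setOf_le_affine _ _ _))
      rintro v ⟨hvM, hvN⟩
      have h2 : (α M - α N) + inner ℝ (g M - g N) v = 0 := by
        rw [inner_sub_left]
        linarith [hαg M hM v hvM, hαg N hN v hvN]
      exact ⟨h2.le, h2.ge⟩
    have h2 : (α M - α N) + inner ℝ (g M - g N) z ≤ 0 := (h1 hz).1
    have h3 : 0 ≤ (α M - α N) + inner ℝ (g M - g N) z := (h1 hz).2
    rw [inner_sub_left] at h2 h3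
    linarith
  set G : ℝ := s ^ 2 * Γ * s with hG
  have hgn : ∀ M ∈ T.cells, ‖g M‖ ≤ G := by
    intro M hM
    have hr := D.pos M hM
    have h1 := norm_le_of_affine_mem_Icc (α := α M) (g := g M) (x := x M) hr (fun z hz =>
      ⟨(D.hK_pos hM).le.trans (hlo M hM z (D.ball M hM hz)), hhi M hM z (D.ball M hM hz)⟩)
    have h2 : s ^ 2 * Γ * KGHDG.hK M ≤ s ^ 2 * Γ * (s * r M) := by
      gcongr
      exact D.le M hM
    have h3 : 2 * r M * ‖g M‖ ≤ r M * G := by rw [hG]; linarith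
    have h4 : 2 * ‖g M‖ ≤ G := le_of_mul_le_mul_left (by linarith) hr
    linarith [norm_nonneg (g M)]
  have hxK := D.center_mem hK
  -- follow the piecewise affine function along the segment from `x K` to `y`
  have hγ : ∀ t ∈ Set.Icc (0 : ℝ) 1, x K + t • (y - x K) ∈ closure Ω := fun t ht =>
    hΩ.convex.closure.add_smul_sub_mem (T.hull_subset hK hxK) (T.hull_subset hL hy) ht
  have hchoose : ∀ t : ℝ, ∃ M ∈ T.cells, t ∈ Set.Icc (0 : ℝ) 1 → x K + t • (y - x K) ∈ hull M := by
    intro t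
    by_cases ht : t ∈ Set.Icc (0 : ℝ) 1
    · obtain ⟨M, hM, hMt⟩ := T.exists_mem_hull (hγ t ht)
      exact ⟨M, hM, fun _ => hMt⟩
    · exact ⟨K, hK, fun h => absurd h ht⟩
  choose m hm hmem using hchoose
  have hcurve := le_add_of_finite_closed_cover T.cells
    (A := fun M => Set.Icc 0 1 ∩ (fun t : ℝ => x K + t • (y - x K)) ⁻¹' hull M)
    (fun M _ => isClosed_Icc.inter ((isCompact_hull M).isClosed.preimage (by fun_prop)))
    (fun t ht => ⟨m t, hm t, ht, hmem t ht⟩)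
    (G := G * dist y (x K)) (f := fun M t => α M + inner ℝ (g M) (x K + t • (y - x K)))
    (fun M hM a b => by
      have e : α M + inner ℝ (g M) (x K + a • (y - x K)) - (α M + inner ℝ (g M) (x K + b • (y - x K)))
          = (a - b) * inner ℝ (g M) (y - x K) := by
        rw [inner_add_right, inner_add_right, inner_smul_right, inner_smul_right]; ring
      rw [e, abs_mul, mul_comm]
      refine mul_le_mul_of_nonneg_right ((abs_real_inner_le_norm _ _).trans ?_) (abs_nonneg _)
      rw [← dist_eq_norm]
      exact mul_le_mul_of_nonneg_right (hgn M hM) dist_nonneg)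
    (g := fun t => α (m t) + inner ℝ (g (m t)) (x K + t • (y - x K)))
    (fun M hM t ht => hagree _ (hm t) _ hM _ (hmem t ht.1) ht.2)
  have h0 := hhi K hK _ hxK
  have e0 := hagree _ (hm 0) _ hK _ (hmem 0 ⟨le_rfl, zero_le_one⟩) (by simpa using hxK)
  have e1 := hagree _ (hm 1) _ hL _ (hmem 1 ⟨zero_le_one, le_rfl⟩) (by simpa using hy)
  rw [e0, e1] at hcurve
  simp only [one_smul, zero_smul, add_zero, add_sub_cancel] at hcurve
  have h1 := hlo L hL _ hy
  have h2 := D.radius_le_dist hK hL hLK hy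
  have h3 : s ^ 2 * Γ * KGHDG.hK K ≤ G * dist y (x K) := by
    calc s ^ 2 * Γ * KGHDG.hK K ≤ s ^ 2 * Γ * (s * r K) := by gcongr; exact D.le K hK
      _ = G * r K := by rw [hG]; ring
      _ ≤ G * dist y (x K) := by gcongr
  have h4 : lquConst s * dist y (x K) = 2 * (G * dist y (x K)) := by rw [lquConst]; ring
  rw [h4]
  linarith

end Triangulation

/-! ### A discrete Hardy-Littlewood-Sobolev inequality -/

section HLS

variable {ι : Type*} {S : Finset ι} {E : ι → ι → ℝ} {μ : ι → ℝ} {A : ℝ}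

/-- The near part of a potential, by dyadic summation of the packing condition `hpack`. With `E` the
square root of a distance `D`, this condition says that the measure of a disc of radius `δ` is at most
`A δ ^ 2`. -/
theorem sum_near_le (hE : ∀ K ∈ S, ∀ L ∈ S, 0 < E K L) (hμ : ∀ K ∈ S, 0 ≤ μ K) (hA : 0 ≤ A)
    (hpack : ∀ K ∈ S, ∀ ρ > 0, ∑ L ∈ S with E K L ≤ ρ, μ L ≤ A * ρ ^ 4) {m : ℕ} (hm : m ≤ 3)
    {K : ι} (hK : K ∈ S) {ρ : ℝ} (hρ : 0 < ρ) :
    ∑ L ∈ S with E K L ≤ ρ, μ L / E K L ^ m ≤ 16 * A * (ρ ^ 4 / ρ ^ m) := by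
  have key : ∀ n : ℕ, ∀ ρ > 0, (∀ L ∈ S, ρ / 2 ^ n < E K L) →
      ∑ L ∈ S with E K L ≤ ρ, μ L / E K L ^ m ≤ 16 * A * (ρ ^ 4 / ρ ^ m) := by
    intro n
    induction n with
    | zero =>
      intro ρ hρ h
      rw [Finset.filter_false_of_mem (fun L hL => by simpa using h L hL), Finset.sum_empty]
      positivity
    | succ n ih =>
      intro ρ hρ h
      have h1 := ih (ρ / 2) (by positivity) (fun L hL => by
        have := h L hL
        rwa [pow_succ', ← div_div] at this)
      have hsplit : ∑ L ∈ S with E K L ≤ ρ, μ L / E K L ^ m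
          ≤ ∑ L ∈ S with E K L ≤ ρ, μ L / (ρ / 2) ^ m
            + ∑ L ∈ S with E K L ≤ ρ / 2, μ L / E K L ^ m := by
        rw [← Finset.sum_filter_add_sum_filter_not (S.filter (fun L => E K L ≤ ρ))
          (fun L => E K L ≤ ρ / 2), add_comm]
        refine add_le_add ?_ (le_of_eq ?_)
        · calc _ ≤ ∑ L ∈ (S.filter (fun L => E K L ≤ ρ)).filter (fun L => ¬ E K L ≤ ρ / 2),
                μ L / (ρ / 2) ^ m := by
                refine Finset.sum_le_sum fun L hL => ?_
                simp only [Finset.mem_filter, not_le] at hL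
                have := hμ L hL.1.1
                have := hL.2
                gcongr
            _ ≤ _ := by
                refine Finset.sum_le_sum_of_subset_of_nonneg (Finset.filter_subset _ _) ?_
                intro L hL _
                have := hμ L (Finset.mem_filter.1 hL).1
                positivity
        · rw [Finset.filter_filter]
          refine Finset.sum_congr (Finset.filter_congr fun L _ => ?_) fun _ _ => rfl
          exact ⟨fun h => h.2, fun h => ⟨h.trans (by linarith), h⟩⟩
      refine hsplit.trans ?_
      rw [← Finset.sum_div]
      have h2 : (∑ L ∈ S with E K L ≤ ρ, μ L) / (ρ / 2) ^ m ≤ 2 ^ m * A * (ρ ^ 4 / ρ ^ m) := by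
        rw [div_pow]
        calc _ ≤ A * ρ ^ 4 / (ρ ^ m / 2 ^ m) := by
              gcongr
              exact hpack K hK ρ hρ
          _ = _ := by field_simp
      have h3 : 16 * A * ((ρ / 2) ^ 4 / (ρ / 2) ^ m) = 2 ^ m * A * (ρ ^ 4 / ρ ^ m) := by
        rw [div_pow, div_pow]
        field_simp
        ring
      rw [h3] at h1
      have h4 : (2 : ℝ) ^ m ≤ 8 := by
        calc (2 : ℝ) ^ m ≤ 2 ^ 3 := pow_le_pow_right₀ (by norm_num) hm
          _ = 8 := by norm_num
      have h5 : 0 ≤ A * (ρ ^ 4 / ρ ^ m) := by positivity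
      nlinarith
  obtain ⟨n, hn⟩ : ∃ n : ℕ, ∀ L ∈ S, ρ / 2 ^ n < E K L := by
    have ht : Tendsto (fun n : ℕ => ρ / 2 ^ n) atTop (𝓝 0) := by
      simpa [div_eq_mul_inv] using
        (tendsto_pow_atTop_nhds_zero_of_lt_one (r := (2 : ℝ)⁻¹) (by norm_num) (by norm_num)).const_mul ρ
    have : ∀ᶠ n : ℕ in atTop, ∀ L ∈ S, ρ / 2 ^ n < E K L := by
      rw [Filter.eventually_all_finset]
      exact fun L hL => ht.eventually_lt_const (hE K hK L hL)
    exact this.exists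
  exact key n ρ hρ hn

/-- The far part of a potential, by dyadic summation of the packing condition. -/
theorem sum_far_le (hμ : ∀ K ∈ S, 0 ≤ μ K) (hA : 0 ≤ A)
    (hpack : ∀ K ∈ S, ∀ ρ > 0, ∑ L ∈ S with E K L ≤ ρ, μ L ≤ A * ρ ^ 4) {m : ℕ} (hm : 5 ≤ m)
    {K : ι} (hK : K ∈ S) {ρ : ℝ} (hρ : 0 < ρ) :
    ∑ L ∈ S with ρ < E K L, μ L / E K L ^ m ≤ 32 * A * (ρ ^ 4 / ρ ^ m) := by
  have key : ∀ n : ℕ, ∀ ρ > 0, (∀ L ∈ S, E K L ≤ ρ * 2 ^ n) →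
      ∑ L ∈ S with ρ < E K L, μ L / E K L ^ m ≤ 32 * A * (ρ ^ 4 / ρ ^ m) := by
    intro n
    induction n with
    | zero =>
      intro ρ hρ h
      rw [Finset.filter_false_of_mem (fun L hL => by simpa using h L hL), Finset.sum_empty]
      positivity
    | succ n ih =>
      intro ρ hρ h
      have h1 := ih (ρ * 2) (by positivity) (fun L hL => by
        have := h L hL
        rwa [pow_succ', ← mul_assoc] at this)
      have hsplit : ∑ L ∈ S with ρ < E K L, μ L / E K L ^ m
          ≤ ∑ L ∈ S with E K L ≤ ρ * 2, μ L / ρ ^ m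
            + ∑ L ∈ S with ρ * 2 < E K L, μ L / E K L ^ m := by
        rw [← Finset.sum_filter_add_sum_filter_not (S.filter (fun L => ρ < E K L))
          (fun L => E K L ≤ ρ * 2)]
        refine add_le_add ?_ (le_of_eq ?_)
        · calc _ ≤ ∑ L ∈ (S.filter (fun L => ρ < E K L)).filter (fun L => E K L ≤ ρ * 2),
                μ L / ρ ^ m := by
                refine Finset.sum_le_sum fun L hL => ?_
                simp only [Finset.mem_filter] at hL
                have := hμ L hL.1.1
                have := hL.1.2
                gcongr
            _ ≤ _ := by
                rw [Finset.filter_filter]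
                refine Finset.sum_le_sum_of_subset_of_nonneg (fun L hL => ?_) ?_
                · simp only [Finset.mem_filter] at hL ⊢
                  exact ⟨hL.1, hL.2.2⟩
                intro L hL _
                have := hμ L (Finset.mem_filter.1 hL).1
                positivity
        · rw [Finset.filter_filter]
          refine Finset.sum_congr (Finset.filter_congr fun L _ => ?_) fun _ _ => rfl
          rw [not_le]
          exact ⟨fun h => h.2, fun h => ⟨lt_trans (by linarith) h, h⟩⟩
      refine hsplit.trans ?_
      rw [← Finset.sum_div]
      have h2 : (∑ L ∈ S with E K L ≤ ρ * 2, μ L) / ρ ^ m ≤ 16 * A * (ρ ^ 4 / ρ ^ m) := by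
        calc _ ≤ A * (ρ * 2) ^ 4 / ρ ^ m := by
              gcongr
              exact hpack K hK _ (by positivity)
          _ = _ := by ring
      have h3 : 32 * A * ((ρ * 2) ^ 4 / (ρ * 2) ^ m) = 32 * 16 / 2 ^ m * (A * (ρ ^ 4 / ρ ^ m)) := by
        rw [mul_pow, mul_pow]
        field_simp
        norm_num
      rw [h3] at h1
      have h4 : (32 : ℝ) * 16 / 2 ^ m ≤ 16 := by
        rw [div_le_iff₀ (by positivity)]
        have : (2 : ℝ) ^ 5 ≤ 2 ^ m := pow_le_pow_right₀ (by norm_num) hm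
        linarith
      have h5 : 0 ≤ A * (ρ ^ 4 / ρ ^ m) := by positivity
      nlinarith
  obtain ⟨n, hn⟩ : ∃ n : ℕ, ∀ L ∈ S, E K L ≤ ρ * 2 ^ n := by
    have ht : Tendsto (fun n : ℕ => ρ * 2 ^ n) atTop atTop :=
      (tendsto_pow_atTop_atTop_of_one_lt (by norm_num : (1 : ℝ) < 2)).const_mul_atTop hρ
    have : ∀ᶠ n : ℕ in atTop, ∀ L ∈ S, E K L ≤ ρ * 2 ^ n := by
      rw [Filter.eventually_all_finset]
      exact fun L _ => ht.eventually_ge_atTop _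
    exact this.exists
  exact key n ρ hρ hn

/-- The composition of the kernel `D ^ (-3/2)` with itself is bounded by the kernel `D ^ (-1)`, where
`D = E ^ 2`. -/
theorem kernel_comp_le (hE : ∀ K ∈ S, ∀ L ∈ S, 0 < E K L) (hsymm : ∀ K L, E K L = E L K)
    (htri : ∀ K ∈ S, ∀ L ∈ S, ∀ M ∈ S, E K M ^ 2 ≤ E K L ^ 2 + E L M ^ 2)
    (hμ : ∀ K ∈ S, 0 ≤ μ K) (hA : 0 ≤ A)
    (hpack : ∀ K ∈ S, ∀ ρ > 0, ∑ L ∈ S with E K L ≤ ρ, μ L ≤ A * ρ ^ 4)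
    {K M : ι} (hK : K ∈ S) (hM : M ∈ S) :
    ∑ L ∈ S, μ L * ((E K L ^ 3)⁻¹ * (E L M ^ 3)⁻¹) ≤ 256 * A / E K M ^ 2 := by
  have hEKM := hE K hK M hM
  set ρ := E K M / 2 with hρ
  have hρ0 : 0 < ρ := by positivity
  have n1 := sum_near_le hE hμ hA hpack (m := 3) le_rfl hK hρ0
  have n2 := sum_near_le hE hμ hA hpack (m := 3) le_rfl hM hρ0
  have f1 := sum_far_le hμ hA hpack (m := 6) (by norm_num) hK hρ0
  have f2 := sum_far_le hμ hA hpack (m := 6) (by norm_num) hM hρ0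
  rw [Finset.sum_filter] at n1 n2 f1 f2
  -- the three regions: close to `K`, close to `M`, far from both
  have hpt : ∀ L ∈ S, μ L * ((E K L ^ 3)⁻¹ * (E L M ^ 3)⁻¹)
      ≤ (ρ ^ 3)⁻¹ * (if E K L ≤ ρ then μ L / E K L ^ 3 else 0)
        + (ρ ^ 3)⁻¹ * (if E M L ≤ ρ then μ L / E M L ^ 3 else 0)
        + (2⁻¹ * (if ρ < E K L then μ L / E K L ^ 6 else 0)
          + 2⁻¹ * (if ρ < E M L then μ L / E M L ^ 6 else 0)) := by
    intro L hL
    have p1 := hE K hK L hL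
    have p2 := hE M hM L hL
    have hm := hμ L hL
    rw [hsymm L M]
    have q1 : 0 ≤ (ρ ^ 3)⁻¹ * (if E K L ≤ ρ then μ L / E K L ^ 3 else 0) := by
      split_ifs <;> positivity
    have q2 : 0 ≤ (ρ ^ 3)⁻¹ * (if E M L ≤ ρ then μ L / E M L ^ 3 else 0) := by
      split_ifs <;> positivity
    have q3 : 0 ≤ 2⁻¹ * (if ρ < E K L then μ L / E K L ^ 6 else 0) := by
      split_ifs <;> positivity
    have q4 : 0 ≤ 2⁻¹ * (if ρ < E M L then μ L / E M L ^ 6 else 0) := by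
      split_ifs <;> positivity
    have ht := htri K hK L hL M hM
    rw [hsymm L M] at ht
    have hKM : E K M = 2 * ρ := by rw [hρ]; ring
    rw [hKM] at ht
    by_cases h1 : E K L ≤ ρ
    · have h2 : ρ ≤ E M L := by nlinarith
      have : μ L * ((E K L ^ 3)⁻¹ * (E M L ^ 3)⁻¹) ≤ (ρ ^ 3)⁻¹ * (μ L / E K L ^ 3) := by
        rw [div_eq_mul_inv]
        have h3 : (E M L ^ 3)⁻¹ ≤ (ρ ^ 3)⁻¹ := by gcongr
        calc μ L * ((E K L ^ 3)⁻¹ * (E M L ^ 3)⁻¹)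
            = (E M L ^ 3)⁻¹ * (μ L * (E K L ^ 3)⁻¹) := by ring
          _ ≤ _ := by gcongr
      rw [if_pos h1] at q1 ⊢
      linarith
    by_cases h2 : E M L ≤ ρ
    · have h1' : ρ ≤ E K L := (not_le.1 h1).le
      have : μ L * ((E K L ^ 3)⁻¹ * (E M L ^ 3)⁻¹) ≤ (ρ ^ 3)⁻¹ * (μ L / E M L ^ 3) := by
        rw [div_eq_mul_inv]
        have h3 : (E K L ^ 3)⁻¹ ≤ (ρ ^ 3)⁻¹ := by gcongr
        calc μ L * ((E K L ^ 3)⁻¹ * (E M L ^ 3)⁻¹)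
            = (E K L ^ 3)⁻¹ * (μ L * (E M L ^ 3)⁻¹) := by ring
          _ ≤ _ := by gcongr
      rw [if_pos h2] at q2 ⊢
      linarith
    · rw [if_pos (not_le.1 h1), if_pos (not_le.1 h2)]
      have : μ L * ((E K L ^ 3)⁻¹ * (E M L ^ 3)⁻¹)
          ≤ 2⁻¹ * (μ L / E K L ^ 6) + 2⁻¹ * (μ L / E M L ^ 6) := by
        have e1 : (E K L ^ 6)⁻¹ = ((E K L ^ 3)⁻¹) ^ 2 := by rw [← inv_pow, ← inv_pow, ← pow_mul]
        have e2 : (E M L ^ 6)⁻¹ = ((E M L ^ 3)⁻¹) ^ 2 := by rw [← inv_pow, ← inv_pow, ← pow_mul]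
        rw [div_eq_mul_inv, div_eq_mul_inv, e1, e2]
        nlinarith [mul_nonneg hm (sq_nonneg ((E K L ^ 3)⁻¹ - (E M L ^ 3)⁻¹))]
      linarith
  refine (Finset.sum_le_sum hpt).trans ?_
  rw [Finset.sum_add_distrib, Finset.sum_add_distrib, Finset.sum_add_distrib, ← Finset.mul_sum,
    ← Finset.mul_sum, ← Finset.mul_sum, ← Finset.mul_sum]
  have hi : 0 ≤ (ρ ^ 3)⁻¹ := by positivity
  have n1' := mul_le_mul_of_nonneg_left n1 hi
  have n2' := mul_le_mul_of_nonneg_left n2 hi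
  have e1 : (ρ ^ 3)⁻¹ * (16 * A * (ρ ^ 4 / ρ ^ 3)) = 16 * (A / ρ ^ 2) := by field_simp
  have e2 : 32 * A * (ρ ^ 4 / ρ ^ 6) = 32 * (A / ρ ^ 2) := by field_simp
  have e3 : 256 * A / E K M ^ 2 = 64 * (A / ρ ^ 2) := by
    rw [hρ]; field_simp; ring
  rw [e1] at n1' n2'
  rw [e2] at f1 f2
  rw [e3]
  linarith

/-- The diagonal Hardy-Littlewood-Sobolev inequality for the kernel `D ^ (-1)`, `D = E ^ 2`, in two
dimensions, for `g = s ^ 3` in `ℓ^{4/3}`. By symmetry only pairs with `s M ≤ s K` matter. For these, the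
near part of the inner sum is bounded by the largest value `s K ^ 3`, the far part by Young's
inequality. -/
theorem hls_diagonal (hE : ∀ K ∈ S, ∀ L ∈ S, 0 < E K L) (hsymm : ∀ K L, E K L = E L K)
    (hμ : ∀ K ∈ S, 0 ≤ μ K) (hA : 0 ≤ A)
    (hpack : ∀ K ∈ S, ∀ ρ > 0, ∑ L ∈ S with E K L ≤ ρ, μ L ≤ A * ρ ^ 4)
    {s : ι → ℝ} (hs : ∀ K ∈ S, 0 ≤ s K) {Y : ℝ} (hY0 : 0 ≤ Y) (hY : Y ^ 2 = ∑ K ∈ S, μ K * s K ^ 4) :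
    ∑ K ∈ S, ∑ M ∈ S, (μ K * s K ^ 3) * (μ M * s M ^ 3) / E K M ^ 2
      ≤ 2 * (1 + 48 * A) * Y ^ 3 := by
  set q : ι → ι → ℝ := fun K M => (μ K * s K ^ 3) * (μ M * s M ^ 3) / E K M ^ 2 with hq
  have hq0 : ∀ K ∈ S, ∀ M ∈ S, 0 ≤ q K M := by
    intro K hK M hM
    have := hμ K hK; have := hμ M hM; have := hs K hK; have := hs M hM
    simp only [hq]; positivity
  have hqs : ∀ K M, q K M = q M K := by
    intro K M
    simp only [hq, hsymm K M]; ring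
  have hred : ∑ K ∈ S, ∑ M ∈ S, q K M ≤ 2 * ∑ K ∈ S, ∑ M ∈ S, if s M ≤ s K then q K M else 0 := by
    have h1 : ∑ K ∈ S, ∑ M ∈ S, q K M ≤ ∑ K ∈ S, ∑ M ∈ S,
        ((if s M ≤ s K then q K M else 0) + (if s K ≤ s M then q K M else 0)) := by
      refine Finset.sum_le_sum fun K hK => Finset.sum_le_sum fun M hM => ?_
      have := hq0 K hK M hM
      rcases le_total (s M) (s K) with h | h
      · rw [if_pos h]; split_ifs <;> linarith
      · rw [if_pos h]; split_ifs <;> linarith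
    have h2 : ∑ K ∈ S, ∑ M ∈ S, (if s K ≤ s M then q K M else 0)
        = ∑ K ∈ S, ∑ M ∈ S, (if s M ≤ s K then q K M else 0) := by
      rw [Finset.sum_comm]
      refine Finset.sum_congr rfl fun K _ => Finset.sum_congr rfl fun M _ => ?_
      rw [hqs]
    simp only [Finset.sum_add_distrib] at h1
    rw [h2] at h1
    linarith
  have hterm : ∀ K ∈ S, ∑ M ∈ S, (if s M ≤ s K then q K M else 0)
      ≤ (μ K * s K ^ 4) * ((1 + 48 * A) * Y) := by
    intro K hK
    have hmK := hμ K hK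
    rcases (hs K hK).eq_or_lt with h0 | hpos
    · have : ∑ M ∈ S, (if s M ≤ s K then q K M else 0) = 0 := by
        refine Finset.sum_eq_zero fun M _ => ?_
        simp [hq, ← h0]
      rw [this, ← h0]; simp
    rcases hmK.eq_or_lt with hm0 | hmpos
    · have : ∑ M ∈ S, (if s M ≤ s K then q K M else 0) = 0 := by
        refine Finset.sum_eq_zero fun M _ => ?_
        simp [hq, ← hm0]
      rw [this, ← hm0]; simp
    have hYpos : 0 < Y := by
      have h1 : 0 < Y ^ 2 := by
        rw [hY]
        refine Finset.sum_pos' (fun M hM => ?_) ⟨K, hK, by positivity⟩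
        have := hμ M hM; have := hs M hM
        positivity
      exact hY0.lt_of_ne fun h => by simp [← h] at h1
    -- the radius that balances the two parts
    set ρ := Real.sqrt (Y / s K ^ 2) with hρ
    have hρ0 : 0 < ρ := Real.sqrt_pos.2 (by positivity)
    have hρ2 : ρ ^ 2 = Y / s K ^ 2 := Real.sq_sqrt (by positivity)
    set θ := s K / Y with hθ
    have hθ0 : 0 < θ := by positivity
    have near := sum_near_le hE hμ hA hpack (m := 2) (by norm_num) hK hρ0
    have far := sum_far_le hμ hA hpack (m := 8) (by norm_num) hK hρ0
    rw [Finset.sum_filter] at near far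
    have hpt : ∀ M ∈ S, (if s M ≤ s K then μ M * s M ^ 3 / E K M ^ 2 else 0)
        ≤ s K ^ 3 * (if E K M ≤ ρ then μ M / E K M ^ 2 else 0)
          + (θ * (μ M * s M ^ 4) + (θ ^ 3)⁻¹ * (if ρ < E K M then μ M / E K M ^ 8 else 0)) := by
      intro M hM
      have hm := hμ M hM
      have hsM := hs M hM
      have hEp := hE K hK M hM
      have p1 : 0 ≤ s K ^ 3 * (if E K M ≤ ρ then μ M / E K M ^ 2 else 0) := by
        split_ifs <;> positivity
      have p2 : 0 ≤ θ * (μ M * s M ^ 4) := by positivity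
      have p3 : 0 ≤ (θ ^ 3)⁻¹ * (if ρ < E K M then μ M / E K M ^ 8 else 0) := by
        split_ifs <;> positivity
      by_cases h : s M ≤ s K
      swap
      · rw [if_neg h]; linarith
      rw [if_pos h]
      by_cases hn : E K M ≤ ρ
      · rw [if_pos hn] at p1 ⊢
        have : μ M * s M ^ 3 / E K M ^ 2 ≤ s K ^ 3 * (μ M / E K M ^ 2) := by
          rw [mul_comm (μ M), mul_div_assoc]
          gcongr
        linarith
      · rw [if_pos (not_le.1 hn)] at p3 ⊢
        have : μ M * s M ^ 3 / E K M ^ 2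
            ≤ θ * (μ M * s M ^ 4) + (θ ^ 3)⁻¹ * (μ M / E K M ^ 8) := by
          set y := (E K M ^ 2)⁻¹ with hy
          have hy0 : 0 < y := by positivity
          have e : (E K M ^ 8)⁻¹ = y ^ 4 := by rw [hy, ← inv_pow, ← inv_pow, ← pow_mul]
          rw [div_eq_mul_inv, div_eq_mul_inv, e, ← hy]
          rcases le_total y (θ * s M) with hc | hc
          · have : μ M * s M ^ 3 * y ≤ θ * (μ M * s M ^ 4) := by
              calc μ M * s M ^ 3 * y ≤ μ M * s M ^ 3 * (θ * s M) := by gcongr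
                _ = _ := by ring
            have : 0 ≤ (θ ^ 3)⁻¹ * (μ M * y ^ 4) := by positivity
            linarith
          · have h3 : μ M * s M ^ 3 * y ≤ (θ ^ 3)⁻¹ * (μ M * y ^ 4) := by
              have h4 : s M ≤ y / θ := by
                rw [le_div_iff₀ hθ0, mul_comm]; exact hc
              calc μ M * s M ^ 3 * y ≤ μ M * (y / θ) ^ 3 * y := by gcongr
                _ = _ := by rw [div_pow]; field_simp
            linarith
        linarith
    have hsum := Finset.sum_le_sum hpt
    rw [Finset.sum_add_distrib, Finset.sum_add_distrib, ← Finset.mul_sum, ← Finset.mul_sum,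
      ← Finset.mul_sum, ← hY] at hsum
    have e1 : s K ^ 3 * (16 * A * (ρ ^ 4 / ρ ^ 2)) = 16 * A * (s K * Y) := by
      have : ρ ^ 4 / ρ ^ 2 = Y / s K ^ 2 := by rw [← hρ2]; field_simp
      rw [this]; field_simp
    have e2 : (θ ^ 3)⁻¹ * (32 * A * (ρ ^ 4 / ρ ^ 8)) = 32 * A * (s K * Y) := by
      have : ρ ^ 4 / ρ ^ 8 = (Y / s K ^ 2)⁻¹ ^ 2 := by rw [← hρ2]; field_simp
      rw [this, hθ]; field_simp
    have e3 : θ * Y ^ 2 = s K * Y := by rw [hθ]; field_simp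
    have near' := mul_le_mul_of_nonneg_left near (by positivity : 0 ≤ s K ^ 3)
    have far' := mul_le_mul_of_nonneg_left far (by positivity : 0 ≤ (θ ^ 3)⁻¹)
    rw [e1] at near'
    rw [e2] at far'
    rw [e3] at hsum
    have hfin : ∑ M ∈ S, (if s M ≤ s K then μ M * s M ^ 3 / E K M ^ 2 else 0)
        ≤ (1 + 48 * A) * (s K * Y) := by linarith
    have e4 : ∑ M ∈ S, (if s M ≤ s K then q K M else 0)
        = (μ K * s K ^ 3) * ∑ M ∈ S, (if s M ≤ s K then μ M * s M ^ 3 / E K M ^ 2 else 0) := by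
      rw [Finset.mul_sum]
      refine Finset.sum_congr rfl fun M _ => ?_
      split_ifs
      · simp only [hq]; ring
      · ring
    rw [e4]
    calc _ ≤ (μ K * s K ^ 3) * ((1 + 48 * A) * (s K * Y)) := by gcongr
      _ = _ := by ring
  have h2 := Finset.sum_le_sum hterm
  rw [← Finset.sum_mul, ← hY] at h2
  calc _ ≤ _ := hred
    _ ≤ 2 * (Y ^ 2 * ((1 + 48 * A) * Y)) := by gcongr
    _ = _ := by ring

/-- The discrete form of the mapping property `L² → L⁴` of the Riesz potential with kernel
`D ^ (-3/2)` in two dimensions, where `D = E ^ 2` and the cells have the measure `m K ^ 2`. -/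
theorem riesz_potential_le (hE : ∀ K ∈ S, ∀ L ∈ S, 0 < E K L) (hsymm : ∀ K L, E K L = E L K)
    (htri : ∀ K ∈ S, ∀ L ∈ S, ∀ M ∈ S, E K M ^ 2 ≤ E K L ^ 2 + E L M ^ 2)
    {m : ι → ℝ} (hA : 0 ≤ A)
    (hpack : ∀ K ∈ S, ∀ ρ > 0, ∑ L ∈ S with E K L ≤ ρ, m L ^ 2 ≤ A * ρ ^ 4)
    {s β : ι → ℝ} (hs : ∀ K ∈ S, 0 ≤ s K)
    (hsβ : ∀ K ∈ S, s K ≤ ∑ L ∈ S, β L * m L * (E K L ^ 3)⁻¹) :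
    ∑ K ∈ S, m K ^ 2 * s K ^ 4 ≤ (512 * A * (1 + 48 * A)) ^ 2 * (∑ L ∈ S, β L ^ 2) ^ 2 := by
  set X := ∑ K ∈ S, m K ^ 2 * s K ^ 4 with hX
  have hX0 : 0 ≤ X := Finset.sum_nonneg fun K hK => by
    have := hs K hK; positivity
  set Y := Real.sqrt X with hY
  have hY0 : 0 ≤ Y := Real.sqrt_nonneg _
  have hY2 : Y ^ 2 = X := Real.sq_sqrt hX0
  set B := ∑ L ∈ S, β L ^ 2 with hB
  have hB0 : 0 ≤ B := Finset.sum_nonneg fun _ _ => sq_nonneg _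
  set V : ι → ℝ := fun L => ∑ K ∈ S, (m K ^ 2 * s K ^ 3) * (E K L ^ 3)⁻¹ with hV
  have h1 : X ≤ ∑ L ∈ S, β L * (m L * V L) := by
    calc X ≤ ∑ K ∈ S, (m K ^ 2 * s K ^ 3) * ∑ L ∈ S, β L * m L * (E K L ^ 3)⁻¹ := by
          rw [hX]
          refine Finset.sum_le_sum fun K hK => ?_
          have h := hs K hK
          calc m K ^ 2 * s K ^ 4 = (m K ^ 2 * s K ^ 3) * s K := by ring
            _ ≤ _ := by gcongr; exact hsβ K hK
      _ = _ := by
          simp only [hV, Finset.mul_sum]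
          rw [Finset.sum_comm]
          refine Finset.sum_congr rfl fun L _ => Finset.sum_congr rfl fun K _ => ?_
          ring
  have h2 : X ^ 2 ≤ B * ∑ L ∈ S, (m L * V L) ^ 2 := by
    calc X ^ 2 ≤ (∑ L ∈ S, β L * (m L * V L)) ^ 2 := by gcongr
      _ ≤ _ := Finset.sum_mul_sq_le_sq_mul_sq _ _ _
  have h3 : ∑ L ∈ S, (m L * V L) ^ 2
      = ∑ K ∈ S, ∑ M ∈ S, (m K ^ 2 * s K ^ 3) * (m M ^ 2 * s M ^ 3)
        * ∑ L ∈ S, m L ^ 2 * ((E K L ^ 3)⁻¹ * (E L M ^ 3)⁻¹) := by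
    have : ∀ L ∈ S, (m L * V L) ^ 2 = ∑ K ∈ S, ∑ M ∈ S, (m K ^ 2 * s K ^ 3) * (m M ^ 2 * s M ^ 3)
        * (m L ^ 2 * ((E K L ^ 3)⁻¹ * (E L M ^ 3)⁻¹)) := by
      intro L _
      rw [mul_pow, sq (V L)]
      simp only [hV]
      rw [Finset.sum_mul_sum, Finset.mul_sum]
      refine Finset.sum_congr rfl fun K _ => ?_
      rw [Finset.mul_sum]
      refine Finset.sum_congr rfl fun M _ => ?_
      rw [hsymm M L]
      ring
    rw [Finset.sum_congr rfl this, Finset.sum_comm]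
    refine Finset.sum_congr rfl fun K _ => ?_
    rw [Finset.sum_comm]
    refine Finset.sum_congr rfl fun M _ => ?_
    rw [Finset.mul_sum]
  have h4 : ∑ L ∈ S, (m L * V L) ^ 2
      ≤ 256 * A * ∑ K ∈ S, ∑ M ∈ S, (m K ^ 2 * s K ^ 3) * (m M ^ 2 * s M ^ 3) / E K M ^ 2 := by
    rw [h3, Finset.mul_sum]
    refine Finset.sum_le_sum fun K hK => ?_
    rw [Finset.mul_sum]
    refine Finset.sum_le_sum fun M hM => ?_
    have hc := kernel_comp_le hE hsymm htri (fun L _ => sq_nonneg (m L)) hA hpack hK hM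
    have h := hs K hK
    have h' := hs M hM
    calc _ ≤ (m K ^ 2 * s K ^ 3) * (m M ^ 2 * s M ^ 3) * (256 * A / E K M ^ 2) := by gcongr
      _ = _ := by ring
  have h5 := hls_diagonal hE hsymm (fun L _ => sq_nonneg (m L)) hA hpack hs hY0 hY2
  have h6 : Y ^ 4 ≤ (512 * A * (1 + 48 * A)) * B * Y ^ 3 := by
    calc Y ^ 4 = X ^ 2 := by rw [← hY2]; ring
      _ ≤ B * (256 * A * (2 * (1 + 48 * A) * Y ^ 3)) := by
          refine h2.trans ?_
          gcongr
          exact h4.trans (by gcongr)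
      _ = _ := by ring
  have h7 : Y ≤ (512 * A * (1 + 48 * A)) * B := by
    rcases hY0.eq_or_lt with h0 | hpos
    · rw [← h0]; positivity
    · have : Y ^ 3 * Y ≤ Y ^ 3 * ((512 * A * (1 + 48 * A)) * B) := by
        calc Y ^ 3 * Y = Y ^ 4 := by ring
          _ ≤ _ := h6
          _ = _ := by ring
      exact le_of_mul_le_mul_left this (by positivity)
  calc X = Y ^ 2 := hY2.symm
    _ ≤ ((512 * A * (1 + 48 * A)) * B) ^ 2 := by gcongr
    _ = _ := by ring

end HLS

/-! ### Inverse inequalities for polynomials -/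

@[fun_prop]
theorem continuous_val (p : Poly) : Continuous (val p) := by
  unfold val
  exact (MvPolynomial.continuous_eval p).comp (by fun_prop)

@[simp] theorem val_add (p q : Poly) (x : Plane) : val (p + q) x = val p x + val q x := by simp [val]
@[simp] theorem val_sub (p q : Poly) (x : Plane) : val (p - q) x = val p x - val q x := by simp [val]
@[simp] theorem val_mul (p q : Poly) (x : Plane) : val (p * q) x = val p x * val q x := by simp [val]
@[simp] theorem val_smul (c : ℝ) (p : Poly) (x : Plane) : val (c • p) x = c * val p x := by simp [val]
@[simp] theorem val_zero (x : Plane) : val 0 x = 0 := by simp [val]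
@[simp] theorem val_C (c : ℝ) (x : Plane) : val (MvPolynomial.C c) x = c := by simp [val]
@[simp] theorem val_sum {ι : Type*} (s : Finset ι) (f : ι → Poly) (x : Plane) :
    val (∑ i ∈ s, f i) x = ∑ i ∈ s, val (f i) x := by simp [val]

theorem val_injective {p q : Poly} (h : ∀ x, val p x = val q x) : p = q := by
  refine MvPolynomial.funext fun y => ?_
  simpa [val] using h (WithLp.toLp 2 y)

/-- The derivative of the function of a polynomial. -/
def valFDeriv (p : Poly) (x : Plane) : Plane →L[ℝ] ℝ :=
  ∑ i, val (grad p i) x • (EuclideanSpace.proj i : Plane →L[ℝ] ℝ)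

theorem valFDeriv_apply (p : Poly) (x e : Plane) :
    valFDeriv p x e = ∑ i, val (grad p i) x * e i := by
  simp [valFDeriv]

theorem continuous_valFDeriv (p : Poly) : Continuous (valFDeriv p) := by
  unfold valFDeriv
  fun_prop

theorem hasFDerivAt_val (p : Poly) (x : Plane) : HasFDerivAt (val p) (valFDeriv p x) x := by
  induction p using MvPolynomial.induction_on with
  | C a =>
    have h1 : val (MvPolynomial.C a) = fun _ : Plane => a := by ext; simp
    have h2 : valFDeriv (MvPolynomial.C a) x = 0 := by simp [valFDeriv, grad]
    rw [h1, h2]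
    exact hasFDerivAt_const a x
  | add p q hp hq =>
    have h1 : val (p + q) = fun y => val p y + val q y := by ext; simp
    have h2 : valFDeriv (p + q) x = valFDeriv p x + valFDeriv q x := by
      ext e; simp [valFDeriv_apply, grad]; ring
    rw [h1, h2]
    exact hp.add hq
  | mul_X p i hp =>
    have h1 : val (p * MvPolynomial.X i) = fun y : Plane => val p y * y i := by
      ext; simp [val]
    have h2 : valFDeriv (p * MvPolynomial.X i) x
        = val p x • (EuclideanSpace.proj i : Plane →L[ℝ] ℝ) + x i • valFDeriv p x := by
      ext e
      fin_cases i <;>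
      simp [valFDeriv_apply, grad, MvPolynomial.pderiv_X, val, Pi.single_apply] <;> ring
    rw [h1, h2]
    exact hp.mul (EuclideanSpace.proj i : Plane →L[ℝ] ℝ).hasFDerivAt

theorem totalDegree_grad_le {p : Poly} {k : ℕ} (hp : p.totalDegree ≤ k) (i : Fin 2) :
    (grad p i).totalDegree ≤ k := by
  rw [grad, p.as_sum, map_sum]
  refine MvPolynomial.totalDegree_finsetSum_le fun v hv => ?_
  rw [MvPolynomial.pderiv_monomial]
  refine (MvPolynomial.totalDegree_monomial_le _ _).trans ?_
  refine le_trans ?_ ((MvPolynomial.le_totalDegree hv).trans hp)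
  rw [Finsupp.sum_fintype _ _ (fun _ => rfl), Finsupp.sum_fintype _ _ (fun _ => rfl)]
  exact Finset.sum_le_sum fun j _ => by simp

/-- Composition with the affine map `y ↦ x + r y`. -/
def rescale (x : Plane) (r : ℝ) (p : Poly) : Poly :=
  MvPolynomial.aeval (fun i => MvPolynomial.C (x i) + MvPolynomial.C r * MvPolynomial.X i) p

theorem val_rescale (x : Plane) (r : ℝ) (p : Poly) (y : Plane) :
    val (rescale x r p) y = val p (x + r • y) := by
  unfold val rescale
  induction p using MvPolynomial.induction_on with
  | C a => simp
  | add p q hp hq => rw [map_add, map_add, map_add, hp, hq]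
  | mul_X p i hp =>
    rw [map_mul, map_mul, map_mul, hp]
    simp

theorem totalDegree_rescale_le (x : Plane) (r : ℝ) (p : Poly) :
    (rescale x r p).totalDegree ≤ p.totalDegree := by
  conv_lhs => rw [rescale, p.as_sum, map_sum]
  refine MvPolynomial.totalDegree_finsetSum_le fun v hv => ?_
  rw [MvPolynomial.aeval_monomial, MvPolynomial.algebraMap_eq]
  refine (MvPolynomial.totalDegree_mul _ _).trans ?_
  rw [MvPolynomial.totalDegree_C, zero_add]
  refine le_trans ?_ (MvPolynomial.le_totalDegree hv)
  refine (MvPolynomial.totalDegree_finsetProd _ _).trans ?_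
  refine Finset.sum_le_sum fun i _ => ?_
  refine (MvPolynomial.totalDegree_pow _ _).trans ?_
  have : (MvPolynomial.C (x i) + MvPolynomial.C r * MvPolynomial.X i : Poly).totalDegree ≤ 1 := by
    refine (MvPolynomial.totalDegree_add _ _).trans (max_le ?_ ?_)
    · rw [MvPolynomial.totalDegree_C]; exact zero_le_one
    · refine (MvPolynomial.totalDegree_mul _ _).trans ?_
      rw [MvPolynomial.totalDegree_C, zero_add, MvPolynomial.totalDegree_X]
  simpa using Nat.mul_le_mul_left (v i) this

theorem val_grad_rescale (x : Plane) (r : ℝ) (p : Poly) (i : Fin 2) (y : Plane) :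
    val (grad (rescale x r p) i) y = r * val (grad p i) (x + r • y) := by
  have h1 := hasFDerivAt_val (rescale x r p) y
  have h2 : HasFDerivAt (fun z : Plane => x + r • z) (r • ContinuousLinearMap.id ℝ Plane) y :=
    ((hasFDerivAt_id y).const_smul r).const_add x
  have h3 := (hasFDerivAt_val p (x + r • y)).comp y h2
  have h4 : val (rescale x r p) = val p ∘ fun z : Plane => x + r • z := by
    ext z; exact val_rescale x r p z
  rw [h4] at h1
  have h5 := congrArg (fun l : Plane →L[ℝ] ℝ => l (EuclideanSpace.single i 1)) (h1.unique h3)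
  simp only [ContinuousLinearMap.comp_apply, smul_apply, valFDeriv_apply,
    ContinuousLinearMap.id_apply, map_smul] at h5
  simpa [PiLp.single_apply] using h5

/-- The polynomials of degree at most `k`. -/
abbrev PolyLe (k : ℕ) : Submodule ℝ Poly := MvPolynomial.restrictTotalDegree (Fin 2) ℝ k

theorem memLp_val (p : Poly) {S : Set Plane} (hS : IsCompact S) :
    MemLp (val p) 2 (volume.restrict S) := by
  have : IsFiniteMeasure (volume.restrict S) := ⟨by simpa using hS.measure_lt_top⟩
  obtain ⟨C, hC⟩ := hS.exists_bound_of_continuousOn (continuous_val p).continuousOn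
  refine MemLp.of_bound (continuous_val p).aestronglyMeasurable C ?_
  exact (ae_restrict_mem hS.isClosed.measurableSet).mono hC

theorem eq_zero_of_ae_eq_zero {p : Poly}
    (h : val p =ᵐ[volume.restrict (Metric.closedBall 0 1)] 0) : p = 0 := by
  have h1 : val p =ᵐ[volume.restrict (Metric.ball (0 : Plane) 1)] 0 :=
    ae_mono (Measure.restrict_mono Metric.ball_subset_closedBall le_rfl) h
  have h2 := Measure.eqOn_open_of_ae_eq h1 Metric.isOpen_ball (continuous_val p).continuousOn
    continuousOn_const
  refine MvPolynomial.funext_set (fun _ => Set.Ioo (-(1 / 2) : ℝ) (1 / 2))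
    (fun _ => Set.Ioo_infinite (by norm_num)) fun y hy => ?_
  have hy0 := hy 0 (Set.mem_univ _)
  have hy1 := hy 1 (Set.mem_univ _)
  have h3 := h2 (x := WithLp.toLp 2 y) (by
    rw [mem_ball_zero_iff, ← sq_lt_one_iff₀ (norm_nonneg _), norm_sq_plane]
    have e0 : (WithLp.toLp 2 y : Plane) 0 = y 0 := rfl
    have e1 : (WithLp.toLp 2 y : Plane) 1 = y 1 := rfl
    rw [e0, e1]
    nlinarith [hy0.1, hy0.2, hy1.1, hy1.2])
  simpa [val] using h3

/-- The embedding of the polynomials of degree at most `k` into `L²` of the unit disc. -/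
def toL2 (k : ℕ) : PolyLe k →ₗ[ℝ] Lp ℝ 2 (volume.restrict (Metric.closedBall (0 : Plane) 1)) where
  toFun p := (memLp_val (p : Poly) (isCompact_closedBall 0 1)).toLp _
  map_add' p q := by
    rw [← MemLp.toLp_add]
    exact MemLp.toLp_congr _ _ (Eventually.of_forall fun x => by simp)
  map_smul' c p := by
    rw [RingHom.id_apply, ← MemLp.toLp_const_smul]
    exact MemLp.toLp_congr _ _ (Eventually.of_forall fun x => by simp)

theorem toL2_injective (k : ℕ) : Function.Injective (toL2 k) := by
  rw [← LinearMap.ker_eq_bot, LinearMap.ker_eq_bot']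
  intro p hp
  have h1 := (memLp_val (p : Poly) (isCompact_closedBall (0 : Plane) 1)).coeFn_toLp
  have h2 : (memLp_val (p : Poly) (isCompact_closedBall (0 : Plane) 1)).toLp _ = 0 := hp
  rw [h2] at h1
  exact Subtype.ext (eq_zero_of_ae_eq_zero (h1.symm.trans (Lp.coeFn_zero _ _ _)))

theorem norm_sq_toL2 (k : ℕ) (p : PolyLe k) :
    ‖toL2 k p‖ ^ 2 = ∫ x in Metric.closedBall (0 : Plane) 1, val (p : Poly) x ^ 2 := by
  rw [← real_inner_self_eq_norm_sq, L2.inner_def]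
  refine integral_congr_ae ?_
  filter_upwards [(memLp_val (p : Poly) (isCompact_closedBall (0 : Plane) 1)).coeFn_toLp] with x hx
  have : (toL2 k p : Plane → ℝ) x = val (p : Poly) x := hx
  rw [this]
  simp [sq]

/-- A linear map on the polynomials of degree at most `k` is bounded in terms of the `L²` norm on the
unit disc. -/
theorem exists_bound_linear {k : ℕ} {F : Type*} [NormedAddCommGroup F] [NormedSpace ℝ F]
    (L : PolyLe k →ₗ[ℝ] F) : ∃ C : ℝ, 0 < C ∧ ∀ p : PolyLe k,
      ‖L p‖ ^ 2 ≤ C * ∫ x in Metric.closedBall (0 : Plane) 1, val (p : Poly) x ^ 2 := by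
  set e := LinearEquiv.ofInjective (toL2 k) (toL2_injective k) with he
  have hfin : FiniteDimensional ℝ (LinearMap.range (toL2 k)) := e.finiteDimensional
  set M : LinearMap.range (toL2 k) →L[ℝ] F := (L ∘ₗ e.symm.toLinearMap).toContinuousLinearMap with hM
  refine ⟨‖M‖ ^ 2 + 1, by positivity, fun p => ?_⟩
  have h1 : L p = M (e p) := by simp [hM]
  have h2 : ‖e p‖ = ‖toL2 k p‖ := rfl
  rw [← norm_sq_toL2, h1, ← h2]
  have h3 : ‖M (e p)‖ ^ 2 ≤ (‖M‖ * ‖e p‖) ^ 2 := by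
    gcongr
    exact M.le_opNorm _
  nlinarith [sq_nonneg ‖e p‖]

theorem integral_closedBall_comp (f : Plane → ℝ) (x : Plane) {r : ℝ} (hr : 0 < r) :
    ∫ y in Metric.closedBall (0 : Plane) 1, f (x + r • y)
      = (r ^ 2)⁻¹ * ∫ y in Metric.closedBall x r, f y := by
  have h1 := Measure.setIntegral_comp_smul_of_pos (volume : Measure Plane) (fun z => f (x + z))
    (Metric.closedBall (0 : Plane) 1) hr
  rw [h1, smul_closedBall _ _ zero_le_one, smul_zero, mul_one, Real.norm_of_nonneg hr.le,
    finrank_euclideanSpace_fin, smul_eq_mul]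
  congr 1
  have h2 := (measurePreserving_add_left (volume : Measure Plane) x).setIntegral_preimage_emb
    (measurableEmbedding_addLeft x) f (Metric.closedBall x r)
  rw [← h2]
  congr 2
  ext z
  simp

/-- Pointwise bound of a polynomial and of its gradient by the `L²` norm on a disc, with the scaling in
the radius. -/
theorem exists_pointwise_bound (k : ℕ) (s : ℝ) : ∃ C : ℝ, 0 < C ∧ ∀ p : Poly, p.totalDegree ≤ k →
    ∀ (x : Plane) (r : ℝ), 0 < r → ∀ y ∈ Metric.closedBall x (s * r),
      val p y ^ 2 ≤ C / r ^ 2 * ∫ z in Metric.closedBall x r, val p z ^ 2 ∧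
      ∀ i, val (grad p i) y ^ 2 ≤ C / r ^ 4 * ∫ z in Metric.closedBall x r, val p z ^ 2 := by
  have : CompactSpace (Metric.closedBall (0 : Plane) s) :=
    isCompact_iff_compactSpace.1 (isCompact_closedBall _ _)
  set L0 : PolyLe k →ₗ[ℝ] C(Metric.closedBall (0 : Plane) s, ℝ) :=
    { toFun := fun p => ⟨fun y => val (p : Poly) y, by fun_prop⟩
      map_add' := fun p q => by ext; simp
      map_smul' := fun c p => by ext; simp }
  set L1 : Fin 2 → PolyLe k →ₗ[ℝ] C(Metric.closedBall (0 : Plane) s, ℝ) := fun i =>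
    { toFun := fun p => ⟨fun y => val (grad (p : Poly) i) y, by fun_prop⟩
      map_add' := fun p q => by ext; simp [grad]
      map_smul' := fun c p => by ext; simp [grad] }
  obtain ⟨C0, hC0, h0⟩ := exists_bound_linear L0
  choose C1 hC1 h1 using fun i => exists_bound_linear (L1 i)
  refine ⟨C0 + ∑ i, C1 i, by
    have := Finset.sum_nonneg fun i (_ : i ∈ Finset.univ) => (hC1 i).le
    linarith, fun p hp x r hr y hy => ?_⟩
  have hdeg : rescale x r p ∈ PolyLe k :=
    (MvPolynomial.mem_restrictTotalDegree _ _ _).2 ((totalDegree_rescale_le x r p).trans hp)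
  have hz : r⁻¹ • (y - x) ∈ Metric.closedBall (0 : Plane) s := by
    rw [mem_closedBall_zero_iff, norm_smul, Real.norm_of_nonneg (by positivity),
      inv_mul_le_iff₀ hr, mul_comm]
    rwa [mem_closedBall_iff_norm] at hy
  have hzy : x + r • (r⁻¹ • (y - x)) = y := by
    rw [smul_smul, mul_inv_cancel₀ hr.ne', one_smul, add_sub_cancel]
  have hI : ∫ z in Metric.closedBall (0 : Plane) 1, val (rescale x r p) z ^ 2
      = (r ^ 2)⁻¹ * ∫ z in Metric.closedBall x r, val p z ^ 2 := by
    rw [← integral_closedBall_comp (fun z => val p z ^ 2) x hr]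
    simp only [val_rescale]
  have hI0 : 0 ≤ ∫ z in Metric.closedBall x r, val p z ^ 2 :=
    integral_nonneg fun z => sq_nonneg _
  constructor
  · have h := h0 ⟨_, hdeg⟩
    rw [hI] at h
    have h2 := (L0 ⟨_, hdeg⟩).norm_coe_le_norm ⟨_, hz⟩
    have h3 : L0 ⟨_, hdeg⟩ ⟨_, hz⟩ = val p y := by
      change val (rescale x r p) (r⁻¹ • (y - x)) = _
      rw [val_rescale, hzy]
    rw [h3, Real.norm_eq_abs] at h2
    have hsum : 0 ≤ ∑ i, C1 i := Finset.sum_nonneg fun i _ => (hC1 i).le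
    calc val p y ^ 2 = |val p y| ^ 2 := (sq_abs _).symm
      _ ≤ ‖L0 ⟨_, hdeg⟩‖ ^ 2 := by gcongr
      _ ≤ C0 * ((r ^ 2)⁻¹ * ∫ z in Metric.closedBall x r, val p z ^ 2) := h
      _ ≤ (C0 + ∑ i, C1 i) * ((r ^ 2)⁻¹ * ∫ z in Metric.closedBall x r, val p z ^ 2) := by
        gcongr; linarith
      _ = _ := by ring
  · intro i
    have h := h1 i ⟨_, hdeg⟩
    rw [hI] at h
    have h2 := (L1 i ⟨_, hdeg⟩).norm_coe_le_norm ⟨_, hz⟩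
    have h3 : L1 i ⟨_, hdeg⟩ ⟨_, hz⟩ = r * val (grad p i) y := by
      change val (grad (rescale x r p) i) (r⁻¹ • (y - x)) = _
      rw [val_grad_rescale, hzy]
    rw [h3, Real.norm_eq_abs] at h2
    have hsum : C1 i ≤ ∑ i, C1 i :=
      Finset.single_le_sum (f := C1) (fun i _ => (hC1 i).le) (Finset.mem_univ i)
    have h4 : (r * val (grad p i) y) ^ 2
        ≤ (C0 + ∑ i, C1 i) * ((r ^ 2)⁻¹ * ∫ z in Metric.closedBall x r, val p z ^ 2) :=
      calc (r * val (grad p i) y) ^ 2 = |r * val (grad p i) y| ^ 2 := (sq_abs _).symm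
      _ ≤ ‖L1 i ⟨_, hdeg⟩‖ ^ 2 := by gcongr
      _ ≤ C1 i * ((r ^ 2)⁻¹ * ∫ z in Metric.closedBall x r, val p z ^ 2) := h
      _ ≤ _ := by gcongr; linarith
    calc val (grad p i) y ^ 2 = (r ^ 2)⁻¹ * (r * val (grad p i) y) ^ 2 := by field_simp
      _ ≤ (r ^ 2)⁻¹ * ((C0 + ∑ i, C1 i) * ((r ^ 2)⁻¹ * ∫ z in Metric.closedBall x r, val p z ^ 2)) := by
        gcongr
      _ = _ := by field_simp

/-! ### Integrals over a cell and over its boundary -/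

/-- The integral over the triangle `K`. -/
def cellInt (K : Finset Plane) (f : Plane → ℝ) : ℝ := ∫ x in hull K, f x

/-- The integral over the boundary of the triangle `K`, with an integrand for each edge. -/
def bdryInt (K : Finset Plane) (f : Finset Plane → Plane → ℝ) : ℝ :=
  ∑ E ∈ edges K, ∫ x in hull E, f E x ∂(Measure.hausdorffMeasure 1)

theorem integrableOn_hull (K : Finset Plane) {f : Plane → ℝ} (hf : ContinuousOn f (hull K)) :
    IntegrableOn f (hull K) := hf.integrableOn_compact (isCompact_hull K)

theorem integrableOn_edge {K E : Finset Plane} (hE : E ∈ edges K) {f : Plane → ℝ}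
    (hf : ContinuousOn f (hull E)) :
    IntegrableOn f (hull E) (Measure.hausdorffMeasure 1) := by
  obtain ⟨C, hC⟩ := (isCompact_hull E).exists_bound_of_continuousOn hf
  have : IsFiniteMeasure ((Measure.hausdorffMeasure 1 : Measure Plane).restrict (hull E)) :=
    ⟨by simpa using (hausdorff_edge hE).2⟩
  exact Integrable.of_bound (hf.aestronglyMeasurable (measurableSet_hull E)) C
    ((ae_restrict_mem (measurableSet_hull E)).mono hC)

section
variable {K : Finset Plane} {f g : Plane → ℝ} {F G : Finset Plane → Plane → ℝ}

theorem cellInt_add (hf : Continuous f) (hg : Continuous g) :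
    cellInt K (fun x => f x + g x) = cellInt K f + cellInt K g :=
  integral_add (integrableOn_hull K hf.continuousOn) (integrableOn_hull K hg.continuousOn)

theorem cellInt_sub (hf : Continuous f) (hg : Continuous g) :
    cellInt K (fun x => f x - g x) = cellInt K f - cellInt K g :=
  integral_sub (integrableOn_hull K hf.continuousOn) (integrableOn_hull K hg.continuousOn)

theorem cellInt_const_mul (c : ℝ) (f : Plane → ℝ) :
    cellInt K (fun x => c * f x) = c * cellInt K f := integral_const_mul c f

theorem cellInt_mono (hf : Continuous f) (hg : Continuous g) (h : ∀ x ∈ hull K, f x ≤ g x) :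
    cellInt K f ≤ cellInt K g :=
  setIntegral_mono_on (integrableOn_hull K hf.continuousOn) (integrableOn_hull K hg.continuousOn)
    (measurableSet_hull K) h

theorem cellInt_nonneg (h : ∀ x, 0 ≤ f x) : 0 ≤ cellInt K f := integral_nonneg h

theorem cellInt_congr (h : ∀ x, f x = g x) : cellInt K f = cellInt K g := by
  rw [funext h]

theorem cellInt_const (c : ℝ) : cellInt K (fun _ => c) = volume.real (hull K) * c := by
  simp [cellInt]

theorem bdryInt_add (hF : ∀ E, Continuous (F E)) (hG : ∀ E, Continuous (G E)) :
    bdryInt K (fun E x => F E x + G E x) = bdryInt K F + bdryInt K G := by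
  simp only [bdryInt]
  rw [← Finset.sum_add_distrib]
  exact Finset.sum_congr rfl fun E hE => integral_add (integrableOn_edge hE (hF E).continuousOn)
    (integrableOn_edge hE (hG E).continuousOn)

theorem bdryInt_const_mul (c : ℝ) (F : Finset Plane → Plane → ℝ) :
    bdryInt K (fun E x => c * F E x) = c * bdryInt K F := by
  simp only [bdryInt, integral_const_mul, Finset.mul_sum]

theorem bdryInt_sub (hF : ∀ E, Continuous (F E)) (hG : ∀ E, Continuous (G E)) :
    bdryInt K (fun E x => F E x - G E x) = bdryInt K F - bdryInt K G := by
  have h1 : (fun (E : Finset Plane) x => F E x - G E x) = fun E x => F E x + (-1) * G E x := by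
    ext E x; ring
  rw [h1, bdryInt_add (G := fun E x => (-1) * G E x) hF (fun E => continuous_const.mul (hG E)),
    bdryInt_const_mul]
  ring

theorem bdryInt_mono_of_continuousOn (hF : ∀ E ∈ edges K, ContinuousOn (F E) (hull E))
    (hG : ∀ E ∈ edges K, ContinuousOn (G E) (hull E))
    (h : ∀ E ∈ edges K, ∀ x ∈ hull E, F E x ≤ G E x) : bdryInt K F ≤ bdryInt K G :=
  Finset.sum_le_sum fun E hE => setIntegral_mono_on (integrableOn_edge hE (hF E hE))
    (integrableOn_edge hE (hG E hE)) (measurableSet_hull E) (h E hE)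

theorem bdryInt_mono (hF : ∀ E, Continuous (F E)) (hG : ∀ E, Continuous (G E))
    (h : ∀ E ∈ edges K, ∀ x ∈ hull E, F E x ≤ G E x) : bdryInt K F ≤ bdryInt K G :=
  bdryInt_mono_of_continuousOn (fun E _ => (hF E).continuousOn) (fun E _ => (hG E).continuousOn) h

theorem bdryInt_nonneg (h : ∀ E ∈ edges K, ∀ x, 0 ≤ F E x) : 0 ≤ bdryInt K F :=
  Finset.sum_nonneg fun E hE => integral_nonneg (h E hE)

theorem bdryInt_congr (h : ∀ E ∈ edges K, ∀ x, F E x = G E x) : bdryInt K F = bdryInt K G :=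
  Finset.sum_congr rfl fun E hE => by rw [funext (h E hE)]

theorem card_edges (h3 : K.card = 3) : (edges K).card = 3 := by
  rw [edges, Finset.card_powersetCard, h3]; decide

theorem bdryInt_const_le (h3 : K.card = 3) {c : ℝ} (hc : 0 ≤ c) :
    bdryInt K (fun _ _ => c) ≤ 3 * hK K * c := by
  have : ∀ E ∈ edges K, ∫ _ in hull E, c ∂(Measure.hausdorffMeasure 1 : Measure Plane)
      ≤ hK K * c := by
    intro E hE
    rw [setIntegral_const, smul_eq_mul]
    exact mul_le_mul_of_nonneg_right (hausdorff_edge hE).1 hc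
  calc bdryInt K (fun _ _ => c) ≤ (edges K).card • (hK K * c) :=
        Finset.sum_le_card_nsmul _ _ _ this
    _ = _ := by rw [card_edges h3]; simp; ring

theorem sq_integral_le {α : Type*} [MeasurableSpace α] {μ : Measure α} [IsFiniteMeasure μ]
    {f : α → ℝ} (hf : Integrable f μ) (hf2 : Integrable (fun x => f x ^ 2) μ) :
    (∫ x, f x ∂μ) ^ 2 ≤ μ.real Set.univ * ∫ x, f x ^ 2 ∂μ := by
  set V := μ.real Set.univ with hV
  set I := ∫ x, f x ∂μ with hI
  have h1 : 0 ≤ ∫ x, (V * f x - I) ^ 2 ∂μ := integral_nonneg fun x => sq_nonneg _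
  have h2 : ∫ x, (V * f x - I) ^ 2 ∂μ = V ^ 2 * ∫ x, f x ^ 2 ∂μ - V * I ^ 2 := by
    have e : (fun x => (V * f x - I) ^ 2) = fun x => V ^ 2 * f x ^ 2 + ((-2 * V * I) * f x + I ^ 2) := by
      ext x; ring
    rw [e, integral_add (f := fun x => V ^ 2 * f x ^ 2)
        (g := fun x => (-2 * V * I) * f x + I ^ 2) (hf2.const_mul _)
        ((hf.const_mul _).add (integrable_const _)),
      integral_add (f := fun x => (-2 * V * I) * f x) (g := fun _ => I ^ 2) (hf.const_mul _)
        (integrable_const _), integral_const_mul, integral_const_mul,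
      integral_const, smul_eq_mul, ← hI, ← hV]
    ring
  rw [h2] at h1
  have hV0 : 0 ≤ V := measureReal_nonneg
  rcases hV0.eq_or_lt with h0 | hpos
  · have : μ = 0 := by
      rw [← Measure.measure_univ_eq_zero]
      exact (measureReal_eq_zero_iff).1 (hV.symm.trans h0.symm)
    have hI0 : I = 0 := by rw [hI, this]; simp
    rw [hI0, ← h0]; simp
  · have : 0 ≤ V * (V * ∫ x, f x ^ 2 ∂μ - I ^ 2) := by linarith
    have := nonneg_of_mul_nonneg_right this hpos
    linarith

theorem sq_cellInt_le (hf : Continuous f) :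
    cellInt K f ^ 2 ≤ volume.real (hull K) * cellInt K (fun x => f x ^ 2) := by
  have : IsFiniteMeasure (volume.restrict (hull K)) := ⟨by simpa using volume_hull_lt_top K⟩
  have := sq_integral_le (μ := volume.restrict (hull K)) (integrableOn_hull K hf.continuousOn)
    (integrableOn_hull K (hf.pow 2).continuousOn)
  simpa [cellInt] using this

theorem sq_bdryInt_le (h3 : K.card = 3) (hF : ∀ E, Continuous (F E)) :
    bdryInt K F ^ 2 ≤ 3 * hK K * bdryInt K (fun E x => F E x ^ 2) := by
  have h1 := sq_sum_le_card_mul_sum_sq (s := edges K)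
    (f := fun E => ∫ x in hull E, F E x ∂(Measure.hausdorffMeasure 1))
  rw [card_edges h3] at h1
  refine h1.trans ?_
  rw [bdryInt, mul_assoc, Finset.mul_sum (a := hK K)]
  push_cast
  gcongr with E hE
  have : IsFiniteMeasure ((Measure.hausdorffMeasure 1 : Measure Plane).restrict (hull E)) :=
    ⟨by simpa using (hausdorff_edge hE).2⟩
  have h2 := sq_integral_le (μ := (Measure.hausdorffMeasure 1 : Measure Plane).restrict (hull E))
    (integrableOn_edge hE (hF E).continuousOn) (integrableOn_edge hE ((hF E).pow 2).continuousOn)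
  refine h2.trans ?_
  refine mul_le_mul_of_nonneg_right ?_ (integral_nonneg fun x => sq_nonneg _)
  simpa using (hausdorff_edge hE).1

end

/-- The normal component `v · n` of a polynomial vector field. -/
def normalComp (v : Fin 2 → Poly) (n : Plane) (x : Plane) : ℝ := ∑ i, val (v i) x * n i

@[fun_prop]
theorem continuous_normalComp (v : Fin 2 → Poly) (n : Plane) : Continuous (normalComp v n) := by
  unfold normalComp; fun_prop

theorem normalComp_sq_le (v : Fin 2 → Poly) {n : Plane} (hn : ‖n‖ = 1) (x : Plane) :
    normalComp v n x ^ 2 ≤ ∑ i, val (v i) x ^ 2 := by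
  have h : ‖n‖ ^ 2 = 1 := by rw [hn]; norm_num
  rw [norm_sq_plane] at h
  unfold normalComp
  rw [Fin.sum_univ_two, Fin.sum_univ_two]
  nlinarith [sq_nonneg (val (v 0) x * n 1 - val (v 1) x * n 0), sq_nonneg (val (v 0) x),
    sq_nonneg (val (v 1) x)]

/-- Integration by parts on a triangle. -/
theorem integration_by_parts {K : Finset Plane} (hK : IsTriangle K) (p : Poly) (v : Fin 2 → Poly) :
    cellInt K (fun x => ∑ i, val (grad p i) x * val (v i) x)
      + cellInt K (fun x => val p x * val (dvg v) x)
      = bdryInt K (fun E x => val p x * normalComp v (normal K E) x) := by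
  have h : ∀ i : Fin 2, cellInt K (fun x => val (grad p i) x * val (v i) x
      + val p x * val (MvPolynomial.pderiv i (v i)) x)
      = bdryInt K (fun E x => val p x * val (v i) x * normal K E i) := by
    intro i
    have h1 := divergence_theorem hK.1 hK.2 (F := val (p * v i)) (F' := valFDeriv (p * v i))
      (fun x _ => hasFDerivAt_val _ x) (continuous_valFDeriv _).continuousOn
      (EuclideanSpace.single i 1)
    have e1 : ∀ x, valFDeriv (p * v i) x (EuclideanSpace.single i 1)
        = val (grad p i) x * val (v i) x + val p x * val (MvPolynomial.pderiv i (v i)) x := by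
      intro x
      rw [valFDeriv_apply]
      simp only [PiLp.single_apply, mul_ite, mul_one, mul_zero, Finset.sum_ite_eq', Finset.mem_univ,
        if_true]
      simp [grad]
      ring
    rw [cellInt, ← funext e1, h1, bdryInt]
    refine Finset.sum_congr rfl fun E _ => ?_
    have e2 : inner ℝ (normal K E) (EuclideanSpace.single i 1 : Plane) = normal K E i := by
      rw [inner_plane]
      fin_cases i <;> simp
    rw [e2, ← integral_mul_const]
    simp
  have h2 : cellInt K (fun x => ∑ i, val (grad p i) x * val (v i) x)
      + cellInt K (fun x => val p x * val (dvg v) x)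
      = ∑ i, cellInt K (fun x => val (grad p i) x * val (v i) x
      + val p x * val (MvPolynomial.pderiv i (v i)) x) := by
    rw [← cellInt_add (by fun_prop) (by fun_prop), Fin.sum_univ_two,
      ← cellInt_add (by fun_prop) (by fun_prop)]
    refine cellInt_congr fun x => ?_
    simp only [dvg, Fin.sum_univ_two, val_add]
    ring
  rw [h2, Fin.sum_univ_two, h 0, h 1, ← bdryInt_add (by fun_prop) (by fun_prop)]
  refine bdryInt_congr fun E _ x => ?_
  simp only [normalComp, Fin.sum_univ_two]
  ring

/-! ### Estimates on one triangle -/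

/-- The constant in `exists_pointwise_bound`. -/
def polyConst (k : ℕ) (s : ℝ) : ℝ := (exists_pointwise_bound k s).choose

theorem polyConst_pos (k : ℕ) (s : ℝ) : 0 < polyConst k s :=
  (exists_pointwise_bound k s).choose_spec.1

section
variable {K : Finset Plane} {x : Plane} {r s : ℝ} {k : ℕ}

theorem hull_subset_closedBall (hr : 0 < r) (hball : Metric.closedBall x r ⊆ hull K)
    (hs : hK K ≤ s * r) : hull K ⊆ Metric.closedBall x (s * r) := fun _ hy =>
  (dist_le_hK hy (hball (Metric.mem_closedBall_self hr.le))).trans hs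

theorem integral_disc_le (hball : Metric.closedBall x r ⊆ hull K) (p : Poly) :
    ∫ z in Metric.closedBall x r, val p z ^ 2 ≤ cellInt K (fun z => val p z ^ 2) :=
  setIntegral_mono_set (integrableOn_hull K (by fun_prop))
    (Eventually.of_forall fun z => sq_nonneg _) (LE.le.eventuallyLE hball)

theorem val_sq_le (hr : 0 < r) (hball : Metric.closedBall x r ⊆ hull K) (hs : hK K ≤ s * r)
    {p : Poly} (hp : p.totalDegree ≤ k) {y : Plane} (hy : y ∈ hull K) :
    val p y ^ 2 ≤ polyConst k s / r ^ 2 * cellInt K (fun z => val p z ^ 2) := by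
  have h := ((exists_pointwise_bound k s).choose_spec.2 p hp x r hr y
    (hull_subset_closedBall hr hball hs hy)).1
  refine h.trans ?_
  have := polyConst_pos k s
  exact mul_le_mul_of_nonneg_left (integral_disc_le hball p) (div_nonneg this.le (by positivity))

theorem grad_sq_le (hr : 0 < r) (hball : Metric.closedBall x r ⊆ hull K) (hs : hK K ≤ s * r)
    {p : Poly} (hp : p.totalDegree ≤ k) {y : Plane} (hy : y ∈ hull K) (i : Fin 2) :
    val (grad p i) y ^ 2 ≤ polyConst k s / r ^ 4 * cellInt K (fun z => val p z ^ 2) := by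
  have h := ((exists_pointwise_bound k s).choose_spec.2 p hp x r hr y
    (hull_subset_closedBall hr hball hs hy)).2 i
  refine h.trans ?_
  have := polyConst_pos k s
  exact mul_le_mul_of_nonneg_left (integral_disc_le hball p) (div_nonneg this.le (by positivity))

/-- The discrete trace inequality. -/
theorem bdryInt_sq_le (h3 : K.card = 3) (hr : 0 < r) (hball : Metric.closedBall x r ⊆ hull K)
    (hs : hK K ≤ s * r) {p : Poly} (hp : p.totalDegree ≤ k) :
    bdryInt K (fun _ y => val p y ^ 2)
      ≤ 3 * s * polyConst k s / r * cellInt K (fun z => val p z ^ 2) := by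
  have hC := polyConst_pos k s
  have hI : 0 ≤ cellInt K (fun z => val p z ^ 2) := cellInt_nonneg fun z => sq_nonneg _
  have h1 : bdryInt K (fun _ y => val p y ^ 2)
      ≤ bdryInt K (fun _ _ => polyConst k s / r ^ 2 * cellInt K (fun z => val p z ^ 2)) :=
    bdryInt_mono (by fun_prop) (by fun_prop) fun E hE y hy =>
      val_sq_le hr hball hs hp (hull_edge_subset hE hy)
  refine h1.trans ((bdryInt_const_le h3 (by positivity)).trans ?_)
  calc _ ≤ 3 * (s * r) * (polyConst k s / r ^ 2 * cellInt K (fun z => val p z ^ 2)) := by gcongr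
    _ = _ := by field_simp

/-- The inverse inequality for the gradient. -/
theorem cellInt_grad_sq_le (hr : 0 < r) (hball : Metric.closedBall x r ⊆ hull K)
    (hs : hK K ≤ s * r) {p : Poly} (hp : p.totalDegree ≤ k) :
    cellInt K (fun y => ∑ i, val (grad p i) y ^ 2)
      ≤ 2 * Real.pi * s ^ 2 * polyConst k s / r ^ 2 * cellInt K (fun z => val p z ^ 2) := by
  have hC := polyConst_pos k s
  have hI : 0 ≤ cellInt K (fun z => val p z ^ 2) := cellInt_nonneg fun z => sq_nonneg _
  have h1 : cellInt K (fun y => ∑ i, val (grad p i) y ^ 2)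
      ≤ cellInt K (fun _ => 2 * (polyConst k s / r ^ 4 * cellInt K (fun z => val p z ^ 2))) :=
    cellInt_mono (by fun_prop) (by fun_prop) fun y hy => by
      rw [Fin.sum_univ_two]
      linarith [grad_sq_le hr hball hs hp hy 0, grad_sq_le hr hball hs hp hy 1]
  have h2 := volume_hull_le (hball (Metric.mem_closedBall_self hr.le))
  have h3 : hK K ^ 2 ≤ (s * r) ^ 2 := by
    have : 0 ≤ hK K := Metric.diam_nonneg
    gcongr
  rw [cellInt_const] at h1
  have hpi := Real.pi_pos
  calc _ ≤ _ := h1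
    _ ≤ (Real.pi * (s * r) ^ 2) * (2 * (polyConst k s / r ^ 4 * cellInt K (fun z => val p z ^ 2))) := by
      gcongr
      exact h2.trans (by gcongr)
    _ = _ := by field_simp

/-- The oscillation of a polynomial on a triangle is bounded by the `L²` norm of its gradient. -/
theorem osc_sq_le (hr : 0 < r) (hball : Metric.closedBall x r ⊆ hull K) (hs : hK K ≤ s * r)
    {p : Poly} (hp : p.totalDegree ≤ k) {y z : Plane} (hy : y ∈ hull K) (hz : z ∈ hull K) :
    (val p y - val p z) ^ 2
      ≤ s ^ 2 * polyConst k s * cellInt K (fun w => ∑ i, val (grad p i) w ^ 2) := by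
  have hC := polyConst_pos k s
  set I := cellInt K (fun w => ∑ i, val (grad p i) w ^ 2) with hI
  have hI0 : 0 ≤ I := cellInt_nonneg fun w => Finset.sum_nonneg fun i _ => sq_nonneg _
  set B := Real.sqrt (polyConst k s / r ^ 2 * I) with hB
  have hB2 : B ^ 2 = polyConst k s / r ^ 2 * I := Real.sq_sqrt (by positivity)
  have hB0 : 0 ≤ B := Real.sqrt_nonneg _
  have hder : ∀ w ∈ hull K, ‖valFDeriv p w‖ ≤ B := by
    intro w hw
    have h1 : ∑ i, val (grad p i) w ^ 2 ≤ B ^ 2 := by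
      rw [hB2, hI]
      have e : cellInt K (fun w => ∑ i, val (grad p i) w ^ 2)
          = ∑ i, cellInt K (fun w => val (grad p i) w ^ 2) := by
        simp only [Fin.sum_univ_two]
        exact cellInt_add (by fun_prop) (by fun_prop)
      rw [e, Finset.mul_sum]
      exact Finset.sum_le_sum fun i _ =>
        val_sq_le hr hball hs (totalDegree_grad_le hp i) hw
    refine ContinuousLinearMap.opNorm_le_bound _ hB0 fun e => ?_
    rw [valFDeriv_apply, Real.norm_eq_abs]
    refine abs_le_of_sq_le_sq ?_ (by positivity)
    rw [mul_pow]
    calc (∑ i, val (grad p i) w * e i) ^ 2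
        ≤ (∑ i, val (grad p i) w ^ 2) * ∑ i, e i ^ 2 := Finset.sum_mul_sq_le_sq_mul_sq _ _ _
      _ ≤ B ^ 2 * ‖e‖ ^ 2 := by
        rw [EuclideanSpace.real_norm_sq_eq]
        gcongr
  have h2 := (convex_hull K).norm_image_sub_le_of_norm_hasFDerivWithin_le
    (fun w hw => (hasFDerivAt_val p w).hasFDerivWithinAt) hder hz hy
  have h3 : ‖y - z‖ ≤ s * r := by
    rw [← dist_eq_norm]; exact (dist_le_hK hy hz).trans hs
  rw [Real.norm_eq_abs] at h2
  calc (val p y - val p z) ^ 2 = |val p y - val p z| ^ 2 := (sq_abs _).symm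
    _ ≤ (B * (s * r)) ^ 2 := by
      gcongr
      exact h2.trans (by gcongr)
    _ = _ := by rw [mul_pow, hB2]; field_simp

end

/-! ### The algebra of the HDG method -/

theorem dotNormal_eq (v : Finset Plane → Fin 2 → Poly) (K E : Finset Plane) (x : Plane) :
    dotNormal v K E x = normalComp (v K) (normal K E) x := rfl

@[fun_prop]
theorem continuous_dotNormal (v : Finset Plane → Fin 2 → Poly) (K E : Finset Plane) :
    Continuous (dotNormal v K E) := continuous_normalComp _ _

@[fun_prop]
theorem continuous_fluxHat (τ : Finset Plane → ℝ) (u : Finset Plane → Poly)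
    (q : Finset Plane → Fin 2 → Poly) (uhat : Finset Plane → Poly) (K E : Finset Plane) :
    Continuous (fluxHat τ u q uhat K E) := by
  unfold fluxHat; fun_prop

namespace Triangulation
variable {Ω : Set Plane} (T : Triangulation Ω)

theorem cellSum_eq (f : Finset Plane → Plane → ℝ) :
    T.cellSum f = ∑ K ∈ T.cells, cellInt K (f K) := rfl

theorem bdrySum_eq (f : Finset Plane → Finset Plane → Plane → ℝ) :
    T.bdrySum f = ∑ K ∈ T.cells, bdryInt K (f K) := rfl

theorem cellSum_sub {f g : Finset Plane → Plane → ℝ} (hf : ∀ K, Continuous (f K))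
    (hg : ∀ K, Continuous (g K)) :
    T.cellSum (fun K x => f K x - g K x) = T.cellSum f - T.cellSum g := by
  simp only [cellSum_eq, ← Finset.sum_sub_distrib]
  exact Finset.sum_congr rfl fun K _ => cellInt_sub (hf K) (hg K)

theorem cellSum_add {f g : Finset Plane → Plane → ℝ} (hf : ∀ K, Continuous (f K))
    (hg : ∀ K, Continuous (g K)) :
    T.cellSum (fun K x => f K x + g K x) = T.cellSum f + T.cellSum g := by
  simp only [cellSum_eq, ← Finset.sum_add_distrib]
  exact Finset.sum_congr rfl fun K _ => cellInt_add (hf K) (hg K)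

theorem cellSum_const_mul (c : ℝ) (f : Finset Plane → Plane → ℝ) :
    T.cellSum (fun K x => c * f K x) = c * T.cellSum f := by
  simp only [cellSum_eq, Finset.mul_sum]
  exact Finset.sum_congr rfl fun K _ => cellInt_const_mul c _

theorem cellSum_congr {f g : Finset Plane → Plane → ℝ} (h : ∀ K ∈ T.cells, ∀ x, f K x = g K x) :
    T.cellSum f = T.cellSum g :=
  Finset.sum_congr rfl fun K hK => cellInt_congr (h K hK)

theorem cellSum_nonneg {f : Finset Plane → Plane → ℝ} (h : ∀ K x, 0 ≤ f K x) : 0 ≤ T.cellSum f :=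
  Finset.sum_nonneg fun K _ => cellInt_nonneg (h K)

theorem bdrySum_sub {F G : Finset Plane → Finset Plane → Plane → ℝ}
    (hF : ∀ K E, Continuous (F K E)) (hG : ∀ K E, Continuous (G K E)) :
    T.bdrySum (fun K E x => F K E x - G K E x) = T.bdrySum F - T.bdrySum G := by
  simp only [bdrySum_eq, ← Finset.sum_sub_distrib]
  exact Finset.sum_congr rfl fun K _ => bdryInt_sub (hF K) (hG K)

theorem bdrySum_add {F G : Finset Plane → Finset Plane → Plane → ℝ}
    (hF : ∀ K E, Continuous (F K E)) (hG : ∀ K E, Continuous (G K E)) :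
    T.bdrySum (fun K E x => F K E x + G K E x) = T.bdrySum F + T.bdrySum G := by
  simp only [bdrySum_eq, ← Finset.sum_add_distrib]
  exact Finset.sum_congr rfl fun K _ => bdryInt_add (hF K) (hG K)

theorem bdrySum_const_mul (c : ℝ) (F : Finset Plane → Finset Plane → Plane → ℝ) :
    T.bdrySum (fun K E x => c * F K E x) = c * T.bdrySum F := by
  simp only [bdrySum_eq, Finset.mul_sum]
  exact Finset.sum_congr rfl fun K _ => bdryInt_const_mul c _

theorem bdrySum_congr {F G : Finset Plane → Finset Plane → Plane → ℝ}
    (h : ∀ K ∈ T.cells, ∀ E ∈ edges K, ∀ x, F K E x = G K E x) : T.bdrySum F = T.bdrySum G :=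
  Finset.sum_congr rfl fun K hK => bdryInt_congr (h K hK)

theorem mem_allEdges {K E : Finset Plane} (hK : K ∈ T.cells) (hE : E ∈ edges K) :
    E ∈ T.allEdges := by
  classical
  exact Finset.mem_biUnion.2 ⟨K, hK, hE⟩

/-- The boundary edges contribute nothing to an integral that vanishes on each of them. -/
theorem interiorBdrySum_eq_bdrySum {F : Finset Plane → Finset Plane → Plane → ℝ}
    (h : ∀ K ∈ T.cells, ∀ E ∈ edges K, IsBdryEdge Ω E →
      ∫ x in hull E, F K E x ∂(Measure.hausdorffMeasure 1) = 0) :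
    T.interiorBdrySum F = T.bdrySum F := by
  classical
  refine Finset.sum_congr rfl fun K hK => ?_
  refine Finset.sum_subset (Finset.filter_subset _ _) fun E hE hE' => ?_
  refine h K hK E hE ?_
  by_contra hb
  exact hE' (Finset.mem_filter.2 ⟨hE, hb⟩)

theorem interiorBdrySum_sub {F G : Finset Plane → Finset Plane → Plane → ℝ}
    (hF : ∀ K E, Continuous (F K E)) (hG : ∀ K E, Continuous (G K E)) :
    T.interiorBdrySum (fun K E x => F K E x - G K E x)
      = T.interiorBdrySum F - T.interiorBdrySum G := by
  classical
  simp only [interiorBdrySum, ← Finset.sum_sub_distrib]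
  refine Finset.sum_congr rfl fun K _ => Finset.sum_congr rfl fun E hE => ?_
  have hE := (Finset.mem_filter.1 hE).1
  exact integral_sub (integrableOn_edge hE (hF K E).continuousOn)
    (integrableOn_edge hE (hG K E).continuousOn)

theorem exteriorEdgeSum_sub {F G : Finset Plane → Plane → ℝ}
    (hF : ∀ E, Continuous (F E)) (hG : ∀ E, Continuous (G E)) :
    T.exteriorEdgeSum (fun E x => F E x - G E x)
      = T.exteriorEdgeSum F - T.exteriorEdgeSum G := by
  classical
  simp only [exteriorEdgeSum, ← Finset.sum_sub_distrib]
  refine Finset.sum_congr rfl fun E hE => ?_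
  obtain ⟨K, -, hE⟩ := Finset.mem_biUnion.1 (Finset.mem_filter.1 hE).1
  exact integral_sub (integrableOn_edge hE (hF E).continuousOn)
    (integrableOn_edge hE (hG E).continuousOn)

end Triangulation

/-- `‖q‖²` on the triangle `K`. -/
def fluxSq (q : Finset Plane → Fin 2 → Poly) (K : Finset Plane) : ℝ :=
  cellInt K fun x => ∑ i, val (q K i) x ^ 2

/-- The square of the norm of `u - û` in `L²(∂K)`. -/
def jumpSq (u uhat : Finset Plane → Poly) (K : Finset Plane) : ℝ :=
  bdryInt K fun E x => (val (u K) x - val (uhat E) x) ^ 2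

theorem fluxSq_nonneg (q : Finset Plane → Fin 2 → Poly) (K : Finset Plane) : 0 ≤ fluxSq q K :=
  cellInt_nonneg fun _ => Finset.sum_nonneg fun _ _ => sq_nonneg _

theorem jumpSq_nonneg (u uhat : Finset Plane → Poly) (K : Finset Plane) : 0 ≤ jumpSq u uhat K :=
  bdryInt_nonneg fun _ _ _ => sq_nonneg _

/-- The energy `‖q‖² + ‖u - û‖₊²` of a triple. -/
def discEnergy {Ω : Set Plane} (T : Triangulation Ω) (τ : Finset Plane → ℝ)
    (u : Finset Plane → Poly) (q : Finset Plane → Fin 2 → Poly)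
    (uhat : Finset Plane → Poly) : ℝ :=
  T.normSqV q + T.normPlusSq τ u uhat

namespace IsHDGTriple
variable {Ω : Set Plane} {T : Triangulation Ω} {k : ℕ} {τ : Finset Plane → ℝ}
  {u w : Finset Plane → Poly} {q p : Finset Plane → Fin 2 → Poly} {uhat what : Finset Plane → Poly}

/-- The equation of the flux, on one triangle and integrated by parts. -/
theorem local_flux (h : IsHDGTriple T k τ u q uhat) {K : Finset Plane} (hK : K ∈ T.cells)
    {v : Fin 2 → Poly} (hv : ∀ i, (v i).totalDegree ≤ k) :
    cellInt K (fun x => ∑ i, val (q K i) x * val (v i) x)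
      = cellInt K (fun x => ∑ i, val (grad (u K) i) x * val (v i) x)
        - bdryInt K (fun E x => (val (u K) x - val (uhat E) x) * normalComp v (normal K E) x) := by
  classical
  have hV := h.flux (fun L => if L = K then v else 0) (by
    intro L _ i
    by_cases hL : L = K
    · simpa [hL] using hv i
    · simp [hL])
  rw [T.cellSum_eq, T.cellSum_eq, T.bdrySum_eq,
    Finset.sum_eq_single_of_mem K hK, Finset.sum_eq_single_of_mem K hK,
    Finset.sum_eq_single_of_mem K hK] at hV
  · simp only [if_true] at hV
    have h2 := integration_by_parts (T.isTriangle hK) (u K) v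
    have h3 : bdryInt K (fun E x => (val (u K) x - val (uhat E) x) * normalComp v (normal K E) x)
        = bdryInt K (fun E x => val (u K) x * normalComp v (normal K E) x)
          - bdryInt K (fun E x => val (uhat E) x * normalComp v (normal K E) x) := by
      rw [← bdryInt_sub (by fun_prop) (by fun_prop)]
      exact bdryInt_congr fun E _ x => by ring
    have h4 : bdryInt K (fun E x => val (uhat E) x
          * dotNormal (fun L => if L = K then v else 0) K E x)
        = bdryInt K (fun E x => val (uhat E) x * normalComp v (normal K E) x) := by
      refine bdryInt_congr fun E _ x => ?_
      simp [dotNormal, normalComp]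
    rw [h4] at hV
    rw [h3]
    linarith
  · intro L _ hL
    simp [hL, bdryInt, dotNormal]
  · intro L _ hL
    simp [hL, cellInt, dvg]
  · intro L _ hL
    simp [hL, cellInt]

/-- The boundary condition, tested with `û` itself. -/
theorem uhat_ae_eq_zero (h : IsHDGTriple T k τ u q uhat) {E : Finset Plane} (hE : E ∈ T.allEdges)
    (hb : IsBdryEdge Ω E) :
    ∀ᵐ x ∂((Measure.hausdorffMeasure 1 : Measure Plane).restrict (hull E)),
      val (uhat E) x = 0 := by
  classical
  have h1 := h.boundary uhat h.memM
  rw [Triangulation.exteriorEdgeSum, Finset.sum_eq_zero_iff_of_nonneg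
    (fun E _ => integral_nonneg fun x => mul_self_nonneg _)] at h1
  have h2 := h1 E (Finset.mem_filter.2 ⟨hE, hb⟩)
  obtain ⟨K, -, hEK⟩ := Finset.mem_biUnion.1 hE
  rw [integral_eq_zero_iff_of_nonneg (fun x => mul_self_nonneg _)
    (integrableOn_edge hEK ((continuous_val _).mul (continuous_val _)).continuousOn)] at h2
  filter_upwards [h2] with x hx
  exact mul_self_eq_zero.1 hx

theorem integral_mul_uhat_eq_zero (h : IsHDGTriple T k τ u q uhat) {E : Finset Plane}
    (hE : E ∈ T.allEdges) (hb : IsBdryEdge Ω E) (f : Plane → ℝ) :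
    ∫ x in hull E, f x * val (uhat E) x ∂(Measure.hausdorffMeasure 1) = 0 := by
  refine integral_eq_zero_of_ae ?_
  filter_upwards [h.uhat_ae_eq_zero hE hb] with x hx
  simp [hx]

/-- The conservativity of the numerical flux, with test functions that vanish on the boundary. -/
theorem bdrySum_fluxHat_eq_zero (h : IsHDGTriple T k τ u q uhat) {μ : Finset Plane → Poly}
    (hμ : T.MemM k μ) (hb : ∀ E ∈ T.allEdges, IsBdryEdge Ω E → ∀ f : Plane → ℝ,
      ∫ x in hull E, f x * val (μ E) x ∂(Measure.hausdorffMeasure 1) = 0) :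
    T.bdrySum (fun K E x => fluxHat τ u q uhat K E x * val (μ E) x) = 0 := by
  rw [← T.interiorBdrySum_eq_bdrySum]
  · exact h.conservative μ hμ
  · intro K hK E hE hbE
    exact hb E (T.mem_allEdges hK hE) hbE _

theorem sub (h : IsHDGTriple T k τ u q uhat) (h' : IsHDGTriple T k τ w p what) :
    IsHDGTriple T k τ (fun K => u K - w K) (fun K i => q K i - p K i)
      (fun E => uhat E - what E) where
  memW K hK := (MvPolynomial.totalDegree_sub _ _).trans (max_le (h.memW K hK) (h'.memW K hK))
  memV K hK i := (MvPolynomial.totalDegree_sub _ _).trans (max_le (h.memV K hK i) (h'.memV K hK i))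
  memM K hK := (MvPolynomial.totalDegree_sub _ _).trans (max_le (h.memM K hK) (h'.memM K hK))
  flux v hv := by
    have e1 : T.cellSum (fun K x => ∑ i, val (q K i - p K i) x * val (v K i) x)
        = T.cellSum (fun K x => ∑ i, val (q K i) x * val (v K i) x)
          - T.cellSum (fun K x => ∑ i, val (p K i) x * val (v K i) x) := by
      rw [← T.cellSum_sub (by fun_prop) (by fun_prop)]
      exact T.cellSum_congr fun K _ x => by simp only [Fin.sum_univ_two, val_sub]; ring
    have e2 : T.cellSum (fun K x => val (u K - w K) x * val (dvg (v K)) x)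
        = T.cellSum (fun K x => val (u K) x * val (dvg (v K)) x)
          - T.cellSum (fun K x => val (w K) x * val (dvg (v K)) x) := by
      rw [← T.cellSum_sub (by fun_prop) (by fun_prop)]
      exact T.cellSum_congr fun K _ x => by simp only [val_sub]; ring
    have e3 : T.bdrySum (fun K E x => val (uhat E - what E) x * dotNormal v K E x)
        = T.bdrySum (fun K E x => val (uhat E) x * dotNormal v K E x)
          - T.bdrySum (fun K E x => val (what E) x * dotNormal v K E x) := by
      rw [← T.bdrySum_sub (by fun_prop) (by fun_prop)]
      exact T.bdrySum_congr fun K _ E _ x => by simp only [val_sub]; ring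
    rw [e1, e2, e3]
    linarith [h.flux v hv, h'.flux v hv]
  conservative μ hμ := by
    have e : (fun (K E : Finset Plane) x => fluxHat τ (fun K => u K - w K) (fun K i => q K i - p K i)
          (fun E => uhat E - what E) K E x * val (μ E) x)
        = fun K E x => fluxHat τ u q uhat K E x * val (μ E) x
          - fluxHat τ w p what K E x * val (μ E) x := by
      ext K E x
      simp only [fluxHat, dotNormal, Fin.sum_univ_two, val_sub]; ring
    rw [e, T.interiorBdrySum_sub (by fun_prop) (by fun_prop), h.conservative μ hμ,
      h'.conservative μ hμ, sub_zero]
  boundary μ hμ := by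
    have e : (fun (E : Finset Plane) x => val (uhat E - what E) x * val (μ E) x)
        = fun E x => val (uhat E) x * val (μ E) x - val (what E) x * val (μ E) x := by
      ext E x
      simp only [val_sub]; ring
    rw [e, T.exteriorEdgeSum_sub (by fun_prop) (by fun_prop), h.boundary μ hμ,
      h'.boundary μ hμ, sub_zero]

/-- By the conservativity of the numerical flux, a function on the edges that vanishes on the boundary
may be subtracted from the test function. -/
theorem diffusionForm_eq_of_hat (h : IsHDGTriple T k τ u q uhat) (w : Finset Plane → Poly)
    {μ : Finset Plane → Poly}
    (hμ : T.MemM k μ) (hb : ∀ E ∈ T.allEdges, IsBdryEdge Ω E → ∀ f : Plane → ℝ,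
      ∫ x in hull E, f x * val (μ E) x ∂(Measure.hausdorffMeasure 1) = 0) :
    diffusionForm T τ u q uhat w
      = T.cellSum (fun K x => ∑ i, val (q K i) x * val (grad (w K) i) x)
        - T.bdrySum (fun K E x => fluxHat τ u q uhat K E x * (val (w K) x - val (μ E) x)) := by
  have e : T.bdrySum (fun K E x => fluxHat τ u q uhat K E x * (val (w K) x - val (μ E) x))
      = T.bdrySum (fun K E x => fluxHat τ u q uhat K E x * val (w K) x)
        - T.bdrySum (fun K E x => fluxHat τ u q uhat K E x * val (μ E) x) := by
    rw [← T.bdrySum_sub (by fun_prop) (by fun_prop)]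
    exact T.bdrySum_congr fun K _ E _ x => by ring
  rw [e, h.bdrySum_fluxHat_eq_zero hμ hb, sub_zero, diffusionForm]

/-- The diffusion form is symmetric: it is the bilinear form of the energy. -/
theorem diffusionForm_eq (h : IsHDGTriple T k τ u q uhat) (h' : IsHDGTriple T k τ w p what) :
    diffusionForm T τ u q uhat w
      = T.cellSum (fun K x => ∑ i, val (q K i) x * val (p K i) x)
        + T.bdrySum (fun K E x => τ E * ((val (u K) x - val (uhat E) x)
          * (val (w K) x - val (what E) x))) := by
  rw [h.diffusionForm_eq_of_hat w h'.memM fun E hE hb f => h'.integral_mul_uhat_eq_zero hE hb f]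
  have e1 : T.bdrySum (fun K E x => fluxHat τ u q uhat K E x * (val (w K) x - val (what E) x))
      = T.bdrySum (fun K E x => (val (w K) x - val (what E) x) * dotNormal q K E x)
        - T.bdrySum (fun K E x => τ E * ((val (u K) x - val (uhat E) x)
          * (val (w K) x - val (what E) x))) := by
    rw [← T.bdrySum_sub (by fun_prop) (by fun_prop)]
    exact T.bdrySum_congr fun K _ E _ x => by simp only [fluxHat]; ring
  have e2 : T.cellSum (fun K x => ∑ i, val (q K i) x * val (p K i) x)
      = T.cellSum (fun K x => ∑ i, val (q K i) x * val (grad (w K) i) x)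
        - T.bdrySum (fun K E x => (val (w K) x - val (what E) x) * dotNormal q K E x) := by
    simp only [T.cellSum_eq, T.bdrySum_eq, ← Finset.sum_sub_distrib]
    refine Finset.sum_congr rfl fun K hK => ?_
    have := h'.local_flux hK (v := q K) (h.memV K hK)
    simp only [dotNormal_eq]
    simp only [mul_comm (val (q K _) _)]
    exact this
  rw [e1, e2]
  ring

theorem diffusionForm_self (h : IsHDGTriple T k τ u q uhat) :
    diffusionForm T τ u q uhat u = discEnergy T τ u q uhat := by
  rw [h.diffusionForm_eq h, discEnergy, Triangulation.normSqV, Triangulation.normPlusSq]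
  simp only [← sq]

/-- The increment of the energy. -/
theorem discEnergy_sub (h : IsHDGTriple T k τ u q uhat) (h' : IsHDGTriple T k τ w p what) :
    discEnergy T τ w p what - discEnergy T τ u q uhat
      = 2 * diffusionForm T τ u q uhat (fun K => w K - u K)
        + discEnergy T τ (fun K => w K - u K) (fun K i => p K i - q K i)
          (fun E => what E - uhat E) := by
  rw [h.diffusionForm_eq (h'.sub h)]
  simp only [discEnergy, Triangulation.normSqV, Triangulation.normPlusSq, mul_add,
    ← T.cellSum_const_mul, ← T.bdrySum_const_mul]
  have e1 : T.cellSum (fun K x => ∑ i, val (p K i) x ^ 2)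
      - T.cellSum (fun K x => ∑ i, val (q K i) x ^ 2)
      = T.cellSum (fun K x => 2 * ∑ i, val (q K i) x * val (p K i - q K i) x)
        + T.cellSum (fun K x => ∑ i, val (p K i - q K i) x ^ 2) := by
    rw [← T.cellSum_sub (by fun_prop) (by fun_prop), ← T.cellSum_add (by fun_prop) (by fun_prop)]
    exact T.cellSum_congr fun K _ x => by simp only [Fin.sum_univ_two, val_sub]; ring
  have e2 : T.bdrySum (fun K E x => τ E * (val (w K) x - val (what E) x) ^ 2)
      - T.bdrySum (fun K E x => τ E * (val (u K) x - val (uhat E) x) ^ 2)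
      = T.bdrySum (fun K E x => 2 * (τ E * ((val (u K) x - val (uhat E) x)
          * (val (w K - u K) x - val (what E - uhat E) x))))
        + T.bdrySum (fun K E x => τ E * (val (w K - u K) x - val (what E - uhat E) x) ^ 2) := by
    rw [← T.bdrySum_sub (by fun_prop) (by fun_prop), ← T.bdrySum_add (by fun_prop) (by fun_prop)]
    exact T.bdrySum_congr fun K _ E _ x => by simp only [val_sub]; ring
  linarith

end IsHDGTriple

theorem jumpSum_le {Ω : Set Plane} {T : Triangulation Ω} {τ : Finset Plane → ℝ} {τ₀ : ℝ}
    (u uhat : Finset Plane → Poly) (hτ : ∀ E ∈ T.allEdges, τ₀ ≤ τ E) :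
    τ₀ * ∑ K ∈ T.cells, jumpSq u uhat K ≤ T.normPlusSq τ u uhat := by
  rw [Triangulation.normPlusSq, T.bdrySum_eq, Finset.mul_sum]
  refine Finset.sum_le_sum fun K hK => ?_
  rw [jumpSq, ← bdryInt_const_mul]
  refine bdryInt_mono (by fun_prop) (by fun_prop) fun E hE x _ => ?_
  exact mul_le_mul_of_nonneg_right (hτ E (T.mem_allEdges hK hE)) (sq_nonneg _)

theorem discEnergy_nonneg {Ω : Set Plane} {T : Triangulation Ω} {τ : Finset Plane → ℝ}
    (hτ : ∀ E ∈ T.allEdges, 0 ≤ τ E) (u : Finset Plane → Poly) (q : Finset Plane → Fin 2 → Poly)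
    (uhat : Finset Plane → Poly) : 0 ≤ discEnergy T τ u q uhat := by
  refine add_nonneg (T.cellSum_nonneg fun K x => Finset.sum_nonneg fun i _ => sq_nonneg _) ?_
  refine Finset.sum_nonneg fun K hK => bdryInt_nonneg fun E hE x => ?_
  exact mul_nonneg (hτ E (T.mem_allEdges hK hE)) (sq_nonneg _)

/-! ### Estimates for the HDG method on one triangle -/

section
variable {K : Finset Plane} {x : Plane} {r s : ℝ} {k : ℕ}

theorem bdryInt_normalComp_sq_le (h3 : IsTriangle K) (hr : 0 < r)
    (hball : Metric.closedBall x r ⊆ hull K) (hs : hK K ≤ s * r) {v : Fin 2 → Poly}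
    (hv : ∀ i, (v i).totalDegree ≤ k) :
    bdryInt K (fun E y => normalComp v (normal K E) y ^ 2)
      ≤ 3 * s * polyConst k s / r * cellInt K (fun z => ∑ i, val (v i) z ^ 2) := by
  calc bdryInt K (fun E y => normalComp v (normal K E) y ^ 2)
      ≤ bdryInt K (fun _ y => val (v 0) y ^ 2 + val (v 1) y ^ 2) :=
        bdryInt_mono (by fun_prop) (by fun_prop) fun E hE y _ =>
          (normalComp_sq_le v (norm_normal h3 hE) y).trans_eq (Fin.sum_univ_two _)
    _ = bdryInt K (fun _ y => val (v 0) y ^ 2) + bdryInt K (fun _ y => val (v 1) y ^ 2) :=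
        bdryInt_add (by fun_prop) (by fun_prop)
    _ ≤ 3 * s * polyConst k s / r * cellInt K (fun z => val (v 0) z ^ 2)
        + 3 * s * polyConst k s / r * cellInt K (fun z => val (v 1) z ^ 2) :=
        add_le_add (bdryInt_sq_le h3.1 hr hball hs (hv 0)) (bdryInt_sq_le h3.1 hr hball hs (hv 1))
    _ = _ := by
        rw [← mul_add, ← cellInt_add (by fun_prop) (by fun_prop)]
        simp only [Fin.sum_univ_two]

variable {Ω : Set Plane} {T : Triangulation Ω} {τ : Finset Plane → ℝ}
  {u : Finset Plane → Poly} {q : Finset Plane → Fin 2 → Poly} {uhat : Finset Plane → Poly}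

theorem mul_le_young {l : ℝ} (hl : 0 < l) (a b : ℝ) : a * b ≤ l * a ^ 2 + b ^ 2 / (4 * l) := by
  have : l * a ^ 2 + b ^ 2 / (4 * l) - a * b = (2 * l * a - b) ^ 2 / (4 * l) := by
    field_simp; ring
  have : 0 ≤ (2 * l * a - b) ^ 2 / (4 * l) := by positivity
  linarith

/-- The gradient of `u` is controlled by the flux and by the jump `u - û`. -/
theorem IsHDGTriple.grad_le (h : IsHDGTriple T k τ u q uhat) (hK : K ∈ T.cells) (hr : 0 < r)
    (hball : Metric.closedBall x r ⊆ hull K) (hs : KGHDG.hK K ≤ s * r) (hs0 : 0 < s) :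
    cellInt K (fun y => ∑ i, val (grad (u K) i) y ^ 2)
      ≤ 2 * fluxSq q K + 6 * s * polyConst k s / r * jumpSq u uhat K := by
  have hC := polyConst_pos k s
  set A := 3 * s * polyConst k s / r with hA
  have hA0 : 0 < A := by positivity
  set G := cellInt K (fun y => ∑ i, val (grad (u K) i) y ^ 2) with hG
  have hdeg : ∀ i, (grad (u K) i).totalDegree ≤ k := totalDegree_grad_le (h.memW K hK)
  have h1 := h.local_flux hK hdeg
  have h2 := bdryInt_normalComp_sq_le (T.isTriangle hK) hr hball hs hdeg
  rw [← hG, ← hA] at h2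
  have h3 : cellInt K (fun x => ∑ i, val (q K i) x * val (grad (u K) i) x)
      ≤ fluxSq q K + 4⁻¹ * G := by
    rw [fluxSq, hG, ← cellInt_const_mul, ← cellInt_add (by fun_prop) (by fun_prop)]
    refine cellInt_mono (by fun_prop) (by fun_prop) fun y _ => ?_
    simp only [Fin.sum_univ_two]
    nlinarith [sq_nonneg (val (q K 0) y - 2⁻¹ * val (grad (u K) 0) y),
      sq_nonneg (val (q K 1) y - 2⁻¹ * val (grad (u K) 1) y)]
  have h4 : bdryInt K (fun E x => (val (u K) x - val (uhat E) x)
        * normalComp (grad (u K)) (normal K E) x)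
      ≤ A * jumpSq u uhat K
        + (4 * A)⁻¹ * bdryInt K (fun E y => normalComp (grad (u K)) (normal K E) y ^ 2) := by
    rw [jumpSq, ← bdryInt_const_mul, ← bdryInt_const_mul,
      ← bdryInt_add (by fun_prop) (by fun_prop)]
    refine bdryInt_mono (by fun_prop) (by fun_prop) fun E _ y _ => ?_
    have := mul_le_young hA0 (val (u K) y - val (uhat E) y)
      (normalComp (grad (u K)) (normal K E) y)
    rwa [div_eq_inv_mul] at this
  have h5 : (4 * A)⁻¹ * bdryInt K (fun E y => normalComp (grad (u K)) (normal K E) y ^ 2)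
      ≤ (4 * A)⁻¹ * (A * G) := mul_le_mul_of_nonneg_left h2 (by positivity)
  have h6 : (4 * A)⁻¹ * (A * G) = 4⁻¹ * G := by field_simp
  have h7 : cellInt K (fun x => ∑ i, val (grad (u K) i) x * val (grad (u K) i) x) = G := by
    rw [hG]; exact cellInt_congr fun x => by simp only [sq]
  have h8 : 6 * s * polyConst k s / r * jumpSq u uhat K = 2 * (A * jumpSq u uhat K) := by
    rw [hA]; ring
  rw [h7] at h1
  rw [h8]
  linarith

/-- `β_K`, up to a square: the local quantity that controls the oscillation of `u` and `û` on a
triangle; `R` is an upper bound of the radii, so that both terms scale alike. -/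
def betaSq (R : ℝ) (u : Finset Plane → Poly) (q : Finset Plane → Fin 2 → Poly)
    (uhat : Finset Plane → Poly) (K : Finset Plane) : ℝ :=
  jumpSq u uhat K + R * fluxSq q K

theorem IsHDGTriple.grad_le_betaSq (h : IsHDGTriple T k τ u q uhat) (hK : K ∈ T.cells) (hr : 0 < r)
    (hball : Metric.closedBall x r ⊆ hull K) (hs : KGHDG.hK K ≤ s * r) (hs0 : 0 < s) {R : ℝ}
    (hR : r ≤ R) :
    cellInt K (fun y => ∑ i, val (grad (u K) i) y ^ 2)
      ≤ (2 + 6 * s * polyConst k s) / r * betaSq R u q uhat K := by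
  refine (h.grad_le hK hr hball hs hs0).trans ?_
  have hC := polyConst_pos k s
  have hQ := fluxSq_nonneg q K
  have hb := jumpSq_nonneg u uhat K
  rw [betaSq, div_mul_eq_mul_div, div_mul_eq_mul_div, le_div_iff₀ hr, add_mul, div_mul_cancel₀ _ hr.ne']
  have h1 : fluxSq q K * r ≤ R * fluxSq q K := by
    rw [mul_comm]; exact mul_le_mul_of_nonneg_right hR hQ
  have h2 : 0 ≤ R * fluxSq q K := le_trans (by positivity) h1
  have h3 : 0 ≤ 6 * s * polyConst k s * (R * fluxSq q K) := by positivity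
  nlinarith

/-- The constant in `IsHDGTriple.osc_sq_le_betaSq`. -/
def oscConst (k : ℕ) (s : ℝ) : ℝ := s ^ 2 * polyConst k s * (2 + 6 * s * polyConst k s)

theorem oscConst_pos (hs0 : 0 < s) : 0 < oscConst k s := by
  have := polyConst_pos k s
  unfold oscConst; positivity

theorem IsHDGTriple.osc_sq_le_betaSq (h : IsHDGTriple T k τ u q uhat) (hK : K ∈ T.cells)
    (hr : 0 < r) (hball : Metric.closedBall x r ⊆ hull K) (hs : KGHDG.hK K ≤ s * r) (hs0 : 0 < s)
    {R : ℝ} (hR : r ≤ R) {y z : Plane} (hy : y ∈ hull K) (hz : z ∈ hull K) :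
    (val (u K) y - val (u K) z) ^ 2 ≤ oscConst k s / r * betaSq R u q uhat K := by
  have hC := polyConst_pos k s
  refine (osc_sq_le hr hball hs (h.memW K hK) hy hz).trans ?_
  refine (mul_le_mul_of_nonneg_left (h.grad_le_betaSq hK hr hball hs hs0 hR)
    (by positivity)).trans_eq ?_
  rw [oscConst]; ring

theorem betaSq_nonneg {R : ℝ} (hR : 0 ≤ R) : 0 ≤ betaSq R u q uhat K :=
  add_nonneg (jumpSq_nonneg _ _ _) (mul_nonneg hR (fluxSq_nonneg _ _))

/-- The values of `û` on the boundary of a triangle are close to the values of `u` in it. -/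
theorem IsHDGTriple.bdryInt_uhat_sub_sq_le (h : IsHDGTriple T k τ u q uhat) (hK : K ∈ T.cells)
    (hr : 0 < r) (hball : Metric.closedBall x r ⊆ hull K) (hs : KGHDG.hK K ≤ s * r) (hs0 : 0 < s)
    {R : ℝ} (hR : r ≤ R) {z : Plane} (hz : z ∈ hull K) :
    bdryInt K (fun E y => (val (uhat E) y - val (u K) z) ^ 2)
      ≤ (2 + 6 * s * oscConst k s) * betaSq R u q uhat K := by
  have hO := oscConst_pos (k := k) hs0
  have hb := betaSq_nonneg (u := u) (q := q) (uhat := uhat) (K := K) (hr.le.trans hR)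
  set B := oscConst k s / r * betaSq R u q uhat K with hB
  have h1 : bdryInt K (fun E y => (val (uhat E) y - val (u K) z) ^ 2)
      ≤ bdryInt K (fun E y => 2 * (val (u K) y - val (uhat E) y) ^ 2 + 2 * B) := by
    refine bdryInt_mono (by fun_prop) (by fun_prop) fun E hE y hy => ?_
    have := h.osc_sq_le_betaSq hK hr hball hs hs0 hR (hull_edge_subset hE hy) hz
    rw [← hB] at this
    nlinarith [sq_nonneg ((val (u K) y - val (uhat E) y) + (val (u K) y - val (u K) z))]
  rw [bdryInt_add (by fun_prop) (by fun_prop), bdryInt_const_mul] at h1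
  have h2 := bdryInt_const_le (T.card_eq K hK) (c := 2 * B) (by positivity)
  have h3 : 3 * KGHDG.hK K * (2 * B) ≤ 3 * (s * r) * (2 * B) := by gcongr
  have h4 : 3 * (s * r) * (2 * B) = 6 * s * oscConst k s * betaSq R u q uhat K := by
    rw [hB]; field_simp; ring
  have h5 : bdryInt K (fun E y => (val (u K) y - val (uhat E) y) ^ 2) ≤ betaSq R u q uhat K :=
    le_add_of_nonneg_right (mul_nonneg (hr.le.trans hR) (fluxSq_nonneg _ _))
  linarith

/-- The constant in `IsHDGTriple.discEnergy_le`. -/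
def liftConst (k : ℕ) (s τ₁ R : ℝ) : ℝ :=
  2 * (2 * Real.pi * s ^ 2 * polyConst k s
    + 3 * s * polyConst k s * (3 * s * polyConst k s + |τ₁| * R))

/-- The energy of a triple is bounded by the distance of `u` to constants on the edges that vanish
on the boundary, in a norm with the weight `r_K⁻²`. Indeed, the energy is the diffusion form at `u`, in
which these constants may replace `û` as a test function on the edges; the flux and the jump are then
absorbed, and the rest is bounded by the inverse inequalities. -/
theorem IsHDGTriple.discEnergy_le {R τ₁ : ℝ} {c : Finset Plane → Plane} {ρ : Finset Plane → ℝ}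
    (h : IsHDGTriple T k τ u q uhat) (D : T.HasDiscs s c ρ) (hR : ∀ K ∈ T.cells, ρ K ≤ R)
    (hτ : ∀ E ∈ T.allEdges, 0 ≤ τ E ∧ τ E ≤ τ₁) {m : Finset Plane → ℝ}
    (hm : ∀ E ∈ T.allEdges, IsBdryEdge Ω E → m E = 0) :
    discEnergy T τ u q uhat
      ≤ liftConst k s τ₁ R * ∑ K ∈ T.cells, (ρ K ^ 2)⁻¹
        * ∑ E ∈ edges K, cellInt K (fun y => (val (u K) y - m E) ^ 2) := by
  have hs0 : 0 < s := lt_of_lt_of_le one_pos D.one_le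
  have hC := polyConst_pos k s
  have hself := h.diffusionForm_self
  rw [h.diffusionForm_eq_of_hat u (μ := fun E => MvPolynomial.C (m E)) (fun E _ => by simp)
    (fun E hE hb f => by simp [hm E hE hb])] at hself
  set M := liftConst k s τ₁ R with hM
  have key : ∀ K ∈ T.cells,
      cellInt K (fun x => ∑ i, val (q K i) x * val (grad (u K) i) x)
        - bdryInt K (fun E x => fluxHat τ u q uhat K E x * (val (u K) x - val (MvPolynomial.C (m E)) x))
      ≤ 2⁻¹ * (fluxSq q K + bdryInt K (fun E x => τ E * (val (u K) x - val (uhat E) x) ^ 2))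
        + 2⁻¹ * (M * ((ρ K ^ 2)⁻¹
          * ∑ E ∈ edges K, cellInt K (fun y => (val (u K) y - m E) ^ 2))) := by
    intro K hK
    have hr := D.pos K hK
    have hball := D.ball K hK
    have hs := D.le K hK
    set r := ρ K with hr_def
    set S := ∑ E ∈ edges K, cellInt K (fun y => (val (u K) y - m E) ^ 2) with hS
    have hS0 : 0 ≤ S := Finset.sum_nonneg fun E _ => cellInt_nonneg fun _ => sq_nonneg _
    have hE1 : ∀ E ∈ edges K, cellInt K (fun y => (val (u K) y - m E) ^ 2) ≤ S := fun E hE =>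
      Finset.single_le_sum (f := fun E => cellInt K (fun y => (val (u K) y - m E) ^ 2))
        (fun E _ => cellInt_nonneg fun _ => sq_nonneg _) hE
    have hdeg : ∀ E, (u K - MvPolynomial.C (m E)).totalDegree ≤ k := fun E =>
      (MvPolynomial.totalDegree_sub _ _).trans (max_le (h.memW K hK) (by simp))
    set A := 3 * s * polyConst k s / r with hA
    have hA0 : 0 < A := by positivity
    set G := cellInt K (fun y => ∑ i, val (grad (u K) i) y ^ 2) with hG
    -- the gradient does not see the constants
    have hGS : G ≤ 2 * Real.pi * s ^ 2 * polyConst k s / r ^ 2 * S := by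
      obtain ⟨E, hE⟩ : (edges K).Nonempty := by
        rw [← Finset.card_pos, card_edges (T.card_eq K hK)]; norm_num
      have h1 := cellInt_grad_sq_le hr hball hs (hdeg E)
      have e1 : cellInt K (fun y => ∑ i, val (grad (u K - MvPolynomial.C (m E)) i) y ^ 2) = G := by
        rw [hG]; refine cellInt_congr fun y => ?_
        simp [grad]
      rw [e1] at h1
      refine h1.trans (mul_le_mul_of_nonneg_left ?_ (by positivity))
      refine le_trans (le_of_eq ?_) (hE1 E hE)
      exact cellInt_congr fun y => by simp
    set J := bdryInt K (fun E y => (val (u K) y - m E) ^ 2) with hJ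
    have hJS : J ≤ A * S := by
      rw [hJ, bdryInt, hS, Finset.mul_sum]
      refine Finset.sum_le_sum fun E hE => ?_
      have h1 := bdryInt_sq_le (T.card_eq K hK) hr hball hs (hdeg E)
      simp only [val_sub, val_C] at h1
      refine le_trans ?_ h1
      exact Finset.single_le_sum (f := fun E' => ∫ x in hull E', (val (u K) x - m E) ^ 2
        ∂(Measure.hausdorffMeasure 1)) (fun E _ => integral_nonneg fun _ => sq_nonneg _) hE
    have h1 : cellInt K (fun x => ∑ i, val (q K i) x * val (grad (u K) i) x)
        ≤ 4⁻¹ * fluxSq q K + G := by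
      rw [fluxSq, hG, ← cellInt_const_mul, ← cellInt_add (by fun_prop) (by fun_prop)]
      refine cellInt_mono (by fun_prop) (by fun_prop) fun y _ => ?_
      simp only [Fin.sum_univ_two]
      nlinarith [sq_nonneg (2⁻¹ * val (q K 0) y - val (grad (u K) 0) y),
        sq_nonneg (2⁻¹ * val (q K 1) y - val (grad (u K) 1) y)]
    have h2 : - bdryInt K (fun E x => fluxHat τ u q uhat K E x
          * (val (u K) x - val (MvPolynomial.C (m E)) x))
        ≤ (4 * A)⁻¹ * bdryInt K (fun E y => normalComp (q K) (normal K E) y ^ 2)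
          + ((A + |τ₁|) * J
          + 4⁻¹ * bdryInt K (fun E x => τ E * (val (u K) x - val (uhat E) x) ^ 2)) := by
      rw [hJ, ← bdryInt_const_mul, ← bdryInt_const_mul, ← bdryInt_const_mul,
        ← bdryInt_add (by fun_prop) (by fun_prop), ← bdryInt_add (by fun_prop) (by fun_prop),
        neg_eq_neg_one_mul, ← bdryInt_const_mul]
      refine bdryInt_mono (by fun_prop) (by fun_prop) fun E hE y _ => ?_
      simp only [fluxHat, dotNormal_eq, val_C]
      have hy1 := mul_le_young hA0 (-(val (u K) y - m E)) (normalComp (q K) (normal K E) y)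
      rw [div_eq_inv_mul, neg_sq] at hy1
      obtain ⟨hτ0, hτ1⟩ := hτ E (T.mem_allEdges hK hE)
      have hτ2 : τ E * (val (u K) y - m E) ^ 2 ≤ |τ₁| * (val (u K) y - m E) ^ 2 :=
        mul_le_mul_of_nonneg_right (hτ1.trans (le_abs_self _)) (sq_nonneg _)
      nlinarith [mul_nonneg hτ0 (sq_nonneg (2⁻¹ * (val (u K) y - val (uhat E) y)
        - (val (u K) y - m E)))]
    have h3 := bdryInt_normalComp_sq_le (T.isTriangle hK) hr hball hs (h.memV K hK)
    rw [← hA] at h3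
    have h4 : (4 * A)⁻¹ * bdryInt K (fun E y => normalComp (q K) (normal K E) y ^ 2)
        ≤ (4 * A)⁻¹ * (A * fluxSq q K) := mul_le_mul_of_nonneg_left h3 (by positivity)
    have h5 : (4 * A)⁻¹ * (A * fluxSq q K) = 4⁻¹ * fluxSq q K := by field_simp
    have h6 : (A + |τ₁|) * J ≤ (A + |τ₁|) * (A * S) :=
      mul_le_mul_of_nonneg_left hJS (by positivity)
    have h7 : (A + |τ₁|) * (A * S)
        ≤ 3 * s * polyConst k s * (3 * s * polyConst k s + |τ₁| * R) * ((r ^ 2)⁻¹ * S) := by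
      have : (A + |τ₁|) * (A * S)
          = 3 * s * polyConst k s * (3 * s * polyConst k s + |τ₁| * r) * ((r ^ 2)⁻¹ * S) := by
        rw [hA]; field_simp
      rw [this]
      gcongr
      exact hR K hK
    have h8 : 2 * Real.pi * s ^ 2 * polyConst k s / r ^ 2 * S
        = 2 * Real.pi * s ^ 2 * polyConst k s * ((r ^ 2)⁻¹ * S) := by ring
    have hb0 : 0 ≤ bdryInt K (fun E x => τ E * (val (u K) x - val (uhat E) x) ^ 2) :=
      bdryInt_nonneg fun E hE x => mul_nonneg (hτ E (T.mem_allEdges hK hE)).1 (sq_nonneg _)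
    rw [hM, liftConst]
    linarith
  have hsum := Finset.sum_le_sum key
  rw [Finset.sum_sub_distrib, Finset.sum_add_distrib, ← Finset.mul_sum, ← Finset.mul_sum,
    ← Finset.mul_sum, Finset.sum_add_distrib] at hsum
  have e1 : discEnergy T τ u q uhat = ∑ K ∈ T.cells, fluxSq q K
      + ∑ K ∈ T.cells, bdryInt K (fun E x => τ E * (val (u K) x - val (uhat E) x) ^ 2) := rfl
  rw [T.cellSum_eq, T.bdrySum_eq, e1] at hself
  rw [e1]
  linarith

end

/-! ### The point source field -/

/-- The field `y ↦ (y - x₀) / |y - x₀|²`, divergence free off `x₀`, cut off in the disc of radius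
`r` about `x₀` so as to be continuous. -/
def sourceField (x₀ : Plane) (r : ℝ) (y : Plane) : Plane := (max (‖y - x₀‖ ^ 2) (r ^ 2))⁻¹ • (y - x₀)

section
variable {x₀ y z : Plane} {r : ℝ}

theorem continuous_sourceField (hr : 0 < r) : Continuous (sourceField x₀ r) := by
  unfold sourceField
  have h : Continuous fun y : Plane => max (‖y - x₀‖ ^ 2) (r ^ 2) := by fun_prop
  exact (h.inv₀ fun y => (lt_max_of_lt_right (by positivity)).ne').smul
    (continuous_id.sub continuous_const)

theorem sourceField_eq (hr : 0 < r) (hy : r ≤ dist y x₀) :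
    sourceField x₀ r y = (‖y - x₀‖ ^ 2)⁻¹ • (y - x₀) := by
  rw [sourceField, max_eq_left]
  rw [dist_eq_norm] at hy
  gcongr

theorem sourceField_eq_inversion (hr : 0 < r) (hy : r ≤ dist y x₀) :
    sourceField x₀ r y = EuclideanGeometry.inversion x₀ 1 y - x₀ := by
  rw [sourceField_eq hr hy, EuclideanGeometry.inversion, dist_eq_norm]
  simp

theorem norm_sourceField (hr : 0 < r) (hy : r ≤ dist y x₀) :
    ‖sourceField x₀ r y‖ = (dist y x₀)⁻¹ := by
  rw [sourceField_eq_inversion hr hy, ← dist_eq_norm, EuclideanGeometry.dist_inversion_center]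
  simp

theorem norm_sourceField_sub (hr : 0 < r) (hy : r ≤ dist y x₀) (hz : r ≤ dist z x₀) :
    ‖sourceField x₀ r y - sourceField x₀ r z‖ = dist y z / (dist y x₀ * dist z x₀) := by
  have hy0 : y ≠ x₀ := fun h => by rw [h, dist_self] at hy; linarith
  have hz0 : z ≠ x₀ := fun h => by rw [h, dist_self] at hz; linarith
  rw [sourceField_eq_inversion hr hy, sourceField_eq_inversion hr hz, sub_sub_sub_cancel_right,
    ← dist_eq_norm, EuclideanGeometry.dist_inversion_inversion hy0 hz0]
  ring

/-- The flux of the source field through the boundary of a triangle away from the source. -/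
theorem bdryInt_sourceField_eq_zero {K : Finset Plane} (h3 : IsTriangle K) (hr : 0 < r)
    (hK : ∀ y ∈ hull K, r ≤ dist y x₀) :
    bdryInt K (fun E y => inner ℝ (normal K E) (sourceField x₀ r y)) = 0 := by
  have hN : ∀ y ∈ hull K, ‖y - x₀‖ ^ 2 ≠ 0 := fun y hy => by
    have := hK y hy
    rw [dist_eq_norm] at this
    exact pow_ne_zero 2 (hr.trans_le this).ne'
  set G : Fin 2 → Plane → Plane →L[ℝ] ℝ := fun i y =>
    (‖y - x₀‖ ^ 2)⁻¹ • EuclideanSpace.proj (𝕜 := ℝ) i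
      + (y i - x₀ i) • (-((‖y - x₀‖ ^ 2) ^ 2)⁻¹ • ((2 : ℝ) • innerSL ℝ (y - x₀))) with hG
  have hder : ∀ i, ∀ y ∈ hull K,
      HasFDerivAt (fun y : Plane => (‖y - x₀‖ ^ 2)⁻¹ * (y i - x₀ i)) (G i y) y := by
    intro i y hy
    have h1 : HasFDerivAt (fun y : Plane => ‖y - x₀‖ ^ 2) ((2 : ℝ) • innerSL ℝ (y - x₀)) y := by
      have := ((hasFDerivAt_id y).sub_const x₀).norm_sq
      refine this.congr_fderiv ?_
      ext v
      simp [two_mul]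
    have h2 := (hasDerivAt_inv (hN y hy)).comp_hasFDerivAt y h1
    have h3 : HasFDerivAt (fun y : Plane => y i - x₀ i) (EuclideanSpace.proj (𝕜 := ℝ) i) y :=
      (EuclideanSpace.proj (𝕜 := ℝ) i).hasFDerivAt.sub_const (x₀ i)
    exact h2.mul h3
  have hcont : ∀ i, ContinuousOn (G i) (hull K) := by
    intro i
    have hc : ContinuousOn (fun y : Plane => ‖y - x₀‖ ^ 2) (hull K) := by fun_prop
    refine ((hc.inv₀ hN).smul continuousOn_const).add ?_
    have hc' : ContinuousOn (fun y : Plane => y i - x₀ i) (hull K) := by fun_prop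
    refine hc'.smul (ContinuousOn.smul ((hc.pow 2).inv₀ fun y hy =>
      pow_ne_zero 2 (hN y hy)).neg ?_)
    have : Continuous fun y : Plane => innerSL ℝ (y - x₀) :=
      (innerSL ℝ).continuous.comp (continuous_id.sub continuous_const)
    exact (this.const_smul (2 : ℝ)).continuousOn
  have hdiv := fun i => divergence_theorem h3.1 h3.2 (hder i) (hcont i) (EuclideanSpace.single i 1)
  have hsum : ∑ i, ∫ x in hull K, G i x (EuclideanSpace.single i 1) = 0 := by
    rw [← integral_finsetSum _ fun i _ => integrableOn_hull K
      ((hcont i).clm_apply continuousOn_const)]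
    rw [setIntegral_congr_fun (g := fun _ => 0) (measurableSet_hull K)]
    · simp
    · intro y hy
      have h1 := hN y hy
      simp only [hG, Fin.sum_univ_two, add_apply, smul_apply,
        innerSL_apply_apply, EuclideanSpace.proj, PiLp.proj_apply, smul_eq_mul]
      rw [EuclideanSpace.inner_single_right, EuclideanSpace.inner_single_right]
      rw [norm_sq_plane] at h1 ⊢
      simp only [PiLp.sub_apply] at h1 ⊢
      simp
      field_simp
      ring
  have hinner : ∀ (E : Finset Plane) (i : Fin 2),
      inner ℝ (normal K E) (EuclideanSpace.single i 1 : Plane) = normal K E i := by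
    intro E i
    rw [EuclideanSpace.inner_single_right]; simp
  have hE : ∀ E ∈ edges K, ∫ y in hull E, inner ℝ (normal K E) (sourceField x₀ r y)
        ∂(Measure.hausdorffMeasure 1)
      = ∑ i, (∫ y in hull E, (‖y - x₀‖ ^ 2)⁻¹ * (y i - x₀ i) ∂(Measure.hausdorffMeasure 1))
          * normal K E i := by
    intro E hE
    simp only [← integral_mul_const]
    rw [← integral_finsetSum]
    · refine setIntegral_congr_fun (measurableSet_hull E) fun y hy => ?_
      simp only [sourceField_eq hr (hK y (hull_edge_subset hE hy)), inner_smul_right,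
        inner_plane, Fin.sum_univ_two, PiLp.sub_apply]
      ring
    · intro i _
      refine integrableOn_edge hE ?_
      refine ContinuousOn.mul (ContinuousOn.mul (ContinuousOn.inv₀ (by fun_prop) fun y hy =>
        hN y (hull_edge_subset hE hy)) (by fun_prop)) continuousOn_const
  rw [bdryInt, Finset.sum_congr rfl hE, Finset.sum_comm, ← hsum]
  refine Finset.sum_congr rfl fun i _ => ?_
  rw [hdiv i]
  simp only [hinner]

/-- The flux of the source field through the boundary of the triangle of the source. -/
theorem bdryInt_sourceField_ge {K : Finset Plane} {s : ℝ} (h3 : IsTriangle K) (hr : 0 < r)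
    (hball : Metric.closedBall x₀ r ⊆ hull K) (hs : hK K ≤ s * r) :
    2 / s ^ 2 ≤ bdryInt K (fun E y => inner ℝ (normal K E) (sourceField x₀ r y)) := by
  have hrK : r ≤ hK K := radius_le_hK hr.le hball
  have hK0 : 0 < hK K := hr.trans_le hrK
  have hx : x₀ ∈ hull K := hball (Metric.mem_closedBall_self hr.le)
  have hpt : ∀ E ∈ edges K, ∀ y ∈ hull E,
      r / hK K ^ 2 ≤ inner ℝ (normal K E) (sourceField x₀ r y) := by
    intro E hE y hy
    have h1 := normal_inner_ge_radius h3 hE hr.le hball hy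
    have h2 : r ≤ dist y x₀ := by
      have := real_inner_le_norm (normal K E) (y - x₀)
      rw [norm_normal h3 hE, one_mul, ← dist_eq_norm] at this
      exact h1.trans this
    have h4 : dist y x₀ ≤ hK K := dist_le_hK (hull_edge_subset hE hy) hx
    rw [sourceField_eq hr h2, inner_smul_right, ← dist_eq_norm, inv_mul_eq_div]
    have : 0 < dist y x₀ := hr.trans_le h2
    have h5 : 0 ≤ inner ℝ (normal K E) (y - x₀) := hr.le.trans h1
    gcongr
  obtain ⟨a, b, c, hab, hac, hbc, hKeq, -⟩ := exists_vertices h3.1 h3.2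
  have hE : ({a, b} : Finset Plane) ∈ edges K := by
    rw [hKeq]
    exact Finset.mem_powersetCard.2 ⟨by intro z; simp; tauto, Finset.card_pair hab⟩
  have hlen : 2 * r ≤ dist a b := two_mul_radius_le_dist h3 (by simp [hKeq]) (by simp [hKeq]) hab
    hr.le hball
  have hnn : ∀ E ∈ edges K, 0 ≤ ∫ y in hull E, inner ℝ (normal K E) (sourceField x₀ r y)
      ∂(Measure.hausdorffMeasure 1) := fun E hE =>
    setIntegral_nonneg (measurableSet_hull E) fun y hy =>
      (by positivity : (0 : ℝ) ≤ r / hK K ^ 2).trans (hpt E hE y hy)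
  have h5 := Finset.single_le_sum hnn hE
  refine le_trans ?_ h5
  have hcont := continuous_sourceField (x₀ := x₀) hr
  have h6 : ∫ _ in hull {a, b}, r / hK K ^ 2 ∂(Measure.hausdorffMeasure 1)
      ≤ ∫ y in hull {a, b}, inner ℝ (normal K {a, b}) (sourceField x₀ r y)
        ∂(Measure.hausdorffMeasure 1) :=
    setIntegral_mono_on (integrableOn_edge hE continuousOn_const)
      (integrableOn_edge hE (by fun_prop)) (measurableSet_hull _) (hpt _ hE)
  refine le_trans ?_ h6
  rw [integral_hull_pair]
  simp only [intervalIntegral.integral_const, sub_zero, one_mul, smul_eq_mul]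
  rw [dist_comm, dist_eq_norm] at hlen
  have hs0 : 0 < s := pos_of_mul_pos_left (hK0.trans_le hs) hr.le
  have h7 : 2 / s ^ 2 ≤ 2 * r * (r / hK K ^ 2) := by
    rw [div_le_iff₀ (by positivity)]
    have e : 2 * r * (r / hK K ^ 2) * s ^ 2 = 2 * ((s * r) ^ 2 / hK K ^ 2) := by ring
    rw [e]
    have : 1 ≤ (s * r) ^ 2 / hK K ^ 2 := by
      rw [one_le_div (by positivity)]; gcongr
    linarith
  refine h7.trans ?_
  gcongr

end

/-! ### The discrete Sobolev inequality -/

/-- A distance of triangles that does not vanish for equal ones; `x` are the centres. -/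
def meshDist (x : Finset Plane → Plane) (K L : Finset Plane) : ℝ := dist (x K) (x L) + hK K + hK L

theorem meshDist_comm (x : Finset Plane → Plane) (K L : Finset Plane) :
    meshDist x K L = meshDist x L K := by
  unfold meshDist; rw [dist_comm]; ring

theorem hK_nonneg (K : Finset Plane) : 0 ≤ hK K := Metric.diam_nonneg

theorem abs_inner_le_of_norm_le {n v : Plane} (hn : ‖n‖ = 1) {c : ℝ} (hv : ‖v‖ ≤ c) :
    |inner ℝ n v| ≤ c := by
  have := abs_real_inner_le_norm n v
  rw [hn, one_mul] at this
  exact this.trans hv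

section
variable {Ω : Set Plane} {T : Triangulation Ω} {k : ℕ} {τ : Finset Plane → ℝ}
  {u : Finset Plane → Poly} {q : Finset Plane → Fin 2 → Poly} {uhat : Finset Plane → Poly}
  {s : ℝ} {x : Finset Plane → Plane} {r : Finset Plane → ℝ}

/-- The total flux of `û F`, for a continuous field `F`: the contributions of the two sides of an
interior edge cancel, and `û` vanishes on the boundary. -/
theorem IsHDGTriple.sum_bdryInt_uhat_mul_eq_zero (h : IsHDGTriple T k τ u q uhat)
    (hΩ : IsConvexPolygon Ω) {F : Plane → Plane} (hF : Continuous F) :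
    ∑ K ∈ T.cells, bdryInt K (fun E y => val (uhat E) y * inner ℝ (normal K E) (F y)) = 0 := by
  classical
  have h1 : ∑ K ∈ T.cells, bdryInt K (fun E y => val (uhat E) y * inner ℝ (normal K E) (F y))
      = ∑ E ∈ T.allEdges, ∑ K ∈ T.cells with E ∈ edges K,
        ∫ y in hull E, val (uhat E) y * inner ℝ (normal K E) (F y)
          ∂(Measure.hausdorffMeasure 1) := by
    refine Finset.sum_comm' fun K E => ?_
    rw [Finset.mem_filter]
    exact ⟨fun hKE => ⟨hKE, T.mem_allEdges hKE.1 hKE.2⟩, fun hKE => hKE.1⟩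
  rw [h1]
  refine Finset.sum_eq_zero fun E hE => ?_
  by_cases hb : IsBdryEdge Ω E
  · refine Finset.sum_eq_zero fun K _ => ?_
    have := h.integral_mul_uhat_eq_zero hE hb fun y => inner ℝ (normal K E) (F y)
    simpa only [mul_comm] using this
  · rw [← integral_finsetSum]
    · have h2 := T.sum_normal_eq_zero hΩ hE hb
      have h3 : ∀ y, ∑ K ∈ T.cells with E ∈ edges K, val (uhat E) y * inner ℝ (normal K E) (F y)
          = 0 := by
        intro y
        rw [← Finset.mul_sum, ← sum_inner, h2, inner_zero_left, mul_zero]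
      simp [h3]
    · intro K hK
      exact integrableOn_edge (Finset.mem_filter.1 hK).2 (by fun_prop)

theorem bdryInt_inner_const_eq_zero {K : Finset Plane} (h3 : IsTriangle K) (c : Plane) :
    bdryInt K (fun E _ => inner ℝ (normal K E) c) = 0 := by
  have := integration_by_parts h3 1 (fun i => MvPolynomial.C (c i))
  have e0 : cellInt K (fun x => ∑ i, val (grad 1 i) x * val (MvPolynomial.C (c i)) x) = 0 := by
    simp [cellInt, grad]
  have e1 : cellInt K (fun x => val 1 x * val (dvg fun i => MvPolynomial.C (c i)) x) = 0 := by
    simp [cellInt, dvg]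
  rw [e0, e1, add_zero] at this
  rw [this]
  refine bdryInt_congr fun E _ y => ?_
  have : val 1 y = 1 := by simp [val]
  simp only [this, normalComp, val_C, inner_plane, Fin.sum_univ_two]
  ring

/-- The equation of the flux with a constant test function. -/
theorem IsHDGTriple.cellInt_flux_const (h : IsHDGTriple T k τ u q uhat) {K : Finset Plane}
    (hK : K ∈ T.cells) (c : Plane) :
    bdryInt K (fun E y => val (uhat E) y * inner ℝ (normal K E) c)
      = cellInt K (fun y => ∑ i, val (q K i) y * c i) := by
  have h1 := h.local_flux hK (v := fun i => MvPolynomial.C (c i)) (fun i => by simp)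
  have h2 := integration_by_parts (T.isTriangle hK) (u K) (fun i => MvPolynomial.C (c i))
  have e1 : cellInt K (fun x => val (u K) x * val (dvg fun i => MvPolynomial.C (c i)) x) = 0 := by
    simp [cellInt, dvg]
  rw [e1, add_zero] at h2
  rw [h2, ← bdryInt_sub (by fun_prop) (by fun_prop)] at h1
  simp only [val_C] at h1
  rw [h1]
  refine bdryInt_congr fun E _ y => ?_
  simp only [normalComp, val_C, inner_plane, Fin.sum_univ_two]
  ring

theorem sq_abs_bdryInt_mul_le {K : Finset Plane} (h3 : K.card = 3) {F G : Finset Plane → Plane → ℝ}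
    (hF : ∀ E, Continuous (F E)) (hG : ∀ E, Continuous (G E)) {M : ℝ}
    (hM : ∀ E ∈ edges K, ∀ y ∈ hull E, |G E y| ≤ M) :
    bdryInt K (fun E y => F E y * G E y) ^ 2
      ≤ 3 * hK K * (M ^ 2 * bdryInt K (fun E y => F E y ^ 2)) := by
  refine (sq_bdryInt_le (F := fun E y => F E y * G E y) h3
    fun E => (hF E).mul (hG E)).trans ?_
  have := hK_nonneg K
  refine mul_le_mul_of_nonneg_left ?_ (by positivity)
  rw [← bdryInt_const_mul]
  refine bdryInt_mono (by fun_prop) (by fun_prop) fun E hE y hy => ?_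
  rw [mul_pow, mul_comm]
  refine mul_le_mul_of_nonneg_right ?_ (sq_nonneg _)
  rw [← sq_abs]
  exact pow_le_pow_left₀ (abs_nonneg _) (hM E hE y hy) 2

/-- The square root of `meshDist`, the distance in which the kernel of the potential estimate is a
power. -/
def meshGauge (x : Finset Plane → Plane) (K L : Finset Plane) : ℝ := Real.sqrt (meshDist x K L)

theorem meshGauge_sq (x : Finset Plane → Plane) (K L : Finset Plane) :
    meshGauge x K L ^ 2 = meshDist x K L := by
  have h1 := hK_nonneg K
  have h2 := hK_nonneg L
  exact Real.sq_sqrt (by unfold meshDist; positivity)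

theorem abs_le_of_sq_le_mul {a b c e : ℝ} (hb : 0 ≤ b) (he : 0 ≤ e) (hc : 0 ≤ c)
    (h : a ^ 2 ≤ c * (b * e) ^ 2) : |a| ≤ Real.sqrt c * b * e := by
  refine abs_le_of_sq_le_sq ?_ (by positivity)
  rw [mul_assoc, mul_pow, Real.sq_sqrt hc]
  exact h

/-- The constant in `meshDist_le_mul_dist`. -/
def sepConst (s : ℝ) : ℝ := s + 1 + 2 * Triangulation.lquConst s

theorem sepConst_pos (hs : 1 ≤ s) : 0 < sepConst s := by
  have := Triangulation.one_le_lquConst hs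
  unfold sepConst; linarith

/-- Seen from the centre of `K`, all points of another triangle are at the distance of `K` and `L`,
up to a factor. This rests on local quasi-uniformity. -/
theorem meshDist_le_mul_dist (D : T.HasDiscs s x r) (hΩ : IsConvexPolygon Ω) {K L : Finset Plane}
    (hK : K ∈ T.cells) (hL : L ∈ T.cells) (hLK : L ≠ K) {y : Plane} (hy : y ∈ hull L) :
    meshDist x K L ≤ sepConst s * dist y (x K) := by
  have h1 := D.hK_le_dist hΩ hK hL hLK hy
  have h2 : KGHDG.hK K ≤ s * dist y (x K) := (D.le K hK).trans
    (mul_le_mul_of_nonneg_left (D.radius_le_dist hK hL hLK hy) (zero_le_one.trans D.one_le))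
  have h3 : dist (x K) (x L) ≤ dist y (x K) + KGHDG.hK L := by
    have h4 := dist_le_hK hy (D.center_mem hL)
    have h5 := dist_triangle (x K) y (x L)
    rw [dist_comm (x K) y] at h5
    linarith
  have e : sepConst s * dist y (x K) = s * dist y (x K) + dist y (x K)
      + 2 * (Triangulation.lquConst s * dist y (x K)) := by unfold sepConst; ring
  unfold meshDist
  rw [e]
  linarith

theorem meshDist_pos (D : T.HasDiscs s x r) {K L : Finset Plane} (hL : L ∈ T.cells) :
    0 < meshDist x K L := by
  have h1 := D.hK_pos hL
  have h2 := hK_nonneg K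
  unfold meshDist; positivity

theorem meshGauge_pos (D : T.HasDiscs s x r) {K L : Finset Plane} (hL : L ∈ T.cells) :
    0 < meshGauge x K L := Real.sqrt_pos.2 (meshDist_pos D hL)

/-- The constant in `IsHDGTriple.bdryInt_uhat_sub_sq_le`. -/
def hatConst (k : ℕ) (s : ℝ) : ℝ := 2 + 6 * s * oscConst k s

theorem hatConst_pos (hs : 1 ≤ s) : 0 < hatConst k s := by
  have := oscConst_pos (k := k) (zero_lt_one.trans_le hs)
  unfold hatConst; positivity

/-- The square root of `betaSq`. -/
def beta (R : ℝ) (u : Finset Plane → Poly) (q : Finset Plane → Fin 2 → Poly)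
    (uhat : Finset Plane → Poly) (K : Finset Plane) : ℝ := Real.sqrt (betaSq R u q uhat K)

theorem beta_nonneg {R : ℝ} (K : Finset Plane) : 0 ≤ beta R u q uhat K := Real.sqrt_nonneg _

theorem beta_sq {R : ℝ} (hR : 0 ≤ R) (K : Finset Plane) :
    beta R u q uhat K ^ 2 = betaSq R u q uhat K := Real.sq_sqrt (betaSq_nonneg hR)

theorem radius_le_of_meshDist_le (D : T.HasDiscs s x r) {R : ℝ}
    (hR : ∀ K ∈ T.cells, ∀ L ∈ T.cells, meshDist x K L ≤ R) {K : Finset Plane} (hK : K ∈ T.cells) :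
    r K ≤ R := by
  have h1 := radius_le_hK (D.pos K hK).le (D.ball K hK)
  have h2 := hR K hK K hK
  have h3 := hK_nonneg K
  rw [meshDist, dist_self] at h2
  linarith

/-- The contribution of a triangle away from the source to the total flux. -/
theorem IsHDGTriple.abs_bdryInt_source_le (h : IsHDGTriple T k τ u q uhat)
    (D : T.HasDiscs s x r) (hΩ : IsConvexPolygon Ω) {R : ℝ}
    (hR : ∀ K ∈ T.cells, ∀ L ∈ T.cells, meshDist x K L ≤ R) {K L : Finset Plane}
    (hK : K ∈ T.cells) (hL : L ∈ T.cells) (hLK : L ≠ K) :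
    |bdryInt L (fun E y => val (uhat E) y
        * inner ℝ (normal L E) (sourceField (x K) (r K) y))|
      ≤ (Real.sqrt (3 * hatConst k s * sepConst s ^ 4) + Real.sqrt (Real.pi * sepConst s ^ 2))
        * (beta R u q uhat L * KGHDG.hK L * (meshGauge x K L ^ 3)⁻¹) := by
  have hs0 : 0 < s := zero_lt_one.trans_le D.one_le
  have hrK := D.pos K hK
  have hrL := D.pos L hL
  have hRL := radius_le_of_meshDist_le D hR hL
  have hR0 : 0 < R := hrL.trans_le hRL
  have hγ := sepConst_pos D.one_le
  have hc1 := hatConst_pos (k := k) D.one_le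
  have hg := meshGauge_pos D (K := K) hL
  have hg2 := meshGauge_sq x K L
  have hhL := D.hK_pos hL
  have hxL := D.center_mem hL
  have hβ := beta_nonneg (u := u) (q := q) (uhat := uhat) (R := R) L
  have hβ2 := beta_sq (u := u) (q := q) (uhat := uhat) hR0.le L
  set P := sourceField (x K) (r K) with hP
  set c := P (x L) with hc
  set a := val (u L) (x L) with ha
  set g := meshGauge x K L with hg_def
  set β := beta R u q uhat L with hβ_def
  set H := KGHDG.hK L with hH
  have hPc : Continuous P := continuous_sourceField hrK
  have hdist : ∀ y ∈ hull L, g ^ 2 / sepConst s ≤ dist y (x K) := by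
    intro y hy
    rw [div_le_iff₀' hγ, hg2]
    exact meshDist_le_mul_dist D hΩ hK hL hLK hy
  have hsep : ∀ y ∈ hull L, r K ≤ dist y (x K) := fun y hy => D.radius_le_dist hK hL hLK hy
  have h1 := h.cellInt_flux_const hL c
  have h2 := bdryInt_inner_const_eq_zero (T.isTriangle hL) c
  have h3 : bdryInt L (fun E y => inner ℝ (normal L E) (P y)) = 0 :=
    bdryInt_sourceField_eq_zero (T.isTriangle hL) hrK hsep
  have hsplit : bdryInt L (fun E y => val (uhat E) y * inner ℝ (normal L E) (P y))
      = bdryInt L (fun E y => (val (uhat E) y - a) * inner ℝ (normal L E) (P y - c))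
        + cellInt L (fun y => ∑ i, val (q L i) y * c i) := by
    have e : bdryInt L (fun E y => (val (uhat E) y - a) * inner ℝ (normal L E) (P y - c))
        = bdryInt L (fun E y => val (uhat E) y * inner ℝ (normal L E) (P y))
          - bdryInt L (fun E y => val (uhat E) y * inner ℝ (normal L E) c)
          - (a * bdryInt L (fun E y => inner ℝ (normal L E) (P y))
            - a * bdryInt L (fun E _ => inner ℝ (normal L E) c)) := by
      rw [← bdryInt_const_mul, ← bdryInt_const_mul, ← bdryInt_sub (by fun_prop) (by fun_prop),
        ← bdryInt_sub (by fun_prop) (by fun_prop), ← bdryInt_sub (by fun_prop) (by fun_prop)]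
      refine bdryInt_congr fun E _ y => ?_
      rw [inner_sub_right]; ring
    rw [e, h2, h3, h1]; ring
  have hhg : H ≤ g ^ 2 := by
    rw [hg2, meshDist]
    have := hK_nonneg K
    have := dist_nonneg (x := x K) (y := x L)
    linarith
  have hA1 : |bdryInt L (fun E y => (val (uhat E) y - a) * inner ℝ (normal L E) (P y - c))|
      ≤ Real.sqrt (3 * hatConst k s * sepConst s ^ 4) * β * (H * (g ^ 3)⁻¹) := by
    refine abs_le_of_sq_le_mul hβ (by positivity) (by positivity) ?_
    have hM : ∀ E ∈ edges L, ∀ y ∈ hull E,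
        |inner ℝ (normal L E) (P y - c)| ≤ H * (sepConst s ^ 2 / g ^ 4) := by
      intro E hE y hy
      have hy' := hull_edge_subset hE hy
      refine abs_inner_le_of_norm_le (norm_normal (T.isTriangle hL) hE) ?_
      rw [hc, hP, norm_sourceField_sub hrK (hsep y hy') (hsep _ hxL)]
      have hd1 := hdist y hy'
      have hd2 := hdist _ hxL
      have hd0 : 0 < g ^ 2 / sepConst s := by positivity
      calc dist y (x L) / (dist y (x K) * dist (x L) (x K))
          ≤ H / (g ^ 2 / sepConst s * (g ^ 2 / sepConst s)) := by
            gcongr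
            exact dist_le_hK hy' hxL
        _ = _ := by field_simp
    refine (sq_abs_bdryInt_mul_le (T.card_eq L hL) (F := fun E y => val (uhat E) y - a)
      (G := fun E y => inner ℝ (normal L E) (P y - c)) (by fun_prop) (by fun_prop) hM).trans ?_
    have h5 := h.bdryInt_uhat_sub_sq_le hL hrL (D.ball L hL) (D.le L hL) hs0 hRL hxL
    rw [← hβ2, ← ha] at h5
    have hb0 : 0 ≤ bdryInt L (fun E y => (val (uhat E) y - a) ^ 2) :=
      bdryInt_nonneg fun _ _ _ => sq_nonneg _
    calc 3 * H * ((H * (sepConst s ^ 2 / g ^ 4)) ^ 2 * bdryInt L (fun E y => (val (uhat E) y - a) ^ 2))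
        ≤ 3 * g ^ 2 * ((H * (sepConst s ^ 2 / g ^ 4)) ^ 2 * (hatConst k s * β ^ 2)) := by
          gcongr
          exact h5
      _ = _ := by field_simp
  have hA2 : |cellInt L (fun y => ∑ i, val (q L i) y * c i)|
      ≤ Real.sqrt (Real.pi * sepConst s ^ 2) * β * (H * (g ^ 3)⁻¹) := by
    have hpi := Real.pi_pos
    refine abs_le_of_sq_le_mul hβ (by positivity) (by positivity) ?_
    refine (sq_cellInt_le (by fun_prop)).trans ?_
    have hcn : ‖c‖ ≤ sepConst s / g ^ 2 := by
      rw [hc, hP, norm_sourceField hrK (hsep _ hxL)]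
      have hd0 : 0 < g ^ 2 / sepConst s := by positivity
      calc (dist (x L) (x K))⁻¹ ≤ (g ^ 2 / sepConst s)⁻¹ := by
            gcongr
            exact hdist _ hxL
        _ = _ := by field_simp
    have h6 : cellInt L (fun y => (∑ i, val (q L i) y * c i) ^ 2)
        ≤ (sepConst s / g ^ 2) ^ 2 * fluxSq q L := by
      rw [fluxSq, ← cellInt_const_mul]
      refine cellInt_mono (by fun_prop) (by fun_prop) fun y _ => ?_
      calc (∑ i, val (q L i) y * c i) ^ 2
          ≤ (∑ i, val (q L i) y ^ 2) * ∑ i, c i ^ 2 := Finset.sum_mul_sq_le_sq_mul_sq _ _ _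
        _ ≤ (∑ i, val (q L i) y ^ 2) * (sepConst s / g ^ 2) ^ 2 := by
            rw [← EuclideanSpace.real_norm_sq_eq]
            gcongr
        _ = _ := mul_comm _ _
    have h7 : fluxSq q L * g ^ 2 ≤ β ^ 2 := by
      have hg3 : g ^ 2 ≤ R := hg2.trans_le (hR K hK L hL)
      have h8 : fluxSq q L * g ^ 2 ≤ fluxSq q L * R :=
        mul_le_mul_of_nonneg_left hg3 (fluxSq_nonneg _ _)
      have h9 := jumpSq_nonneg u uhat L
      rw [hβ2, betaSq]
      linarith
    have h8 : fluxSq q L ≤ β ^ 2 / g ^ 2 := by rwa [le_div_iff₀ (by positivity)]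
    calc _ ≤ (Real.pi * H ^ 2) * ((sepConst s / g ^ 2) ^ 2 * (β ^ 2 / g ^ 2)) := by
          refine mul_le_mul (volume_hull_le hxL)
            (h6.trans (mul_le_mul_of_nonneg_left h8 (sq_nonneg _)))
            (cellInt_nonneg fun _ => sq_nonneg _) (by positivity)
      _ = _ := by field_simp
  rw [hsplit]
  refine (abs_add_le _ _).trans ?_
  linarith

/-- The contribution of the triangle of the source to the total flux. -/
theorem IsHDGTriple.abs_bdryInt_source_self_le (h : IsHDGTriple T k τ u q uhat)
    (D : T.HasDiscs s x r) {R : ℝ}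
    (hR : ∀ K ∈ T.cells, ∀ L ∈ T.cells, meshDist x K L ≤ R) {K : Finset Plane} (hK : K ∈ T.cells) :
    |bdryInt K (fun E y => val (uhat E) y * inner ℝ (normal K E) (sourceField (x K) (r K) y))
        - val (u K) (x K) * bdryInt K (fun E y => inner ℝ (normal K E) (sourceField (x K) (r K) y))|
      ≤ Real.sqrt (24 * hatConst k s * s ^ 2)
        * (beta R u q uhat K * KGHDG.hK K * (meshGauge x K K ^ 3)⁻¹) := by
  have hs0 : 0 < s := zero_lt_one.trans_le D.one_le
  have hrK := D.pos K hK
  have hRK := radius_le_of_meshDist_le D hR hK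
  have hc1 := hatConst_pos (k := k) D.one_le
  have hg := meshGauge_pos D (K := K) hK
  have hg2 := meshGauge_sq x K K
  have hh := D.hK_pos hK
  have hxK := D.center_mem hK
  have hsr := D.le K hK
  have hβ := beta_nonneg (u := u) (q := q) (uhat := uhat) (R := R) K
  have hβ2 := beta_sq (u := u) (q := q) (uhat := uhat) (hrK.le.trans hRK) K
  set P := sourceField (x K) (r K) with hP
  set a := val (u K) (x K) with ha
  set g := meshGauge x K K with hg_def
  set β := beta R u q uhat K with hβ_def
  set H := KGHDG.hK K with hH
  have hg2' : g ^ 2 = 2 * H := by rw [hg2, meshDist, dist_self]; ring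
  have hPc : Continuous P := continuous_sourceField hrK
  have e : bdryInt K (fun E y => val (uhat E) y * inner ℝ (normal K E) (P y))
      - a * bdryInt K (fun E y => inner ℝ (normal K E) (P y))
      = bdryInt K (fun E y => (val (uhat E) y - a) * inner ℝ (normal K E) (P y)) := by
    rw [← bdryInt_const_mul, ← bdryInt_sub (by fun_prop) (by fun_prop)]
    exact bdryInt_congr fun E _ y => by ring
  rw [e, ← mul_assoc]
  refine abs_le_of_sq_le_mul (by positivity) (by positivity) (by positivity) ?_
  have hM : ∀ E ∈ edges K, ∀ y ∈ hull E, |inner ℝ (normal K E) (P y)| ≤ (r K)⁻¹ := by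
    intro E hE y hy
    have h1 := normal_inner_ge_radius (T.isTriangle hK) hE hrK.le (D.ball K hK) hy
    have h2 : r K ≤ dist y (x K) := by
      have := real_inner_le_norm (normal K E) (y - x K)
      rw [norm_normal (T.isTriangle hK) hE, one_mul, ← dist_eq_norm] at this
      exact h1.trans this
    refine abs_inner_le_of_norm_le (norm_normal (T.isTriangle hK) hE) ?_
    rw [hP, norm_sourceField hrK h2]
    gcongr
  refine (sq_abs_bdryInt_mul_le (T.card_eq K hK) (F := fun E y => val (uhat E) y - a)
    (G := fun E y => inner ℝ (normal K E) (P y)) (by fun_prop) (by fun_prop) hM).trans ?_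
  have h5 := h.bdryInt_uhat_sub_sq_le hK hrK (D.ball K hK) hsr hs0 hRK hxK
  rw [← hβ2, ← ha] at h5
  have hb0 : 0 ≤ bdryInt K (fun E y => (val (uhat E) y - a) ^ 2) :=
    bdryInt_nonneg fun _ _ _ => sq_nonneg _
  have h6 : (r K)⁻¹ ≤ s / H := by
    rw [inv_le_comm₀ hrK (by positivity), inv_div, div_le_iff₀ hs0, mul_comm]
    exact hsr
  calc 3 * H * ((r K)⁻¹ ^ 2 * bdryInt K (fun E y => (val (uhat E) y - a) ^ 2))
      ≤ 3 * H * ((s / H) ^ 2 * (hatConst k s * β ^ 2)) := by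
        gcongr
        exact h5
    _ = 24 * hatConst k s * s ^ 2 * (β ^ 2 * H ^ 2 * ((g ^ 2) ^ 3)⁻¹) := by
        rw [hg2']; field_simp; ring
    _ = _ := by ring

/-- The constant in `IsHDGTriple.abs_val_le`. -/
def supConst (k : ℕ) (s : ℝ) : ℝ :=
  s ^ 2 / 2 * (Real.sqrt (3 * hatConst k s * sepConst s ^ 4) + Real.sqrt (Real.pi * sepConst s ^ 2)
    + Real.sqrt (24 * hatConst k s * s ^ 2)) + Real.sqrt (8 * s * oscConst k s)

/-- A discrete potential estimate: `u` is bounded on a triangle by a discrete Riesz potential of the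
flux and of the jumps. The total flux of `û F` vanishes for the point source field `F` at the centre of
the triangle; the triangle itself contributes its value of `u`, up to an oscillation, and the others
contribute only their oscillations, as `F` has no flux through their boundaries. -/
theorem IsHDGTriple.abs_val_le (h : IsHDGTriple T k τ u q uhat)
    (D : T.HasDiscs s x r) (hΩ : IsConvexPolygon Ω) {R : ℝ}
    (hR : ∀ K ∈ T.cells, ∀ L ∈ T.cells, meshDist x K L ≤ R) {K : Finset Plane}
    (hK : K ∈ T.cells) {z : Plane} (hz : z ∈ hull K) :
    |val (u K) z| ≤ supConst k s
      * ∑ L ∈ T.cells, beta R u q uhat L * KGHDG.hK L * (meshGauge x K L ^ 3)⁻¹ := by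
  classical
  have hs0 : 0 < s := zero_lt_one.trans_le D.one_le
  have hrK := D.pos K hK
  have hRK := radius_le_of_meshDist_le D hR hK
  have hhK := D.hK_pos hK
  have hxK := D.center_mem hK
  have hO := oscConst_pos (k := k) hs0
  set t : Finset Plane → ℝ := fun L => beta R u q uhat L * KGHDG.hK L * (meshGauge x K L ^ 3)⁻¹
    with ht
  have ht0 : ∀ L ∈ T.cells, 0 ≤ t L := fun L hL =>
    mul_nonneg (mul_nonneg (beta_nonneg L) (hK_nonneg L))
      (inv_nonneg.2 (pow_nonneg (meshGauge_pos D hL).le 3))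
  set S := ∑ L ∈ T.cells, t L with hS
  have htK : t K ≤ S := Finset.single_le_sum ht0 hK
  set c₁ := Real.sqrt (3 * hatConst k s * sepConst s ^ 4) + Real.sqrt (Real.pi * sepConst s ^ 2)
    with hc₁
  have hc₁0 : 0 ≤ c₁ := by positivity
  set c₂ := Real.sqrt (24 * hatConst k s * s ^ 2) with hc₂
  have hc₂0 : 0 ≤ c₂ := by positivity
  set Φ := bdryInt K (fun E y => inner ℝ (normal K E) (sourceField (x K) (r K) y)) with hΦ
  have hΦ2 : 2 / s ^ 2 ≤ Φ := bdryInt_sourceField_ge (T.isTriangle hK) hrK (D.ball K hK) (D.le K hK)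
  have htot := h.sum_bdryInt_uhat_mul_eq_zero hΩ (continuous_sourceField (x₀ := x K) hrK)
  rw [← Finset.add_sum_erase _ _ hK] at htot
  have hoff : |∑ L ∈ T.cells.erase K, bdryInt L (fun E y => val (uhat E) y
        * inner ℝ (normal L E) (sourceField (x K) (r K) y))| ≤ c₁ * S := by
    refine (Finset.abs_sum_le_sum_abs _ _).trans ?_
    rw [hS, Finset.mul_sum]
    refine (Finset.sum_le_sum fun L hL => h.abs_bdryInt_source_le D hΩ hR hK
      (Finset.mem_of_mem_erase hL) (Finset.ne_of_mem_erase hL)).trans ?_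
    exact Finset.sum_le_sum_of_subset_of_nonneg (Finset.erase_subset _ _)
      fun L hL _ => mul_nonneg hc₁0 (ht0 L hL)
  have hself := h.abs_bdryInt_source_self_le D hR hK
  rw [← hΦ, ← hc₂] at hself
  have hself' := hself.trans (mul_le_mul_of_nonneg_left htK hc₂0)
  have h1 : |val (u K) (x K) * Φ| ≤ (c₁ + c₂) * S := by
    rw [abs_le] at hoff hself' ⊢
    constructor <;> linarith [hoff.1, hoff.2, hself'.1, hself'.2]
  have h2 : |val (u K) (x K)| ≤ s ^ 2 / 2 * ((c₁ + c₂) * S) := by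
    have hΦ0 : 0 < Φ := lt_of_lt_of_le (by positivity) hΦ2
    rw [abs_mul, abs_of_pos hΦ0] at h1
    have h3 : |val (u K) (x K)| * (2 / s ^ 2) ≤ (c₁ + c₂) * S :=
      (mul_le_mul_of_nonneg_left hΦ2 (abs_nonneg _)).trans h1
    calc |val (u K) (x K)| = s ^ 2 / 2 * (|val (u K) (x K)| * (2 / s ^ 2)) := by field_simp
      _ ≤ _ := by gcongr
  have h4 : |val (u K) z - val (u K) (x K)| ≤ Real.sqrt (8 * s * oscConst k s) * S := by
    refine le_trans ?_ (mul_le_mul_of_nonneg_left htK (Real.sqrt_nonneg _))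
    have hg := meshGauge_pos D (K := K) hK
    have hg2 : meshGauge x K K ^ 2 = 2 * KGHDG.hK K := by
      rw [meshGauge_sq, meshDist, dist_self]; ring
    simp only [ht]
    rw [← mul_assoc]
    have hβ := beta_nonneg (u := u) (q := q) (uhat := uhat) (R := R) K
    refine abs_le_of_sq_le_mul (by positivity) (by positivity) (by positivity) ?_
    refine (h.osc_sq_le_betaSq hK hrK (D.ball K hK) (D.le K hK) hs0 hRK hz hxK).trans ?_
    rw [← beta_sq (hrK.le.trans hRK)]
    have h6 : (r K)⁻¹ ≤ s / KGHDG.hK K := by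
      rw [inv_le_comm₀ hrK (by positivity), inv_div, div_le_iff₀ hs0, mul_comm]
      exact D.le K hK
    calc oscConst k s / r K * beta R u q uhat K ^ 2
        = oscConst k s * (r K)⁻¹ * beta R u q uhat K ^ 2 := by ring
      _ ≤ oscConst k s * (s / KGHDG.hK K) * beta R u q uhat K ^ 2 := by gcongr
      _ = 8 * s * oscConst k s * (beta R u q uhat K ^ 2 * KGHDG.hK K ^ 2
          * ((meshGauge x K K ^ 2) ^ 3)⁻¹) := by rw [hg2]; field_simp; ring
      _ = _ := by ring
  have h5 : |val (u K) z| ≤ |val (u K) z - val (u K) (x K)| + |val (u K) (x K)| := by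
    have := abs_add_le (val (u K) z - val (u K) (x K)) (val (u K) (x K))
    rwa [sub_add_cancel] at this
  have e : supConst k s * S = s ^ 2 / 2 * ((c₁ + c₂) * S) + Real.sqrt (8 * s * oscConst k s) * S := by
    rw [supConst]; ring
  rw [e]
  linarith

/-- The triangles in a disc have a total area of at most that of the disc. -/
theorem sum_hK_sq_le (D : T.HasDiscs s x r) (K : Finset Plane) {ρ : ℝ} (hρ : 0 < ρ) :
    ∑ L ∈ T.cells with meshGauge x K L ≤ ρ, KGHDG.hK L ^ 2 ≤ s ^ 2 * ρ ^ 4 := by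
  classical
  have hs0 : 0 < s := zero_lt_one.trans_le D.one_le
  have hpi := Real.pi_pos
  have h1 := T.sum_volume_le (C := T.cells.filter fun L => meshGauge x K L ≤ ρ)
    (Finset.filter_subset _ _) (A := hull) (fun L _ => measurableSet_hull L) (fun L _ => subset_rfl)
    (B := Metric.closedBall (x K) (ρ ^ 2)) measure_closedBall_lt_top.ne (by
      intro L hL y hy
      obtain ⟨hL, hLρ⟩ := Finset.mem_filter.1 hL
      have h2 : meshDist x K L ≤ ρ ^ 2 := by
        rw [← meshGauge_sq]
        exact pow_le_pow_left₀ (Real.sqrt_nonneg _) hLρ 2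
      have h3 := dist_triangle y (x L) (x K)
      have h4 := dist_le_hK hy (D.center_mem hL)
      have h5 := hK_nonneg K
      rw [dist_comm (x L)] at h3
      rw [meshDist] at h2
      rw [Metric.mem_closedBall]
      linarith)
  rw [volume_real_closedBall _ (by positivity)] at h1
  have h2 : ∑ L ∈ T.cells with meshGauge x K L ≤ ρ, KGHDG.hK L ^ 2
      ≤ ∑ L ∈ T.cells with meshGauge x K L ≤ ρ, s ^ 2 / Real.pi * volume.real (hull L) := by
    refine Finset.sum_le_sum fun L hL => ?_
    have hL := (Finset.mem_filter.1 hL).1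
    have h3 := volume_hull_ge (D.pos L hL).le (D.ball L hL)
    have h4 := pow_le_pow_left₀ (hK_nonneg L) (D.le L hL) 2
    calc KGHDG.hK L ^ 2 ≤ (s * r L) ^ 2 := h4
      _ = s ^ 2 / Real.pi * (Real.pi * r L ^ 2) := by field_simp
      _ ≤ _ := by gcongr
  refine h2.trans ?_
  rw [← Finset.mul_sum]
  calc s ^ 2 / Real.pi * ∑ L ∈ T.cells with meshGauge x K L ≤ ρ, volume.real (hull L)
      ≤ s ^ 2 / Real.pi * (Real.pi * (ρ ^ 2) ^ 2) := by gcongr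
    _ = _ := by field_simp

/-- The constant in `IsHDGTriple.normL4Pow4_le`. -/
def sobolevConst (k : ℕ) (s : ℝ) : ℝ :=
  Real.pi * supConst k s ^ 4 * (512 * s ^ 2 * (1 + 48 * s ^ 2)) ^ 2

/-- The discrete Sobolev inequality: the potential estimate `IsHDGTriple.abs_val_le`, combined with
the mapping property of the discrete Riesz potential. -/
theorem IsHDGTriple.normL4Pow4_le (h : IsHDGTriple T k τ u q uhat)
    (D : T.HasDiscs s x r) (hΩ : IsConvexPolygon Ω) {R : ℝ}
    (hR : ∀ K ∈ T.cells, ∀ L ∈ T.cells, meshDist x K L ≤ R) {τ₀ : ℝ} (hτ₀ : 0 < τ₀)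
    (hτ : ∀ E ∈ T.allEdges, τ₀ ≤ τ E) :
    T.normL4Pow4 u ≤ sobolevConst k s * ((τ₀⁻¹ + R) * discEnergy T τ u q uhat) ^ 2 := by
  classical
  have hs0 : 0 < s := zero_lt_one.trans_le D.one_le
  have hpi := Real.pi_pos
  rcases T.cells.eq_empty_or_nonempty with hemp | ⟨K₀, hK₀⟩
  · have : T.normL4Pow4 u = 0 := by simp [Triangulation.normL4Pow4, Triangulation.cellSum, hemp]
    rw [this]
    unfold sobolevConst
    positivity
  have hR0 : 0 < R := (D.pos K₀ hK₀).trans_le (radius_le_of_meshDist_le D hR hK₀)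
  set S : Finset Plane → ℝ := fun K =>
    ∑ L ∈ T.cells, beta R u q uhat L * KGHDG.hK L * (meshGauge x K L ^ 3)⁻¹ with hS
  have hS0 : ∀ K ∈ T.cells, 0 ≤ S K := fun K _ => Finset.sum_nonneg fun L hL =>
    mul_nonneg (mul_nonneg (beta_nonneg L) (hK_nonneg L))
      (inv_nonneg.2 (pow_nonneg (meshGauge_pos D hL).le 3))
  have hriesz := riesz_potential_le (S := T.cells) (E := meshGauge x) (m := KGHDG.hK)
    (s := S) (β := beta R u q uhat) (A := s ^ 2)
    (fun K _ L hL => meshGauge_pos D hL) (fun K L => by rw [meshGauge, meshDist_comm, meshGauge])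
    (fun K _ L _ M _ => by
      rw [meshGauge_sq, meshGauge_sq, meshGauge_sq]
      have h1 := dist_triangle (x K) (x L) (x M)
      have h2 := hK_nonneg L
      unfold meshDist
      linarith) (sq_nonneg s) (fun K _ ρ hρ => sum_hK_sq_le D K hρ) hS0 (fun K _ => le_rfl)
  have h1 : T.normL4Pow4 u ≤ Real.pi * supConst k s ^ 4
      * ∑ K ∈ T.cells, KGHDG.hK K ^ 2 * S K ^ 4 := by
    rw [Triangulation.normL4Pow4, T.cellSum_eq, Finset.mul_sum]
    refine Finset.sum_le_sum fun K hK => ?_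
    have h2 : cellInt K (fun y => val (u K) y ^ 4) ≤ cellInt K fun _ => (supConst k s * S K) ^ 4 := by
      refine cellInt_mono (by fun_prop) (by fun_prop) fun y hy => ?_
      have h3 := h.abs_val_le D hΩ hR hK hy
      have h4 := pow_le_pow_left₀ (abs_nonneg _) h3 4
      rwa [Even.pow_abs (by decide)] at h4
    refine h2.trans ?_
    rw [cellInt_const]
    calc volume.real (hull K) * (supConst k s * S K) ^ 4
        ≤ (Real.pi * KGHDG.hK K ^ 2) * (supConst k s * S K) ^ 4 := by
          refine mul_le_mul_of_nonneg_right (volume_hull_le (D.center_mem hK))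
            (Even.pow_nonneg (by decide) _)
      _ = _ := by ring
  have h5 : ∑ L ∈ T.cells, beta R u q uhat L ^ 2 ≤ (τ₀⁻¹ + R) * discEnergy T τ u q uhat := by
    have e : ∑ L ∈ T.cells, beta R u q uhat L ^ 2
        = ∑ L ∈ T.cells, jumpSq u uhat L + R * T.normSqV q := by
      rw [Finset.sum_congr rfl fun L _ => beta_sq hR0.le L, Triangulation.normSqV, T.cellSum_eq,
        Finset.mul_sum, ← Finset.sum_add_distrib]
      rfl
    have h6 := jumpSum_le u uhat hτ
    have h7 : ∑ L ∈ T.cells, jumpSq u uhat L ≤ τ₀⁻¹ * T.normPlusSq τ u uhat := by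
      rw [inv_mul_eq_div, le_div_iff₀ hτ₀, mul_comm]; exact h6
    have h8 : 0 ≤ T.normSqV q :=
      T.cellSum_nonneg fun K x => Finset.sum_nonneg fun i _ => sq_nonneg _
    have h9 : 0 ≤ T.normPlusSq τ u uhat := by
      refine le_trans (mul_nonneg hτ₀.le (Finset.sum_nonneg fun K _ => jumpSq_nonneg u uhat K)) h6
    have h10 : 0 ≤ τ₀⁻¹ * T.normSqV q := by positivity
    have h11 : 0 ≤ R * T.normPlusSq τ u uhat := by positivity
    rw [e, discEnergy]
    nlinarith
  have h6 : 0 ≤ ∑ L ∈ T.cells, beta R u q uhat L ^ 2 := Finset.sum_nonneg fun _ _ => sq_nonneg _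
  have h12 : 0 ≤ supConst k s ^ 4 := Even.pow_nonneg (by decide) _
  calc T.normL4Pow4 u ≤ _ := h1
    _ ≤ Real.pi * supConst k s ^ 4 * ((512 * s ^ 2 * (1 + 48 * s ^ 2)) ^ 2
        * (∑ L ∈ T.cells, beta R u q uhat L ^ 2) ^ 2) := by gcongr
    _ = sobolevConst k s * (∑ L ∈ T.cells, beta R u q uhat L ^ 2) ^ 2 := by
        rw [sobolevConst]; ring
    _ ≤ _ := by
        have : 0 ≤ sobolevConst k s := by unfold sobolevConst; positivity
        gcongr

end

/-! ### Time derivatives of integrals -/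

/-- Polynomials of degree at most `k` are determined by their values at finitely many points. -/
theorem exists_lagrange_basis (k : ℕ) : ∃ (X : Finset Plane) (b : Plane → Poly),
    (∀ x, (b x).totalDegree ≤ k) ∧
    ∀ p : Poly, p.totalDegree ≤ k → p = ∑ x ∈ X, val p x • b x := by
  classical
  set V : Submodule ℝ Poly := MvPolynomial.restrictTotalDegree (Fin 2) ℝ k with hV
  set S : Finset ℝ := (Finset.range (k + 1)).image (fun n : ℕ => (n : ℝ)) with hS
  have hScard : S.card = k + 1 := by
    rw [hS, Finset.card_image_of_injective _ Nat.cast_injective, Finset.card_range]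
  set X : Finset Plane := (S ×ˢ S).image fun a => !₂[a.1, a.2] with hX
  let ev : V →ₗ[ℝ] (X → ℝ) :=
    { toFun := fun p x => val p x
      map_add' := fun p q => by ext x; simp
      map_smul' := fun c p => by ext x; simp }
  have hinj : LinearMap.ker ev = ⊥ := by
    rw [LinearMap.ker_eq_bot']
    intro p hp
    have hdeg : (p : Poly).totalDegree ≤ k :=
      (MvPolynomial.mem_restrictTotalDegree _ _ _).1 p.2
    have h0 : (p : Poly) = 0 := by
      refine MvPolynomial.eq_zero_of_eval_zero_at_prod_finset (p : Poly) (fun _ => S)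
        (fun i => ?_) fun a ha => ?_
      · rw [hScard]
        exact Nat.lt_succ_of_le ((MvPolynomial.degreeOf_le_totalDegree _ _).trans hdeg)
      · have hmem : !₂[a 0, a 1] ∈ X :=
          Finset.mem_image.2 ⟨(a 0, a 1), Finset.mem_product.2 ⟨ha 0, ha 1⟩, rfl⟩
        have h1 := congrFun hp ⟨_, hmem⟩
        have h2 : val (p : Poly) !₂[a 0, a 1] = 0 := h1
        rw [val] at h2
        have e : a = fun i => (!₂[a 0, a 1] : Plane) i := by
          funext i; fin_cases i <;> rfl
        rwa [← e] at h2
    exact Subtype.ext h0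
  obtain ⟨g, hg⟩ := ev.exists_leftInverse_of_injective hinj
  refine ⟨X, fun x => if h : x ∈ X then (g (Pi.single ⟨x, h⟩ 1) : V) else 0, fun x => ?_,
    fun p hp => ?_⟩
  · by_cases h : x ∈ X
    · simp only [h, dif_pos]
      exact (MvPolynomial.mem_restrictTotalDegree _ _ _).1 (g (Pi.single ⟨x, h⟩ 1)).2
    · simp [h]
  · have hp' : p ∈ V := (MvPolynomial.mem_restrictTotalDegree _ _ _).2 hp
    have h1 : g (ev ⟨p, hp'⟩) = ⟨p, hp'⟩ := LinearMap.congr_fun hg _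
    have h2 : ev ⟨p, hp'⟩ = ∑ x : X, val p x • (Pi.single x 1 : X → ℝ) := by
      ext x
      simp [ev, Finset.sum_apply, Pi.single_apply]
    rw [h2, map_sum] at h1
    have h3 := congrArg (Subtype.val) h1
    simp only [map_smul, AddSubmonoidClass.coe_finsetSum, Submodule.coe_smul] at h3
    rw [← Finset.sum_coe_sort X]
    exact h3.symm.trans (Finset.sum_congr rfl fun x _ => by simp)

instance (K : Finset Plane) : CompactSpace (hull K) :=
  isCompact_iff_compactSpace.1 (isCompact_hull K)

/-- The restriction of a polynomial to a triangle, as an element of the Banach algebra of continuous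
functions. -/
def restr (K : Finset Plane) : Poly →+* C(hull K, ℝ) where
  toFun p := ⟨fun y => val p y, by fun_prop⟩
  map_one' := by ext; simp [val]
  map_mul' p q := by ext; simp
  map_zero' := by ext; simp
  map_add' p q := by ext; simp

theorem restr_smul (K : Finset Plane) (c : ℝ) (p : Poly) : restr K (c • p) = c • restr K p := by
  ext; simp [restr]

/-- Integration over a triangle. -/
def integralCLM (K : Finset Plane) : C(hull K, ℝ) →L[ℝ] ℝ :=
  LinearMap.mkContinuous
    { toFun := fun f => ∫ y, f y ∂(Measure.comap Subtype.val (volume : Measure Plane))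
      map_add' := fun f g => by
        have : IsFiniteMeasure (Measure.comap (Subtype.val : hull K → Plane) volume) :=
          ⟨by rw [(MeasurableEmbedding.subtype_coe (measurableSet_hull K)).comap_apply]
              simpa using volume_hull_lt_top K⟩
        exact integral_add (f.continuous.integrable_of_hasCompactSupport
          (HasCompactSupport.of_compactSpace f))
          (g.continuous.integrable_of_hasCompactSupport (HasCompactSupport.of_compactSpace g))
      map_smul' := fun c f => integral_smul c f }
    ((Measure.comap (Subtype.val : hull K → Plane) volume).real Set.univ) fun f => by
      have : IsFiniteMeasure (Measure.comap (Subtype.val : hull K → Plane) volume) :=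
        ⟨by rw [(MeasurableEmbedding.subtype_coe (measurableSet_hull K)).comap_apply]
            simpa using volume_hull_lt_top K⟩
      rw [mul_comm]
      exact norm_integral_le_of_norm_le_const (Eventually.of_forall fun y => f.norm_coe_le_norm y)

theorem cellInt_val (K : Finset Plane) (p : Poly) : cellInt K (val p) = integralCLM K (restr K p) :=
  (integral_subtype_comap (measurableSet_hull K) (val p)).symm

section
variable {k : ℕ} {p : ℝ → Poly} {p' : Poly} {S : Set ℝ} {t : ℝ}

theorem hasDerivWithinAt_restr (hp : ∀ s ∈ S, (p s).totalDegree ≤ k) (ht : t ∈ S)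
    (hp' : p'.totalDegree ≤ k)
    (h : ∀ x, HasDerivWithinAt (fun s => val (p s) x) (val p' x) S t) (K : Finset Plane) :
    HasDerivWithinAt (fun s => restr K (p s)) (restr K p') S t := by
  obtain ⟨X, b, -, hb⟩ := exists_lagrange_basis k
  have h1 : ∀ q : Poly, q.totalDegree ≤ k → restr K q = ∑ x ∈ X, val q x • restr K (b x) := by
    intro q hq
    conv_lhs => rw [hb q hq, map_sum]
    simp only [restr_smul]
  have h2 : HasDerivWithinAt (fun s => ∑ x ∈ X, val (p s) x • restr K (b x))
      (∑ x ∈ X, val p' x • restr K (b x)) S t :=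
    HasDerivWithinAt.fun_sum fun x _ => (h x).smul_const (restr K (b x))
  rw [h1 p' hp']
  exact h2.congr (fun s hs => h1 _ (hp s hs)) (h1 _ (hp t ht))

theorem continuousWithinAt_restr (hp : ∀ s ∈ S, (p s).totalDegree ≤ k) (ht : t ∈ S)
    (h : ∀ x, ContinuousWithinAt (fun s => val (p s) x) S t) (K : Finset Plane) :
    ContinuousWithinAt (fun s => restr K (p s)) S t := by
  obtain ⟨X, b, -, hb⟩ := exists_lagrange_basis k
  have h1 : ∀ q : Poly, q.totalDegree ≤ k → restr K q = ∑ x ∈ X, val q x • restr K (b x) := by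
    intro q hq
    conv_lhs => rw [hb q hq, map_sum]
    simp only [restr_smul]
  have h2 : ContinuousWithinAt (fun s => ∑ x ∈ X, val (p s) x • restr K (b x)) S t :=
    tendsto_finsetSum _ fun x _ => (h x).smul_const (restr K (b x))
  exact h2.congr (fun s hs => h1 _ (hp s hs)) (h1 _ (hp t ht))

/-- The pointwise derivative of a curve of polynomials of degree at most `k` is of degree at most
`k`. -/
theorem totalDegree_deriv_le (hp : ∀ s ∈ S, (p s).totalDegree ≤ k) (ht : t ∈ S)
    (hu : UniqueDiffWithinAt ℝ S t)
    (h : ∀ x, HasDerivWithinAt (fun s => val (p s) x) (val p' x) S t) : p'.totalDegree ≤ k := by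
  obtain ⟨X, b, hbdeg, hb⟩ := exists_lagrange_basis k
  have h1 : p' = ∑ x ∈ X, val p' x • b x := by
    refine val_injective fun y => ?_
    have h2 : HasDerivWithinAt (fun s => ∑ x ∈ X, val (p s) x * val (b x) y)
        (∑ x ∈ X, val p' x * val (b x) y) S t :=
      HasDerivWithinAt.fun_sum fun x _ => (h x).mul_const _
    have h3 : ∀ s ∈ S, val (p s) y = ∑ x ∈ X, val (p s) x * val (b x) y := by
      intro s hs
      conv_lhs => rw [hb _ (hp s hs)]
      simp
    have h4 := h2.congr h3 (h3 t ht)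
    rw [hu.eq_deriv S (h y) h4]
    simp
  rw [h1]
  exact MvPolynomial.totalDegree_finsetSum_le fun x _ =>
    (MvPolynomial.totalDegree_smul_le _ _).trans (hbdeg x)

end

/-! ### Conservation of energy -/

@[simp] theorem val_pow (p : Poly) (n : ℕ) (x : Plane) : val (p ^ n) x = val p x ^ n := by
  simp [val]

section
variable {p : ℝ → Poly} {p' : Poly} {S : Set ℝ} {t : ℝ} {K : Finset Plane}

theorem hasDerivWithinAt_cellInt_pow
    (h : HasDerivWithinAt (fun s => restr K (p s)) (restr K p') S t) (n : ℕ) :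
    HasDerivWithinAt (fun s => cellInt K (fun y => val (p s) y ^ n))
      (cellInt K (fun y => n * val (p t) y ^ (n - 1) * val p' y)) S t := by
  have h1 := (integralCLM K).hasFDerivAt.comp_hasDerivWithinAt t (h.fun_pow n)
  have e1 : ∀ s, cellInt K (fun y => val (p s) y ^ n) = integralCLM K (restr K (p s) ^ n) := by
    intro s
    rw [← map_pow, ← cellInt_val]
    exact cellInt_congr fun y => by simp
  have e2 : cellInt K (fun y => n * val (p t) y ^ (n - 1) * val p' y)
      = integralCLM K (n * restr K (p t) ^ (n - 1) * restr K p') := by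
    have : (n : C(hull K, ℝ)) * restr K (p t) ^ (n - 1) * restr K p'
        = restr K (MvPolynomial.C (n : ℝ) * p t ^ (n - 1) * p') := by
      rw [map_mul, map_mul, map_pow, MvPolynomial.C_eq_coe_nat, map_natCast]
    rw [this, ← cellInt_val]
    refine cellInt_congr fun y => ?_
    rw [val_mul, val_mul, val_pow, val_C]
  rw [e2]
  exact h1.congr (fun s _ => e1 s) (e1 t)

theorem hasDerivWithinAt_cellInt_mul
    (h : HasDerivWithinAt (fun s => restr K (p s)) (restr K p') S t) (g : Poly) :
    HasDerivWithinAt (fun s => cellInt K (fun y => val g y * val (p s) y))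
      (cellInt K (fun y => val g y * val p' y)) S t := by
  have h1 := (integralCLM K).hasFDerivAt.comp_hasDerivWithinAt t (h.const_mul (restr K g))
  have e1 : ∀ r : Poly, cellInt K (fun y => val g y * val r y)
      = integralCLM K (restr K g * restr K r) := by
    intro r
    rw [← map_mul, ← cellInt_val]
    exact cellInt_congr fun y => by simp
  rw [e1]
  exact h1.congr (fun s _ => e1 _) (e1 _)

theorem continuousWithinAt_cellInt_pow
    (h : ContinuousWithinAt (fun s => restr K (p s)) S t) (n : ℕ) :
    ContinuousWithinAt (fun s => cellInt K (fun y => val (p s) y ^ n)) S t := by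
  have h1 := (integralCLM K).continuous.continuousAt.comp_continuousWithinAt (h.pow n)
  have e1 : ∀ s, cellInt K (fun y => val (p s) y ^ n) = integralCLM K (restr K (p s) ^ n) := by
    intro s
    rw [← map_pow, ← cellInt_val]
    exact cellInt_congr fun y => by simp
  exact h1.congr (fun s _ => e1 s) (e1 t)

/-- A nonnegative function has derivative zero at `t` if it lies below a function whose value and
derivative at `t` vanish. -/
theorem hasDerivWithinAt_zero_of_le {R N : ℝ → ℝ} (ht : t ∈ S) (h0 : ∀ s ∈ S, 0 ≤ R s)
    (hRN : ∀ s ∈ S, R s ≤ N s) (hNt : N t = 0) (hN : HasDerivWithinAt N 0 S t) :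
    HasDerivWithinAt R 0 S t := by
  have hRt : R t = 0 := le_antisymm ((hRN t ht).trans_eq hNt) (h0 t ht)
  rw [hasDerivWithinAt_iff_isLittleO] at hN ⊢
  simp only [hRt, hNt, smul_zero, sub_zero] at hN ⊢
  refine Asymptotics.IsBigO.trans_isLittleO (Asymptotics.IsBigO.of_bound 1 ?_) hN
  filter_upwards [self_mem_nhdsWithin] with s hs
  rw [one_mul, Real.norm_of_nonneg (h0 s hs), Real.norm_of_nonneg ((h0 s hs).trans (hRN s hs))]
  exact hRN s hs

end

/-- The energy of the semidiscrete wave equation: kinetic energy, energy of the diffusion, and the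
potential of the nonlinearity. -/
def waveEnergy {Ω : Set Plane} (T : Triangulation Ω) (τ : Finset Plane → ℝ)
    (u ut : Finset Plane → Poly) (q : Finset Plane → Fin 2 → Poly)
    (uhat : Finset Plane → Poly) : ℝ :=
  2⁻¹ * T.normSqW ut + 2⁻¹ * discEnergy T τ u q uhat + 4⁻¹ * T.normL4Pow4 u - 2⁻¹ * T.normSqW u

namespace IsSemidiscreteSolution
variable {Ω : Set Plane} {T : Triangulation Ω} {k : ℕ} {τ : Finset Plane → ℝ} {tf : ℝ}
  {uh0 uh1 : Finset Plane → Poly} {u ut utt : ℝ → Finset Plane → Poly}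
  {q : ℝ → Finset Plane → Fin 2 → Poly} {uhat : ℝ → Finset Plane → Poly}

theorem memW (h : IsSemidiscreteSolution T k τ tf uh0 uh1 u ut utt q uhat) (h0 : T.MemW k uh0)
    {t : ℝ} (ht : t ∈ Set.Icc 0 tf) : T.MemW k (u t) := by
  rcases ht.1.eq_or_lt with rfl | hpos
  · intro K hK
    rw [h.init K hK]
    exact h0 K hK
  · exact (h.triple t ⟨hpos, ht.2⟩).memW

theorem memW_t (h : IsSemidiscreteSolution T k τ tf uh0 uh1 u ut utt q uhat) (h0 : T.MemW k uh0)
    (htf : 0 < tf) {t : ℝ} (ht : t ∈ Set.Icc 0 tf) : T.MemW k (ut t) := fun K hK =>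
  totalDegree_deriv_le (p := fun s => u s K) (fun _ hs => h.memW h0 hs K hK) ht
    (uniqueDiffOn_Icc htf t ht) (h.hasDeriv t ht K hK)

theorem memW_tt (h : IsSemidiscreteSolution T k τ tf uh0 uh1 u ut utt q uhat) (h0 : T.MemW k uh0)
    (htf : 0 < tf) {t : ℝ} (ht : t ∈ Set.Ioc 0 tf) : T.MemW k (utt t) := fun K hK =>
  have ht' : t ∈ Set.Icc 0 tf := ⟨ht.1.le, ht.2⟩
  totalDegree_deriv_le (p := fun s => ut s K) (fun _ hs => h.memW_t h0 htf hs K hK) ht'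
    (uniqueDiffOn_Icc htf t ht') (h.hasDeriv_t t ht K hK)

theorem hasDerivWithinAt_restr (h : IsSemidiscreteSolution T k τ tf uh0 uh1 u ut utt q uhat)
    (h0 : T.MemW k uh0) (htf : 0 < tf) {t : ℝ} (ht : t ∈ Set.Icc 0 tf) {K : Finset Plane}
    (hK : K ∈ T.cells) :
    HasDerivWithinAt (fun s => restr K (u s K)) (restr K (ut t K)) (Set.Icc 0 tf) t :=
  KGHDG.hasDerivWithinAt_restr (fun _ hs => h.memW h0 hs K hK) ht (h.memW_t h0 htf ht K hK)
    (h.hasDeriv t ht K hK) K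

theorem hasDerivWithinAt_restr_t (h : IsSemidiscreteSolution T k τ tf uh0 uh1 u ut utt q uhat)
    (h0 : T.MemW k uh0) (htf : 0 < tf) {t : ℝ} (ht : t ∈ Set.Ioc 0 tf) {K : Finset Plane}
    (hK : K ∈ T.cells) :
    HasDerivWithinAt (fun s => restr K (ut s K)) (restr K (utt t K)) (Set.Icc 0 tf) t :=
  KGHDG.hasDerivWithinAt_restr (fun _ hs => h.memW_t h0 htf hs K hK) ⟨ht.1.le, ht.2⟩
    (h.memW_tt h0 htf ht K hK) (h.hasDeriv_t t ht K hK) K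

theorem continuousWithinAt_restr_t (h : IsSemidiscreteSolution T k τ tf uh0 uh1 u ut utt q uhat)
    (h0 : T.MemW k uh0) (htf : 0 < tf) {t : ℝ} (ht : t ∈ Set.Icc 0 tf) {K : Finset Plane}
    (hK : K ∈ T.cells) :
    ContinuousWithinAt (fun s => restr K (ut s K)) (Set.Icc 0 tf) t :=
  continuousWithinAt_restr (fun _ hs => h.memW_t h0 htf hs K hK) ht
    (fun x => h.continuous_t K hK x t ht) K

/-- The force that drives the diffusion: minus the acceleration minus the nonlinearity. -/
theorem diffusionForm_eq (h : IsSemidiscreteSolution T k τ tf uh0 uh1 u ut utt q uhat)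
    {t : ℝ} (ht : t ∈ Set.Ioc 0 tf) {w : Finset Plane → Poly} (hw : T.MemW k w) :
    diffusionForm T τ (u t) (q t) (uhat t) w
      = - T.cellSum (fun K y => val (utt t K + u t K ^ 3 - u t K) y * val (w K) y) := by
  have h1 := h.wave t ht w hw
  have e : T.cellSum (fun K y => val (utt t K + u t K ^ 3 - u t K) y * val (w K) y)
      = T.cellSum (fun K x => val (utt t K) x * val (w K) x)
        + T.cellSum (fun K x => nonlin (val (u t K) x) * val (w K) x) := by
    unfold nonlin
    rw [← T.cellSum_add (by fun_prop) (by fun_prop)]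
    exact T.cellSum_congr fun K _ x => by simp; ring
  rw [e]
  linarith

/-- The power of the diffusion. Neither `q` nor `û` is known to be differentiable in time; the
increment of the energy is a linear functional of the increment of `u` plus the energy of the increment,
and the latter is quadratically small by `IsHDGTriple.discEnergy_le`. -/
theorem hasDerivWithinAt_discEnergy
    (h : IsSemidiscreteSolution T k τ tf uh0 uh1 u ut utt q uhat) (h0 : T.MemW k uh0)
    (htf : 0 < tf) {s R τ₁ : ℝ} {c : Finset Plane → Plane} {ρ : Finset Plane → ℝ}
    (D : T.HasDiscs s c ρ) (hR : ∀ K ∈ T.cells, ρ K ≤ R)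
    (hτ : ∀ E ∈ T.allEdges, 0 ≤ τ E ∧ τ E ≤ τ₁) {t : ℝ} (ht : t ∈ Set.Ioc 0 tf) :
    HasDerivWithinAt (fun s => discEnergy T τ (u s) (q s) (uhat s))
      (-2 * T.cellSum (fun K y => val (utt t K + u t K ^ 3 - u t K) y * val (ut t K) y))
      (Set.Ioc 0 tf) t := by
  have hsub : Set.Ioc 0 tf ⊆ Set.Icc 0 tf := Set.Ioc_subset_Icc_self
  have hu : ∀ K ∈ T.cells, HasDerivWithinAt (fun s => restr K (u s K - u t K)) (restr K (ut t K))
      (Set.Ioc 0 tf) t := fun K hK => by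
    have h1 := ((h.hasDerivWithinAt_restr h0 htf (hsub ht) hK).mono hsub).sub_const
      (restr K (u t K))
    simpa only [map_sub] using h1
  set Cst := liftConst k s τ₁ R with hCst
  set N : ℝ → ℝ := fun s' => Cst * ∑ K ∈ T.cells, (ρ K ^ 2)⁻¹ * ∑ E ∈ edges K,
    cellInt K (fun y => val (u s' K - u t K) y ^ 2) with hN
  have hN0 : HasDerivWithinAt N 0 (Set.Ioc 0 tf) t := by
    have h1 : HasDerivWithinAt N (Cst * ∑ K ∈ T.cells, (ρ K ^ 2)⁻¹ * ∑ E ∈ edges K,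
        cellInt K (fun y => (2 : ℕ) * val (u t K - u t K) y ^ (2 - 1) * val (ut t K) y))
        (Set.Ioc 0 tf) t :=
      (HasDerivWithinAt.fun_sum fun K hK => (HasDerivWithinAt.fun_sum fun E _ =>
        hasDerivWithinAt_cellInt_pow (hu K hK) 2).const_mul _).const_mul _
    convert h1 using 1
    simp [cellInt]
  have hRem := hasDerivWithinAt_zero_of_le
    (R := fun s' => discEnergy T τ (fun K => u s' K - u t K) (fun K i => q s' K i - q t K i)
      (fun E => uhat s' E - uhat t E)) ht
    (fun s' _ => discEnergy_nonneg (fun E hE => (hτ E hE).1) _ _ _)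
    (fun s' hs' => by
      have h1 := ((h.triple s' hs').sub (h.triple t ht)).discEnergy_le D hR hτ (m := fun _ => 0)
        (fun _ _ _ => rfl)
      simpa only [sub_zero] using h1)
    (by simp [hN, cellInt]) hN0
  have hlin : HasDerivWithinAt (fun s' => T.cellSum (fun K y =>
        val (utt t K + u t K ^ 3 - u t K) y * val (u s' K - u t K) y))
      (T.cellSum (fun K y => val (utt t K + u t K ^ 3 - u t K) y * val (ut t K) y))
      (Set.Ioc 0 tf) t :=
    HasDerivWithinAt.fun_sum fun K hK => hasDerivWithinAt_cellInt_mul (hu K hK) _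
  have h1 := ((hlin.const_mul (-2)).add hRem).const_add (discEnergy T τ (u t) (q t) (uhat t))
  rw [add_zero] at h1
  have e : ∀ s' ∈ Set.Ioc 0 tf, discEnergy T τ (u s') (q s') (uhat s')
      = discEnergy T τ (u t) (q t) (uhat t) + (-2 * T.cellSum (fun K y =>
        val (utt t K + u t K ^ 3 - u t K) y * val (u s' K - u t K) y)
        + discEnergy T τ (fun K => u s' K - u t K) (fun K i => q s' K i - q t K i)
      (fun E => uhat s' E - uhat t E)) := by
    intro s' hs'
    have h2 := (h.triple t ht).discEnergy_sub (h.triple s' hs')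
    rw [h.diffusionForm_eq ht ((h.triple s' hs').sub (h.triple t ht)).memW] at h2
    linarith
  exact h1.congr e (e t ht)

/-- Conservation of energy, on the half-open interval on which the equations hold. -/
theorem waveEnergy_eq
    (h : IsSemidiscreteSolution T k τ tf uh0 uh1 u ut utt q uhat) (h0 : T.MemW k uh0)
    {s R τ₁ : ℝ} {c : Finset Plane → Plane} {ρ : Finset Plane → ℝ}
    (D : T.HasDiscs s c ρ) (hR : ∀ K ∈ T.cells, ρ K ≤ R)
    (hτ : ∀ E ∈ T.allEdges, 0 ≤ τ E ∧ τ E ≤ τ₁) {t₁ t₂ : ℝ} (ht₁ : t₁ ∈ Set.Ioc 0 tf)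
    (ht₂ : t₂ ∈ Set.Ioc 0 tf) :
    waveEnergy T τ (u t₁) (ut t₁) (q t₁) (uhat t₁)
      = waveEnergy T τ (u t₂) (ut t₂) (q t₂) (uhat t₂) := by
  have htf : 0 < tf := ht₁.1.trans_le ht₁.2
  have hsub : Set.Ioc 0 tf ⊆ Set.Icc 0 tf := Set.Ioc_subset_Icc_self
  have hder : ∀ t ∈ Set.Ioc 0 tf, HasDerivWithinAt
      (fun s => waveEnergy T τ (u s) (ut s) (q s) (uhat s)) 0 (Set.Ioc 0 tf) t := by
    intro t ht
    have hu := fun K hK => (h.hasDerivWithinAt_restr h0 htf (hsub ht) (K := K) hK).mono hsub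
    have hut := fun K hK => (h.hasDerivWithinAt_restr_t h0 htf ht (K := K) hK).mono hsub
    have h1 : HasDerivWithinAt (fun s => T.normSqW (ut s))
        (T.cellSum fun K y => (2 : ℕ) * val (ut t K) y ^ (2 - 1) * val (utt t K) y)
        (Set.Ioc 0 tf) t :=
      HasDerivWithinAt.fun_sum fun K hK => hasDerivWithinAt_cellInt_pow (hut K hK) 2
    have h2 := h.hasDerivWithinAt_discEnergy h0 htf D hR hτ ht
    have h3 : HasDerivWithinAt (fun s => T.normL4Pow4 (u s))
        (T.cellSum fun K y => (4 : ℕ) * val (u t K) y ^ (4 - 1) * val (ut t K) y)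
        (Set.Ioc 0 tf) t :=
      HasDerivWithinAt.fun_sum fun K hK => hasDerivWithinAt_cellInt_pow (hu K hK) 4
    have h4 : HasDerivWithinAt (fun s => T.normSqW (u s))
        (T.cellSum fun K y => (2 : ℕ) * val (u t K) y ^ (2 - 1) * val (ut t K) y)
        (Set.Ioc 0 tf) t :=
      HasDerivWithinAt.fun_sum fun K hK => hasDerivWithinAt_cellInt_pow (hu K hK) 2
    have h5 := (((h1.const_mul 2⁻¹).add (h2.const_mul 2⁻¹)).add (h3.const_mul 4⁻¹)).sub
      (h4.const_mul 2⁻¹)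
    refine HasDerivWithinAt.congr_deriv (f := fun s => waveEnergy T τ (u s) (ut s) (q s) (uhat s))
      h5 ?_
    have e : T.cellSum (fun K y => val (utt t K + u t K ^ 3 - u t K) y * val (ut t K) y)
        = 2⁻¹ * T.cellSum (fun K y => (2 : ℕ) * val (ut t K) y ^ (2 - 1) * val (utt t K) y)
          + 4⁻¹ * T.cellSum (fun K y => (4 : ℕ) * val (u t K) y ^ (4 - 1) * val (ut t K) y)
          - 2⁻¹ * T.cellSum (fun K y => (2 : ℕ) * val (u t K) y ^ (2 - 1) * val (ut t K) y) := by
      simp only [← T.cellSum_const_mul]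
      rw [← T.cellSum_add (by fun_prop) (by fun_prop), ← T.cellSum_sub (by fun_prop) (by fun_prop)]
      refine T.cellSum_congr fun K _ y => ?_
      simp
      ring
    rw [e]
    ring
  have := (convex_Ioc 0 tf).norm_image_sub_le_of_norm_hasDerivWithin_le (C := 0) hder
    (fun t _ => by simp) ht₂ ht₁
  rw [zero_mul, norm_le_zero_iff, sub_eq_zero] at this
  exact this

end IsSemidiscreteSolution

/-! ### Poincaré inequalities on a triangle -/

theorem setIntegral_swap {X Y : Type*} [TopologicalSpace X] [TopologicalSpace Y]
    [MeasurableSpace X] [MeasurableSpace Y] [BorelSpace X] [BorelSpace Y] [SecondCountableTopology X]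
    [SecondCountableTopology Y] [T2Space X] [T2Space Y]
    {μ : Measure X} {ν : Measure Y} [SFinite μ] [SFinite ν] [IsFiniteMeasureOnCompacts μ]
    [IsFiniteMeasureOnCompacts ν] {A : Set X} {B : Set Y} (hA : IsCompact A) (hB : IsCompact B)
    {f : X → Y → ℝ} (hf : Continuous f.uncurry) :
    ∫ x in A, ∫ y in B, f x y ∂ν ∂μ = ∫ y in B, ∫ x in A, f x y ∂μ ∂ν := by
  refine integral_integral_swap ?_
  rw [Measure.prod_restrict]
  exact hf.continuousOn.integrableOn_compact (hA.prod hB)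

/-- Contracting a triangle towards one of its points by a factor of at least `1 / 2` multiplies
integrals by at most `4`. -/
theorem setIntegral_contract_le {K : Finset Plane} {z : Plane} (hz : z ∈ hull K) {t : ℝ}
    (ht : t ∈ Set.Icc (2⁻¹ : ℝ) 1) {G : Plane → ℝ} (hG : Continuous G) (hG0 : ∀ y, 0 ≤ G y) :
    ∫ y in hull K, G (z + t • (y - z)) ≤ 4 * ∫ y in hull K, G y := by
  have ht0 : 0 < t := lt_of_lt_of_le (by norm_num) ht.1
  set g : Plane → ℝ := (hull K).indicator G with hg
  have hgi : Integrable g := (integrableOn_hull K hG.continuousOn).integrable_indicator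
    (measurableSet_hull K)
  have hg0 : ∀ y, 0 ≤ g y := fun y => Set.indicator_nonneg (fun y _ => hG0 y) y
  have e : ∀ y, z + t • (y - z) = (z - t • z) + t • y := fun y => by rw [smul_sub]; abel
  have hci : Integrable fun y => g (z + t • (y - z)) := by
    simp only [e]
    exact (hgi.comp_add_left (z - t • z)).comp_smul ht0.ne'
  have h1 : ∫ y in hull K, G (z + t • (y - z)) = ∫ y in hull K, g (z + t • (y - z)) := by
    refine setIntegral_congr_fun (measurableSet_hull K) fun y hy => ?_
    have : z + t • (y - z) ∈ hull K := (convex_hull K).add_smul_sub_mem hz hy ⟨ht0.le, ht.2⟩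
    simp only [hg, Set.indicator_of_mem this]
  have h2 : ∫ y in hull K, g (z + t • (y - z)) ≤ ∫ y, g (z + t • (y - z)) :=
    setIntegral_le_integral hci (Eventually.of_forall fun y => hg0 _)
  have h3 : ∫ y, g (z + t • (y - z)) = (t ^ 2)⁻¹ * ∫ y in hull K, G y := by
    simp only [e]
    rw [Measure.integral_comp_smul volume (fun y => g ((z - t • z) + y)) t,
      integral_add_left_eq_self g (z - t • z), hg, integral_indicator (measurableSet_hull K)]
    simp
  have h4 : (t ^ 2)⁻¹ ≤ 4 := by
    rw [inv_le_comm₀ (by positivity) (by norm_num)]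
    nlinarith [ht.1]
  rw [h1]
  refine h2.trans (h3.trans_le ?_)
  exact mul_le_mul_of_nonneg_right h4 (setIntegral_nonneg (measurableSet_hull K) fun y _ => hG0 y)

section
variable {K : Finset Plane} {φ : Plane → ℝ}

/-- The fundamental theorem of calculus on the half of a segment that is away from `z`. -/
theorem sq_sub_midpoint_le (hφ : ContDiff ℝ 1 φ) {y z : Plane} (hy : y ∈ hull K)
    (hz : z ∈ hull K) :
    (φ y - φ (z + (2⁻¹ : ℝ) • (y - z))) ^ 2
      ≤ 2⁻¹ * hK K ^ 2 * ∫ t in Set.Icc (2⁻¹ : ℝ) 1, ‖fderiv ℝ φ (z + t • (y - z))‖ ^ 2 := by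
  have hcont : Continuous (fderiv ℝ φ) := hφ.continuous_fderiv one_ne_zero
  have hγ : Continuous fun t : ℝ => z + t • (y - z) := by fun_prop
  have hder : ∀ t ∈ Set.uIcc (2⁻¹ : ℝ) 1, HasDerivAt (fun t : ℝ => φ (z + t • (y - z)))
      (fderiv ℝ φ (z + t • (y - z)) (y - z)) t := by
    intro t _
    have h1 : HasDerivAt (fun t : ℝ => z + t • (y - z)) (y - z) t := by
      simpa using ((hasDerivAt_id t).smul_const (y - z)).const_add z
    exact ((hφ.differentiable one_ne_zero _).hasFDerivAt.comp_hasDerivAt t h1)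
  have hc : Continuous fun t : ℝ => fderiv ℝ φ (z + t • (y - z)) (y - z) :=
    (hcont.comp hγ).clm_apply continuous_const
  have hftc := intervalIntegral.integral_eq_sub_of_hasDerivAt hder (hc.intervalIntegrable _ _)
  rw [one_smul, add_sub_cancel, intervalIntegral.integral_of_le (by norm_num),
    ← integral_Icc_eq_integral_Ioc] at hftc
  have h1 := sq_integral_le (μ := volume.restrict (Set.Icc (2⁻¹ : ℝ) 1))
    (hc.continuousOn.integrableOn_compact isCompact_Icc)
    ((hc.pow 2).continuousOn.integrableOn_compact isCompact_Icc)
  rw [hftc] at h1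
  refine h1.trans ?_
  have h2 : (volume.restrict (Set.Icc (2⁻¹ : ℝ) 1)).real Set.univ = 2⁻¹ := by
    simp [Measure.real]; norm_num
  rw [h2, mul_assoc, ← integral_const_mul (hK K ^ 2)]
  refine mul_le_mul_of_nonneg_left ?_ (by norm_num : (0 : ℝ) ≤ 2⁻¹)
  refine setIntegral_mono_on ((hc.pow 2).continuousOn.integrableOn_compact isCompact_Icc)
    ((((hcont.comp hγ).norm.pow 2).const_mul _).continuousOn.integrableOn_compact isCompact_Icc)
    measurableSet_Icc fun t _ => ?_
  have h3 := (fderiv ℝ φ (z + t • (y - z))).le_opNorm (y - z)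
  have h4 : ‖y - z‖ ≤ hK K := by rw [← dist_eq_norm]; exact dist_le_hK hy hz
  have h5 : ‖fderiv ℝ φ (z + t • (y - z)) (y - z)‖ ≤ hK K * ‖fderiv ℝ φ (z + t • (y - z))‖ := by
    rw [mul_comm]
    exact h3.trans (mul_le_mul_of_nonneg_left h4 (norm_nonneg _))
  calc (fderiv ℝ φ (z + t • (y - z)) (y - z)) ^ 2
      = ‖fderiv ℝ φ (z + t • (y - z)) (y - z)‖ ^ 2 := by rw [Real.norm_eq_abs, sq_abs]
    _ ≤ (hK K * ‖fderiv ℝ φ (z + t • (y - z))‖) ^ 2 := by gcongr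
    _ = _ := by ring

theorem cellInt_sq_sub_midpoint_le (hφ : ContDiff ℝ 1 φ) {z : Plane} (hz : z ∈ hull K) :
    ∫ y in hull K, (φ y - φ (z + (2⁻¹ : ℝ) • (y - z))) ^ 2
      ≤ hK K ^ 2 * ∫ y in hull K, ‖fderiv ℝ φ y‖ ^ 2 := by
  have hcont : Continuous (fderiv ℝ φ) := hφ.continuous_fderiv one_ne_zero
  have hφc := hφ.continuous
  have hunc : Continuous (Function.uncurry fun (y : Plane) (t : ℝ) =>
      ‖fderiv ℝ φ (z + t • (y - z))‖ ^ 2) := by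
    unfold Function.uncurry
    fun_prop
  set I := ∫ y in hull K, ‖fderiv ℝ φ y‖ ^ 2 with hI
  have hswap := setIntegral_swap (μ := (volume : Measure Plane)) (ν := (volume : Measure ℝ))
    (isCompact_hull K) (isCompact_Icc (a := (2⁻¹ : ℝ)) (b := 1)) hunc
  have hint1 : Integrable (Function.uncurry fun (y : Plane) (t : ℝ) =>
      ‖fderiv ℝ φ (z + t • (y - z))‖ ^ 2)
      ((volume.restrict (hull K)).prod (volume.restrict (Set.Icc (2⁻¹ : ℝ) 1))) := by
    rw [Measure.prod_restrict]
    exact hunc.continuousOn.integrableOn_compact ((isCompact_hull K).prod isCompact_Icc)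
  have h1 : ∫ y in hull K, (φ y - φ (z + (2⁻¹ : ℝ) • (y - z))) ^ 2
      ≤ ∫ y in hull K, 2⁻¹ * hK K ^ 2 * ∫ t in Set.Icc (2⁻¹ : ℝ) 1,
        ‖fderiv ℝ φ (z + t • (y - z))‖ ^ 2 := by
    refine setIntegral_mono_on (integrableOn_hull K (by fun_prop)) ?_ (measurableSet_hull K)
      fun y hy => sq_sub_midpoint_le hφ hy hz
    exact (hint1.integral_prod_left).const_mul _
  rw [integral_const_mul, hswap] at h1
  have h2 : ∫ t in Set.Icc (2⁻¹ : ℝ) 1, ∫ y in hull K, ‖fderiv ℝ φ (z + t • (y - z))‖ ^ 2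
      ≤ ∫ _ in Set.Icc (2⁻¹ : ℝ) 1, 4 * I := by
    refine setIntegral_mono_on hint1.integral_prod_right
      (continuousOn_const.integrableOn_compact isCompact_Icc) measurableSet_Icc fun t ht => ?_
    exact setIntegral_contract_le hz ht (G := fun y => ‖fderiv ℝ φ y‖ ^ 2) (by fun_prop)
      fun y => sq_nonneg _
  have h3 : ∫ _ in Set.Icc (2⁻¹ : ℝ) 1, 4 * I = 2 * I := by
    rw [setIntegral_const, Real.volume_real_Icc_of_le (by norm_num), smul_eq_mul]
    ring
  rw [h3] at h2
  calc _ ≤ _ := h1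
    _ ≤ 2⁻¹ * hK K ^ 2 * (2 * I) := mul_le_mul_of_nonneg_left h2 (by positivity)
    _ = _ := by ring

/-- The mean of a function over a triangle. -/
def cellMean (K : Finset Plane) (φ : Plane → ℝ) : ℝ := (volume.real (hull K))⁻¹ * cellInt K φ

/-- The Poincaré inequality on a triangle. The difference of the values at two points is split at
their midpoint: the path from a point to the midpoint consists of its images under contractions towards
the other point by factors of at least `1 / 2`, whose Jacobians are bounded from below. -/
theorem cellInt_sub_cellMean_sq_le (hpos : 0 < volume.real (hull K)) (hφ : ContDiff ℝ 1 φ) :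
    cellInt K (fun y => (φ y - cellMean K φ) ^ 2)
      ≤ 4 * hK K ^ 2 * cellInt K (fun y => ‖fderiv ℝ φ y‖ ^ 2) := by
  have hφc := hφ.continuous
  set V := volume.real (hull K) with hV
  set I := cellInt K (fun y => ‖fderiv ℝ φ y‖ ^ 2) with hI
  set A : Plane → Plane → ℝ := fun z y => (φ y - φ (z + (2⁻¹ : ℝ) • (y - z))) ^ 2 with hA
  have hAc : Continuous (Function.uncurry A) := by
    unfold Function.uncurry
    simp only [hA]
    fun_prop
  have hA1 : ∀ z, Continuous (A z) := fun z => hAc.comp (Continuous.prodMk_right z)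
  have hA2 : ∀ y, Continuous (fun z => A z y) := fun y => hAc.comp (Continuous.prodMk_left y)
  have hpt : ∀ y ∈ hull K, (φ y - cellMean K φ) ^ 2
      ≤ V⁻¹ * (2 * (∫ z in hull K, A z y) + 2 * ∫ z in hull K, A y z) := by
    intro y hy
    have e1 : φ y - cellMean K φ = V⁻¹ * cellInt K (fun z => φ y - φ z) := by
      rw [cellInt_sub continuous_const hφc, cellInt_const, ← hV, cellMean, ← hV]
      field_simp
    have h1 := sq_cellInt_le (K := K) (f := fun z => φ y - φ z) (by fun_prop)
    rw [← hV] at h1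
    have h2 : cellInt K (fun z => (φ y - φ z) ^ 2)
        ≤ 2 * (∫ z in hull K, A z y) + 2 * ∫ z in hull K, A y z := by
      have h3 : cellInt K (fun z => (φ y - φ z) ^ 2)
          ≤ cellInt K (fun z => 2 * A z y + 2 * A y z) := by
        refine cellInt_mono (by fun_prop) (((hA2 y).const_mul 2).add ((hA1 y).const_mul 2))
          fun z _ => ?_
        have e2 : y + (2⁻¹ : ℝ) • (z - y) = z + (2⁻¹ : ℝ) • (y - z) := by module
        simp only [hA, e2]
        nlinarith [sq_nonneg ((φ y - φ (z + (2⁻¹ : ℝ) • (y - z)))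
          + (φ z - φ (z + (2⁻¹ : ℝ) • (y - z))))]
      refine h3.trans_eq ?_
      rw [cellInt_add ((hA2 y).const_mul 2) ((hA1 y).const_mul 2), cellInt_const_mul,
        cellInt_const_mul]
      rfl
    rw [e1, mul_pow]
    calc V⁻¹ ^ 2 * cellInt K (fun z => φ y - φ z) ^ 2
        ≤ V⁻¹ ^ 2 * (V * cellInt K (fun z => (φ y - φ z) ^ 2)) := by gcongr
      _ = V⁻¹ * cellInt K (fun z => (φ y - φ z) ^ 2) := by field_simp
      _ ≤ _ := by gcongr
  have hint : Integrable (Function.uncurry A)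
      ((volume.restrict (hull K)).prod (volume.restrict (hull K))) := by
    rw [Measure.prod_restrict]
    exact hAc.continuousOn.integrableOn_compact ((isCompact_hull K).prod (isCompact_hull K))
  have hi1 : IntegrableOn (fun y => ∫ z in hull K, A z y) (hull K) := hint.integral_prod_right
  have hi2 : IntegrableOn (fun y => ∫ z in hull K, A y z) (hull K) := hint.integral_prod_left
  have hswap := setIntegral_swap (μ := (volume : Measure Plane)) (ν := (volume : Measure Plane))
    (isCompact_hull K) (isCompact_hull K) hAc
  have hB : ∫ z in hull K, ∫ y in hull K, A z y ≤ V * (hK K ^ 2 * I) := by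
    have : ∫ z in hull K, ∫ y in hull K, A z y ≤ ∫ _ in hull K, hK K ^ 2 * I :=
      setIntegral_mono_on hi2 (integrableOn_hull K continuousOn_const) (measurableSet_hull K)
        fun z hz => cellInt_sq_sub_midpoint_le hφ hz
    rwa [setIntegral_const, smul_eq_mul, ← hV] at this
  have h4 : cellInt K (fun y => (φ y - cellMean K φ) ^ 2)
      ≤ ∫ y in hull K, V⁻¹ * (2 * (∫ z in hull K, A z y) + 2 * ∫ z in hull K, A y z) :=
    setIntegral_mono_on (integrableOn_hull K (by fun_prop))
      (((hi1.const_mul 2).add (hi2.const_mul 2)).const_mul _) (measurableSet_hull K) hpt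
  rw [integral_const_mul, integral_add (hi1.const_mul 2) (hi2.const_mul 2), integral_const_mul,
    integral_const_mul, ← hswap] at h4
  calc _ ≤ _ := h4
    _ ≤ V⁻¹ * (2 * (V * (hK K ^ 2 * I)) + 2 * (V * (hK K ^ 2 * I))) := by gcongr
    _ = _ := by field_simp; ring

/-- The mean of a function over an edge. -/
def edgeMean (E : Finset Plane) (φ : Plane → ℝ) : ℝ :=
  ((Measure.hausdorffMeasure 1 : Measure Plane).real (hull E))⁻¹
    * ∫ y in hull E, φ y ∂(Measure.hausdorffMeasure 1)

/-- The divergence theorem for the field `φ(y) (y - a)`, where `a` is the vertex opposite to the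
edge `E`, with `η` the height of the triangle over `E`. -/
theorem exists_height {E : Finset Plane} (h3 : IsTriangle K) (hE : E ∈ edges K) :
    ∃ a ∈ hull K, ∃ η : ℝ, ∀ ψ : Plane → ℝ, ContDiff ℝ 1 ψ →
      cellInt K (fun y => fderiv ℝ ψ y (y - a)) + 2 * cellInt K ψ
        = η * ∫ y in hull E, ψ y ∂(Measure.hausdorffMeasure 1) := by
  classical
  obtain ⟨a, b, c, hab, hac, hbc, hKeq, hEeq, -⟩ := exists_vertices_of_edge h3 hE
  have haK : a ∈ hull K := subset_hull K (by simp [hKeq])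
  have hbE : b ∈ hull E := subset_hull E (by simp [hEeq])
  refine ⟨a, haK, inner ℝ (normal K E) (b - a), fun ψ hψ => ?_⟩
  have hψc := hψ.continuous
  have hcont : Continuous (fderiv ℝ ψ) := hψ.continuous_fderiv one_ne_zero
  set F' : Fin 2 → Plane → Plane →L[ℝ] ℝ := fun i y =>
    ψ y • (EuclideanSpace.proj i : Plane →L[ℝ] ℝ) + (y i - a i) • fderiv ℝ ψ y with hF'
  have hder : ∀ i, ∀ y ∈ hull K, HasFDerivAt (fun y : Plane => ψ y * (y i - a i)) (F' i y) y := by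
    intro i y _
    have h1 : HasFDerivAt (fun y : Plane => y i - a i) (EuclideanSpace.proj (𝕜 := ℝ) i) y :=
      (EuclideanSpace.proj (𝕜 := ℝ) i).hasFDerivAt.sub_const (a i)
    exact (hψ.differentiable one_ne_zero y).hasFDerivAt.mul h1
  have hF'c : ∀ i, Continuous (F' i) := fun i => by
    simp only [hF']
    exact (hψc.smul continuous_const).add ((by fun_prop : Continuous fun y : Plane =>
      y i - a i).smul hcont)
  have hdiv := fun i => divergence_theorem h3.1 h3.2 (hder i) (hF'c i).continuousOn
    (EuclideanSpace.single i 1)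
  have hl : cellInt K (fun y => fderiv ℝ ψ y (y - a)) + 2 * cellInt K ψ
      = ∑ i, ∫ y in hull K, F' i y (EuclideanSpace.single i 1) := by
    rw [← integral_finsetSum _ fun i _ => integrableOn_hull K
      ((hF'c i).clm_apply continuous_const).continuousOn, ← cellInt_const_mul,
      ← cellInt_add (hcont.clm_apply (by fun_prop)) (by fun_prop)]
    refine cellInt_congr fun y => ?_
    have e : y - a = (y 0 - a 0) • (EuclideanSpace.single 0 1 : Plane)
        + (y 1 - a 1) • (EuclideanSpace.single 1 1 : Plane) := by
      ext i; fin_cases i <;> simp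
    conv_lhs => rw [e, map_add, map_smul, map_smul]
    simp [hF', Fin.sum_univ_two]
    ring
  have hr : ∀ E' ∈ edges K, ∑ i, (∫ y in hull E', ψ y * (y i - a i)
        ∂(Measure.hausdorffMeasure 1)) * inner ℝ (normal K E') (EuclideanSpace.single i 1 : Plane)
      = ∫ y in hull E', ψ y * inner ℝ (normal K E') (y - a) ∂(Measure.hausdorffMeasure 1) := by
    intro E' hE'
    simp only [← integral_mul_const]
    rw [← integral_finsetSum _ fun i _ => integrableOn_edge hE' (by fun_prop)]
    congr 1
    ext y
    rw [inner_plane (normal K E') (y - a)]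
    simp [Fin.sum_univ_two, inner_plane]
    ring
  rw [hl, Finset.sum_congr rfl fun i _ => hdiv i, Finset.sum_comm, Finset.sum_congr rfl hr,
    Finset.sum_eq_single_of_mem E hE]
  · rw [← integral_const_mul]
    refine setIntegral_congr_fun (measurableSet_hull E) fun y hy => ?_
    have h1 := normal_inner_edge h3 hE hbE hy
    have e : y - a = (y - b) + (b - a) := by abel
    simp only [e]
    rw [inner_add_right, h1]
    ring
  · intro E' hE' hne
    -- the other edges contain the vertex `a`
    have haE' : a ∈ hull E' := by
      refine subset_hull E' ?_
      by_contra ha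
      obtain ⟨hsub, hcard⟩ := Finset.mem_powersetCard.1 hE'
      refine hne (Finset.eq_of_subset_of_card_le ?_ ?_)
      · intro y hy
        have h1 := hsub hy
        rw [hKeq, Finset.mem_insert] at h1
        rw [hEeq]
        exact h1.resolve_left fun h => ha (h ▸ hy)
      · rw [hcard, (Finset.mem_powersetCard.1 hE).2]
    refine (setIntegral_congr_fun (g := fun _ => 0) (measurableSet_hull E') fun y hy => ?_).trans
      (by simp)
    simp only [normal_inner_edge h3 hE' haE' hy, mul_zero]

/-- The means over a triangle and over one of its edges differ by the integral of a derivative, by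
the divergence theorem in `exists_height`. -/
theorem volume_mul_edgeMean_sub_sq_le {E : Finset Plane} (hpos : 0 < volume.real (hull K))
    (h3 : IsTriangle K) (hE : E ∈ edges K) (hφ : ContDiff ℝ 1 φ) :
    volume.real (hull K) * (edgeMean E φ - cellMean K φ) ^ 2
      ≤ 4⁻¹ * (hK K ^ 2 * cellInt K (fun y => ‖fderiv ℝ φ y‖ ^ 2)) := by
  have hcont : Continuous (fderiv ℝ φ) := hφ.continuous_fderiv one_ne_zero
  obtain ⟨a, haK, η, h⟩ := exists_height h3 hE
  have h1 := h (fun _ => 1) contDiff_const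
  have h2 := h φ hφ
  set V := volume.real (hull K) with hV
  set S := (Measure.hausdorffMeasure 1 : Measure Plane).real (hull E) with hS
  have e1 : cellInt K (fun y => fderiv ℝ (fun _ : Plane => (1 : ℝ)) y (y - a)) = 0 := by
    simp [cellInt]
  rw [e1, zero_add, cellInt_const, ← hV, setIntegral_const, ← hS, smul_eq_mul, mul_one, mul_one]
    at h1
  have hS0 : S ≠ 0 := fun h0 => by rw [h0] at h1; linarith
  have hη0 : η ≠ 0 := fun h0 => by rw [h0] at h1; linarith
  set J := cellInt K (fun y => fderiv ℝ φ y (y - a)) with hJ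
  have h4 : edgeMean E φ - cellMean K φ = J / (2 * V) := by
    have e2 : ∫ y in hull E, φ y ∂(Measure.hausdorffMeasure 1) = (J + 2 * cellInt K φ) / η := by
      rw [h2]; field_simp
    rw [edgeMean, cellMean, ← hS, ← hV, e2]
    have : S = 2 * V / η := by rw [h1]; field_simp
    rw [this]
    field_simp
    ring
  have h5 : J ^ 2 ≤ V * cellInt K (fun y => (fderiv ℝ φ y (y - a)) ^ 2) :=
    sq_cellInt_le (hcont.clm_apply (by fun_prop))
  have h6 : cellInt K (fun y => (fderiv ℝ φ y (y - a)) ^ 2)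
      ≤ hK K ^ 2 * cellInt K (fun y => ‖fderiv ℝ φ y‖ ^ 2) := by
    rw [← cellInt_const_mul]
    refine cellInt_mono ((hcont.clm_apply (by fun_prop)).pow 2) (by fun_prop) fun y hy => ?_
    have h7 := (fderiv ℝ φ y).le_opNorm (y - a)
    have h8 : ‖y - a‖ ≤ hK K := by rw [← dist_eq_norm]; exact dist_le_hK hy haK
    have h9 : ‖fderiv ℝ φ y (y - a)‖ ≤ hK K * ‖fderiv ℝ φ y‖ := by
      rw [mul_comm]
      exact h7.trans (mul_le_mul_of_nonneg_left h8 (norm_nonneg _))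
    calc (fderiv ℝ φ y (y - a)) ^ 2 = ‖fderiv ℝ φ y (y - a)‖ ^ 2 := by
          rw [Real.norm_eq_abs, sq_abs]
      _ ≤ (hK K * ‖fderiv ℝ φ y‖) ^ 2 := by gcongr
      _ = _ := by ring
  rw [h4]
  calc V * (J / (2 * V)) ^ 2 = 4⁻¹ * V⁻¹ * J ^ 2 := by field_simp; ring
    _ ≤ 4⁻¹ * V⁻¹ * (V * (hK K ^ 2 * cellInt K (fun y => ‖fderiv ℝ φ y‖ ^ 2))) := by
        gcongr
        exact h5.trans (mul_le_mul_of_nonneg_left h6 hpos.le)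
    _ = _ := by field_simp

/-- A Poincaré inequality with the mean over an edge. -/
theorem cellInt_sub_edgeMean_sq_le {E : Finset Plane} (hpos : 0 < volume.real (hull K))
    (h3 : IsTriangle K) (hE : E ∈ edges K) (hφ : ContDiff ℝ 1 φ) :
    cellInt K (fun y => (φ y - edgeMean E φ) ^ 2)
      ≤ 9 * (hK K ^ 2 * cellInt K (fun y => ‖fderiv ℝ φ y‖ ^ 2)) := by
  have hφc := hφ.continuous
  have h1 := cellInt_sub_cellMean_sq_le hpos hφ
  have h2 := volume_mul_edgeMean_sub_sq_le hpos h3 hE hφ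
  have h4 : cellInt K (fun y => (φ y - edgeMean E φ) ^ 2)
      ≤ cellInt K (fun y => 2 * (φ y - cellMean K φ) ^ 2
        + 2 * (edgeMean E φ - cellMean K φ) ^ 2) :=
    cellInt_mono (by fun_prop) (by fun_prop) fun y _ => by
      nlinarith [sq_nonneg ((φ y - cellMean K φ) + (edgeMean E φ - cellMean K φ))]
  rw [cellInt_add (by fun_prop) (by fun_prop), cellInt_const_mul, cellInt_const] at h4
  have h5 : 0 ≤ cellInt K (fun y => ‖fderiv ℝ φ y‖ ^ 2) := cellInt_nonneg fun y => sq_nonneg _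
  nlinarith [mul_nonneg (sq_nonneg (hK K)) h5]

end

/-! ### The initial data -/

theorem integral_norm_sq_eq {α F : Type*} [MeasurableSpace α] {μ : Measure α}
    [NormedAddCommGroup F] {f : α → F} (hf : MemLp f 2 μ) :
    ∫ x, ‖f x‖ ^ 2 ∂μ = (eLpNorm f 2 μ).toReal ^ 2 := by
  have hI : 0 ≤ ∫ x, ‖f x‖ ^ 2 ∂μ := integral_nonneg fun x => sq_nonneg _
  rw [hf.eLpNorm_eq_integral_rpow_norm two_ne_zero ENNReal.ofNat_ne_top]
  simp only [ENNReal.toReal_ofNat, Real.rpow_two]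
  rw [ENNReal.toReal_ofReal (by positivity), ← Real.rpow_natCast, ← Real.rpow_mul hI]
  norm_num

theorem norm_gradient (φ : Plane → ℝ) (x : Plane) : ‖gradient φ x‖ = ‖fderiv ℝ φ x‖ := by
  rw [gradient, LinearIsometryEquiv.norm_map]

section
variable {Ω : Set Plane}

theorem IsTestFun.memLp {φ : Plane → ℝ} (h : IsTestFun Ω φ) : MemL2 Ω φ :=
  (h.1.continuous.memLp_of_hasCompactSupport h.2.1).restrict Ω

theorem IsTestFun.continuous_fderiv {φ : Plane → ℝ} (h : IsTestFun Ω φ) :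
    Continuous (fderiv ℝ φ) := h.1.continuous_fderiv (by simp)

theorem IsTestFun.memLp_gradient {φ : Plane → ℝ} (h : IsTestFun Ω φ) :
    MemLp (gradient φ) 2 (volume.restrict Ω) := by
  have h1 : Continuous (gradient φ) :=
    (InnerProductSpace.toDual ℝ Plane).symm.continuous.comp h.continuous_fderiv
  refine (h1.memLp_of_hasCompactSupport ?_).restrict Ω
  exact (h.2.1.fderiv ℝ).comp_left (map_zero _)

/-- Functions in `H¹₀` are approximated in `L²` by test functions with bounded gradients. -/
theorem MemH10.exists_bound {u₀ : Plane → ℝ} (h : MemH10 Ω u₀) :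
    ∃ B : ℝ, 0 ≤ B ∧ ∀ ε > 0, ∃ φ, IsTestFun Ω φ ∧ ∫ x in Ω, (u₀ x - φ x) ^ 2 ≤ ε ∧
      ∫ x in Ω, ‖fderiv ℝ φ x‖ ^ 2 ≤ B := by
  obtain ⟨hu, g, hg, φ, hφ, h1, h2⟩ := h
  set M := 1 + eLpNorm g 2 (volume.restrict Ω) with hM
  have hMtop : M ≠ ⊤ := ENNReal.add_ne_top.2 ⟨ENNReal.one_ne_top, hg.eLpNorm_ne_top⟩
  refine ⟨M.toReal ^ 2, sq_nonneg _, fun ε hε => ?_⟩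
  have e1 := (ENNReal.tendsto_nhds_zero.1 h1) (ENNReal.ofReal (Real.sqrt ε))
    (ENNReal.ofReal_pos.2 (Real.sqrt_pos.2 hε))
  have e2 := (ENNReal.tendsto_nhds_zero.1 h2) 1 one_pos
  obtain ⟨n, hn1, hn2⟩ := (e1.and e2).exists
  refine ⟨φ n, hφ n, ?_, ?_⟩
  · have h3 := integral_norm_sq_eq ((hφ n).memLp.sub hu)
    have e3 : ∫ x in Ω, (u₀ x - φ n x) ^ 2 = ∫ x in Ω, ‖(φ n - u₀) x‖ ^ 2 := by
      congr 1; ext x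
      rw [Real.norm_eq_abs, sq_abs, Pi.sub_apply]; ring
    rw [e3, h3]
    have h4 : (eLpNorm (φ n - u₀) 2 (volume.restrict Ω)).toReal ≤ Real.sqrt ε :=
      ENNReal.toReal_le_of_le_ofReal (Real.sqrt_nonneg _) hn1
    calc _ ≤ Real.sqrt ε ^ 2 := by gcongr
      _ = ε := Real.sq_sqrt hε.le
  · simp only [← norm_gradient]
    rw [integral_norm_sq_eq (hφ n).memLp_gradient]
    gcongr
    have h5 : gradient (φ n) = (fun x => gradient (φ n) x - g x) + g := by
      ext1 x; simp
    rw [h5]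
    refine (eLpNorm_add_le ?_ hg.1 one_le_two).trans ?_
    · exact (hφ n).memLp_gradient.1.sub hg.1
    · exact add_le_add_left hn2 _

/-- The weak Laplacian is unique almost everywhere. -/
theorem integral_sq_eq_of_isWeakLaplacian (hΩ : IsOpen Ω) {u₀ g g' : Plane → ℝ} (hg : MemL2 Ω g)
    (hg' : MemL2 Ω g') (h : IsWeakLaplacian Ω u₀ g) (h' : IsWeakLaplacian Ω u₀ g') :
    ∫ x in Ω, g x ^ 2 = ∫ x in Ω, g' x ^ 2 := by
  have hloc : LocallyIntegrableOn (fun x => g x - g' x) Ω := by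
    have h1 : LocallyIntegrable (fun x => g x - g' x) (volume.restrict Ω) :=
      (hg.sub hg').locallyIntegrable one_le_two
    rw [locallyIntegrableOn_iff hΩ.isLocallyClosed]
    intro k hk hkc
    have := h1.integrableOn_isCompact hkc
    rwa [IntegrableOn, Measure.restrict_restrict_of_subset hk] at this
  have h0 := hΩ.ae_eq_zero_of_integral_contDiff_smul_eq_zero (μ := volume) hloc (by
    intro φ hφ1 hφ2 hφ3
    have hφ : IsTestFun Ω φ := ⟨hφ1, hφ2, hφ3⟩
    have e1 : ∫ x, φ x • (g x - g' x) = ∫ x in Ω, φ x • (g x - g' x) := by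
      refine (setIntegral_eq_integral_of_forall_compl_eq_zero fun x hx => ?_).symm
      rw [image_eq_zero_of_notMem_tsupport fun hx' => hx (hφ3 hx'), zero_smul]
    have e2 : ∫ x in Ω, φ x • (g x - g' x) = (∫ x in Ω, g x * φ x) - ∫ x in Ω, g' x * φ x := by
      have h1 : Integrable (fun x => g x * φ x) (volume.restrict Ω) :=
        hg.integrable_mul hφ.memLp
      have h2 : Integrable (fun x => g' x * φ x) (volume.restrict Ω) :=
        hg'.integrable_mul hφ.memLp
      rw [← integral_sub h1 h2]
      congr 1; ext x
      rw [smul_eq_mul]; ring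
    rw [e1, e2, ← h φ hφ, ← h' φ hφ, sub_self])
  refine setIntegral_congr_ae hΩ.measurableSet ?_
  filter_upwards [h0] with x hx hxΩ
  rw [sub_eq_zero.1 (hx hxΩ)]

variable {T : Triangulation Ω} {K : Finset Plane}

theorem MemL2.memLp_hull (hΩ : IsConvexPolygon Ω) {f : Plane → ℝ} (hf : MemL2 Ω f)
    (hK : K ∈ T.cells) : MemLp f 2 (volume.restrict (hull K)) := by
  have h1 : MemLp f 2 (volume.restrict (closure Ω)) := by
    rw [Measure.restrict_congr_set hΩ.closure_ae_eq]
    exact hf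
  exact h1.mono_measure (Measure.restrict_mono_set _ (T.hull_subset hK))

theorem memLp_hull_of_continuous {f : Plane → ℝ} (hf : Continuous f) (K : Finset Plane) :
    MemLp f 2 (volume.restrict (hull K)) := by
  have : IsFiniteMeasure (volume.restrict (hull K)) := ⟨by simpa using volume_hull_lt_top K⟩
  obtain ⟨C, hC⟩ := (isCompact_hull K).exists_bound_of_continuousOn hf.continuousOn
  exact MemLp.of_bound hf.aestronglyMeasurable C
    ((ae_restrict_mem (measurableSet_hull K)).mono hC)

theorem distL2_sq_le {g : Plane → ℝ} {w : Finset Plane → Poly} {c : ℝ}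
    (h : T.distL2 g w ≤ c) : T.cellSum (fun K x => (g x - val (w K) x) ^ 2) ≤ c ^ 2 := by
  have h0 := T.cellSum_nonneg (f := fun K x => (g x - val (w K) x) ^ 2) fun K x => sq_nonneg _
  have h1 : 0 ≤ T.distL2 g w := Real.sqrt_nonneg _
  rw [← Real.sq_sqrt h0]
  exact pow_le_pow_left₀ h1 h 2

/-- The diameter of the domain. -/
def domDiam (Ω : Set Plane) : ℝ := Metric.diam (closure Ω)

theorem hK_le_domDiam (hΩ : IsConvexPolygon Ω) (hK : K ∈ T.cells) : KGHDG.hK K ≤ domDiam Ω :=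
  Metric.diam_mono (T.hull_subset hK) hΩ.isBounded.closure

theorem hK_le_meshSize (hK : K ∈ T.cells) : KGHDG.hK K ≤ T.meshSize :=
  le_ciSup (f := fun K : T.cells => KGHDG.hK (K : Finset Plane)) (Set.finite_range _).bddAbove
    ⟨K, hK⟩

theorem meshSize_nonneg : 0 ≤ T.meshSize := Real.iSup_nonneg fun K => hK_nonneg (K : Finset Plane)

theorem meshSize_le_domDiam (hΩ : IsConvexPolygon Ω) : T.meshSize ≤ domDiam Ω :=
  Real.iSup_le (fun K => hK_le_domDiam hΩ K.2) Metric.diam_nonneg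

theorem meshDist_le_domDiam (hΩ : IsConvexPolygon Ω) {s : ℝ} {x : Finset Plane → Plane}
    {r : Finset Plane → ℝ} (D : T.HasDiscs s x r) {L : Finset Plane} (hK : K ∈ T.cells)
    (hL : L ∈ T.cells) : meshDist x K L ≤ 3 * domDiam Ω := by
  have h1 : dist (x K) (x L) ≤ domDiam Ω := Metric.dist_le_diam_of_mem hΩ.isBounded.closure
    (T.hull_subset hK (D.center_mem hK)) (T.hull_subset hL (D.center_mem hL))
  have h2 := hK_le_domDiam hΩ hK
  have h3 := hK_le_domDiam hΩ hL
  unfold meshDist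
  linarith

theorem sum_volume_hull_le (hΩ : IsConvexPolygon Ω) :
    ∑ K ∈ T.cells, volume.real (hull K) ≤ volume.real (closure Ω) :=
  T.sum_volume_le subset_rfl (fun K _ => measurableSet_hull K) (fun _ _ => subset_rfl)
    hΩ.isBounded.closure.measure_lt_top.ne fun _ hK => T.hull_subset hK

/-- The approximate initial velocity is bounded in `L²`. -/
theorem normSqW_le_of_distL2_le (hΩ : IsConvexPolygon Ω) {u₁ : Plane → ℝ} (hu₁ : MemL2 Ω u₁)
    {w : Finset Plane → Poly} {C₀ : ℝ} {n : ℕ} (h : T.distL2 u₁ w ≤ C₀ * T.meshSize ^ n) :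
    T.normSqW w ≤ 2 * (∫ x in Ω, u₁ x ^ 2) + 2 * (C₀ ^ 2 * (domDiam Ω ^ n) ^ 2) := by
  have h1 := distL2_sq_le h
  rw [mul_pow] at h1
  have h2 : C₀ ^ 2 * (T.meshSize ^ n) ^ 2 ≤ C₀ ^ 2 * (domDiam Ω ^ n) ^ 2 := by
    have := meshSize_nonneg (T := T)
    gcongr
    exact meshSize_le_domDiam hΩ
  have h3 := T.cellSum_eq_integral hΩ (hu₁.integrable_sq)
  have h4 : T.normSqW w ≤ 2 * T.cellSum (fun _ x => u₁ x ^ 2)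
      + 2 * T.cellSum (fun K x => (u₁ x - val (w K) x) ^ 2) := by
    rw [Triangulation.normSqW, T.cellSum_eq, T.cellSum_eq, T.cellSum_eq, Finset.mul_sum,
      Finset.mul_sum, ← Finset.sum_add_distrib]
    refine Finset.sum_le_sum fun K hK => ?_
    have hi1 := hu₁.memLp_hull hΩ hK
    have hi2 := hi1.sub (memLp_hull_of_continuous (continuous_val (w K)) K)
    have hj1 : IntegrableOn (fun x => 2 * u₁ x ^ 2) (hull K) := hi1.integrable_sq.const_mul 2
    have hj2 : IntegrableOn (fun x => 2 * (u₁ x - val (w K) x) ^ 2) (hull K) :=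
      hi2.integrable_sq.const_mul 2
    rw [← cellInt_const_mul, ← cellInt_const_mul, cellInt, cellInt, cellInt,
      ← integral_add hj1 hj2]
    refine setIntegral_mono (integrableOn_hull K (by fun_prop)) (hj1.add hj2) fun x => ?_
    beta_reduce
    nlinarith [sq_nonneg (2 * u₁ x - val (w K) x)]
  rw [h3] at h4
  linarith

/-- The distance of the approximate initial displacement to suitable constants on the edges, namely
the means over the edges of a test function `φ` close to `u₀`. They vanish on the boundary, and the
Poincaré inequality makes up for the weight `r_K⁻²` in the part of the error that is due to `φ`; the
condition on the size of the triangles does so in the part that is due to the approximation. -/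
theorem exists_edge_constants (hΩ : IsConvexPolygon Ω) {u₀ : Plane → ℝ} (hu₀ : MemL2 Ω u₀) {B : ℝ}
    (hB : ∀ ε > 0, ∃ φ, IsTestFun Ω φ ∧ ∫ x in Ω, (u₀ x - φ x) ^ 2 ≤ ε ∧
      ∫ x in Ω, ‖fderiv ℝ φ x‖ ^ 2 ≤ B)
    {s : ℝ} {x : Finset Plane → Plane} {r : Finset Plane → ℝ} (D : T.HasDiscs s x r)
    {w : Finset Plane → Poly} {C₀ ρ : ℝ} {n : ℕ} (h : T.distL2 u₀ w ≤ C₀ * T.meshSize ^ n)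
    (hρ : ∀ K ∈ T.cells, T.meshSize ^ n ≤ ρ * hK K) :
    ∃ m : Finset Plane → ℝ, (∀ E ∈ T.allEdges, IsBdryEdge Ω E → m E = 0) ∧
      ∑ K ∈ T.cells, (r K ^ 2)⁻¹ * ∑ E ∈ edges K, cellInt K (fun y => (val (w K) y - m E) ^ 2)
        ≤ 9 * s ^ 2 * ρ ^ 2 * C₀ ^ 2 + 1 + 81 * s ^ 2 * B := by
  have hs0 : 0 < s := zero_lt_one.trans_le D.one_le
  set M := ∑ K ∈ T.cells, (r K ^ 2)⁻¹ with hM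
  have hM0 : 0 ≤ M := Finset.sum_nonneg fun K _ => by positivity
  obtain ⟨φ, hφ, h1, h2⟩ := hB (9 * M + 1)⁻¹ (by positivity)
  have hφ1 : ContDiff ℝ 1 φ := hφ.1.of_le (by simp)
  have hφc := hφ1.continuous
  have hdφ := hφ.continuous_fderiv
  refine ⟨fun E => edgeMean E φ, fun E hE hb => ?_, ?_⟩
  · have h0 : ∀ y ∈ hull E, φ y = 0 := fun y hy => by
      refine image_eq_zero_of_notMem_tsupport fun hy' => ?_
      have h3 := hb hy
      rw [hΩ.isOpen.frontier_eq] at h3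
      exact h3.2 (hφ.2.2 hy')
    show edgeMean E φ = 0
    rw [edgeMean, setIntegral_congr_fun (g := fun _ => 0) (measurableSet_hull E) h0]
    simp
  -- the three parts of the error
  set e : Finset Plane → ℝ := fun K => cellInt K (fun y => (u₀ y - val (w K) y) ^ 2) with he
  set d : Finset Plane → ℝ := fun K => cellInt K (fun y => (u₀ y - φ y) ^ 2) with hd
  set g : Finset Plane → ℝ := fun K => cellInt K (fun y => ‖fderiv ℝ φ y‖ ^ 2) with hg
  have he0 : ∀ K, 0 ≤ e K := fun K => cellInt_nonneg fun _ => sq_nonneg _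
  have hd0 : ∀ K, 0 ≤ d K := fun K => cellInt_nonneg fun _ => sq_nonneg _
  have hg0 : ∀ K, 0 ≤ g K := fun K => cellInt_nonneg fun _ => sq_nonneg _
  have hdsum : ∑ K ∈ T.cells, d K ≤ (9 * M + 1)⁻¹ := by
    refine le_trans (le_of_eq ?_) h1
    exact T.cellSum_eq_integral hΩ (hu₀.sub hφ.memLp).integrable_sq
  have hgsum : ∑ K ∈ T.cells, g K ≤ B := by
    refine le_trans (le_of_eq ?_) h2
    refine T.cellSum_eq_integral hΩ ?_
    exact (hdφ.norm.pow 2).continuousOn.integrableOn_compact hΩ.isBounded.isCompact_closure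
      |>.mono_set subset_closure
  have hesum : ∑ K ∈ T.cells, e K ≤ C₀ ^ 2 * (T.meshSize ^ n) ^ 2 := by
    have := distL2_sq_le h
    rwa [mul_pow] at this
  have hcell : ∀ K ∈ T.cells, ∀ E ∈ edges K, cellInt K (fun y => (val (w K) y - edgeMean E φ) ^ 2)
      ≤ 3 * e K + 3 * d K + 27 * (hK K ^ 2 * g K) := by
    intro K hK E hE
    have hpos : 0 < volume.real (hull K) :=
      lt_of_lt_of_le (mul_pos Real.pi_pos (pow_pos (D.pos K hK) 2))
        (volume_hull_ge (D.pos K hK).le (D.ball K hK))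
    have h3 := cellInt_sub_edgeMean_sq_le hpos (T.isTriangle hK) hE hφ1
    have hi1 := (hu₀.memLp_hull hΩ hK).sub (memLp_hull_of_continuous (continuous_val (w K)) K)
    have hi2 := (hu₀.memLp_hull hΩ hK).sub (memLp_hull_of_continuous hφc K)
    have hi3 : IntegrableOn (fun y => (φ y - edgeMean E φ) ^ 2) (hull K) :=
      integrableOn_hull K (by fun_prop)
    have hi4 := ((hi1.integrable_sq.const_mul 3).add (hi2.integrable_sq.const_mul 3))
    have h4 : cellInt K (fun y => (val (w K) y - edgeMean E φ) ^ 2)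
        ≤ 3 * e K + 3 * d K + 3 * cellInt K (fun y => (φ y - edgeMean E φ) ^ 2) := by
      simp only [he, hd]
      rw [← cellInt_const_mul, ← cellInt_const_mul, ← cellInt_const_mul, cellInt, cellInt, cellInt,
        cellInt]
      have e1 := integral_add (hi1.integrable_sq.const_mul 3) (hi2.integrable_sq.const_mul 3)
      have e2 := integral_add hi4 (hi3.const_mul 3)
      simp only [Pi.sub_apply] at e1 e2
      refine le_trans ?_ ((e2.trans (congrArg (· + _) e1)).le)
      refine setIntegral_mono (integrableOn_hull K (by fun_prop))
        (hi4.add (hi3.const_mul 3)) fun y => ?_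
      simp only [Pi.add_apply]
      nlinarith [sq_nonneg ((val (w K) y - u₀ y) - (u₀ y - φ y)),
        sq_nonneg ((u₀ y - φ y) - (φ y - edgeMean E φ)),
        sq_nonneg ((val (w K) y - u₀ y) - (φ y - edgeMean E φ))]
    linarith
  have hmain : ∀ K ∈ T.cells,
      (r K ^ 2)⁻¹ * ∑ E ∈ edges K, cellInt K (fun y => (val (w K) y - edgeMean E φ) ^ 2)
      ≤ 9 * s ^ 2 * (hK K ^ 2)⁻¹ * e K + 9 * M * d K + 81 * s ^ 2 * g K := by
    intro K hK
    have hr := D.pos K hK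
    have hh := D.hK_pos hK
    have h3 : ∑ E ∈ edges K, cellInt K (fun y => (val (w K) y - edgeMean E φ) ^ 2)
        ≤ 3 * (3 * e K + 3 * d K + 27 * (KGHDG.hK K ^ 2 * g K)) := by
      have := Finset.sum_le_card_nsmul _ _ _ (hcell K hK)
      rw [card_edges (T.card_eq K hK)] at this
      rwa [nsmul_eq_mul, Nat.cast_ofNat] at this
    have h4 : (r K ^ 2)⁻¹ ≤ s ^ 2 * (KGHDG.hK K ^ 2)⁻¹ := by
      rw [← div_eq_mul_inv, le_div_iff₀ (by positivity), inv_mul_le_iff₀ (by positivity), ← mul_pow,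
        mul_comm (r K)]
      have := D.le K hK
      gcongr
    have h5 : (r K ^ 2)⁻¹ ≤ M :=
      Finset.single_le_sum (f := fun K => (r K ^ 2)⁻¹) (fun K _ => by positivity) hK
    calc _ ≤ (r K ^ 2)⁻¹ * (3 * (3 * e K + 3 * d K + 27 * (KGHDG.hK K ^ 2 * g K))) :=
          mul_le_mul_of_nonneg_left h3 (by positivity)
      _ = 9 * ((r K ^ 2)⁻¹ * e K) + 9 * ((r K ^ 2)⁻¹ * d K)
          + 81 * ((r K ^ 2)⁻¹ * (KGHDG.hK K ^ 2 * g K)) := by ring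
      _ ≤ 9 * (s ^ 2 * (KGHDG.hK K ^ 2)⁻¹ * e K) + 9 * (M * d K)
          + 81 * (s ^ 2 * (KGHDG.hK K ^ 2)⁻¹ * (KGHDG.hK K ^ 2 * g K)) := by
          have a1 := mul_le_mul_of_nonneg_right h4 (he0 K)
          have a2 := mul_le_mul_of_nonneg_right h5 (hd0 K)
          have a3 := mul_le_mul_of_nonneg_right h4 (mul_nonneg (sq_nonneg (KGHDG.hK K)) (hg0 K))
          linarith
      _ = _ := by field_simp
  have hep : ∀ K ∈ T.cells, (hK K ^ 2)⁻¹ * e K ≤ ρ ^ 2 * (((T.meshSize ^ n) ^ 2)⁻¹ * e K) := by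
    intro K hK
    have hh := D.hK_pos hK
    have hmesh : 0 < T.meshSize := hh.trans_le (hK_le_meshSize hK)
    rw [← mul_assoc]
    refine mul_le_mul_of_nonneg_right ?_ (he0 K)
    rw [← div_eq_mul_inv, le_div_iff₀ (by positivity), inv_mul_le_iff₀ (by positivity), ← mul_pow,
      mul_comm (KGHDG.hK K)]
    have := hρ K hK
    gcongr
  have hE : ∑ K ∈ T.cells, (hK K ^ 2)⁻¹ * e K ≤ ρ ^ 2 * C₀ ^ 2 := by
    refine (Finset.sum_le_sum hep).trans ?_
    rw [← Finset.mul_sum, ← Finset.mul_sum]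
    refine mul_le_mul_of_nonneg_left ?_ (sq_nonneg ρ)
    rcases eq_or_ne ((T.meshSize ^ n) ^ 2) 0 with h0 | h0
    · rw [h0, inv_zero, zero_mul]; positivity
    · have : 0 < (T.meshSize ^ n) ^ 2 := lt_of_le_of_ne (sq_nonneg _) h0.symm
      rw [inv_mul_le_iff₀ this, mul_comm]
      exact hesum
  have hfin := Finset.sum_le_sum hmain
  rw [Finset.sum_add_distrib, Finset.sum_add_distrib, ← Finset.mul_sum, ← Finset.mul_sum] at hfin
  have e3 : ∑ K ∈ T.cells, 9 * s ^ 2 * (hK K ^ 2)⁻¹ * e K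
      = 9 * s ^ 2 * ∑ K ∈ T.cells, (hK K ^ 2)⁻¹ * e K := by
    rw [Finset.mul_sum]
    exact Finset.sum_congr rfl fun K _ => by ring
  rw [e3] at hfin
  have h6 : 9 * s ^ 2 * ∑ K ∈ T.cells, (hK K ^ 2)⁻¹ * e K ≤ 9 * s ^ 2 * (ρ ^ 2 * C₀ ^ 2) :=
    mul_le_mul_of_nonneg_left hE (by positivity)
  have h7 : 9 * M * ∑ K ∈ T.cells, d K ≤ 1 := by
    calc 9 * M * ∑ K ∈ T.cells, d K ≤ 9 * M * (9 * M + 1)⁻¹ :=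
          mul_le_mul_of_nonneg_left hdsum (by positivity)
      _ ≤ 1 := by
          rw [mul_inv_le_iff₀ (by positivity)]; linarith
  have h8 : 81 * s ^ 2 * ∑ K ∈ T.cells, g K ≤ 81 * s ^ 2 * B :=
    mul_le_mul_of_nonneg_left hgsum (by positivity)
  linarith

end

/-! ### Bounds near the initial time -/

theorem liftConst_nonneg {k : ℕ} {s τ₁ R : ℝ} (hs : 0 ≤ s) (hR : 0 ≤ R) :
    0 ≤ liftConst k s τ₁ R := by
  have := polyConst_pos k s
  have := Real.pi_pos
  unfold liftConst
  positivity

section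
variable {Ω : Set Plane} {T : Triangulation Ω} {k : ℕ} {τ : Finset Plane → ℝ}
  {u w : Finset Plane → Poly} {q p : Finset Plane → Fin 2 → Poly} {uhat what : Finset Plane → Poly}

theorem discEnergy_le_two_mul (hτ : ∀ E ∈ T.allEdges, 0 ≤ τ E) :
    discEnergy T τ u q uhat ≤ 2 * discEnergy T τ w p what
      + 2 * discEnergy T τ (fun K => u K - w K) (fun K i => q K i - p K i)
        (fun E => uhat E - what E) := by
  have h1 : T.normSqV q ≤ 2 * T.normSqV p + 2 * T.normSqV (fun K i => q K i - p K i) := by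
    simp only [Triangulation.normSqV, ← T.cellSum_const_mul]
    rw [← T.cellSum_add (by fun_prop) (by fun_prop)]
    refine Finset.sum_le_sum fun K _ => cellInt_mono (by fun_prop) (by fun_prop) fun x _ => ?_
    simp only [Fin.sum_univ_two, val_sub]
    nlinarith [sq_nonneg (val (q K 0) x - 2 * val (p K 0) x),
      sq_nonneg (val (q K 1) x - 2 * val (p K 1) x)]
  have h2 : T.normPlusSq τ u uhat ≤ 2 * T.normPlusSq τ w what
      + 2 * T.normPlusSq τ (fun K => u K - w K) (fun E => uhat E - what E) := by
    simp only [Triangulation.normPlusSq, ← T.bdrySum_const_mul]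
    rw [← T.bdrySum_add (by fun_prop) (by fun_prop)]
    refine Finset.sum_le_sum fun K hK => bdryInt_mono (by fun_prop) (by fun_prop) fun E hE x _ => ?_
    simp only [val_sub]
    nlinarith [mul_nonneg (hτ E (T.mem_allEdges hK hE))
      (sq_nonneg ((val (u K) x - val (uhat E) x) - 2 * (val (w K) x - val (what E) x)))]
  unfold discEnergy
  linarith

/-- The constant in `IsHDGTriple.discEnergy_le_integral_sq`. -/
def ellipticConst (Ω : Set Plane) (k : ℕ) (s c : ℝ) : ℝ :=
  2⁻¹ * (sobolevConst k s * c ^ 2 + volume.real (closure Ω)) + 1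

theorem sobolevConst_nonneg (k : ℕ) (s : ℝ) : 0 ≤ sobolevConst k s := by
  have h1 := Real.pi_pos
  have h2 : 0 ≤ supConst k s ^ 4 := Even.pow_nonneg (by decide) _
  unfold sobolevConst
  positivity

theorem one_le_ellipticConst (Ω : Set Plane) (k : ℕ) (s c : ℝ) : 1 ≤ ellipticConst Ω k s c := by
  have h1 := sobolevConst_nonneg k s
  have h2 : 0 ≤ volume.real (closure Ω) := measureReal_nonneg
  unfold ellipticConst
  have : 0 ≤ 2⁻¹ * (sobolevConst k s * c ^ 2 + volume.real (closure Ω)) := by positivity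
  linarith

/-- The energy of the HDG solution of an elliptic problem is bounded by the datum: the energy is the
integral of the datum against `u`, and the discrete Sobolev inequality bounds `u` by the energy. -/
theorem IsHDGTriple.discEnergy_le_integral_sq (h : IsHDGTriple T k τ u q uhat)
    (hΩ : IsConvexPolygon Ω) {s : ℝ} {x : Finset Plane → Plane} {r : Finset Plane → ℝ}
    (D : T.HasDiscs s x r) {R : ℝ} (hR : ∀ K ∈ T.cells, ∀ L ∈ T.cells, meshDist x K L ≤ R)
    {τ₀ : ℝ} (hτ₀ : 0 < τ₀) (hτ : ∀ E ∈ T.allEdges, τ₀ ≤ τ E) {g : Plane → ℝ} (hg : MemL2 Ω g)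
    (hform : diffusionForm T τ u q uhat u = - T.cellSum (fun K y => g y * val (u K) y)) :
    discEnergy T τ u q uhat ≤ ellipticConst Ω k s (τ₀⁻¹ + R) * ∫ y in Ω, g y ^ 2 := by
  set E := discEnergy T τ u q uhat with hE
  set A := ellipticConst Ω k s (τ₀⁻¹ + R) with hA
  have hA1 : 1 ≤ A := one_le_ellipticConst _ _ _ _
  have hA0 : 0 < A := zero_lt_one.trans_le hA1
  have hG0 : 0 ≤ ∫ y in Ω, g y ^ 2 := integral_nonneg fun y => sq_nonneg _
  rcases le_or_gt E 0 with hE0 | hE0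
  · exact hE0.trans (by positivity)
  have hL4 := h.normL4Pow4_le D hΩ hR hτ₀ hτ
  rw [← hE] at hL4
  -- `u² ≤ (u⁴ / E + E) / 2` bounds the `L²` norm by the energy
  have hL2 : T.normSqW u ≤ 2⁻¹ * (E⁻¹ * T.normL4Pow4 u + E * volume.real (closure Ω)) := by
    have h1 : T.normSqW u ≤ T.cellSum (fun K y => 2⁻¹ * E⁻¹ * val (u K) y ^ 4 + 2⁻¹ * E) := by
      refine Finset.sum_le_sum fun K _ => cellInt_mono (by fun_prop) (by fun_prop) fun y _ => ?_
      have e : 2⁻¹ * E⁻¹ * val (u K) y ^ 4 + 2⁻¹ * E - val (u K) y ^ 2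
          = 2⁻¹ * E⁻¹ * (val (u K) y ^ 2 - E) ^ 2 := by field_simp; ring
      have : 0 ≤ 2⁻¹ * E⁻¹ * (val (u K) y ^ 2 - E) ^ 2 := by positivity
      linarith
    rw [T.cellSum_add (by fun_prop) (by fun_prop), T.cellSum_const_mul] at h1
    have h2 : T.cellSum (fun _ _ => 2⁻¹ * E) ≤ volume.real (closure Ω) * (2⁻¹ * E) := by
      rw [T.cellSum_eq]
      simp only [cellInt_const]
      rw [← Finset.sum_mul]
      exact mul_le_mul_of_nonneg_right (sum_volume_hull_le hΩ) (by positivity)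
    have h3 : T.cellSum (fun K y => val (u K) y ^ 4) = T.normL4Pow4 u := rfl
    rw [h3] at h1
    linarith
  have hL2' : T.normSqW u ≤ A * E := by
    have h1 : E⁻¹ * T.normL4Pow4 u ≤ E⁻¹ * (sobolevConst k s * ((τ₀⁻¹ + R) * E) ^ 2) :=
      mul_le_mul_of_nonneg_left hL4 (by positivity)
    have h2 : E⁻¹ * (sobolevConst k s * ((τ₀⁻¹ + R) * E) ^ 2)
        = sobolevConst k s * (τ₀⁻¹ + R) ^ 2 * E := by field_simp
    have h3 : A * E = 2⁻¹ * (sobolevConst k s * (τ₀⁻¹ + R) ^ 2 * E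
        + E * volume.real (closure Ω)) + E := by rw [hA, ellipticConst]; ring
    linarith
  rw [h.diffusionForm_self, ← hE] at hform
  have hY : - T.cellSum (fun K y => g y * val (u K) y)
      ≤ T.cellSum (fun _ y => 2⁻¹ * A * g y ^ 2) + (2 * A)⁻¹ * T.normSqW u := by
    rw [Triangulation.normSqW, ← T.cellSum_const_mul, T.cellSum_eq, T.cellSum_eq, T.cellSum_eq,
      ← Finset.sum_neg_distrib, ← Finset.sum_add_distrib]
    refine Finset.sum_le_sum fun K hK => ?_
    have hgK := hg.memLp_hull hΩ hK
    have huK := memLp_hull_of_continuous (continuous_val (u K)) K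
    have hi1 : IntegrableOn (fun y => g y * val (u K) y) (hull K) := hgK.integrable_mul huK
    have hi2 : IntegrableOn (fun y => 2⁻¹ * A * g y ^ 2) (hull K) :=
      hgK.integrable_sq.const_mul _
    have hi3 : IntegrableOn (fun y => (2 * A)⁻¹ * val (u K) y ^ 2) (hull K) :=
      huK.integrable_sq.const_mul _
    rw [cellInt, cellInt, cellInt, ← integral_neg, ← integral_add hi2 hi3]
    refine setIntegral_mono hi1.neg (hi2.add hi3) fun y => ?_
    beta_reduce
    have e : 2⁻¹ * A * g y ^ 2 + (2 * A)⁻¹ * val (u K) y ^ 2 - -(g y * val (u K) y)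
        = (2 * A)⁻¹ * (A * g y + val (u K) y) ^ 2 := by field_simp; ring
    have : 0 ≤ (2 * A)⁻¹ * (A * g y + val (u K) y) ^ 2 := by positivity
    linarith
  rw [T.cellSum_const_mul, T.cellSum_eq_integral hΩ hg.integrable_sq] at hY
  have h4 : (2 * A)⁻¹ * T.normSqW u ≤ (2 * A)⁻¹ * (A * E) :=
    mul_le_mul_of_nonneg_left hL2' (by positivity)
  have h5 : (2 * A)⁻¹ * (A * E) = 2⁻¹ * E := by field_simp
  linarith

end

namespace IsSemidiscreteSolution
variable {Ω : Set Plane} {T : Triangulation Ω} {k : ℕ} {τ : Finset Plane → ℝ} {tf : ℝ}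
  {uh0 uh1 : Finset Plane → Poly} {u ut utt : ℝ → Finset Plane → Poly}
  {q : ℝ → Finset Plane → Fin 2 → Poly} {uhat : ℝ → Finset Plane → Poly}

theorem tendsto_normSqW_t (h : IsSemidiscreteSolution T k τ tf uh0 uh1 u ut utt q uhat)
    (h0 : T.MemW k uh0) (htf : 0 < tf) :
    Tendsto (fun t => T.normSqW (ut t)) (𝓝[Set.Ioc 0 tf] 0) (𝓝 (T.normSqW uh1)) := by
  have h1 : Tendsto (fun t => T.normSqW (ut t)) (𝓝[Set.Ioc 0 tf] 0) (𝓝 (T.normSqW (ut 0))) := by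
    refine tendsto_finsetSum _ fun K hK => ?_
    have h2 := continuousWithinAt_cellInt_pow
      (h.continuousWithinAt_restr_t h0 htf ⟨le_rfl, htf.le⟩ hK) 2
    exact h2.mono Set.Ioc_subset_Icc_self
  have e : T.normSqW (ut 0) = T.normSqW uh1 :=
    T.cellSum_congr fun K hK x => by rw [h.init_t K hK]
  rwa [e] at h1

/-- The weighted distance of `u` to given polynomials is continuous at the initial time, where the
equations themselves, and hence `q` and `û`, are not at hand. -/
theorem tendsto_sum_sq_sub (h : IsSemidiscreteSolution T k τ tf uh0 uh1 u ut utt q uhat)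
    (h0 : T.MemW k uh0) (htf : 0 < tf) (c : Finset Plane → ℝ)
    (g : Finset Plane → Finset Plane → Poly) :
    Tendsto (fun t => ∑ K ∈ T.cells, c K * ∑ E ∈ edges K,
        cellInt K (fun y => val (u t K - g K E) y ^ 2)) (𝓝[Set.Ioc 0 tf] 0)
      (𝓝 (∑ K ∈ T.cells, c K * ∑ E ∈ edges K,
        cellInt K (fun y => val (uh0 K - g K E) y ^ 2))) := by
  refine tendsto_finsetSum _ fun K hK => (tendsto_finsetSum _ fun E _ => ?_).const_mul _
  have h1 : ContinuousWithinAt (fun t => restr K (u t K - g K E)) (Set.Icc 0 tf) 0 := by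
    simp only [map_sub]
    exact (h.hasDerivWithinAt_restr h0 htf ⟨le_rfl, htf.le⟩ hK).continuousWithinAt.sub
      continuousWithinAt_const
  have h2 := (continuousWithinAt_cellInt_pow h1 2).mono Set.Ioc_subset_Icc_self
  rw [ContinuousWithinAt, h.init K hK] at h2
  exact h2

variable {s R τ₁ : ℝ} {x : Finset Plane → Plane} {r : Finset Plane → ℝ}

/-- If the initial displacement has a flux and a trace, as the HDG solution of an elliptic problem does,
then its energy controls the energy at small times. -/
theorem eventually_discEnergy_le_of_triple
    (h : IsSemidiscreteSolution T k τ tf uh0 uh1 u ut utt q uhat)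
    (h0 : T.MemW k uh0) (htf : 0 < tf) (D : T.HasDiscs s x r) (hR : ∀ K ∈ T.cells, r K ≤ R)
    (hτ : ∀ E ∈ T.allEdges, 0 ≤ τ E ∧ τ E ≤ τ₁) {q₀ : Finset Plane → Fin 2 → Poly}
    {uhat₀ : Finset Plane → Poly} (h' : IsHDGTriple T k τ uh0 q₀ uhat₀) :
    ∀ᶠ t in 𝓝[Set.Ioc 0 tf] 0, discEnergy T τ (u t) (q t) (uhat t)
      ≤ 2 * discEnergy T τ uh0 q₀ uhat₀ + 1 := by
  have h1 := (h.tendsto_sum_sq_sub h0 htf (fun K => (r K ^ 2)⁻¹) (fun K _ => uh0 K)).const_mul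
    (2 * liftConst k s τ₁ R)
  have e : 2 * liftConst k s τ₁ R * ∑ K ∈ T.cells, (r K ^ 2)⁻¹ * ∑ E ∈ edges K,
      cellInt K (fun y => val (uh0 K - uh0 K) y ^ 2) = 0 := by
    simp [cellInt]
  rw [e] at h1
  filter_upwards [h1.eventually_le_const one_pos, self_mem_nhdsWithin] with t ht htI
  have h2 := discEnergy_le_two_mul (u := u t) (q := q t) (uhat := uhat t) (w := uh0) (p := q₀)
    (what := uhat₀) (T := T) (fun E hE => (hτ E hE).1)
  have h3 := ((h.triple t htI).sub h').discEnergy_le D hR hτ (m := fun _ => 0)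
    (fun _ _ _ => rfl)
  simp only [sub_zero] at h3
  linarith

/-- If the initial displacement is close to constants on the edges that vanish on the boundary, then
its distance to them controls the energy at small times. -/
theorem eventually_discEnergy_le_of_edge_constants
    (h : IsSemidiscreteSolution T k τ tf uh0 uh1 u ut utt q uhat)
    (h0 : T.MemW k uh0) (htf : 0 < tf) (D : T.HasDiscs s x r) (hR : ∀ K ∈ T.cells, r K ≤ R)
    (hτ : ∀ E ∈ T.allEdges, 0 ≤ τ E ∧ τ E ≤ τ₁) {m : Finset Plane → ℝ}
    (hm : ∀ E ∈ T.allEdges, IsBdryEdge Ω E → m E = 0) :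
    ∀ᶠ t in 𝓝[Set.Ioc 0 tf] 0, discEnergy T τ (u t) (q t) (uhat t)
      ≤ liftConst k s τ₁ R * ∑ K ∈ T.cells, (r K ^ 2)⁻¹ * ∑ E ∈ edges K,
        cellInt K (fun y => (val (uh0 K) y - m E) ^ 2) + 1 := by
  have h1 := (h.tendsto_sum_sq_sub h0 htf (fun K => (r K ^ 2)⁻¹)
    (fun _ E => MvPolynomial.C (m E))).const_mul (liftConst k s τ₁ R)
  simp only [val_sub, val_C] at h1
  filter_upwards [h1.eventually_le_const (lt_add_one _), self_mem_nhdsWithin] with t ht htI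
  exact ((h.triple t htI).discEnergy_le D hR hτ hm).trans ht

/-- The energy bound: bounds of the kinetic energy and of the energy of the diffusion near the
initial time give a bound at all times. -/
theorem energy_le_of_energy_le
    (h : IsSemidiscreteSolution T k τ tf uh0 uh1 u ut utt q uhat) (h0 : T.MemW k uh0)
    (hΩ : IsConvexPolygon Ω) (D : T.HasDiscs s x r)
    (hR : ∀ K ∈ T.cells, ∀ L ∈ T.cells, meshDist x K L ≤ R) {τ₀ : ℝ} (hτ₀ : 0 < τ₀)
    (hτ : ∀ E ∈ T.allEdges, τ₀ ≤ τ E ∧ τ E ≤ τ₁) {t₁ t : ℝ} (ht₁ : t₁ ∈ Set.Ioc 0 tf)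
    (ht : t ∈ Set.Ioc 0 tf) {W E : ℝ} (hW : T.normSqW (ut t₁) ≤ W)
    (hE : discEnergy T τ (u t₁) (q t₁) (uhat t₁) ≤ E) :
    T.normSqW (ut t) + T.normSqV (q t) + T.normPlusSq τ (u t) (uhat t) + T.normL4Pow4 (u t)
      ≤ 4 * W + 4 * E + 2 * (sobolevConst k s * ((τ₀⁻¹ + R) * E) ^ 2)
        + 4 * volume.real (closure Ω) := by
  have hτ' : ∀ E ∈ T.allEdges, 0 ≤ τ E ∧ τ E ≤ τ₁ := fun E hE => ⟨hτ₀.le.trans (hτ E hE).1, (hτ E hE).2⟩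
  have hcons := h.waveEnergy_eq h0 D (fun K hK => radius_le_of_meshDist_le D hR hK) hτ' ht ht₁
  have hL4 := (h.triple t₁ ht₁).normL4Pow4_le D hΩ hR hτ₀ (fun E hE => (hτ E hE).1)
  have hE0 := discEnergy_nonneg (fun E hE => (hτ' E hE).1) (u t₁) (q t₁) (uhat t₁)
  have hL4' : T.normL4Pow4 (u t₁) ≤ sobolevConst k s * ((τ₀⁻¹ + R) * E) ^ 2 := by
    refine hL4.trans (mul_le_mul_of_nonneg_left ?_ (sobolevConst_nonneg k s))
    rw [mul_pow, mul_pow]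
    exact mul_le_mul_of_nonneg_left (pow_le_pow_left₀ hE0 hE 2) (sq_nonneg _)
  have hL2 : 0 ≤ T.normSqW (u t₁) := T.cellSum_nonneg fun K y => sq_nonneg _
  -- the potential `u⁴ / 4 - u² / 2` is at least `u⁴ / 8 - 1 / 2`
  have hlow : 2⁻¹ * T.normSqW (u t)
      ≤ 8⁻¹ * T.normL4Pow4 (u t) + 2⁻¹ * volume.real (closure Ω) := by
    have h1 : 2⁻¹ * T.normSqW (u t)
        ≤ T.cellSum (fun K y => 8⁻¹ * val (u t K) y ^ 4 + 2⁻¹) := by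
      rw [Triangulation.normSqW, ← T.cellSum_const_mul]
      refine Finset.sum_le_sum fun K _ => cellInt_mono (by fun_prop) (by fun_prop) fun y _ => ?_
      nlinarith [sq_nonneg (val (u t K) y ^ 2 - 2)]
    rw [T.cellSum_add (by fun_prop) (by fun_prop), T.cellSum_const_mul] at h1
    have h2 : T.cellSum (fun _ _ => (2⁻¹ : ℝ)) ≤ volume.real (closure Ω) * 2⁻¹ := by
      rw [T.cellSum_eq]
      simp only [cellInt_const]
      rw [← Finset.sum_mul]
      exact mul_le_mul_of_nonneg_right (sum_volume_hull_le hΩ) (by norm_num)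
    have h3 : T.cellSum (fun K y => val (u t K) y ^ 4) = T.normL4Pow4 (u t) := rfl
    rw [h3] at h1
    linarith
  have hpos1 : 0 ≤ T.normSqW (ut t) := T.cellSum_nonneg fun K y => sq_nonneg _
  have hpos2 := discEnergy_nonneg (fun E hE => (hτ' E hE).1) (u t) (q t) (uhat t)
  simp only [waveEnergy] at hcons
  have e : T.normSqV (q t) + T.normPlusSq τ (u t) (uhat t)
      = discEnergy T τ (u t) (q t) (uhat t) := rfl
  linarith

end IsSemidiscreteSolution

/-! ### The uniform bound -/

/-- The square of the `L²` norm of the weak Laplacian of `u₀` on `Ω` if that Laplacian is a square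
integrable function, and `0` otherwise. The choice of the representative does not matter, by
`integral_sq_eq_of_isWeakLaplacian`. -/
def laplacianNormSq (Ω : Set Plane) (u₀ : Plane → ℝ) : ℝ :=
  open Classical in
  if h : ∃ g, MemL2 Ω g ∧ IsWeakLaplacian Ω u₀ g then ∫ x in Ω, h.choose x ^ 2 else 0

theorem laplacianNormSq_nonneg (Ω : Set Plane) (u₀ : Plane → ℝ) : 0 ≤ laplacianNormSq Ω u₀ := by
  unfold laplacianNormSq
  split_ifs
  · exact integral_nonneg fun x => sq_nonneg _
  · exact le_rfl

theorem laplacianNormSq_eq {Ω : Set Plane} (hΩ : IsOpen Ω) {u₀ g : Plane → ℝ} (hg : MemL2 Ω g)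
    (h : IsWeakLaplacian Ω u₀ g) : laplacianNormSq Ω u₀ = ∫ x in Ω, g x ^ 2 := by
  have hex : ∃ g, MemL2 Ω g ∧ IsWeakLaplacian Ω u₀ g := ⟨g, hg, h⟩
  rw [laplacianNormSq, dif_pos hex]
  exact integral_sq_eq_of_isWeakLaplacian hΩ hex.choose_spec.1 hg hex.choose_spec.2 h

/-- The discrete energy is bounded near the initial time, under either of the two conditions on the
initial approximation of `u₀`. -/
theorem IsSemidiscreteSolution.eventually_discEnergy_le {Ω : Set Plane} (hΩ : IsConvexPolygon Ω)
    {T : Triangulation Ω} {k : ℕ} {τ : Finset Plane → ℝ} {tf : ℝ} {uh0 uh1 : Finset Plane → Poly}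
    {u ut utt : ℝ → Finset Plane → Poly} {q : ℝ → Finset Plane → Fin 2 → Poly}
    {uhat : ℝ → Finset Plane → Poly}
    (h : IsSemidiscreteSolution T k τ tf uh0 uh1 u ut utt q uhat) (htf : 0 < tf)
    {u₀ u₁ : Plane → ℝ} (hu₀ : MemL2 Ω u₀) {B : ℝ} (hB0 : 0 ≤ B)
    (hB : ∀ ε > 0, ∃ φ, IsTestFun Ω φ ∧ ∫ x in Ω, (u₀ x - φ x) ^ 2 ≤ ε ∧
      ∫ x in Ω, ‖fderiv ℝ φ x‖ ^ 2 ≤ B)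
    {C₀ ρ : ℝ} (hadm : AdmissibleInitialData T k τ C₀ ρ u₀ u₁ uh0 uh1)
    {s R : ℝ} {x : Finset Plane → Plane} {r : Finset Plane → ℝ} (D : T.HasDiscs s x r)
    (hR0 : 0 ≤ R) (hR : ∀ K ∈ T.cells, ∀ L ∈ T.cells, meshDist x K L ≤ R) {τ₀ τ₁ : ℝ} (hτ₀ : 0 < τ₀)
    (hτ : ∀ E ∈ T.allEdges, τ₀ ≤ τ E ∧ τ E ≤ τ₁) :
    ∀ᶠ t in 𝓝[Set.Ioc 0 tf] 0, discEnergy T τ (u t) (q t) (uhat t)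
      ≤ 2 * (ellipticConst Ω k s (τ₀⁻¹ + R) * laplacianNormSq Ω u₀)
        + liftConst k s τ₁ R * (9 * s ^ 2 * ρ ^ 2 * C₀ ^ 2 + 1 + 81 * s ^ 2 * B) + 1 := by
  have hs := D.one_le
  have hL : 0 ≤ liftConst k s τ₁ R := liftConst_nonneg (zero_le_one.trans hs) hR0
  have hA : 0 ≤ ellipticConst Ω k s (τ₀⁻¹ + R) :=
    zero_le_one.trans (one_le_ellipticConst Ω k s (τ₀⁻¹ + R))
  have hG := mul_nonneg hA (laplacianNormSq_nonneg Ω u₀)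
  have hX : 0 ≤ 9 * s ^ 2 * ρ ^ 2 * C₀ ^ 2 + 1 + 81 * s ^ 2 * B := by positivity
  have hRr : ∀ K ∈ T.cells, r K ≤ R := fun K hK => radius_le_of_meshDist_le D hR hK
  have hτ' : ∀ E ∈ T.allEdges, 0 ≤ τ E ∧ τ E ≤ τ₁ := fun E hE =>
    ⟨hτ₀.le.trans (hτ E hE).1, (hτ E hE).2⟩
  obtain ⟨h0, -, -, ⟨g, hg, hlap, q₀, uhat₀, htriple, hform⟩ | ⟨hdist, hρ⟩⟩ := hadm
  · filter_upwards [h.eventually_discEnergy_le_of_triple h0 htf D hRr hτ' htriple] with t ht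
    have h1 := htriple.discEnergy_le_integral_sq hΩ D hR hτ₀ (fun E hE => (hτ E hE).1) hg
      (hform uh0 h0)
    rw [← laplacianNormSq_eq hΩ.isOpen hg hlap] at h1
    have h2 := mul_nonneg hL hX
    linarith
  · obtain ⟨m, hm, hm'⟩ := exists_edge_constants hΩ hu₀ hB D hdist hρ
    filter_upwards [h.eventually_discEnergy_le_of_edge_constants h0 htf D hRr hτ' hm] with t ht
    have h1 := mul_le_mul_of_nonneg_left hm' hL
    linarith

/-- The bound for all meshes and all times. All constants are chosen before the mesh; a time `t₁` close
to the initial time, at which both energies are bounded by them, gives the bound at every time. -/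
theorem exists_uniform_bound {Ω : Set Plane} (hΩ : IsConvexPolygon Ω)
    {u₀ u₁ : Plane → ℝ} (hu₀ : MemH10 Ω u₀) (hu₁ : MemL2 Ω u₁)
    (k : ℕ) (σ : ℝ) {τ₀ : ℝ} (τ₁ C₀ ρ : ℝ) (hτ₀ : 0 < τ₀) :
    ∃ C : ℝ, 0 < C ∧
      ∀ T : Triangulation Ω, T.ShapeRegular σ →
      ∀ τ : Finset Plane → ℝ, (∀ E ∈ T.allEdges, τ₀ ≤ τ E ∧ τ E ≤ τ₁) →
      ∀ uh0 uh1 : Finset Plane → Poly, AdmissibleInitialData T k τ C₀ ρ u₀ u₁ uh0 uh1 →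
      ∀ (tf : ℝ) (u ut utt : ℝ → Finset Plane → Poly) (q : ℝ → Finset Plane → Fin 2 → Poly)
        (uhat : ℝ → Finset Plane → Poly),
        IsSemidiscreteSolution T k τ tf uh0 uh1 u ut utt q uhat →
      ∀ t : ℝ, 0 < t → t ≤ tf →
        T.normSqW (ut t) + T.normSqV (q t) + T.normPlusSq τ (u t) (uhat t)
          + T.normL4Pow4 (u t) ≤ C := by
  obtain ⟨B, hB0, hB⟩ := hu₀.exists_bound
  set s : ℝ := max (2 * σ) 1 with hs
  set R : ℝ := 3 * domDiam Ω with hRdef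
  have hR0 : 0 ≤ R := mul_nonneg (by norm_num) Metric.diam_nonneg
  have hs1 : 1 ≤ s := le_max_right _ _
  set W : ℝ := 2 * (∫ x in Ω, u₁ x ^ 2) + 2 * (C₀ ^ 2 * (domDiam Ω ^ (k + 1)) ^ 2) + 1 with hW
  set E : ℝ := 2 * (ellipticConst Ω k s (τ₀⁻¹ + R) * laplacianNormSq Ω u₀)
    + liftConst k s τ₁ R * (9 * s ^ 2 * ρ ^ 2 * C₀ ^ 2 + 1 + 81 * s ^ 2 * B) + 1 with hE
  have hW0 : 0 < W := by
    have : 0 ≤ ∫ x in Ω, u₁ x ^ 2 := integral_nonneg fun x => sq_nonneg _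
    positivity
  have hE0 : 0 < E := by
    have h1 : 0 ≤ liftConst k s τ₁ R := liftConst_nonneg (zero_le_one.trans hs1) hR0
    have h2 : 0 ≤ ellipticConst Ω k s (τ₀⁻¹ + R) :=
      zero_le_one.trans (one_le_ellipticConst Ω k s (τ₀⁻¹ + R))
    have h3 := laplacianNormSq_nonneg Ω u₀
    positivity
  have hS0 := sobolevConst_nonneg k s
  refine ⟨4 * W + 4 * E + 2 * (sobolevConst k s * ((τ₀⁻¹ + R) * E) ^ 2)
        + 4 * volume.real (closure Ω), by positivity, ?_⟩
  intro T hT τ hτ uh0 uh1 hadm tf u ut utt q uhat h t ht0 httf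
  have htf : 0 < tf := ht0.trans_le httf
  obtain ⟨x, r, D⟩ := hT.exists_hasDiscs
  have hR : ∀ K ∈ T.cells, ∀ L ∈ T.cells, meshDist x K L ≤ R := fun K hK L hL =>
    meshDist_le_domDiam hΩ D hK hL
  have hne : (𝓝[Set.Ioc 0 tf] (0 : ℝ)).NeBot := by
    rw [← mem_closure_iff_nhdsWithin_neBot, closure_Ioc htf.ne]
    exact Set.left_mem_Icc.2 htf.le
  have hlt : T.normSqW uh1 < W :=
    (normSqW_le_of_distL2_le hΩ hu₁ hadm.2.2.1).trans_lt (lt_add_one _)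
  obtain ⟨t₁, ⟨hW₁, hE₁⟩, ht₁⟩ :=
    (((h.tendsto_normSqW_t hadm.1 htf).eventually_lt_const hlt).and
      (h.eventually_discEnergy_le hΩ htf hu₀.1 hB0 hB hadm D hR0 hR hτ₀ hτ)).and
      self_mem_nhdsWithin |>.exists
  exact h.energy_le_of_energy_le hadm.1 hΩ D hR hτ₀ hτ ht₁ ⟨ht0, httf⟩ hW₁.le hE₁

end KGHDG

end

/-- The constant `C` depends only on the domain, the exact initial data, the polynomial degree, the
shape regularity `σ`, the bounds `τ₀ ≤ τ ≤ τ₁` of the stabilization, and the constants `C₀`, `ρ` of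
the initial approximations; it depends neither on the mesh nor on the time. -/
theorem corollary2p1 (Ω : Set KGHDG.Plane) (hΩ : KGHDG.IsConvexPolygon Ω)
    (u₀ u₁ : KGHDG.Plane → ℝ) (hu₀ : KGHDG.MemH10 Ω u₀) (hu₁ : KGHDG.MemL2 Ω u₁)
    (k : ℕ) (σ τ₀ τ₁ C₀ ρ : ℝ) (hτ₀ : 0 < τ₀) :
    ∃ C : ℝ, 0 < C ∧
      ∀ T : KGHDG.Triangulation Ω, T.ShapeRegular σ →
      ∀ τ : Finset KGHDG.Plane → ℝ, (∀ E ∈ T.allEdges, τ₀ ≤ τ E ∧ τ E ≤ τ₁) →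
      ∀ uh0 uh1 : Finset KGHDG.Plane → KGHDG.Poly,
        KGHDG.AdmissibleInitialData T k τ C₀ ρ u₀ u₁ uh0 uh1 →
      ∀ (tf : ℝ) (u ut utt : ℝ → Finset KGHDG.Plane → KGHDG.Poly)
        (q : ℝ → Finset KGHDG.Plane → Fin 2 → KGHDG.Poly)
        (uhat : ℝ → Finset KGHDG.Plane → KGHDG.Poly),
        KGHDG.IsSemidiscreteSolution T k τ tf uh0 uh1 u ut utt q uhat →
      ∀ t : ℝ, 0 < t → t ≤ tf →
        T.normSqW (ut t) + T.normSqV (q t) + T.normPlusSq τ (u t) (uhat t)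
          + T.normL4Pow4 (u t) ≤ C := by
  exact KGHDG.exists_uniform_bound hΩ hu₀ hu₁ k σ τ₁ C₀ ρ hτ₀
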